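/- Let $\mathcal M=(M,\mathcal O_{\mathcal M})$ be a smooth finite-dimensional real supermanifold with a Batchelor model, i.e. a smooth real vector bundle $\pi:E\to M$ and a fixed isomorphism of sheaves of superalgebras $\mathcal O_{\mathcal M}\cong\Gamma_{\Lambda E^*}$, and let $\nabla$ be a connection on $\mathcal M$ (an even map $\nabla:\mathcal T_{\mathcal M}\otimes_{\mathbb R}\mathcal T_{\mathcal M}\to\mathcal T_{\mathcal M}$ of sheaves on $\mathcal T_{\mathcal M}=\mathrm{Der}(\mathcal O_{\mathcal M})$, $\mathcal O_{\mathcal M}$-linear in the first argument, with $\nabla_X(fY)=X(f)Y+(-1)^{|X||f|}f\nabla_XY$). Notation. Let $\mathcal F=\Gamma_{\mathbb R\oplus E^*}\subset\mathcal O_{\mathcal M}$ be the superfunctions of degree at most one, $pr:\mathcal O_{\mathcal M}\to\mathcal F$ the projection along the terms of degree at least two, and for $s=s_0+s_1\in\mathcal F(U)$ let $\psi(s)\in C^\infty(\pi^{-1}(U))$ be the function $e\mapsto s_0(\pi(e))+s_1(\pi(e))(e)$. For an even superderivation $Z$ of $\mathcal O_{\mathcal M}|_U$, a vector field $Z'$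 on $\pi^{-1}(U)$ is called the reduction of $Z$ if $Z'(\psi(s))=\psi(pr(Z(s)))$ for all local sections $s$ of $\mathcal F$ over open subsets of $U$. Let $T(f+h\tau):=f+h$, where $\tau$ is the odd coordinate of $\mathbb R^{1|1}$, resp. $\mathbb R^{0|1}$. A supercurve is a morphism $\Phi:\mathbb R^{1|1}\to\mathcal M$; it is a geodesic of $(\mathcal M,\nabla)$ if $\frac{\nabla}{dt}(\Phi_*\partial_t)=0$, where $\frac{\nabla}{dt}$ is the operator on $\mathrm{Der}(\mathcal O_{\mathcal M},\Phi_*\mathcal O_{\mathbb R^{1|1}})$ obtained by pulling back $\nabla$ along $\Phi$ and inserting $\partial_t$. Geodesics $\gamma:\mathbb R\to E$ of a connection on the manifold $E$ are defined in the same way. An initial condition on $\mathcal M$ is an element $A$ of $T\mathcal M(\mathbb R^{0|1})$, i.e. a morphism $f:\mathbb R^{0|1}\to\mathcal M$ together with an even derivation $h$ along $f$. The initial condition of $\Phi$ is the restriction of $\Phi_*\partial_t$ to $t=0$; that of $\gamma$ is $\gamma'(0)\in TE$. Then: (a) There is exactly one connection $\nabla^{TE}$ on the manifold $E$ such that, for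 all open $U\subset M$ and all even superderivations $X,Y$ of $\mathcal O_{\mathcal M}|_U$ preserving $\mathcal F$, with reductions $X',Y'$, the vector field $\nabla^{TE}_{X'}Y'$ is the reduction of $\nabla_XY$. (b) There is a unique bijection $\kappa:\mathcal M(\mathbb R^{1|1})\to E(\mathbb R)$ from supercurves onto smooth curves in $E$ such that $\kappa(\Phi)=\gamma$ iff $\pi\circ\gamma$ is the curve in $M$ underlying $\Phi$ and $T\circ\Phi^*=\gamma^*\circ\psi$ on $\mathcal F$; and there is a unique bijection $\iota:T\mathcal M(\mathbb R^{0|1})\to TE$ such that $\iota(f,h)=\alpha\in T_eE$ iff $\pi(e)$ is the point of $M$ underlying $f$ and $T(f^*s)=\psi(s)(e)$ and $T(h(s))=d\psi(s)(\alpha)$ for all local sections $s$ of $\mathcal F$ around $\pi(e)$. If a supercurve $\Phi$ has initial condition $A$, then $\kappa(\Phi)$ has initial condition $\iota(A)$. (c) The bijection $\iota$ of initial conditions induces a bijection $G$ from the set of geodesics $\mathbb R^{1|1}\to\mathcal M$ of $(\mathcal M,\nabla)$ onto the set of geodesics $\mathbb R\to E$ of $(E,\nabla^{TE})$: for geodesics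 $\Phi$ and $\gamma$ one has $G(\Phi)=\gamma$ if and only if the initial condition of $\gamma$ is the image under $\iota$ of the initial condition of $\Phi$. This bijection $G$ is the restriction of $\kappa$. -/

import Mathlib

open scoped Manifold ContDiff Topology
open TopologicalSpace

namespace SuperGeo

noncomputable section

universe u v w u' v'

/-! ## Sheaves of superalgebras, their morphisms and derivations -/

/-- A presheaf of real supercommutative superalgebras on `X`.  The `ℤ/2`-grading is recorded by the
parity involution `par` (that is `+1` on even and `-1` on odd elements): `f` is even iff
`par f = f` and odd iff `par f = -f`. -/
structure SuperPresheaf (X : Type u) [TopologicalSpace X] where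
  obj : Opens X → Type v
  ring : ∀ U, Ring (obj U)
  algebra : ∀ U, Algebra ℝ (obj U)
  res : ∀ {U V : Opens X}, V ≤ U → (obj U →ₐ[ℝ] obj V)
  res_self : ∀ {U : Opens X} (h : U ≤ U) (f : obj U), res h f = f
  res_res : ∀ {U V W : Opens X} (h : V ≤ U) (k : W ≤ V) (f : obj U),
    res k (res h f) = res (k.trans h) f
  par : ∀ U, obj U →ₐ[ℝ] obj U
  par_par : ∀ (U) (f : obj U), par U (par U f) = f
  par_res : ∀ {U V : Opens X} (h : V ≤ U) (f : obj U), par V (res h f) = res h (par U f)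
  even_comm : ∀ (U) (f g : obj U), par U f = f → f * g = g * f
  odd_comm : ∀ (U) (f g : obj U), par U f = -f → f * g = par U g * f

attribute [instance] SuperPresheaf.ring SuperPresheaf.algebra

/-- The sign `(-1)^p`. -/
def psign (p : ZMod 2) : ℝ := if p = 0 then 1 else -1

/-- `twist p f = (-1)^{p|f|} f` on homogeneous `f`. -/
def SuperPresheaf.twist {X : Type u} [TopologicalSpace X] (O : SuperPresheaf.{u, v} X)
    (p : ZMod 2) (U : Opens X) : O.obj U →ₐ[ℝ] O.obj U :=
  if p = 0 then AlgHom.id ℝ _ else O.par U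

/-- The direct image `φ_* O`. -/
def SuperPresheaf.pushforward {X : Type u} {Y : Type u'} [TopologicalSpace X] [TopologicalSpace Y]
    (φ : C(X, Y)) (O : SuperPresheaf.{u, v} X) : SuperPresheaf.{u', v} Y where
  obj V := O.obj (Opens.comap φ V)
  ring V := O.ring (Opens.comap φ V)
  algebra V := O.algebra (Opens.comap φ V)
  res h := O.res (Opens.comap_mono φ h)
  res_self _ f := O.res_self _ f
  res_res _ _ f := O.res_res _ _ f
  par V := O.par (Opens.comap φ V)
  par_par _ f := O.par_par _ f
  par_res _ f := O.par_res _ f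
  even_comm _ f g h := O.even_comm _ f g h
  odd_comm _ f g h := O.odd_comm _ f g h

/-- An (even) morphism of presheaves of superalgebras over the same space. -/
@[ext] structure SheafHom {X : Type u} [TopologicalSpace X] (O : SuperPresheaf.{u, v} X)
    (P : SuperPresheaf.{u, w} X) where
  app : ∀ U, O.obj U →ₐ[ℝ] P.obj U
  app_res : ∀ {U V : Opens X} (h : V ≤ U) (f : O.obj U), app V (O.res h f) = P.res h (app U f)
  app_par : ∀ (U) (f : O.obj U), app U (O.par U f) = P.par U (app U f)

/-- The identity morphism. -/
def SheafHom.id {X : Type u} [TopologicalSpace X] (O : SuperPresheaf.{u, v} X) : SheafHom O O where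
  app U := AlgHom.id ℝ (O.obj U)
  app_res _ _ := rfl
  app_par _ _ := rfl

/-- An isomorphism of presheaves of superalgebras over the same space. -/
structure SheafIso {X : Type u} [TopologicalSpace X] (O : SuperPresheaf.{u, v} X)
    (P : SuperPresheaf.{u, w} X) extends SheafHom O P where
  bijective : ∀ U, Function.Bijective (app U)

/-- A morphism of superspaces `(N, O_N) → (M, O_M)`: a continuous map `φ : N → M` with an even
morphism of sheaves of superalgebras `O_M → φ_* O_N`.  (Between supermanifolds such a morphism is
automatically local on stalks, and `φ` is smooth.) -/
structure SMap {N : Type u} {M : Type u'} [TopologicalSpace N] [TopologicalSpace M]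
    (ON : SuperPresheaf.{u, v} N) (OM : SuperPresheaf.{u', v'} M) where
  base : C(N, M)
  pull : SheafHom OM (ON.pushforward base)

/-- Composition of morphisms of superspaces. -/
def SMap.comp {L N M : Type*} [TopologicalSpace L] [TopologicalSpace N] [TopologicalSpace M]
    {OL : SuperPresheaf L} {ON : SuperPresheaf N} {OM : SuperPresheaf M}
    (Φ : SMap ON OM) (Θ : SMap OL ON) : SMap OL OM where
  base := Φ.base.comp Θ.base
  pull :=
    { app := fun U => (Θ.pull.app (Opens.comap Φ.base U)).comp (Φ.pull.app U)
      app_res := fun h f => by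
        change Θ.pull.app _ (Φ.pull.app _ (OM.res h f)) = _
        rw [Φ.pull.app_res]
        exact Θ.pull.app_res (Opens.comap_mono Φ.base h) _
      app_par := fun U f => by
        change Θ.pull.app _ (Φ.pull.app _ (OM.par U f)) = _
        rw [Φ.pull.app_par]
        exact Θ.pull.app_par (Opens.comap Φ.base U) _ }

section Derivations

variable {X : Type u} [TopologicalSpace X] {O : SuperPresheaf.{u, v} X} {P : SuperPresheaf.{u, w} X}

/-- Homogeneous superderivations of parity `p` from `O|_U` to `P|_U` along `h : O → P`: families of
linear maps `D_V : O(V) → P(V)` for `V ⊆ U`, compatible with restrictions, of parity `p`, with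
`D(fg) = D(f) h(g) + (-1)^{p|f|} h(f) D(g)`. -/
def homDer (h : SheafHom O P) (p : ZMod 2) (U : Opens X) :
    Submodule ℝ (∀ V : {V : Opens X // V ≤ U}, O.obj V.1 →ₗ[ℝ] P.obj V.1) where
  carrier := {D |
    (∀ (V W : {V : Opens X // V ≤ U}) (hWV : W.1 ≤ V.1) (f : O.obj V.1),
      P.res hWV (D V f) = D W (O.res hWV f)) ∧
    (∀ (V : {V : Opens X // V ≤ U}) (f : O.obj V.1),
      P.par V.1 (D V f) = psign p • D V (O.par V.1 f)) ∧
    (∀ (V : {V : Opens X // V ≤ U}) (f g : O.obj V.1),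
      D V (f * g) = D V f * h.app V.1 g + P.twist p V.1 (h.app V.1 f) * D V g)}
  zero_mem' := by simp
  add_mem' := by
    rintro D D' ⟨h1, h2, h3⟩ ⟨k1, k2, k3⟩
    refine ⟨fun V W hWV f => ?_, fun V f => ?_, fun V f g => ?_⟩
    · simp [h1 V W hWV, k1 V W hWV]
    · simp [h2, k2]
    · simp only [Pi.add_apply, LinearMap.add_apply, h3, k3, add_mul, mul_add]
      abel
  smul_mem' := by
    rintro c D ⟨h1, h2, h3⟩
    refine ⟨fun V W hWV f => ?_, fun V f => ?_, fun V f g => ?_⟩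
    · simp [h1 V W hWV]
    · simp only [Pi.smul_apply, LinearMap.smul_apply, map_smul, h2]
      exact smul_comm _ _ _
    · simp [h3]

/-- All superderivations from `O|_U` to `P|_U` along `h`: sums of an even and an odd one. -/
def Der (h : SheafHom O P) (U : Opens X) :
    Submodule ℝ (∀ V : {V : Opens X // V ≤ U}, O.obj V.1 →ₗ[ℝ] P.obj V.1) :=
  homDer h 0 U ⊔ homDer h 1 U

/-- The value `D(f)` for `f ∈ O(V)`, `V ⊆ U`. -/
def Der.act {h : SheafHom O P} {U V : Opens X} (D : Der h U) (hV : V ≤ U) :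
    O.obj V →ₗ[ℝ] P.obj V :=
  D.1 ⟨V, hV⟩

/-- `D` is homogeneous of parity `p`. -/
def Der.HasParity {h : SheafHom O P} {U : Opens X} (D : Der h U) (p : ZMod 2) : Prop :=
  D.1 ∈ homDer h p U

lemma homDer_res_mem {h : SheafHom O P} {p : ZMod 2} {U U' : Opens X} (hU : U' ≤ U)
    {D : ∀ V : {V : Opens X // V ≤ U}, O.obj V.1 →ₗ[ℝ] P.obj V.1} (hD : D ∈ homDer h p U) :
    (fun V : {V : Opens X // V ≤ U'} => D ⟨V.1, V.2.trans hU⟩) ∈ homDer h p U' :=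
  ⟨fun V W hWV f => hD.1 ⟨V.1, V.2.trans hU⟩ ⟨W.1, W.2.trans hU⟩ hWV f,
    fun V f => hD.2.1 ⟨V.1, V.2.trans hU⟩ f, fun V f g => hD.2.2 ⟨V.1, V.2.trans hU⟩ f g⟩

/-- Restriction of derivations to a smaller open set. -/
def Der.res {h : SheafHom O P} {U U' : Opens X} (hU : U' ≤ U) : Der h U →ₗ[ℝ] Der h U' where
  toFun D := ⟨fun V => D.1 ⟨V.1, V.2.trans hU⟩, by
    obtain ⟨D0, h0, D1, h1, hD⟩ := Submodule.mem_sup.1 D.2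
    refine Submodule.mem_sup.2 ⟨_, homDer_res_mem hU h0, _, homDer_res_mem hU h1, ?_⟩
    funext V
    exact congrFun hD ⟨V.1, V.2.trans hU⟩⟩
  map_add' _ _ := rfl
  map_smul' _ _ := rfl

lemma homDer_post_mem {h : SheafHom O P} {p : ZMod 2} {U : Opens X}
    {D : ∀ V : {V : Opens X // V ≤ U}, O.obj V.1 →ₗ[ℝ] O.obj V.1}
    (hD : D ∈ homDer (SheafHom.id O) p U) :
    (fun V : {V : Opens X // V ≤ U} => (h.app V.1).toLinearMap ∘ₗ D V) ∈ homDer h p U := by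
  refine ⟨fun V W hWV f => ?_, fun V f => ?_, fun V f g => ?_⟩
  · simp [← h.app_res, hD.1 V W hWV]
  · simp [← h.app_par, hD.2.1]
  · have := hD.2.2 V f g
    simp only [LinearMap.comp_apply, AlgHom.toLinearMap_apply, this, map_add, map_mul]
    by_cases hp : p = 0 <;> simp [SuperPresheaf.twist, hp, SheafHom.id, h.app_par]

/-- `h ∘ Y`, as a derivation along `h`, for a superderivation `Y` of `O|_U`. -/
def Der.post (h : SheafHom O P) {U : Opens X} (Y : Der (SheafHom.id O) U) : Der h U :=
  ⟨fun V => (h.app V.1).toLinearMap ∘ₗ Y.1 V, by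
    obtain ⟨D0, h0, D1, h1, hD⟩ := Submodule.mem_sup.1 Y.2
    refine Submodule.mem_sup.2 ⟨_, homDer_post_mem h0, _, homDer_post_mem h1, ?_⟩
    funext V
    rw [← hD]
    exact (LinearMap.comp_add _ _ _).symm⟩

lemma homDer_smul_mem {h : SheafHom O P} {p q : ZMod 2} {U : Opens X} {a : P.obj U}
    (ha : P.par U a = psign q • a)
    {D : ∀ V : {V : Opens X // V ≤ U}, O.obj V.1 →ₗ[ℝ] P.obj V.1} (hD : D ∈ homDer h p U) :
    (fun V : {V : Opens X // V ≤ U} => LinearMap.mulLeft ℝ (P.res V.2 a) ∘ₗ D V) ∈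
      homDer h (q + p) U := by
  have hpar : ∀ V : {V : Opens X // V ≤ U}, P.par V.1 (P.res V.2 a) = psign q • P.res V.2 a := by
    intro V
    rw [P.par_res, ha, map_smul]
  refine ⟨fun V W hWV f => ?_, fun V f => ?_, fun V f g => ?_⟩
  · simp [← hD.1 V W hWV, P.res_res]
  · simp only [LinearMap.comp_apply, LinearMap.mulLeft_apply, map_mul, hpar, hD.2.1]
    have : psign (q + p) = psign q * psign p := by
      have h11 : (1 : ZMod 2) + 1 = 0 := by decide
      have h01 : ∀ r : ZMod 2, r = 0 ∨ r = 1 := by decide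
      rcases h01 p with rfl | rfl <;> rcases h01 q with rfl | rfl <;> simp [psign, h11]
    rw [this, smul_mul_smul_comm]
  · simp only [LinearMap.comp_apply, LinearMap.mulLeft_apply, hD.2.2, mul_add, mul_assoc]
    congr 1
    rw [← mul_assoc, ← mul_assoc]
    congr 1
    have h2 : ∀ b : P.obj V.1, P.res V.2 a * b = P.twist q V.1 b * P.res V.2 a := by
      intro b
      by_cases hq : q = 0
      · simpa [SuperPresheaf.twist, hq] using
          P.even_comm _ _ b (by simpa [psign, hq] using hpar V)
      · simpa [SuperPresheaf.twist, hq] using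
          P.odd_comm _ _ b (by simpa [psign, hq] using hpar V)
    rw [h2]
    congr 1
    have h11 : (1 : ZMod 2) + 1 = 0 := by decide
    have h10 : (1 : ZMod 2) ≠ 0 := by decide
    have h01 : ∀ r : ZMod 2, r = 0 ∨ r = 1 := by decide
    rcases h01 p with rfl | rfl <;> rcases h01 q with rfl | rfl <;>
      simp [SuperPresheaf.twist, h11, P.par_par]

/-- The `P(U)`-module structure on derivations, `(a • D)(f) = a · D(f)`. -/
def Der.mulLeft {h : SheafHom O P} {U : Opens X} (a : P.obj U) (D : Der h U) : Der h U :=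
  ⟨fun V => LinearMap.mulLeft ℝ (P.res V.2 a) ∘ₗ D.1 V, by
    obtain ⟨D0, h0, D1, h1, hD⟩ := Submodule.mem_sup.1 D.2
    have h11 : (1 : ZMod 2) + 1 = 0 := by decide
    have e0 : P.par U ((1 / 2 : ℝ) • (a + P.par U a)) =
        psign 0 • ((1 / 2 : ℝ) • (a + P.par U a)) := by
      simp [psign, P.par_par, add_comm]
    have e1 : P.par U ((1 / 2 : ℝ) • (a - P.par U a)) =
        psign 1 • ((1 / 2 : ℝ) • (a - P.par U a)) := by
      simp [psign, P.par_par, ← smul_neg]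
    have m00 := homDer_smul_mem e0 h0
    have m01 := homDer_smul_mem e0 h1
    have m10 := homDer_smul_mem e1 h0
    have m11 := homDer_smul_mem e1 h1
    rw [h11] at m11
    rw [add_zero] at m00 m10
    rw [zero_add] at m01
    refine Submodule.mem_sup.2 ⟨_, Submodule.add_mem _ m00 m11, _, Submodule.add_mem _ m01 m10, ?_⟩
    funext V
    rw [← hD]
    ext f
    have ha : a = (1 / 2 : ℝ) • (a + P.par U a) + (1 / 2 : ℝ) • (a - P.par U a) := by
      rw [← smul_add, add_add_sub_cancel, ← two_smul ℝ a, smul_smul]; norm_num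
    conv_rhs => rw [ha]
    simp only [Pi.add_apply, LinearMap.add_apply, LinearMap.comp_apply, LinearMap.mulLeft_apply,
      map_add, add_mul]
    abel⟩

end Derivations

/-- The sheaf `𝒯_M = Der(O_M)`: superderivations of `O|_U`. -/
abbrev VF {X : Type u} [TopologicalSpace X] (O : SuperPresheaf.{u, v} X) (U : Opens X) :=
  Der (SheafHom.id O) U

/-- A connection on `(X, O)`: an even morphism of sheaves `𝒯 ⊗_ℝ 𝒯 → 𝒯`, `O`-linear in the first
argument, with `∇_X(fY) = X(f) Y + (-1)^{|X||f|} f ∇_X Y`. -/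
structure Connection {X : Type u} [TopologicalSpace X] (O : SuperPresheaf.{u, v} X) where
  cov : ∀ U, VF O U →ₗ[ℝ] VF O U →ₗ[ℝ] VF O U
  cov_res : ∀ {U V : Opens X} (h : V ≤ U) (A B : VF O U),
    Der.res h (cov U A B) = cov V (Der.res h A) (Der.res h B)
  cov_even : ∀ {U} {A B : VF O U} {p q : ZMod 2}, Der.HasParity A p → Der.HasParity B q →
    Der.HasParity (cov U A B) (p + q)
  cov_mulLeft : ∀ {U} (f : O.obj U) (A B : VF O U),
    cov U (Der.mulLeft f A) B = Der.mulLeft f (cov U A B)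
  cov_leibniz : ∀ {U} {p : ZMod 2} {A : VF O U}, Der.HasParity A p → ∀ (f : O.obj U) (B : VF O U),
    cov U A (Der.mulLeft f B) =
      Der.mulLeft (Der.act A le_rfl f) B + Der.mulLeft (O.twist p U f) (cov U A B)

section Geodesics

variable {N : Type u} {M : Type u'} [TopologicalSpace N] [TopologicalSpace M]
  {ON : SuperPresheaf.{u, v} N} {OM : SuperPresheaf.{u', v'} M}

/-- `Φ_* δ = δ ∘ Φ^*`, an even derivation along `Φ`, for an even vector field `δ` on the source. -/
def velocity (Φ : SMap ON OM) (δ : homDer (SheafHom.id ON) 0 ⊤) : homDer Φ.pull 0 ⊤ :=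
  ⟨fun V => δ.1 ⟨Opens.comap Φ.base V.1, le_top⟩ ∘ₗ (Φ.pull.app V.1).toLinearMap, by
    refine ⟨fun V W hWV f => ?_, fun V f => ?_, fun V f g => ?_⟩
    · have := δ.2.1 ⟨Opens.comap Φ.base V.1, le_top⟩ ⟨Opens.comap Φ.base W.1, le_top⟩
        (Opens.comap_mono Φ.base hWV) (Φ.pull.app V.1 f)
      change _ = δ.1 ⟨Opens.comap Φ.base W.1, le_top⟩ (Φ.pull.app W.1 (OM.res hWV f))
      rw [Φ.pull.app_res]
      exact this
    · have := δ.2.2.1 ⟨Opens.comap Φ.base V.1, le_top⟩ (Φ.pull.app V.1 f)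
      change _ = psign 0 • δ.1 ⟨Opens.comap Φ.base V.1, le_top⟩ (Φ.pull.app V.1 (OM.par V.1 f))
      rw [Φ.pull.app_par]
      exact this
    · have := δ.2.2.2 ⟨Opens.comap Φ.base V.1, le_top⟩ (Φ.pull.app V.1 f) (Φ.pull.app V.1 g)
      change δ.1 ⟨Opens.comap Φ.base V.1, le_top⟩ (Φ.pull.app V.1 (f * g)) = _
      rw [map_mul]
      exact this⟩

/-- `Φ_* δ` as an element of `Der(O_M, Φ_* O_N)`. -/
def velocityDer (Φ : SMap ON OM) (δ : homDer (SheafHom.id ON) 0 ⊤) : Der Φ.pull ⊤ :=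
  ⟨(velocity Φ δ).1, Submodule.mem_sup_left (velocity Φ δ).2⟩

/-- `D` is the covariant derivative `∇/dδ` on `Der(O_M, Φ_* O_N)`, i.e. the pullback of `∇` along
`Φ` evaluated on the even vector field `δ` of the source: it is an even morphism of sheaves on `M`,
satisfies the Leibniz rule, and on vector fields `Φ^* ∘ Y` it is given by `∇`: if
`Φ_* δ = ∑ aᵢ (Φ^* ∘ Xᵢ)` on `U` then `D (Φ^* ∘ Y) = ∑ aᵢ (Φ^* ∘ ∇_{Xᵢ} Y)`. -/
structure IsPullbackCov (nabla : Connection OM) (Φ : SMap ON OM)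
    (δ : homDer (SheafHom.id ON) 0 ⊤)
    (D : ∀ U : Opens M, Der Φ.pull U →ₗ[ℝ] Der Φ.pull U) : Prop where
  res : ∀ {U V : Opens M} (h : V ≤ U) (Y : Der Φ.pull U), Der.res h (D U Y) = D V (Der.res h Y)
  even : ∀ {U : Opens M} {Y : Der Φ.pull U} {p : ZMod 2}, Der.HasParity Y p → Der.HasParity (D U Y) p
  leibniz : ∀ {U : Opens M} (a : ON.obj (Opens.comap Φ.base U)) (Y : Der Φ.pull U),
    D U (Der.mulLeft (P := ON.pushforward Φ.base) a Y) =
      Der.mulLeft (P := ON.pushforward Φ.base) (δ.1 ⟨Opens.comap Φ.base U, le_top⟩ a) Y +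
        Der.mulLeft (P := ON.pushforward Φ.base) a (D U Y)
  compat : ∀ {U : Opens M} {n : ℕ} (a : Fin n → ON.obj (Opens.comap Φ.base U))
    (A : Fin n → VF OM U),
    Der.res le_top (velocityDer Φ δ) =
      ∑ i, Der.mulLeft (P := ON.pushforward Φ.base) (a i) (Der.post Φ.pull (A i)) →
    ∀ Y : VF OM U, D U (Der.post Φ.pull Y) =
      ∑ i, Der.mulLeft (P := ON.pushforward Φ.base) (a i) (Der.post Φ.pull (nabla.cov U (A i) Y))

/-- The geodesic equation `∇/dδ (Φ_* δ) = 0`. -/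
def IsGeodesicFor (nabla : Connection OM) (Φ : SMap ON OM)
    (δ : homDer (SheafHom.id ON) 0 ⊤) : Prop :=
  ∃ D, IsPullbackCov nabla Φ δ D ∧ D ⊤ (velocityDer Φ δ) = 0

end Geodesics

/-! ## Classical manifolds and their products with `ℝ^{0|1}` -/

section Smooth

variable {B : Type*} [NormedAddCommGroup B] [NormedSpace ℝ B] {H : Type*} [TopologicalSpace H]
  (I : ModelWithCorners ℝ B H) (N : Type u) [TopologicalSpace N] [ChartedSpace H N]

/-- Restriction of smooth functions. -/
def resSmooth {U V : Opens N} (h : V ≤ U) :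
    C^∞⟮I, U; 𝓘(ℝ, ℝ), ℝ⟯ →ₐ[ℝ] C^∞⟮I, V; 𝓘(ℝ, ℝ), ℝ⟯ where
  toFun f := ⟨fun x => f ⟨x.1, h x.2⟩, f.contMDiff.comp (contMDiff_inclusion h)⟩
  map_one' := rfl
  map_mul' _ _ := rfl
  map_zero' := rfl
  map_add' _ _ := rfl
  commutes' _ := rfl

/-- A classical manifold as a (purely even) superspace, with its sheaf of smooth functions. -/
def smoothFun : SuperPresheaf.{u, u} N where
  obj U := C^∞⟮I, U; 𝓘(ℝ, ℝ), ℝ⟯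
  ring _ := inferInstance
  algebra _ := inferInstance
  res h := resSmooth I N h
  res_self _ _ := rfl
  res_res _ _ _ := rfl
  par _ := AlgHom.id ℝ _
  par_par _ _ := rfl
  par_res _ _ := rfl
  even_comm _ f g _ := mul_comm f g
  odd_comm _ f g _ := mul_comm f g

/-- The superspace `N × ℝ^{0|1}`: its superfunctions on `U` are `f + h τ` with `f, h ∈ C^∞(U)`,
`τ` odd (so `τ² = 0`); `f` and `h` are the components `fst` and `snd`. -/
def timesOdd : SuperPresheaf.{u, u} N where
  obj U := DualNumber C^∞⟮I, U; 𝓘(ℝ, ℝ), ℝ⟯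
  ring _ := inferInstance
  algebra _ := inferInstance
  res h :=
    { toFun := fun f => (resSmooth I N h f.fst, resSmooth I N h f.snd)
      map_one' := rfl
      map_mul' := fun _ _ => rfl
      map_zero' := rfl
      map_add' := fun _ _ => rfl
      commutes' := fun _ => rfl }
  res_self _ _ := rfl
  res_res _ _ _ := rfl
  par _ :=
    { toFun := fun f => (f.fst, -f.snd)
      map_one' := TrivSqZeroExt.ext rfl neg_zero
      map_mul' := fun f g => by
        refine TrivSqZeroExt.ext rfl ?_
        change -(f.fst • g.snd + MulOpposite.op g.fst • f.snd) =
          f.fst • (-g.snd) + MulOpposite.op g.fst • (-f.snd)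
        rw [smul_neg, smul_neg, neg_add]
      map_zero' := TrivSqZeroExt.ext rfl neg_zero
      map_add' := fun f g => TrivSqZeroExt.ext rfl (neg_add _ _)
      commutes' := fun _ => TrivSqZeroExt.ext rfl neg_zero }
  par_par _ f := TrivSqZeroExt.ext rfl (neg_neg _)
  par_res _ _ := rfl
  even_comm _ f g _ := mul_comm f g
  odd_comm U f g hf := by
    have h0 : f.fst = 0 := by
      have h1 : f.fst = -f.fst := congrArg TrivSqZeroExt.fst hf
      ext x
      have h2 : f.fst x = -f.fst x := congrArg (fun k => k x) h1
      change f.fst x = 0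
      linarith
    refine TrivSqZeroExt.ext ?_ ?_
    · change f.fst * g.fst = g.fst * f.fst
      exact mul_comm _ _
    · change f.fst * g.snd + f.snd * g.fst = g.fst * f.snd + -g.snd * f.fst
      rw [h0]
      ring

end Smooth

section SmoothMaps

variable {B : Type*} [NormedAddCommGroup B] [NormedSpace ℝ B] {H : Type*} [TopologicalSpace H]
  {I : ModelWithCorners ℝ B H} {N : Type u} [TopologicalSpace N] [ChartedSpace H N]
  {B' : Type*} [NormedAddCommGroup B'] [NormedSpace ℝ B'] {H' : Type*} [TopologicalSpace H']
  {I' : ModelWithCorners ℝ B' H'} {N' : Type u'} [TopologicalSpace N'] [ChartedSpace H' N']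

/-- The continuous map underlying a smooth map. -/
def contOf (c : C^∞⟮I, N; I', N'⟯) : C(N, N') := ⟨c, c.contMDiff.continuous⟩

lemma contMDiff_comp_subtype (c : C^∞⟮I, N; I', N'⟯) (U : Opens N')
    (f : C^∞⟮I', U; 𝓘(ℝ, ℝ), ℝ⟯) :
    ContMDiff I 𝓘(ℝ, ℝ) ∞ (fun x : Opens.comap (contOf c) U => f ⟨c x.1, x.2⟩) := by
  intro x
  set G : N' → ℝ := Function.extend Subtype.val f 0 with hG
  have hGf : ∀ y : U, G y.1 = f y := fun y => Subtype.val_injective.extend_apply f 0 y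
  have h1 : ContMDiffAt I' 𝓘(ℝ, ℝ) ∞ G (c x.1) := by
    have h2 : ContMDiffAt I' 𝓘(ℝ, ℝ) ∞ (fun y : U => G y) ⟨c x.1, x.2⟩ := by
      have : (fun y : U => G y) = f := funext hGf
      rw [this]
      exact f.contMDiff.contMDiffAt
    exact contMDiffAt_subtype_iff.1 h2
  have h3 : ContMDiffAt I 𝓘(ℝ, ℝ) ∞ (G ∘ c) x.1 := h1.comp x.1 c.contMDiff.contMDiffAt
  have h4 := (contMDiffAt_subtype_iff (U := Opens.comap (contOf c) U) (x := x)).2 h3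
  refine h4.congr_of_eventuallyEq (Filter.Eventually.of_forall fun y => ?_)
  exact (hGf ⟨c y.1, y.2⟩).symm

/-- Pullback `f ↦ f ∘ c` of smooth functions along a smooth map `c`. -/
def pullSmooth (c : C^∞⟮I, N; I', N'⟯) (U : Opens N') :
    C^∞⟮I', U; 𝓘(ℝ, ℝ), ℝ⟯ →ₐ[ℝ] C^∞⟮I, Opens.comap (contOf c) U; 𝓘(ℝ, ℝ), ℝ⟯ where
  toFun f := ⟨fun x => f ⟨c x.1, x.2⟩, contMDiff_comp_subtype c U f⟩
  map_one' := rfl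
  map_mul' _ _ := rfl
  map_zero' := rfl
  map_add' _ _ := rfl
  commutes' _ := rfl

/-- The morphism of superspaces given by a smooth map of classical manifolds. -/
def ofSmooth (c : C^∞⟮I, N; I', N'⟯) : SMap (smoothFun I N) (smoothFun I' N') where
  base := contOf c
  pull :=
    { app := fun U => pullSmooth c U
      app_res := fun _ _ => rfl
      app_par := fun _ _ => rfl }

/-- The morphism `c × id : N × ℝ^{0|1} → N' × ℝ^{0|1}`. -/
def timesOddMap (c : C^∞⟮I, N; I', N'⟯) : SMap (timesOdd I N) (timesOdd I' N') where
  base := contOf c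
  pull :=
    { app := fun U =>
        { toFun := fun f => (pullSmooth c U f.fst, pullSmooth c U f.snd)
          map_one' := rfl
          map_mul' := fun _ _ => rfl
          map_zero' := rfl
          map_add' := fun _ _ => rfl
          commutes' := fun _ => rfl }
      app_res := fun _ _ => rfl
      app_par := fun _ _ => rfl }

end SmoothMaps

/-! ## Curves, supercurves and the coordinate vector field `∂_t` -/

/-- `ℝ = ℝ^{1|0}`. -/
abbrev R1 : SuperPresheaf ℝ := smoothFun 𝓘(ℝ, ℝ) ℝ

/-- `ℝ^{1|1} = ℝ × ℝ^{0|1}`. -/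
abbrev R11 : SuperPresheaf ℝ := timesOdd 𝓘(ℝ, ℝ) ℝ

/-- `ℝ^0`, a point. -/
abbrev R0 := EuclideanSpace ℝ (Fin 0)

/-- `ℝ^{0|1} = ℝ^0 × ℝ^{0|1}`. -/
abbrev R01 : SuperPresheaf R0 := timesOdd 𝓘(ℝ, R0) R0

/-- The extension by zero of a function on an open subset of `ℝ`. -/
def extZero (U : Opens ℝ) (f : U → ℝ) : ℝ → ℝ := Function.extend Subtype.val f 0

lemma extZero_apply {U : Opens ℝ} (f : U → ℝ) (x : U) : extZero U f x.1 = f x :=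
  Subtype.val_injective.extend_apply f 0 x

lemma extZero_contDiffAt {U : Opens ℝ} (f : C^∞⟮𝓘(ℝ, ℝ), U; 𝓘(ℝ, ℝ), ℝ⟯) (x : U) :
    ContDiffAt ℝ ∞ (extZero U f) x.1 := by
  rw [← contMDiffAt_iff_contDiffAt, ← contMDiffAt_subtype_iff]
  have : (fun y : U => extZero U f y) = f := funext (extZero_apply _)
  rw [this]
  exact f.contMDiff.contMDiffAt

lemma extZero_differentiableAt {U : Opens ℝ} (f : C^∞⟮𝓘(ℝ, ℝ), U; 𝓘(ℝ, ℝ), ℝ⟯) (x : U) :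
    DifferentiableAt ℝ (extZero U f) x.1 :=
  (extZero_contDiffAt f x).differentiableAt (by simp)

lemma deriv_extZero_contMDiff {U : Opens ℝ} (f : C^∞⟮𝓘(ℝ, ℝ), U; 𝓘(ℝ, ℝ), ℝ⟯) :
    ContMDiff 𝓘(ℝ, ℝ) 𝓘(ℝ, ℝ) ∞ (fun x : U => deriv (extZero U f) x.1) := by
  intro x
  rw [contMDiffAt_subtype_iff (f := deriv (extZero U f)), contMDiffAt_iff_contDiffAt]
  have h : ContDiffOn ℝ ∞ (extZero U f) U := fun y hy =>
    (extZero_contDiffAt f ⟨y, hy⟩).contDiffWithinAt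
  exact (h.deriv_of_isOpen U.isOpen (by simp)).contDiffAt (U.isOpen.mem_nhds x.2)

/-- The derivative `f ↦ f'` on `C^∞(U)`, `U ⊆ ℝ` open. -/
def dt (U : Opens ℝ) : C^∞⟮𝓘(ℝ, ℝ), U; 𝓘(ℝ, ℝ), ℝ⟯ →ₗ[ℝ] C^∞⟮𝓘(ℝ, ℝ), U; 𝓘(ℝ, ℝ), ℝ⟯ where
  toFun f := ⟨fun x => deriv (extZero U f) x.1, deriv_extZero_contMDiff f⟩
  map_add' f g := by
    ext x
    change deriv (extZero U (f + g)) x.1 = deriv (extZero U f) x.1 + deriv (extZero U g) x.1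
    rw [← deriv_add (extZero_differentiableAt f x) (extZero_differentiableAt g x)]
    refine Filter.EventuallyEq.deriv_eq ?_
    filter_upwards [U.isOpen.mem_nhds x.2] with y hy
    have h1 := extZero_apply (f + g) ⟨y, hy⟩
    have h2 := extZero_apply f ⟨y, hy⟩
    have h3 := extZero_apply g ⟨y, hy⟩
    simp only [Pi.add_apply] at h1 ⊢
    rw [h2, h3]
    exact h1
  map_smul' c f := by
    ext x
    change deriv (extZero U (c • f)) x.1 = c * deriv (extZero U f) x.1
    rw [← deriv_const_mul c (extZero_differentiableAt f x)]
    refine Filter.EventuallyEq.deriv_eq ?_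
    filter_upwards [U.isOpen.mem_nhds x.2] with y hy
    have h1 := extZero_apply (c • f) ⟨y, hy⟩
    have h2 := extZero_apply f ⟨y, hy⟩
    simp only at h1 h2
    rw [h2]
    exact h1

lemma dt_res {U V : Opens ℝ} (h : V ≤ U) (f : C^∞⟮𝓘(ℝ, ℝ), U; 𝓘(ℝ, ℝ), ℝ⟯) :
    resSmooth 𝓘(ℝ, ℝ) ℝ h (dt U f) = dt V (resSmooth 𝓘(ℝ, ℝ) ℝ h f) := by
  ext x
  change deriv (extZero U f) x.1 = deriv (extZero V (resSmooth 𝓘(ℝ, ℝ) ℝ h f)) x.1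
  refine Filter.EventuallyEq.deriv_eq ?_
  filter_upwards [V.isOpen.mem_nhds x.2] with y hy
  rw [extZero_apply (resSmooth 𝓘(ℝ, ℝ) ℝ h f) ⟨y, hy⟩, extZero_apply f ⟨y, h hy⟩]
  rfl

lemma dt_mul {U : Opens ℝ} (f g : C^∞⟮𝓘(ℝ, ℝ), U; 𝓘(ℝ, ℝ), ℝ⟯) :
    dt U (f * g) = dt U f * g + f * dt U g := by
  ext x
  change deriv (extZero U (f * g)) x.1 =
    deriv (extZero U f) x.1 * g x + f x * deriv (extZero U g) x.1
  have h := deriv_mul (extZero_differentiableAt f x) (extZero_differentiableAt g x)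
  rw [extZero_apply, extZero_apply] at h
  rw [← h]
  refine Filter.EventuallyEq.deriv_eq ?_
  filter_upwards [U.isOpen.mem_nhds x.2] with y hy
  have h1 := extZero_apply (f * g) ⟨y, hy⟩
  have h2 := extZero_apply f ⟨y, hy⟩
  have h3 := extZero_apply g ⟨y, hy⟩
  simp only [Pi.mul_apply] at h1 ⊢
  rw [h2, h3]
  exact h1

/-- The vector field `∂_t` on `ℝ`. -/
def partialT : homDer (SheafHom.id R1) 0 ⊤ :=
  ⟨fun V => dt V.1, fun V W hWV f => dt_res hWV f, fun V f => by
    simp only [psign, if_true, one_smul]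
    rfl, fun V f g => by
    simpa [SuperPresheaf.twist] using! dt_mul f g⟩

/-- The vector field `∂_t` on `ℝ^{1|1}`: `∂_t (f + h τ) = f' + h' τ`. -/
def partialTSuper : homDer (SheafHom.id R11) 0 ⊤ :=
  ⟨fun V =>
    { toFun := fun f => (dt V.1 (TrivSqZeroExt.fst f), dt V.1 (TrivSqZeroExt.snd f))
      map_add' := fun f g => TrivSqZeroExt.ext ((dt V.1).map_add _ _) ((dt V.1).map_add _ _)
      map_smul' := fun c f => TrivSqZeroExt.ext ((dt V.1).map_smul _ _) ((dt V.1).map_smul _ _) },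
    ⟨fun V W hWV f => TrivSqZeroExt.ext (dt_res hWV _) (dt_res hWV _), fun V f => by
      simp only [psign, if_true, one_smul]
      exact TrivSqZeroExt.ext rfl ((dt V.1).map_neg _).symm, fun V f g => by
      simp only [SuperPresheaf.twist, if_true]
      refine TrivSqZeroExt.ext (dt_mul (TrivSqZeroExt.fst f) (TrivSqZeroExt.fst g)) ?_
      change dt V.1 (TrivSqZeroExt.fst f * TrivSqZeroExt.snd g +
        TrivSqZeroExt.snd f * TrivSqZeroExt.fst g) =
        (dt V.1 (TrivSqZeroExt.fst f) * TrivSqZeroExt.snd g +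
          dt V.1 (TrivSqZeroExt.snd f) * TrivSqZeroExt.fst g) +
        (TrivSqZeroExt.fst f * dt V.1 (TrivSqZeroExt.snd g) +
          TrivSqZeroExt.snd f * dt V.1 (TrivSqZeroExt.fst g))
      rw [map_add, dt_mul, dt_mul]
      abel⟩⟩

/-! ## The Batchelor model `ΠE = (M, Γ_{ΛE^*})` -/

section Exterior

variable {V : Type*} [AddCommGroup V] [Module ℝ V]

/-- The parity involution of the exterior algebra. -/
abbrev extPar : ExteriorAlgebra ℝ V →ₐ[ℝ] ExteriorAlgebra ℝ V := CliffordAlgebra.involute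

lemma ext_ι_mul (m : V) (b : ExteriorAlgebra ℝ V) :
    ExteriorAlgebra.ι ℝ m * b = extPar b * ExteriorAlgebra.ι ℝ m := by
  induction b using ExteriorAlgebra.induction with
  | algebraMap r => simp [Algebra.commutes]
  | ι x =>
    have h := ExteriorAlgebra.ι_add_mul_swap (R := ℝ) m x
    have h2 : extPar (ExteriorAlgebra.ι ℝ x) = -ExteriorAlgebra.ι ℝ x :=
      CliffordAlgebra.involute_ι x
    rw [h2, neg_mul]
    exact eq_neg_of_add_eq_zero_left h
  | mul a b ha hb => rw [← mul_assoc, ha, mul_assoc, hb, ← mul_assoc, map_mul]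
  | add a b ha hb => rw [mul_add, ha, hb, map_add, add_mul]

lemma ext_comm_aux (a : ExteriorAlgebra ℝ V) :
    ∀ b, (2 : ℝ) • (a * b) = b * (a + extPar a) + extPar b * (a - extPar a) := by
  induction a using CliffordAlgebra.left_induction with
  | algebraMap r =>
    intro b
    rw [AlgHom.commutes, sub_self, mul_zero, add_zero, ← two_smul ℝ, mul_smul_comm,
      Algebra.commutes]
  | add x y hx hy =>
    intro b
    rw [add_mul, smul_add, hx, hy, map_add]
    noncomm_ring
  | ι_mul x m hx =>
    intro b
    have hm : extPar (ExteriorAlgebra.ι ℝ m) = -ExteriorAlgebra.ι ℝ m :=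
      CliffordAlgebra.involute_ι m
    change (2 : ℝ) • (ExteriorAlgebra.ι ℝ m * x * b) =
      b * (ExteriorAlgebra.ι ℝ m * x + extPar (ExteriorAlgebra.ι ℝ m * x)) +
        extPar b * (ExteriorAlgebra.ι ℝ m * x - extPar (ExteriorAlgebra.ι ℝ m * x))
    have h1 : b * ExteriorAlgebra.ι ℝ m = ExteriorAlgebra.ι ℝ m * extPar b := by
      rw [ext_ι_mul, CliffordAlgebra.involute_involute]
    have h2 : extPar b * ExteriorAlgebra.ι ℝ m = ExteriorAlgebra.ι ℝ m * b := (ext_ι_mul m b).symm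
    rw [mul_assoc, ← mul_smul_comm, hx, map_mul, hm, mul_add, mul_add, mul_sub, neg_mul]
    have a1 : ∀ z, b * (ExteriorAlgebra.ι ℝ m * z) = ExteriorAlgebra.ι ℝ m * (extPar b * z) := by
      intro z; rw [← mul_assoc, h1, mul_assoc]
    have a2 : ∀ z, extPar b * (ExteriorAlgebra.ι ℝ m * z) = ExteriorAlgebra.ι ℝ m * (b * z) := by
      intro z; rw [← mul_assoc, h2, mul_assoc]
    rw [sub_neg_eq_add, ← sub_eq_add_neg, mul_add (extPar b), mul_sub b, a1, a1, a2, a2]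
    noncomm_ring

lemma ext_even_comm {a : ExteriorAlgebra ℝ V} (ha : extPar a = a) (b : ExteriorAlgebra ℝ V) :
    a * b = b * a := by
  have h := ext_comm_aux a b
  rw [ha, sub_self, mul_zero, add_zero, ← two_smul ℝ a, mul_smul_comm] at h
  exact smul_right_injective _ (two_ne_zero' ℝ) h

lemma ext_odd_comm {a : ExteriorAlgebra ℝ V} (ha : extPar a = -a) (b : ExteriorAlgebra ℝ V) :
    a * b = extPar b * a := by
  have h := ext_comm_aux a b
  rw [ha, add_neg_cancel, mul_zero, zero_add, sub_neg_eq_add, ← two_smul ℝ a, mul_smul_comm] at h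
  exact smul_right_injective _ (two_ne_zero' ℝ) h

lemma extPar_map {W : Type*} [AddCommGroup W] [Module ℝ W] (f : V →ₗ[ℝ] W)
    (a : ExteriorAlgebra ℝ V) :
    ExteriorAlgebra.map f (extPar a) = extPar (ExteriorAlgebra.map f a) := by
  have : (ExteriorAlgebra.map f).comp extPar = extPar.comp (ExteriorAlgebra.map f) := by
    refine ExteriorAlgebra.hom_ext ?_
    ext m
    have h1 : extPar (ExteriorAlgebra.ι ℝ m) = -ExteriorAlgebra.ι ℝ m :=
      CliffordAlgebra.involute_ι m
    have h2 : extPar (ExteriorAlgebra.ι ℝ (f m)) = -ExteriorAlgebra.ι ℝ (f m) :=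
      CliffordAlgebra.involute_ι (f m)
    simp only [LinearMap.comp_apply, AlgHom.toLinearMap_apply, AlgHom.comp_apply, h1, map_neg,
      ExteriorAlgebra.map_apply_ι, h2]
  exact DFunLike.congr_fun this a

end Exterior

section Batchelor

open Bundle

variable (B : Type*) [NormedAddCommGroup B] [NormedSpace ℝ B]
  {M : Type*} [TopologicalSpace M] [ChartedSpace B M]
  (F : Type*) [NormedAddCommGroup F] [NormedSpace ℝ F]
  (E : M → Type*) [TopologicalSpace (TotalSpace F E)] [∀ x, AddCommGroup (E x)]
  [∀ x, Module ℝ (E x)] [∀ x, TopologicalSpace (E x)] [FiberBundle F E] [VectorBundle ℝ F E]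

/-- The map `Λ(E_x^*) → Λ(F^*)` induced by the local trivialization of `E` around `x₀`. -/
def localRep (x₀ x : M) :
    ExteriorAlgebra ℝ (Module.Dual ℝ (E x)) →ₐ[ℝ] ExteriorAlgebra ℝ (Module.Dual ℝ F) :=
  ExteriorAlgebra.map (((trivializationAt F E x₀).symmL ℝ x).toLinearMap.dualMap)

/-- Smooth sections of `ΛE^*` over `U`: in the local trivializations of `E`, all coordinates of the
section are smooth. -/
def smoothSections [FiniteDimensional ℝ F] (U : Opens M) :
    Subalgebra ℝ (∀ x : U, ExteriorAlgebra ℝ (Module.Dual ℝ (E x.1))) where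
  carrier := {s | ∀ (x₀ : U) (l : Module.Dual ℝ (ExteriorAlgebra ℝ (Module.Dual ℝ F))),
    ContMDiffAt 𝓘(ℝ, B) 𝓘(ℝ, ℝ) ∞ (fun x : U => l (localRep F E x₀.1 x.1 (s x))) x₀}
  mul_mem' := by
    intro s s' hs hs' x₀ l
    let b := (Module.finBasis ℝ (Module.Dual ℝ F)).ExteriorAlgebra
    have key : ∀ a c : ExteriorAlgebra ℝ (Module.Dual ℝ F),
        l (a * c) = ∑ i, ∑ j, b.coord i a * b.coord j c * l (b i * b j) := by
      intro a c
      conv_lhs => rw [← b.sum_repr a, ← b.sum_repr c]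
      rw [Finset.sum_mul_sum, map_sum]
      refine Finset.sum_congr rfl fun i _ => ?_
      rw [map_sum]
      refine Finset.sum_congr rfl fun j _ => ?_
      rw [smul_mul_smul_comm, map_smul]
      rfl
    have hsm : ContMDiffAt 𝓘(ℝ, B) 𝓘(ℝ, ℝ) ∞ (fun x : U => ∑ i, ∑ j,
        b.coord i (localRep F E x₀.1 x.1 (s x)) * b.coord j (localRep F E x₀.1 x.1 (s' x)) *
          l (b i * b j)) x₀ := by
      refine ContMDiffAt.sum fun i _ => ContMDiffAt.sum fun j _ => ?_
      exact ((hs x₀ (b.coord i)).mul (hs' x₀ (b.coord j))).mul contMDiffAt_const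
    refine hsm.congr_of_eventuallyEq (Filter.Eventually.of_forall fun x => ?_)
    change l (localRep F E x₀.1 x.1 (s x * s' x)) = _
    rw [map_mul, key]
  add_mem' := by
    intro s s' hs hs' x₀ l
    refine ((hs x₀ l).add (hs' x₀ l)).congr_of_eventuallyEq (Filter.Eventually.of_forall fun x => ?_)
    change l (localRep F E x₀.1 x.1 (s x + s' x)) = _
    rw [map_add, map_add]
    rfl
  algebraMap_mem' := by
    intro r x₀ l
    simp only [Pi.algebraMap_apply, AlgHom.commutes]
    exact contMDiffAt_const

/-- The sheaf `Γ_{ΛE^*}` of superfunctions of the supermanifold `ΠE`. -/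
def batchelor [FiniteDimensional ℝ F] : SuperPresheaf M where
  obj U := smoothSections B F E U
  ring _ := inferInstance
  algebra _ := inferInstance
  res h :=
    { toFun := fun s => ⟨fun x => s.1 ⟨x.1, h x.2⟩, fun x₀ l =>
        ContMDiffAt.comp (I' := 𝓘(ℝ, B)) (f := Opens.inclusion h)
          (g := fun x : _ => l (localRep F E x₀.1 x.1 (s.1 x))) x₀
          (s.2 ⟨x₀.1, h x₀.2⟩ l) ((contMDiff_inclusion h) x₀)⟩
      map_one' := rfl
      map_mul' := fun _ _ => rfl
      map_zero' := rfl
      map_add' := fun _ _ => rfl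
      commutes' := fun _ => rfl }
  res_self _ _ := rfl
  res_res _ _ _ := rfl
  par U :=
    { toFun := fun s => ⟨fun x => extPar (s.1 x), fun x₀ l => by
        simp only [localRep, extPar_map]
        exact s.2 x₀ (l ∘ₗ extPar.toLinearMap)⟩
      map_one' := Subtype.ext (funext fun _ => map_one _)
      map_mul' := fun _ _ => Subtype.ext (funext fun _ => map_mul _ _ _)
      map_zero' := Subtype.ext (funext fun _ => map_zero _)
      map_add' := fun _ _ => Subtype.ext (funext fun _ => map_add _ _ _)
      commutes' := fun r => Subtype.ext (funext fun _ => AlgHom.commutes _ r) }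
  par_par _ _ := Subtype.ext (funext fun _ => CliffordAlgebra.involute_involute _)
  par_res _ _ := rfl
  even_comm _ f _ h := Subtype.ext (funext fun x =>
    ext_even_comm (congrFun (congrArg Subtype.val h) x) _)
  odd_comm _ f _ h := Subtype.ext (funext fun x =>
    ext_odd_comm (congrFun (congrArg Subtype.val h) x) _)

/-- `ψ ∘ pr`: the function `e ↦ s₀(π e) + s₁(π e)(e)` on `π⁻¹(U) ⊆ E`, where `s₀` and `s₁` are the
components of degree `0` and `1` of the superfunction `s ∈ Γ_{ΛE^*}(U)`. -/
def affineFun {U : Opens M} (s : ∀ x : U, ExteriorAlgebra ℝ (Module.Dual ℝ (E x.1)))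
    (e : TotalSpace F E) (he : e.proj ∈ U) : ℝ :=
  ExteriorAlgebra.algebraMapInv (s ⟨e.proj, he⟩) +
    (ExteriorAlgebra.ιInv (s ⟨e.proj, he⟩) : Module.Dual ℝ (E e.proj)) e.2

/-- The projection `π : E → M`. -/
def bundleProj : C(TotalSpace F E, M) := ⟨TotalSpace.proj, FiberBundle.continuous_proj F E⟩

lemma affineFun_contMDiff [FiniteDimensional ℝ F] [ContMDiffVectorBundle ∞ F E 𝓘(ℝ, B)]
    {U : Opens M} (s : smoothSections B F E U) :
    ContMDiff (𝓘(ℝ, B).prod 𝓘(ℝ, F)) 𝓘(ℝ, ℝ) ∞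
      (fun e : Opens.comap (bundleProj F E) U => affineFun F E s.1 e.1 e.2) := by
  intro e₀
  set x₀ : U := ⟨e₀.1.proj, e₀.2⟩ with hx₀
  set tr := trivializationAt F E x₀.1 with htr
  let c := Module.finBasis ℝ F
  let l0 : Module.Dual ℝ (ExteriorAlgebra ℝ (Module.Dual ℝ F)) :=
    ExteriorAlgebra.algebraMapInv.toLinearMap
  let lj : ∀ j, Module.Dual ℝ (ExteriorAlgebra ℝ (Module.Dual ℝ F)) := fun j =>
    (Module.Dual.eval ℝ F (c j)) ∘ₗ ExteriorAlgebra.ιInv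
  let G : Module.Dual ℝ (ExteriorAlgebra ℝ (Module.Dual ℝ F)) → M → ℝ := fun l =>
    Function.extend Subtype.val (fun x : U => l (localRep F E x₀.1 x.1 (s.1 x))) 0
  have hGval : ∀ l (x : U), G l x.1 = l (localRep F E x₀.1 x.1 (s.1 x)) := fun l x =>
    Subtype.val_injective.extend_apply _ _ x
  have hG : ∀ l, ContMDiffAt 𝓘(ℝ, B) 𝓘(ℝ, ℝ) ∞ (G l) x₀.1 := by
    intro l
    rw [← contMDiffAt_subtype_iff]
    exact (s.2 x₀ l).congr_of_eventuallyEq (Filter.Eventually.of_forall fun x => hGval l x)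
  have hGp : ∀ l, ContMDiffAt (𝓘(ℝ, B).prod 𝓘(ℝ, F)) 𝓘(ℝ, ℝ) ∞
      (fun e : TotalSpace F E => G l e.proj) e₀.1 := fun l =>
    ContMDiffAt.comp (I' := 𝓘(ℝ, B)) (g := G l) (f := TotalSpace.proj) e₀.1 (hG l)
      (contMDiff_proj E).contMDiffAt
  have hsnd : ContMDiffAt (𝓘(ℝ, B).prod 𝓘(ℝ, F)) 𝓘(ℝ, F) ∞
      (fun e : TotalSpace F E => (tr e).2) e₀.1 :=
    (contMDiffAt_totalSpace.1 (contMDiffAt_id (x := e₀.1))).2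
  have hcoord : ∀ j, ContMDiffAt (𝓘(ℝ, B).prod 𝓘(ℝ, F)) 𝓘(ℝ, ℝ) ∞
      (fun e : TotalSpace F E => c.coord j (tr e).2) e₀.1 := fun j =>
    ContMDiffAt.comp (I' := 𝓘(ℝ, F)) (g := c.coord j) e₀.1
      ((c.coord j).toContinuousLinearMap.contDiff.contMDiff.contMDiffAt) hsnd
  have hmain : ContMDiffAt (𝓘(ℝ, B).prod 𝓘(ℝ, F)) 𝓘(ℝ, ℝ) ∞
      (fun e : TotalSpace F E => G l0 e.proj + ∑ j, c.coord j (tr e).2 * G (lj j) e.proj) e₀.1 :=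
    (hGp l0).add (ContMDiffAt.sum fun j _ => (hcoord j).mul (hGp (lj j)))
  refine ((contMDiffAt_subtype_iff (U := Opens.comap (bundleProj F E) U)).2
    hmain).congr_of_eventuallyEq ?_
  have hbase : ∀ᶠ e : Opens.comap (bundleProj F E) U in 𝓝 e₀, e.1.proj ∈ tr.baseSet := by
    have hcont : Continuous fun e : Opens.comap (bundleProj F E) U => e.1.proj :=
      (FiberBundle.continuous_proj F E).comp continuous_subtype_val
    exact hcont.continuousAt.eventually
      (tr.open_baseSet.mem_nhds (FiberBundle.mem_baseSet_trivializationAt' x₀.1))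
  filter_upwards [hbase] with e he
  have h0 : ∀ a, l0 (localRep F E x₀.1 e.1.proj a) = ExteriorAlgebra.algebraMapInv a := by
    intro a
    have : (ExteriorAlgebra.algebraMapInv (R := ℝ) (M := Module.Dual ℝ F)).comp
        (localRep F E x₀.1 e.1.proj) = ExteriorAlgebra.algebraMapInv := by
      refine ExteriorAlgebra.hom_ext ?_
      ext m
      simp [localRep, ExteriorAlgebra.algebraMapInv]
    exact DFunLike.congr_fun this a
  have h1 : ∀ a, ExteriorAlgebra.ιInv (localRep F E x₀.1 e.1.proj a) =
      (tr.symmL ℝ e.1.proj).toLinearMap.dualMap (ExteriorAlgebra.ιInv a) := by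
    intro a
    exact LinearMap.congr_fun (ExteriorAlgebra.ιInv_comp_map
      ((tr.symmL ℝ e.1.proj).toLinearMap.dualMap)) a
  have h2 : tr.symmL ℝ e.1.proj (tr e.1).2 = e.1.2 := by
    have h3 := tr.symmL_continuousLinearMapAt (R := ℝ) he e.1.2
    rwa [tr.continuousLinearMapAt_apply_of_mem ℝ he] at h3
  have h4 : ∀ φ : Module.Dual ℝ F, φ (tr e.1).2 = ∑ j, c.coord j (tr e.1).2 * φ (c j) := by
    intro φ
    conv_lhs => rw [← c.sum_repr (tr e.1).2, map_sum]
    simp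
  have hv : ∀ l, G l e.1.proj = l (localRep F E x₀.1 e.1.proj (s.1 ⟨e.1.proj, e.2⟩)) := fun l =>
    hGval l ⟨e.1.proj, e.2⟩
  simp only [hv, h0, affineFun]
  congr 1
  have h5 := h4 (ExteriorAlgebra.ιInv (localRep F E x₀.1 e.1.proj (s.1 ⟨e.1.proj, e.2⟩)))
  refine Eq.trans ?_ h5
  rw [h1]
  change _ = ExteriorAlgebra.ιInv (s.1 ⟨e.1.proj, e.2⟩) (tr.symmL ℝ e.1.proj (tr e.1).2)
  rw [h2]

variable {B F E}
variable [FiniteDimensional ℝ F] [ContMDiffVectorBundle ∞ F E 𝓘(ℝ, B)]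
  {Ms : SuperPresheaf M} (β : SheafIso Ms (batchelor B F E))

/-! ### The reduced connection `∇^{TE}`

Here `Ms` is a supermanifold over `M` with a Batchelor model `β : O ≅ Γ_{ΛE^*}` (being isomorphic to
`Γ_{ΛE^*}`, it is a sheaf, locally isomorphic to smooth functions tensor a Grassmann algebra). -/

/-- `s ∈ 𝓕(U) = Γ_{ℝ ⊕ E^*}(U)`: all components of `s` of degree at least two vanish. -/
def InF {U : Opens M} (s : Ms.obj U) : Prop :=
  ∀ x : U, ∃ (r : ℝ) (m : Module.Dual ℝ (E x.1)),
    (β.app U s : smoothSections B F E U).1 x =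
      algebraMap ℝ _ r + ExteriorAlgebra.ι ℝ m

/-- `ψ ∘ pr : O(U) → C^∞(π⁻¹(U))`; on `𝓕(U)` this is the isomorphism `ψ` onto the smooth
functions which are affine linear on the fibers of `E`. -/
def psi {U : Opens M} (s : Ms.obj U) :
    C^∞⟮𝓘(ℝ, B).prod 𝓘(ℝ, F), Opens.comap (bundleProj F E) U; 𝓘(ℝ, ℝ), ℝ⟯ :=
  ⟨fun e => affineFun F E (β.app U s : smoothSections B F E U).1 e.1 e.2,
    affineFun_contMDiff B F E (β.app U s)⟩

variable (B F E) in
/-- The total space of `E` as a classical manifold. -/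
abbrev totE : SuperPresheaf (TotalSpace F E) :=
  smoothFun (𝓘(ℝ, B).prod 𝓘(ℝ, F)) (TotalSpace F E)

/-- `X ∈ 𝓛_{\bar 0}(U)`: `X` is an even derivation preserving `𝓕`. -/
def InL0 {U : Opens M} (X : VF Ms U) : Prop :=
  Der.HasParity X 0 ∧
    ∀ (V : Opens M) (hV : V ≤ U) (s : Ms.obj V), InF β s → InF β (Der.act X hV s)

/-- `Z' = (Ψ ∘ p)(Z)`: the vector field `Z'` on `π⁻¹(U) ⊆ E` satisfies `Z'(ψ s) = ψ (pr (Z s))` for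
all local sections `s` of `𝓕`. -/
def ReducesTo {U : Opens M} (Z : VF Ms U) (Z' : VF (totE B F E) (Opens.comap (bundleProj F E) U)) :
    Prop :=
  ∀ (V : Opens M) (hV : V ≤ U) (s : Ms.obj V), InF β s →
    Der.act Z' (Opens.comap_mono (bundleProj F E) hV) (psi β s) = psi β (Der.act Z hV s)

/-- `∇'` is the connection `∇^{TE}` on the manifold `E` induced by `∇`: it extends the operation
`Ψ ∘ p ∘ ∇ ∘ (Ψ⁻¹ ⊗ Ψ⁻¹)` on `𝓛'_{\bar 0} = Ψ(𝓛_{\bar 0})`. -/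
def IsReducedConnection (nabla : Connection Ms) (nabla' : Connection (totE B F E)) : Prop :=
  ∀ (U : Opens M) (X Y : VF Ms U) (X' Y' : VF (totE B F E) (Opens.comap (bundleProj F E) U)),
    InL0 β X → InL0 β Y → ReducesTo β X X' → ReducesTo β Y Y' →
      ReducesTo β (nabla.cov U X Y) (nabla'.cov _ X' Y')

/-! ### Curves, initial conditions and geodesics -/

/-- `T(f + h τ) = f + h`. -/
def bodyAddSoul {D : Type*} [NormedAddCommGroup D] [NormedSpace ℝ D] {U : Opens D}
    (f : (timesOdd 𝓘(ℝ, D) D).obj U) (x : U) : ℝ :=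
  (TrivSqZeroExt.fst f : C^∞⟮𝓘(ℝ, D), U; 𝓘(ℝ, ℝ), ℝ⟯) x +
    (TrivSqZeroExt.snd f : C^∞⟮𝓘(ℝ, D), U; 𝓘(ℝ, ℝ), ℝ⟯) x

/-- Initial conditions for geodesics: the set `(TM)(ℝ^{0|1})` of morphisms `ℝ^{0|1} → TM` into the
tangent bundle of the supermanifold, i.e. pairs of a morphism `f : ℝ^{0|1} → M` and an even
derivation along `f` (an even section of `f^* 𝒯_M`). -/
structure InitCond (OM : SuperPresheaf M) where
  point : SMap R01 OM
  vec : homDer point.pull 0 ⊤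

/-- The inclusion `ℝ^{0|1} → ℝ^{1|1}` at `t = 0`. -/
def inclZero : SMap R01 R11 := timesOddMap (ContMDiffMap.const 0)

/-- The initial condition of a supercurve `Φ`: the restriction of `Φ_* ∂_t` to `t = 0`. -/
def initCond {OM : SuperPresheaf M} (Φ : SMap R11 OM) : InitCond OM where
  point := Φ.comp inclZero
  vec := ⟨fun V => (inclZero.pull.app (Opens.comap Φ.base V.1)).toLinearMap ∘ₗ
      (velocity Φ partialTSuper).1 V, by
    have hv := (velocity Φ partialTSuper).2
    refine ⟨fun V W hWV f => ?_, fun V f => ?_, fun V f g => ?_⟩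
    · have h1 := hv.1 V W hWV f
      have h2 := inclZero.pull.app_res (Opens.comap_mono Φ.base hWV)
        ((velocity Φ partialTSuper).1 V f)
      exact h2.symm.trans (congrArg (inclZero.pull.app (Opens.comap Φ.base W.1)) h1)
    · have h1 := hv.2.1 V f
      have h2 := inclZero.pull.app_par (Opens.comap Φ.base V.1)
        ((velocity Φ partialTSuper).1 V f)
      simp only [psign, if_true, one_smul] at h1 ⊢
      exact h2.symm.trans (congrArg (inclZero.pull.app (Opens.comap Φ.base V.1)) h1)
    · have h1 := hv.2.2 V f g
      simp only [SuperPresheaf.twist, if_true] at h1 ⊢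
      refine (congrArg (inclZero.pull.app (Opens.comap Φ.base V.1)) h1).trans ?_
      exact (map_add (inclZero.pull.app (Opens.comap Φ.base V.1)) _ _).trans
        (congrArg₂ _ (map_mul (inclZero.pull.app (Opens.comap Φ.base V.1)) _ _)
          (map_mul (inclZero.pull.app (Opens.comap Φ.base V.1)) _ _))⟩

variable (B F E) in
/-- Smooth curves `ℝ → E` in the total space. -/
abbrev CurveE := C^∞⟮𝓘(ℝ, ℝ), ℝ; 𝓘(ℝ, B).prod 𝓘(ℝ, F), TotalSpace F E⟯

/-- The initial condition `γ'(0) ∈ TE` of a curve in `E`. -/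
def initVelocity (γ : CurveE B F E) :
    TangentBundle (𝓘(ℝ, B).prod 𝓘(ℝ, F)) (TotalSpace F E) :=
  ⟨γ 0, mfderiv 𝓘(ℝ, ℝ) (𝓘(ℝ, B).prod 𝓘(ℝ, F)) γ 0 (1 : ℝ)⟩

/-- The supercurve `Φ` and the curve `γ` in `E` correspond to each other: they have the same
underlying curve in `M` and `T ∘ Φ^* = γ^* ∘ ψ` on `𝓕`. -/
def CurveCorr (Φ : SMap R11 Ms) (γ : CurveE B F E) : Prop :=
  (∀ t, (γ t).proj = Φ.base t) ∧
  ∀ (U : Opens M) (s : Ms.obj U), InF β s →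
    ∀ (t : ℝ) (ht : Φ.base t ∈ U) (ht' : (γ t).proj ∈ U),
      bodyAddSoul (D := ℝ) (U := Opens.comap Φ.base U) (Φ.pull.app U s) ⟨t, ht⟩ =
        psi β s ⟨γ t, ht'⟩

/-- The initial condition `A ∈ (TM)(ℝ^{0|1})` and the tangent vector `α ∈ TE` correspond to each
other: for the morphism `f : ℝ^{0|1} → M` and the derivation `h` along `f` that make up `A`, and the
foot point `e` of `α`, one has `T(f^* s) = ψ(s)(e)` and `T(h(s)) = dψ(s)(α)` for all local
sections `s` of `𝓕` (`G` stands for any extension of `ψ(s)` to all of `E`). -/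
def InitCorr (A : InitCond Ms) (α : TangentBundle (𝓘(ℝ, B).prod 𝓘(ℝ, F)) (TotalSpace F E)) :
    Prop :=
  α.proj.proj = A.point.base 0 ∧
  ∀ (U : Opens M) (s : Ms.obj U), InF β s →
    ∀ (h : A.point.base 0 ∈ U) (h' : α.proj.proj ∈ U),
      bodyAddSoul (D := R0) (U := Opens.comap A.point.base U) (A.point.pull.app U s) ⟨0, h⟩ =
        psi β s ⟨α.proj, h'⟩ ∧
      ∀ G : TotalSpace F E → ℝ,
        (∀ e : Opens.comap (bundleProj F E) U, G e.1 = psi β s e) →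
        bodyAddSoul (D := R0) (U := Opens.comap A.point.base U) (A.vec.1 ⟨U, le_top⟩ s) ⟨0, h⟩ =
          mfderiv (𝓘(ℝ, B).prod 𝓘(ℝ, F)) 𝓘(ℝ, ℝ) G α.proj α.2

/-- Geodesics `Φ : ℝ^{1|1} → M` of a supermanifold with connection. -/
def IsSuperGeodesic {OM : SuperPresheaf M} (nabla : Connection OM) (Φ : SMap R11 OM) : Prop :=
  IsGeodesicFor nabla Φ partialTSuper

/-- Geodesics `γ : ℝ → E` of the manifold `E` with a connection. -/
def IsGeodesic (nabla : Connection (totE B F E)) (γ : CurveE B F E) : Prop :=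
  IsGeodesicFor nabla (ofSmooth γ) partialT

end Batchelor

end

end SuperGeo

set_option linter.all false

open scoped Manifold ContDiff Topology
open TopologicalSpace

namespace SuperGeo

noncomputable section

universe u v w u' v' t

/-! ## The algebra of superderivations -/

section DerAlgebra

variable {X : Type u} [TopologicalSpace X] {O : SuperPresheaf.{u, v} X}
  {P : SuperPresheaf.{u, w} X} {h : SheafHom O P} {U V W : Opens X} {p q : ZMod 2}

/-! Everything rests on the evaluation morphism `ev : E × ℝ^{0|1} → 𝓜`. Its pullback q sends a
superfunction s = s₀ + s₁ + … to s₀ + s₁ τ, where s₀ and s₁ are read as functions on E; terms of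
degree at least two die because τ² = 0, and ψ ∘ pr is T ∘ q.

This morphism is universal. At a point of N, a morphism N × ℝ^{0|1} → 𝓜 gives a parity-preserving
algebra map into the dual numbers. Such a map is plain evaluation on smooth functions
(`OddPoint.apply_funIncl`) and sends odd coordinates to multiples of τ, so it is the same thing as a
point of a fibre of E (`OddPoint.eq_evPoint`). Hence every morphism N × ℝ^{0|1} → 𝓜 is `ev` composed
with c × id for a smooth map c : N → E (`ev_comp_liftMap`). The case N = ℝ is κ, and N a point gives
the morphism part of ι.

The connection on E is the pullback of ∇ along `ev`. An even derivation along `ev` sends even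
coordinates to functions on E and odd coordinates to functions times τ, so it has the components of
a vector field on E. Covariant differentiation along `ev` in the direction of a vector field on E
(`exists_isCovAlong`) preserves evenness, and therefore descends to vector fields on E
(`act_cov_liftVF`, `exists_isReducedCov`). For an even superderivation Z, having the reduction Z'
means that Z and Z' are related by `ev` (`reducesTo_of_liftVF`, `liftVF_of_reducesTo`), so the
required compatibility of the two connections is the defining property of a pullback connection. For
uniqueness, the fields ∂_i and ξ_a ∂_a preserve 𝓕 and reduce to ∂_i and y_a ∂_a. They fix the
Christoffel symbols on E up to factors y_a, and y_a g = 0 forces g = 0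
(`IsReducedConnection.unique`).

If Φ = `ev` ∘ (γ × id), each component of the geodesic equation of Φ is 1 or τ times the
corresponding component for γ (`isSuperGeodesic_iff_isGeodesic`), so κ matches geodesics with
geodesics. Every tangent vector of E and every initial condition on 𝓜 comes from a curve defined on
all of ℝ (`exists_curve`, `exists_initCond_eq`), so ι can be built from κ and intertwines initial
conditions (`initEquiv_initCond`). Finally a geodesic of E is determined by its initial velocity
(`IsGeodesic.eq_of_initVelocity_eq`), so prescribing G by initial conditions singles out the
restriction of κ. Completeness plays no role, as only geodesics defined on all of ℝ are compared. -/

theorem zmod2_cases (p : ZMod 2) : p = 0 ∨ p = 1 := by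
  revert p; decide

theorem zmod2_add_self (p : ZMod 2) : p + p = 0 := by
  revert p; decide

theorem psign_add (p q : ZMod 2) : psign (p + q) = psign p * psign q := by
  have h11 : (1 : ZMod 2) + 1 = 0 := by decide
  rcases zmod2_cases p with rfl | rfl <;> rcases zmod2_cases q with rfl | rfl <;>
    simp [psign, h11]

theorem psign_mul_self (p : ZMod 2) : psign p * psign p = 1 := by
  rcases zmod2_cases p with rfl | rfl <;> simp [psign]

theorem SuperPresheaf.twist_res (hV : V ≤ U) (a : P.obj U) :
    P.twist p V (P.res hV a) = P.res hV (P.twist p U a) := by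
  by_cases hp : p = 0
  · simp [SuperPresheaf.twist, hp]
  · simp [SuperPresheaf.twist, hp, P.par_res]

theorem SheafHom.app_twist (h : SheafHom O P) (a : O.obj U) :
    h.app U (O.twist p U a) = P.twist p U (h.app U a) := by
  by_cases hp : p = 0
  · simp [SuperPresheaf.twist, hp]
  · simp [SuperPresheaf.twist, hp, h.app_par]

/-- Moving a homogeneous factor of parity `p` past `c`. -/
theorem SuperPresheaf.mul_twist {a : P.obj U} (ha : P.par U a = psign p • a) (c : P.obj U) :
    a * P.twist p U c = c * a := by
  rcases zmod2_cases p with rfl | rfl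
  · simpa [SuperPresheaf.twist] using P.even_comm _ a c (by simpa [psign] using ha)
  · have := P.odd_comm _ a (P.par U c) (by simpa [psign] using ha)
    simpa [SuperPresheaf.twist, P.par_par] using this

namespace Der

theorem ext_act {D D' : Der h U}
    (H : ∀ V (hV : V ≤ U) (f : O.obj V), act D hV f = act D' hV f) : D = D' :=
  Subtype.ext (funext fun V => LinearMap.ext fun f => H V.1 V.2 f)

@[simp] theorem act_zero (hV : V ≤ U) (f : O.obj V) : act (0 : Der h U) hV f = 0 := rfl

@[simp] theorem act_add (D D' : Der h U) (hV : V ≤ U) (f : O.obj V) :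
    act (D + D') hV f = act D hV f + act D' hV f := rfl

@[simp] theorem act_sub (D D' : Der h U) (hV : V ≤ U) (f : O.obj V) :
    act (D - D') hV f = act D hV f - act D' hV f := rfl

@[simp] theorem act_smul (c : ℝ) (D : Der h U) (hV : V ≤ U) (f : O.obj V) :
    act (c • D) hV f = c • act D hV f := rfl

@[simp] theorem act_sum {ι : Type*} (s : Finset ι) (D : ι → Der h U) (hV : V ≤ U)
    (f : O.obj V) : act (∑ i ∈ s, D i) hV f = ∑ i ∈ s, act (D i) hV f := by
  classical
  induction s using Finset.induction_on with
  | empty => simp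
  | insert i s hi ih => rw [Finset.sum_insert hi, Finset.sum_insert hi, act_add, ih]

@[simp] theorem act_mulLeft (a : P.obj U) (D : Der h U) (hV : V ≤ U) (f : O.obj V) :
    act (mulLeft a D) hV f = P.res hV a * act D hV f := rfl

@[simp] theorem act_res (hV : V ≤ U) (D : Der h U) (hW : W ≤ V) (f : O.obj W) :
    act (res hV D) hW f = act D (hW.trans hV) f := rfl

@[simp] theorem act_post (Y : VF O U) (hV : V ≤ U) (f : O.obj V) :
    act (post h Y) hV f = h.app V (act Y hV f) := rfl

theorem exists_parts (D : Der h U) :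
    ∃ D0 D1 : Der h U, HasParity D0 0 ∧ HasParity D1 1 ∧ D0 + D1 = D := by
  obtain ⟨D0, h0, D1, h1, hD⟩ := Submodule.mem_sup.1 D.2
  exact ⟨⟨D0, Submodule.mem_sup_left h0⟩, ⟨D1, Submodule.mem_sup_right h1⟩, h0, h1,
    Subtype.ext hD⟩

/-- A homogeneous derivation as an element of `Der`. -/
def ofHom (D : homDer h p U) : Der h U :=
  ⟨D.1, by
    rcases zmod2_cases p with rfl | rfl
    · exact Submodule.mem_sup_left D.2
    · exact Submodule.mem_sup_right D.2⟩

theorem ofHom_hasParity (D : homDer h p U) : HasParity (ofHom D) p := D.2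

theorem HasParity.act_mul {D : Der h U} (hD : HasParity D p) (hV : V ≤ U) (f g : O.obj V) :
    act D hV (f * g) = act D hV f * h.app V g + P.twist p V (h.app V f) * act D hV g :=
  hD.2.2 ⟨V, hV⟩ f g

theorem HasParity.par_act {D : Der h U} (hD : HasParity D p) (hV : V ≤ U) (f : O.obj V) :
    P.par V (act D hV f) = psign p • act D hV (O.par V f) :=
  hD.2.1 ⟨V, hV⟩ f

theorem HasParity.par_act_of {D : Der h U} (hD : HasParity D p) (hV : V ≤ U) {f : O.obj V}
    (hf : O.par V f = psign q • f) : P.par V (act D hV f) = psign (p + q) • act D hV f := by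
  rw [hD.par_act, hf, map_smul, smul_smul, psign_add]

theorem HasParity.zero : HasParity (0 : Der h U) p := Submodule.zero_mem _

theorem HasParity.add {D D' : Der h U} (hD : HasParity D p) (hD' : HasParity D' p) :
    HasParity (D + D') p := Submodule.add_mem _ hD hD'

theorem HasParity.sum {ι : Type*} {s : Finset ι} {D : ι → Der h U}
    (hD : ∀ i ∈ s, HasParity (D i) p) : HasParity (∑ i ∈ s, D i) p := by
  classical
  induction s using Finset.induction_on with
  | empty => exact HasParity.zero
  | insert i s hi ih =>
    rw [Finset.sum_insert hi]
    exact (hD i (Finset.mem_insert_self _ _)).add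
      (ih fun j hj => hD j (Finset.mem_insert_of_mem hj))

theorem HasParity.mulLeft {D : Der h U} (hD : HasParity D p) {a : P.obj U}
    (ha : P.par U a = psign q • a) : HasParity (mulLeft a D) (q + p) :=
  homDer_smul_mem ha hD

theorem HasParity.post {Y : VF O U} (hY : HasParity Y p) : HasParity (post h Y) p :=
  homDer_post_mem hY

theorem HasParity.res {D : Der h U} (hD : HasParity D p) (hV : V ≤ U) :
    HasParity (res hV D) p := homDer_res_mem hV hD

/-- Derivations commute with restrictions. -/
theorem res_act (D : Der h U) (hV : V ≤ U) (hW : W ≤ V) (f : O.obj V) :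
    P.res hW (act D hV f) = act D (hW.trans hV) (O.res hW f) := by
  obtain ⟨D0, D1, h0, h1, rfl⟩ := exists_parts D
  rw [act_add, act_add, map_add]
  exact congrArg₂ _ (h0.1 ⟨V, hV⟩ ⟨W, hW.trans hV⟩ hW f) (h1.1 ⟨V, hV⟩ ⟨W, hW.trans hV⟩ hW f)

/-- A sum of an even and an odd element vanishes only if both vanish. -/
theorem _root_.SuperGeo.SuperPresheaf.parts_eq_zero {a b : P.obj U} (ha : P.par U a = psign p • a)
    (hb : P.par U b = psign (p + 1) • b) (hab : a + b = 0) : a = 0 ∧ b = 0 := by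
  have h1 : psign (p + 1) = -psign p := by rw [psign_add]; simp [psign]
  have h2 : psign p • a - psign p • b = 0 := by
    have := congrArg (P.par U) hab
    rw [map_add, ha, hb, map_zero, h1, neg_smul] at this
    rw [sub_eq_add_neg]; exact this
  have h3 : a - b = 0 := by
    have := congrArg (fun z => psign p • z) h2
    simpa [← smul_sub, smul_smul, psign_mul_self] using this
  have h4 : a = b := sub_eq_zero.1 h3
  rw [h4, ← two_smul ℝ] at hab
  have h5 : b = 0 := by simpa using hab
  exact ⟨h4.trans h5, h5⟩

/-- On a homogeneous argument the two values have opposite parities, so both vanish as soon as their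
sum does. A general argument is the sum of its even and odd halves. -/
theorem parts_unique {D0 D1 : Der h U} (h0 : HasParity D0 0) (h1 : HasParity D1 1)
    (hD : D0 + D1 = 0) : D0 = 0 ∧ D1 = 0 := by
  have key : ∀ V (hV : V ≤ U) (f : O.obj V), act D0 hV f = 0 ∧ act D1 hV f = 0 := by
    have hhom : ∀ (q : ZMod 2) V (hV : V ≤ U) (f : O.obj V), O.par V f = psign q • f →
        act D0 hV f = 0 ∧ act D1 hV f = 0 := by
      intro q V hV f hf
      refine SuperPresheaf.parts_eq_zero (h0.par_act_of hV hf) ?_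
        (congrArg (fun D : Der h U => act D hV f) hD)
      have := h1.par_act_of hV hf
      rwa [show (1 : ZMod 2) + q = 0 + q + 1 by ring] at this
    intro V hV f
    have e0 : O.par V ((1 / 2 : ℝ) • (f + O.par V f)) =
        psign 0 • ((1 / 2 : ℝ) • (f + O.par V f)) := by
      simp [psign, O.par_par, add_comm]
    have e1 : O.par V ((1 / 2 : ℝ) • (f - O.par V f)) =
        psign 1 • ((1 / 2 : ℝ) • (f - O.par V f)) := by
      simp [psign, O.par_par, ← smul_neg]
    have hf : f = (1 / 2 : ℝ) • (f + O.par V f) + (1 / 2 : ℝ) • (f - O.par V f) := by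
      rw [← smul_add, add_add_sub_cancel, ← two_smul ℝ f, smul_smul]; norm_num
    have k0 := hhom 0 V hV _ e0
    have k1 := hhom 1 V hV _ e1
    rw [hf, map_add, map_add, k0.1, k0.2, k1.1, k1.2, add_zero]
    exact ⟨rfl, rfl⟩
  exact ⟨ext_act fun V hV f => (key V hV f).1, ext_act fun V hV f => (key V hV f).2⟩

theorem mulLeft_add_left (a b : P.obj U) (D : Der h U) :
    mulLeft (a + b) D = mulLeft a D + mulLeft b D :=
  ext_act fun V hV f => by simp [add_mul]

theorem mulLeft_sum_left {ι : Type*} (s : Finset ι) (a : ι → P.obj U) (D : Der h U) :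
    mulLeft (∑ i ∈ s, a i) D = ∑ i ∈ s, mulLeft (a i) D :=
  ext_act fun V hV f => by simp [Finset.sum_mul]

theorem mulLeft_add (a : P.obj U) (D D' : Der h U) :
    mulLeft a (D + D') = mulLeft a D + mulLeft a D' :=
  ext_act fun V hV f => by simp [mul_add]

theorem mulLeft_sum {ι : Type*} (s : Finset ι) (a : P.obj U) (D : ι → Der h U) :
    mulLeft a (∑ i ∈ s, D i) = ∑ i ∈ s, mulLeft a (D i) :=
  ext_act fun V hV f => by simp [Finset.mul_sum]

theorem mulLeft_mulLeft (a b : P.obj U) (D : Der h U) :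
    mulLeft a (mulLeft b D) = mulLeft (a * b) D :=
  ext_act fun V hV f => by simp [mul_assoc]

theorem one_mulLeft (D : Der h U) : mulLeft 1 D = D := ext_act fun V hV f => by simp

theorem smul_mulLeft (c : ℝ) (a : P.obj U) (D : Der h U) :
    mulLeft (c • a) D = c • mulLeft a D :=
  ext_act fun V hV f => by simp

theorem res_mulLeft (hV : V ≤ U) (a : P.obj U) (D : Der h U) :
    res hV (mulLeft a D) = mulLeft (P.res hV a) (res hV D) :=
  ext_act fun W hW f => by simp [P.res_res]

theorem res_post (hV : V ≤ U) (Y : VF O U) : res hV (post h Y) = post h (res hV Y) := rfl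

theorem res_res (hV : V ≤ U) (hW : W ≤ V) (D : Der h U) :
    res hW (res hV D) = res (hW.trans hV) D := rfl

theorem res_rfl (D : Der h U) : res le_rfl D = D := rfl

theorem post_add (Y Y' : VF O U) : post h (Y + Y') = post h Y + post h Y' :=
  ext_act fun V hV f => by simp

theorem post_sum {ι : Type*} (s : Finset ι) (Y : ι → VF O U) :
    post h (∑ i ∈ s, Y i) = ∑ i ∈ s, post h (Y i) :=
  ext_act fun V hV f => by simp

theorem post_mulLeft (a : O.obj U) (Y : VF O U) :
    post h (mulLeft a Y) = mulLeft (h.app U a) (post h Y) :=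
  ext_act fun V hV f => by simp [h.app_res]

end Der

end DerAlgebra

/-! ## Gluing -/

/-- The sheaf condition, for coverings indexed by types in the universe `t`. -/
structure SuperPresheaf.IsSheaf {X : Type u} [TopologicalSpace X] (P : SuperPresheaf.{u, w} X) :
    Prop where
  sep : ∀ {ι : Type t} {U : Opens X} (V : ι → Opens X), (∀ x ∈ U, ∃ i, x ∈ V i) →
    ∀ b b' : P.obj U, (∀ i, P.res (inf_le_left : U ⊓ V i ≤ U) b = P.res inf_le_left b') → b = b'
  glue : ∀ {ι : Type t} {U : Opens X} (V : ι → Opens X), (∀ x ∈ U, ∃ i, x ∈ V i) →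
    ∀ b : ∀ i, P.obj (U ⊓ V i),
      (∀ i j, P.res (inf_le_inf_left U inf_le_left : U ⊓ (V i ⊓ V j) ≤ U ⊓ V i) (b i) =
        P.res (inf_le_inf_left U inf_le_right) (b j)) →
      ∃ b₀ : P.obj U, ∀ i, P.res inf_le_left b₀ = b i

section Glue

variable {X : Type u} [TopologicalSpace X] {O : SuperPresheaf.{u, v} X}
  {P : SuperPresheaf.{u, w} X} {h : SheafHom O P} {U : Opens X} {p : ZMod 2}
  {ι : Type t} {V : ι → Opens X}

namespace Der

/-- Derivations commute with restriction, so values on W are compared on the pieces W ⊓ V i. The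
cover need not consist of subsets of U. -/
theorem eq_of_cover (hP : SuperPresheaf.IsSheaf.{u, w, t} P) (hV : ∀ x ∈ U, ∃ i, x ∈ V i)
    {D D' : Der h U}
    (H : ∀ i, res (inf_le_left : U ⊓ V i ≤ U) D = res inf_le_left D') : D = D' := by
  refine ext_act fun W hW f => hP.sep V (fun x hx => hV x (hW hx)) _ _ fun i => ?_
  have := congrArg (fun D : Der h (U ⊓ V i) =>
    act D (inf_le_inf_right _ hW : W ⊓ V i ≤ U ⊓ V i) (O.res inf_le_left f)) (H i)
  simpa [res_act] using this

theorem eq_of_cover_of_le (hP : SuperPresheaf.IsSheaf.{u, w, t} P) (hV : ∀ x ∈ U, ∃ i, x ∈ V i)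
    (hVU : ∀ i, V i ≤ U) {D D' : Der h U} (H : ∀ i, res (hVU i) D = res (hVU i) D') : D = D' :=
  eq_of_cover hP hV fun i =>
    congrArg (res (inf_le_right : U ⊓ V i ≤ V i)) (H i)

theorem hasParity_of_cover (hP : SuperPresheaf.IsSheaf.{u, w, t} P)
    (hV : ∀ x ∈ U, ∃ i, x ∈ V i) {D : Der h U}
    (H : ∀ i, HasParity (res (inf_le_left : U ⊓ V i ≤ U) D) p) : HasParity D p := by
  refine ⟨fun A B hBA f => res_act D A.2 hBA f, fun A f => ?_, fun A f g => ?_⟩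
  · refine hP.sep V (fun x hx => hV x (A.2 hx)) _ _ fun i => ?_
    have := (H i).par_act (inf_le_inf_right _ A.2 : A.1 ⊓ V i ≤ U ⊓ V i) (O.res inf_le_left f)
    rw [act_res, ← res_act D A.2, P.par_res, O.par_res] at this
    refine this.trans ?_
    rw [map_smul]
    exact congrArg _ (res_act D A.2 _ _).symm
  · refine hP.sep V (fun x hx => hV x (A.2 hx)) _ _ fun i => ?_
    have := (H i).act_mul (inf_le_inf_right _ A.2 : A.1 ⊓ V i ≤ U ⊓ V i) (O.res inf_le_left f)
      (O.res inf_le_left g)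
    simp only [act_res, h.app_res, SuperPresheaf.twist_res] at this
    rw [← map_mul, ← res_act D A.2, ← res_act D A.2, ← res_act D A.2, ← map_mul, ← map_mul,
      ← map_add] at this
    exact this

/-- The value on a section is glued from the values of the `Z i` on its restrictions; linearity,
parity and the Leibniz rule then hold because they hold locally. -/
theorem glue_hom (hP : SuperPresheaf.IsSheaf.{u, w, t} P) (hV : ∀ x ∈ U, ∃ i, x ∈ V i)
    (Z : ∀ i, Der h (U ⊓ V i)) (hZp : ∀ i, HasParity (Z i) p)
    (hZ : ∀ i j, res (inf_le_inf_left U inf_le_left : U ⊓ (V i ⊓ V j) ≤ U ⊓ V i) (Z i) =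
      res (inf_le_inf_left U inf_le_right) (Z j)) :
    ∃ D : Der h U, HasParity D p ∧ ∀ i, res inf_le_left D = Z i := by
  have hc : ∀ A : {A : Opens X // A ≤ U}, ∀ x ∈ A.1, ∃ i, x ∈ V i := fun A x hx => hV x (A.2 hx)
  have hle : ∀ (A : {A : Opens X // A ≤ U}) i, A.1 ⊓ V i ≤ U ⊓ V i :=
    fun A i => inf_le_inf_right _ A.2
  have ex : ∀ (A : {A : Opens X // A ≤ U}) (f : O.obj A.1), ∃ b : P.obj A.1,
      ∀ i, P.res inf_le_left b = act (Z i) (hle A i) (O.res inf_le_left f) := by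
    intro A f
    refine hP.glue V (hc A) _ fun i j => ?_
    rw [res_act, res_act, O.res_res, O.res_res]
    exact congrArg (fun D : Der h (U ⊓ (V i ⊓ V j)) =>
      act D (inf_le_inf_right _ A.2 : A.1 ⊓ (V i ⊓ V j) ≤ _) (O.res inf_le_left f)) (hZ i j)
  choose b hb using ex
  -- The glued value is characterised by its restrictions, so the chosen `b` can be computed without
  -- unfolding the choice.
  have key : ∀ (A : {A : Opens X // A ≤ U}) (c : P.obj A.1) (f : O.obj A.1),
      (∀ i, P.res inf_le_left c = act (Z i) (hle A i) (O.res inf_le_left f)) → b A f = c :=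
    fun A c f H => hP.sep V (hc A) _ _ fun i => (hb A f i).trans (H i).symm
  let D : ∀ A : {A : Opens X // A ≤ U}, O.obj A.1 →ₗ[ℝ] P.obj A.1 := fun A =>
    { toFun := b A
      map_add' := fun f g => key A _ _ fun i => by simp [hb]
      map_smul' := fun c f => key A _ _ fun i => by simp [hb] }
  have hD : ∀ A f i, P.res inf_le_left (D A f) = act (Z i) (hle A i) (O.res inf_le_left f) := hb
  have hmem : D ∈ homDer h p U := by
    refine ⟨fun A B hBA f => ?_, fun A f => ?_, fun A f g => ?_⟩
    · refine (key B _ _ fun i => ?_).symm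
      have := congrArg (P.res (inf_le_inf_right _ hBA : B.1 ⊓ V i ≤ A.1 ⊓ V i)) (hD A f i)
      rw [res_act, P.res_res, O.res_res] at this
      rw [P.res_res, O.res_res]
      exact this
    · refine hP.sep V (hc A) _ _ fun i => ?_
      rw [← P.par_res, map_smul, hD, hD, (hZp i).par_act, O.par_res]
    · refine hP.sep V (hc A) _ _ fun i => ?_
      rw [hD, map_mul (O.res _), (hZp i).act_mul, map_add, map_mul (P.res _), map_mul (P.res _),
        hD, hD, ← SuperPresheaf.twist_res, h.app_res, h.app_res]
  exact ⟨ofHom ⟨D, hmem⟩, hmem, fun i => ext_act fun W hW f => by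
    have h1 : W ≤ U := hW.trans inf_le_left
    have := hD ⟨W, h1⟩ f i
    -- For W already inside V i, restriction to W ⊓ V i loses nothing.
    have hle' : W ≤ W ⊓ V i := le_inf le_rfl (hW.trans inf_le_right)
    have h2 := congrArg (P.res hle') this
    rw [res_act, P.res_res, O.res_res, P.res_self, O.res_self] at h2
    exact h2⟩

/-- The Leibniz rule is stated for homogeneous derivations, so the even and odd parts are glued
separately. They agree on overlaps because the decomposition into parts is unique. -/
theorem glue (hP : SuperPresheaf.IsSheaf.{u, w, t} P) (hV : ∀ x ∈ U, ∃ i, x ∈ V i)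
    (Z : ∀ i, Der h (U ⊓ V i))
    (hZ : ∀ i j, res (inf_le_inf_left U inf_le_left : U ⊓ (V i ⊓ V j) ≤ U ⊓ V i) (Z i) =
      res (inf_le_inf_left U inf_le_right) (Z j)) :
    ∃ D : Der h U, ∀ i, res inf_le_left D = Z i := by
  choose Z0 Z1 h0 h1 h01 using fun i => exists_parts (Z i)
  have hZ01 : ∀ i j,
      res (inf_le_inf_left U inf_le_left : U ⊓ (V i ⊓ V j) ≤ U ⊓ V i) (Z0 i) -
        res (inf_le_inf_left U inf_le_right) (Z0 j) = 0 ∧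
      res (inf_le_inf_left U inf_le_left : U ⊓ (V i ⊓ V j) ≤ U ⊓ V i) (Z1 i) -
        res (inf_le_inf_left U inf_le_right) (Z1 j) = 0 := by
    intro i j
    refine parts_unique (Submodule.sub_mem _ ((h0 i).res _) ((h0 j).res _))
      (Submodule.sub_mem _ ((h1 i).res _) ((h1 j).res _)) ?_
    have := hZ i j
    rw [← h01, ← h01, map_add, map_add] at this
    refine ext_act fun W hW f => ?_
    have h2 := congrArg (fun D => act D hW f) this
    simp only [act_add, act_sub, act_zero] at h2 ⊢
    rw [sub_add_sub_comm, h2, sub_self]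
  obtain ⟨D0, -, hD0⟩ := glue_hom hP hV Z0 h0 fun i j => sub_eq_zero.1 (hZ01 i j).1
  obtain ⟨D1, -, hD1⟩ := glue_hom hP hV Z1 h1 fun i j => sub_eq_zero.1 (hZ01 i j).2
  exact ⟨D0 + D1, fun i => by rw [map_add, hD0, hD1, h01]⟩

end Der

end Glue

/-! ## Frames and covariant derivatives along morphisms -/

/-- Coordinates `x a` on `U` of parity `parity a`, with vector fields `d a` dual to them. -/
structure Frame {X : Type u} [TopologicalSpace X] (O : SuperPresheaf.{u, v} X) (U : Opens X)
    (ι : Type) [DecidableEq ι] where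
  parity : ι → ZMod 2
  x : ι → O.obj U
  d : ι → VF O U
  x_par : ∀ a, O.par U (x a) = psign (parity a) • x a
  d_par : ∀ a, Der.HasParity (d a) (parity a)
  d_x : ∀ a b, Der.act (d a) le_rfl (x b) = if a = b then 1 else 0

/-- The coordinates of the frame determine all derivations along `h`. -/
def Frame.Spans {X : Type u} [TopologicalSpace X] {O : SuperPresheaf.{u, v} X} {U : Opens X}
    {ι : Type} [DecidableEq ι] (fr : Frame O U ι) {P : SuperPresheaf.{u, w} X}
    (h : SheafHom O P) : Prop :=
  ∀ (V : Opens X) (hV : V ≤ U) (Z : Der h V),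
    (∀ a, Der.act Z le_rfl (O.res hV (fr.x a)) = 0) → Z = 0

section Cov

variable {X : Type u} [TopologicalSpace X] {O : SuperPresheaf.{u, v} X}
  {P : SuperPresheaf.{u, w} X} {h : SheafHom O P} {U V W : Opens X}
  {ι : Type} [Fintype ι] [DecidableEq ι]

namespace Frame

variable (fr : Frame O U ι)

theorem act_post_d (hV : V ≤ U) (a b : ι) :
    Der.act (Der.post h (Der.res hV (fr.d a))) le_rfl (O.res hV (fr.x b)) =
      if a = b then 1 else 0 := by
  have h1 := Der.res_act (fr.d a) le_rfl hV (fr.x b)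
  rw [Der.act_post, Der.act_res]
  refine (congrArg (h.app V) (h1.symm.trans (congrArg _ (fr.d_x a b)))).trans ?_
  split_ifs <;> simp

variable {fr}

theorem Spans.ext (hfr : fr.Spans h) (hV : V ≤ U) {Z Z' : Der h V}
    (H : ∀ a, Der.act Z le_rfl (O.res hV (fr.x a)) = Der.act Z' le_rfl (O.res hV (fr.x a))) :
    Z = Z' :=
  sub_eq_zero.1 (hfr V hV _ fun a => by rw [Der.act_sub, H, sub_self])

/-- Both sides agree on the coordinates, since the fields of the frame are dual to them, and the
coordinates determine derivations along `h`. -/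
theorem Spans.expand (hfr : fr.Spans h) (hV : V ≤ U) (Z : Der h V) :
    Z = ∑ a, Der.mulLeft (Der.act Z le_rfl (O.res hV (fr.x a)))
      (Der.post h (Der.res hV (fr.d a))) := by
  refine hfr.ext hV fun b => ?_
  rw [Der.act_sum]
  simp only [Der.act_mulLeft, act_post_d, P.res_self]
  simp

theorem Spans.expand_id (hfr : fr.Spans (SheafHom.id O)) (hV : V ≤ U) (Z : VF O V) :
    Z = ∑ a, Der.mulLeft (Der.act Z le_rfl (O.res hV (fr.x a))) (Der.res hV (fr.d a)) :=
  hfr.expand hV Z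

end Frame

/-- The derivation `δ ∘ h` along `h`, for an even vector field `δ` on the target. -/
def velocityAlong (h : SheafHom O P) (δ : homDer (SheafHom.id P) 0 ⊤) : homDer h 0 ⊤ :=
  ⟨fun V => δ.1 ⟨V.1, le_top⟩ ∘ₗ (h.app V.1).toLinearMap, by
    refine ⟨fun V W hWV f => ?_, fun V f => ?_, fun V f g => ?_⟩
    · simp only [LinearMap.comp_apply, AlgHom.toLinearMap_apply, h.app_res]
      exact δ.2.1 ⟨V.1, le_top⟩ ⟨W.1, le_top⟩ hWV (h.app V.1 f)
    · simp only [LinearMap.comp_apply, AlgHom.toLinearMap_apply, h.app_par]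
      exact δ.2.2.1 ⟨V.1, le_top⟩ (h.app V.1 f)
    · simp only [LinearMap.comp_apply, AlgHom.toLinearMap_apply, map_mul]
      exact δ.2.2.2 ⟨V.1, le_top⟩ (h.app V.1 f) (h.app V.1 g)⟩

/-- An even vector field as a family of linear maps on all open sets. -/
def ap (δ : homDer (SheafHom.id P) 0 ⊤) (V : Opens X) : P.obj V →ₗ[ℝ] P.obj V :=
  δ.1 ⟨V, le_top⟩

theorem ap_res (δ : homDer (SheafHom.id P) 0 ⊤) (hV : V ≤ U) (a : P.obj U) :
    P.res hV (ap δ U a) = ap δ V (P.res hV a) := δ.2.1 ⟨U, le_top⟩ ⟨V, le_top⟩ hV a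

theorem ap_mul (δ : homDer (SheafHom.id P) 0 ⊤) (a b : P.obj U) :
    ap δ U (a * b) = ap δ U a * b + a * ap δ U b := by
  have := δ.2.2.2 ⟨U, le_top⟩ a b
  simp only [SuperPresheaf.twist, if_true] at this
  exact this

theorem ap_par (δ : homDer (SheafHom.id P) 0 ⊤) {p : ZMod 2} {a : P.obj U}
    (ha : P.par U a = psign p • a) : P.par U (ap δ U a) = psign p • ap δ U a := by
  have := δ.2.2.1 ⟨U, le_top⟩ a
  rw [ha, map_smul] at this
  refine this.trans ?_
  simp only [psign, if_true, one_smul]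
  rfl

theorem act_velocityAlong (δ : homDer (SheafHom.id P) 0 ⊤) (f : O.obj V) :
    Der.act (Der.ofHom (velocityAlong h δ)) le_top f = ap δ V (h.app V f) := rfl

/-- `D` is the pullback of `∇` along `h`, evaluated on `δ`. -/
structure IsCovAlong (nabla : Connection O) (h : SheafHom O P) (δ : homDer (SheafHom.id P) 0 ⊤)
    (D : ∀ U : Opens X, Der h U →ₗ[ℝ] Der h U) : Prop where
  res : ∀ {U V : Opens X} (hV : V ≤ U) (Y : Der h U), Der.res hV (D U Y) = D V (Der.res hV Y)
  even : ∀ {U : Opens X} {Y : Der h U} {p : ZMod 2}, Der.HasParity Y p → Der.HasParity (D U Y) p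
  leibniz : ∀ {U : Opens X} (a : P.obj U) (Y : Der h U),
    D U (Der.mulLeft a Y) = Der.mulLeft (ap δ U a) Y + Der.mulLeft a (D U Y)
  compat : ∀ {U : Opens X} {n : ℕ} (a : Fin n → P.obj U) (A : Fin n → VF O U),
    Der.res le_top (Der.ofHom (velocityAlong h δ)) =
      ∑ i, Der.mulLeft (a i) (Der.post h (A i)) →
    ∀ Y : VF O U, D U (Der.post h Y) =
      ∑ i, Der.mulLeft (a i) (Der.post h (nabla.cov U (A i) Y))

/-- The covariant derivative of `h ∘ ∂_a` in a frame. -/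
def covBasis (nabla : Connection O) (h : SheafHom O P) (δ : homDer (SheafHom.id P) 0 ⊤)
    (fr : Frame O U ι) (hV : V ≤ U) (a : ι) : Der h V :=
  ∑ b, Der.mulLeft (ap δ V (h.app V (O.res hV (fr.x b))))
    (Der.post h (Der.res hV (nabla.cov U (fr.d b) (fr.d a))))

/-- The covariant derivative along `h` in a frame. -/
def covLocal (nabla : Connection O) (h : SheafHom O P) (δ : homDer (SheafHom.id P) 0 ⊤)
    (fr : Frame O U ι) (hV : V ≤ U) : Der h V →ₗ[ℝ] Der h V where
  toFun Y := ∑ a, (Der.mulLeft (ap δ V (Der.act Y le_rfl (O.res hV (fr.x a))))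
      (Der.post h (Der.res hV (fr.d a))) +
    Der.mulLeft (Der.act Y le_rfl (O.res hV (fr.x a))) (covBasis nabla h δ fr hV a))
  map_add' Y Y' := by
    rw [← Finset.sum_add_distrib]
    refine Finset.sum_congr rfl fun a _ => ?_
    simp only [Der.act_add, map_add, Der.mulLeft_add_left]
    abel
  map_smul' c Y := by
    rw [Finset.smul_sum]
    refine Finset.sum_congr rfl fun a _ => ?_
    simp only [Der.act_smul, map_smul, Der.smul_mulLeft, smul_add, RingHom.id_apply]

variable {nabla : Connection O} {δ : homDer (SheafHom.id P) 0 ⊤} {fr : Frame O U ι}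

theorem res_covBasis (hV : V ≤ U) (hW : W ≤ V) (a : ι) :
    Der.res hW (covBasis nabla h δ fr hV a) = covBasis nabla h δ fr (hW.trans hV) a := by
  simp only [covBasis, map_sum, Der.res_mulLeft, ap_res, ← h.app_res, O.res_res, Der.res_post,
    Der.res_res]

theorem res_covLocal (hV : V ≤ U) (hW : W ≤ V) (Y : Der h V) :
    Der.res hW (covLocal nabla h δ fr hV Y) =
      covLocal nabla h δ fr (hW.trans hV) (Der.res hW Y) := by
  simp only [covLocal, LinearMap.coe_mk, AddHom.coe_mk, map_sum, map_add, Der.res_mulLeft,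
    ap_res, Der.res_post, Der.res_res, res_covBasis, Der.res_act, O.res_res, Der.act_res]

/-- In each summand the parity of `x b` in the coefficient cancels that of `d b` in the direction of
differentiation, which leaves the parity of `a`. -/
theorem hasParity_covBasis (hV : V ≤ U) (a : ι) :
    Der.HasParity (covBasis nabla h δ fr hV a) (fr.parity a) := by
  refine Der.HasParity.sum fun b _ => ?_
  have h1 : P.par V (h.app V (O.res hV (fr.x b))) =
      psign (fr.parity b) • h.app V (O.res hV (fr.x b)) := by
    rw [← h.app_par, O.par_res, fr.x_par, map_smul, map_smul]
  have h2 := (((nabla.cov_even (fr.d_par b) (fr.d_par a)).res hV).post (h := h)).mulLeft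
    (ap_par δ h1)
  rwa [← add_assoc, zmod2_add_self, zero_add] at h2

theorem hasParity_covLocal (hV : V ≤ U) {Y : Der h V} {p : ZMod 2} (hY : Der.HasParity Y p) :
    Der.HasParity (covLocal nabla h δ fr hV Y) p := by
  refine Der.HasParity.sum fun a _ => ?_
  have h1 : O.par V (O.res hV (fr.x a)) = psign (fr.parity a) • O.res hV (fr.x a) := by
    rw [O.par_res, fr.x_par, map_smul]
  have h2 := hY.par_act_of le_rfl h1
  have h3 := (((fr.d_par a).res hV).post (h := h)).mulLeft (ap_par δ h2)
  have h4 := (hasParity_covBasis (nabla := nabla) (h := h) (δ := δ) (fr := fr) hV a).mulLeft h2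
  rw [add_assoc, zmod2_add_self, add_zero] at h3 h4
  exact h3.add h4

/-- Expanding Y in the frame turns this into the product rule for the even field δ, so no signs
occur. -/
theorem covLocal_leibniz (hfr : fr.Spans h) (hV : V ≤ U) (a : P.obj V) (Y : Der h V) :
    covLocal nabla h δ fr hV (Der.mulLeft a Y) =
      Der.mulLeft (ap δ V a) Y + Der.mulLeft a (covLocal nabla h δ fr hV Y) := by
  have e : Der.mulLeft (ap δ V a) Y = ∑ b, Der.mulLeft (ap δ V a)
      (Der.mulLeft (Der.act Y le_rfl (O.res hV (fr.x b)))
        (Der.post h (Der.res hV (fr.d b)))) := by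
    conv_lhs => rw [hfr.expand hV Y]
    rw [Der.mulLeft_sum]
  rw [e]
  simp only [covLocal, LinearMap.coe_mk, AddHom.coe_mk, Der.mulLeft_sum]
  rw [← Finset.sum_add_distrib]
  refine Finset.sum_congr rfl fun b _ => ?_
  simp only [Der.act_mulLeft, P.res_self, ap_mul, Der.mulLeft_add_left, Der.mulLeft_add,
    Der.mulLeft_mulLeft]
  abel

/-- `∇` in a frame, in the first argument. -/
theorem cov_expand (hid : fr.Spans (SheafHom.id O)) (hV : V ≤ U) (A Y : VF O V) :
    nabla.cov V A Y = ∑ b, Der.mulLeft (Der.act A le_rfl (O.res hV (fr.x b)))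
      (nabla.cov V (Der.res hV (fr.d b)) Y) := by
  conv_lhs => rw [hid.expand_id hV A]
  simp only [map_sum, LinearMap.sum_apply, nabla.cov_mulLeft]

/-- Linearity of ∇ in the first argument replaces the given decomposition of the velocity by the one
in the frame; the Leibniz rule then expands Y. The sign in the Leibniz rule is exactly what is
needed to move the velocity component past the coefficient of Y. -/
theorem covLocal_compat (hid : fr.Spans (SheafHom.id O)) (hV : V ≤ U)
    {n : ℕ} (a : Fin n → P.obj V) (A : Fin n → VF O V)
    (hvel : Der.res le_top (Der.ofHom (velocityAlong h δ)) =
      ∑ i, Der.mulLeft (a i) (Der.post h (A i))) (Y : VF O V) :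
    covLocal nabla h δ fr hV (Der.post h Y) =
      ∑ i, Der.mulLeft (a i) (Der.post h (nabla.cov V (A i) Y)) := by
  set vx : ι → P.obj V := fun b => ap δ V (h.app V (O.res hV (fr.x b))) with hvx
  set yx : ι → O.obj V := fun b => Der.act Y le_rfl (O.res hV (fr.x b)) with hyx
  have hv : ∀ f : O.obj V, ap δ V (h.app V f) = ∑ i, a i * h.app V (Der.act (A i) le_rfl f) := by
    intro f
    have := congrArg (fun D : Der h V => Der.act D le_rfl f) hvel
    simpa [Der.act_sum, P.res_self, act_velocityAlong] using this
  have hvxp : ∀ b, P.par V (vx b) = psign (fr.parity b) • vx b := fun b => by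
    refine ap_par δ ?_
    rw [← h.app_par, O.par_res, fr.x_par, map_smul, map_smul]
  -- The right-hand side depends only on the velocity, not on how it is written as a sum.
  have hrhs : ∑ i, Der.mulLeft (a i) (Der.post h (nabla.cov V (A i) Y)) =
      ∑ b, Der.mulLeft (vx b) (Der.post h (nabla.cov V (Der.res hV (fr.d b)) Y)) := by
    simp only [hvx, hv, Der.mulLeft_sum_left]
    rw [Finset.sum_comm]
    refine Finset.sum_congr rfl fun i _ => ?_
    rw [cov_expand hid hV (A i) Y, Der.post_sum, Der.mulLeft_sum]
    simp only [Der.post_mulLeft, Der.mulLeft_mulLeft]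
  -- The chain rule in the coordinates of the frame.
  have hvd : ∀ f : O.obj V, ap δ V (h.app V f) =
      ∑ b, vx b * h.app V (Der.act (fr.d b) hV f) := by
    intro f
    rw [hv]
    simp only [hvx, hv, Finset.sum_mul]
    rw [Finset.sum_comm]
    refine Finset.sum_congr rfl fun i _ => ?_
    have := congrArg (fun D : VF O V => Der.act D le_rfl f) (hid.expand_id hV (A i))
    simp only [Der.act_sum, Der.act_mulLeft, O.res_self, Der.act_res] at this
    rw [this, map_sum, Finset.mul_sum]
    simp only [map_mul, mul_assoc]
  have hcovY : ∀ b, nabla.cov V (Der.res hV (fr.d b)) Y =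
      ∑ c, (Der.mulLeft (Der.act (fr.d b) hV (yx c)) (Der.res hV (fr.d c)) +
        Der.mulLeft (O.twist (fr.parity b) V (yx c))
          (Der.res hV (nabla.cov U (fr.d b) (fr.d c)))) := by
    intro b
    conv_lhs => rw [hid.expand_id hV Y]
    rw [map_sum]
    refine Finset.sum_congr rfl fun c _ => ?_
    rw [nabla.cov_leibniz ((fr.d_par b).res hV), nabla.cov_res]
    rfl
  rw [hrhs]
  simp only [hcovY, Der.post_sum, Der.mulLeft_sum]
  rw [Finset.sum_comm]
  refine Finset.sum_congr rfl fun c _ => ?_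
  have hact : Der.act (Der.post h Y) le_rfl (O.res hV (fr.x c)) = h.app V (yx c) := rfl
  rw [hact, hvd, Der.mulLeft_sum_left, covBasis, Der.mulLeft_sum, ← Finset.sum_add_distrib]
  refine Finset.sum_congr rfl fun b _ => ?_
  rw [Der.post_add, Der.mulLeft_add, Der.post_mulLeft, Der.post_mulLeft, Der.mulLeft_mulLeft,
    Der.mulLeft_mulLeft, Der.mulLeft_mulLeft, h.app_twist, SuperPresheaf.mul_twist (hvxp b)]

/-- A covariant derivative along `h` is given in every frame by the local formula. -/
theorem eq_covLocal (hfr : fr.Spans h) (hV : V ≤ U) (D : Der h V →ₗ[ℝ] Der h V)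
    (leib : ∀ (a : P.obj V) (Y : Der h V),
      D (Der.mulLeft a Y) = Der.mulLeft (ap δ V a) Y + Der.mulLeft a (D Y))
    (comp : ∀ {n : ℕ} (a : Fin n → P.obj V) (A : Fin n → VF O V),
      Der.res le_top (Der.ofHom (velocityAlong h δ)) =
        ∑ i, Der.mulLeft (a i) (Der.post h (A i)) →
      ∀ Y : VF O V, D (Der.post h Y) =
        ∑ i, Der.mulLeft (a i) (Der.post h (nabla.cov V (A i) Y))) (Y : Der h V) :
    D Y = covLocal nabla h δ fr hV Y := by
  -- Compatibility is applied to the expansion of the velocity in the frame; `e` reindexes the frame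
  -- by `Fin n`.
  have hb : ∀ a, D (Der.post h (Der.res hV (fr.d a))) = covBasis nabla h δ fr hV a := by
    intro a
    let e := Fintype.equivFin ι
    have h1 := comp (fun i => ap δ V (h.app V (O.res hV (fr.x (e.symm i)))))
      (fun i => Der.res hV (fr.d (e.symm i))) (by
        rw [Equiv.sum_comp e.symm fun b => Der.mulLeft (ap δ V (h.app V (O.res hV (fr.x b))))
          (Der.post h (Der.res hV (fr.d b)))]
        exact hfr.expand hV _) (Der.res hV (fr.d a))
    rw [h1, Equiv.sum_comp e.symm fun b => Der.mulLeft (ap δ V (h.app V (O.res hV (fr.x b))))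
      (Der.post h (nabla.cov V (Der.res hV (fr.d b)) (Der.res hV (fr.d a))))]
    simp only [covBasis, nabla.cov_res]
  conv_lhs => rw [hfr.expand hV Y]
  rw [map_sum]
  refine Finset.sum_congr rfl fun a _ => ?_
  rw [leib, hb]

theorem IsCovAlong.eq_covLocal {D : ∀ U : Opens X, Der h U →ₗ[ℝ] Der h U}
    (hD : IsCovAlong nabla h δ D) (hfr : fr.Spans h) (hV : V ≤ U) (Y : Der h V) :
    D V Y = covLocal nabla h δ fr hV Y :=
  SuperGeo.eq_covLocal hfr hV (D V) hD.leibniz hD.compat Y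

/-- In every frame the local formula satisfies the Leibniz rule and the compatibility with ∇, and
`eq_covLocal` says that these two properties determine it. Hence the formulas of different frames
agree on overlaps and glue. -/
theorem exists_isCovAlong {κ : Type t} (nabla : Connection O) (h : SheafHom O P)
    (δ : homDer (SheafHom.id P) 0 ⊤) (hP : SuperPresheaf.IsSheaf.{u, w, t} P)
    (U : κ → Opens X) (hU : ∀ x, ∃ i, x ∈ U i) (fr : ∀ i, Frame O (U i) ι)
    (hid : ∀ i, (fr i).Spans (SheafHom.id O)) (hfr : ∀ i, (fr i).Spans h) :
    ∃ D, IsCovAlong nabla h δ D := by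
  have hc : ∀ V : Opens X, ∀ x ∈ V, ∃ i, x ∈ U i := fun V x _ => hU x
  have ex : ∀ (V : Opens X) (Y : Der h V), ∃ Z : Der h V, ∀ i,
      Der.res (inf_le_left : V ⊓ U i ≤ V) Z =
        covLocal nabla h δ (fr i) inf_le_right (Der.res inf_le_left Y) := by
    intro V Y
    refine Der.glue hP (hc V) _ fun i j => ?_
    rw [res_covLocal, res_covLocal, Der.res_res, Der.res_res]
    -- The formula of frame `i` is treated as an abstract covariant derivative and recomputed in
    -- frame `j`; this replaces the transformation law of Christoffel symbols.
    exact SuperGeo.eq_covLocal (hfr j) _ (covLocal nabla h δ (fr i) _)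
      (covLocal_leibniz (hfr i) _) (covLocal_compat (hid i) _) _
  choose D' hD' using ex
  obtain ⟨D, hD⟩ : ∃ D : ∀ V : Opens X, Der h V →ₗ[ℝ] Der h V, ∀ V Y i,
      Der.res (inf_le_left : V ⊓ U i ≤ V) (D V Y) =
        covLocal nabla h δ (fr i) inf_le_right (Der.res inf_le_left Y) :=
    ⟨fun V =>
      { toFun := D' V
        map_add' := fun Y Y' => Der.eq_of_cover hP (hc V) fun i => by simp only [map_add, hD']
        map_smul' := fun c Y => Der.eq_of_cover hP (hc V) fun i => by
          simp only [map_smul, hD', RingHom.id_apply] }, hD'⟩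
  have key : ∀ (V : Opens X) (Y Z : Der h V), (∀ i,
      Der.res (inf_le_left : V ⊓ U i ≤ V) Z =
        covLocal nabla h δ (fr i) inf_le_right (Der.res inf_le_left Y)) → D V Y = Z :=
    fun V Y Z H => Der.eq_of_cover hP (hc V) fun i => (hD V Y i).trans (H i).symm
  refine ⟨D, ?_, ?_, ?_, ?_⟩
  · intro V W hV Y
    refine (key _ _ _ fun i => ?_).symm
    have := congrArg (Der.res (inf_le_inf_right _ hV : W ⊓ U i ≤ V ⊓ U i)) (hD V Y i)
    rw [res_covLocal] at this
    simp only [Der.res_res] at this ⊢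
    exact this
  · intro V Y p hY
    refine Der.hasParity_of_cover hP (hc V) fun i => ?_
    have := hasParity_covLocal (nabla := nabla) (δ := δ) (fr := fr i)
      (inf_le_right : V ⊓ U i ≤ U i) (hY.res inf_le_left)
    rw [← hD] at this
    exact this
  · intro V a Y
    refine key _ _ _ fun i => ?_
    rw [Der.res_mulLeft, covLocal_leibniz (hfr i), map_add, Der.res_mulLeft, Der.res_mulLeft,
      hD, ap_res]
  · intro V n a A hvel Y
    refine key _ _ _ fun i => ?_
    have hvel' := congrArg (Der.res (inf_le_left : V ⊓ U i ≤ V)) hvel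
    rw [map_sum] at hvel'
    simp only [Der.res_mulLeft, Der.res_post, Der.res_res] at hvel'
    rw [Der.res_post, covLocal_compat (hid i) _ _ _ hvel', map_sum]
    simp only [Der.res_mulLeft, Der.res_post, nabla.cov_res]

/-- The components of the covariant derivative of `δ ∘ h` along `δ`. -/
theorem act_covLocal_velocity (c : ι) :
    Der.act (covLocal nabla h δ fr le_rfl
        (Der.res le_top (Der.ofHom (velocityAlong h δ)))) le_rfl (fr.x c) =
      ap δ U (ap δ U (h.app U (fr.x c))) + ∑ a, ap δ U (h.app U (fr.x a)) *
        ∑ b, ap δ U (h.app U (fr.x b)) *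
          h.app U (Der.act (nabla.cov U (fr.d b) (fr.d a)) le_rfl (fr.x c)) := by
  have h1 : ∀ a, Der.act (Der.post h (fr.d a)) le_rfl (fr.x c) = if a = c then 1 else 0 := by
    intro a
    have := fr.act_post_d (h := h) le_rfl a c
    rwa [Der.res_rfl, O.res_self] at this
  simp only [covLocal, LinearMap.coe_mk, AddHom.coe_mk, Der.act_sum, Der.act_add,
    Der.act_mulLeft, P.res_self, O.res_self, Der.res_rfl, h1, Der.act_res, act_velocityAlong,
    covBasis, Der.act_post]
  rw [Finset.sum_add_distrib]
  congr 1
  simp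

theorem covLocal_act (hV : V ≤ U) (Y : Der h V) (c : ι) :
    Der.act (covLocal nabla h δ fr hV Y) le_rfl (O.res hV (fr.x c)) =
      ap δ V (Der.act Y le_rfl (O.res hV (fr.x c))) +
        ∑ a, Der.act Y le_rfl (O.res hV (fr.x a)) *
          ∑ b, ap δ V (h.app V (O.res hV (fr.x b))) *
            h.app V (O.res hV (Der.act (nabla.cov U (fr.d b) (fr.d a)) le_rfl (fr.x c))) := by
  simp only [covLocal, LinearMap.coe_mk, AddHom.coe_mk, Der.act_sum, Der.act_add,
    Der.act_mulLeft, P.res_self, fr.act_post_d, covBasis]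
  rw [Finset.sum_add_distrib]
  congr 1
  · simp
  · refine Finset.sum_congr rfl fun a _ => ?_
    congr 1
    refine Finset.sum_congr rfl fun b _ => ?_
    rw [Der.act_post, Der.act_res, Der.res_act]

end Cov

/-! ## Hadamard's lemma -/

section Hadamard

variable {D : Type*} [NormedAddCommGroup D] [NormedSpace ℝ D]

/-- The weighted mean of `f` over the segment from `y₀` to `y`. -/
def segMean (y₀ : D) (k : ℕ) (f : D → ℝ) (y : D) : ℝ :=
  ∫ t in (0 : ℝ)..1, t ^ k * f (y₀ + t • (y - y₀))

theorem seg_mem_ball {y₀ y : D} {r t : ℝ} (hy : y ∈ Metric.ball y₀ r) (ht0 : 0 ≤ t) (ht1 : t ≤ 1) :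
    y₀ + t • (y - y₀) ∈ Metric.ball y₀ r := by
  rw [mem_ball_iff_norm] at hy ⊢
  rw [add_sub_cancel_left, norm_smul, Real.norm_of_nonneg ht0]
  exact (mul_le_of_le_one_left (norm_nonneg _) ht1).trans_lt hy

theorem continuousOn_seg {G : Type*} [TopologicalSpace G] {y₀ y : D} {r : ℝ} {f : D → G}
    (hf : ContinuousOn f (Metric.ball y₀ r)) (hy : y ∈ Metric.ball y₀ r) :
    ContinuousOn (fun t : ℝ => f (y₀ + t • (y - y₀))) (Set.uIcc 0 1) := by
  refine hf.comp (by fun_prop) fun t ht => ?_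
  rw [Set.uIcc_of_le zero_le_one] at ht
  exact seg_mem_ball hy ht.1 ht.2

/-- Differentiation under the integral sign. The inner derivative contributes a factor t, so the
derivative is again a weighted mean, with the weight raised by one; this is why general weights are
considered. -/
theorem hasFDerivAt_segMean [FiniteDimensional ℝ D] {y₀ : D} {r : ℝ} {f : D → ℝ}
    (hf : ContDiffOn ℝ ∞ f (Metric.ball y₀ r)) (k : ℕ) {y : D} (hy : y ∈ Metric.ball y₀ r) :
    ∃ L : D →L[ℝ] ℝ, HasFDerivAt (segMean y₀ k f) L y ∧
      ∀ v, L v = segMean y₀ (k + 1) (fun z => fderiv ℝ f z v) y := by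
  -- The smaller closed ball is compact, which bounds the derivative of f and gives a dominating
  -- constant.
  obtain ⟨ρ, hρ, hρr⟩ := exists_between (mem_ball_iff_norm.1 hy)
  have hdf : ContinuousOn (fderiv ℝ f) (Metric.ball y₀ r) :=
    hf.continuousOn_fderiv_of_isOpen Metric.isOpen_ball (by simp)
  obtain ⟨C, hC⟩ := (isCompact_closedBall y₀ ρ).exists_bound_of_continuousOn
    (hdf.mono (Metric.closedBall_subset_ball hρr))
  have hC0 : 0 ≤ C := (norm_nonneg _).trans
    (hC y₀ (Metric.mem_closedBall_self ((norm_nonneg _).trans hρ.le)))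
  have hsub : Metric.ball y₀ ρ ⊆ Metric.ball y₀ r := Metric.ball_subset_ball hρr.le
  have hF : ∀ x ∈ Metric.ball y₀ r, ContinuousOn
      (fun t : ℝ => t ^ k * f (y₀ + t • (x - y₀))) (Set.uIcc 0 1) := fun x hx =>
    (continuousOn_id.pow k).mul (continuousOn_seg hf.continuousOn hx)
  have hF' : ContinuousOn
      (fun t : ℝ => (t ^ (k + 1)) • fderiv ℝ f (y₀ + t • (y - y₀))) (Set.uIcc 0 1) :=
    (continuousOn_id.pow (k + 1)).smul (continuousOn_seg hdf hy)
  have main := intervalIntegral.hasFDerivAt_integral_of_dominated_of_fderiv_le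
    (μ := MeasureTheory.volume) (a := 0) (b := 1) (bound := fun _ => C)
    (F := fun x t => t ^ k * f (y₀ + t • (x - y₀)))
    (F' := fun x t => (t ^ (k + 1)) • fderiv ℝ f (y₀ + t • (x - y₀)))
    (x₀ := y) (s := Metric.ball y₀ ρ)
    (Metric.isOpen_ball.mem_nhds (mem_ball_iff_norm.2 hρ))
    (by
      filter_upwards [Metric.isOpen_ball.mem_nhds hy] with x hx
      exact ((hF x hx).mono Set.uIoc_subset_uIcc).aestronglyMeasurable measurableSet_uIoc)
    (hF y hy).intervalIntegrable
    ((hF'.mono Set.uIoc_subset_uIcc).aestronglyMeasurable measurableSet_uIoc)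
    (by
      refine Filter.Eventually.of_forall fun t ht x hx => ?_
      rw [Set.uIoc_of_le zero_le_one] at ht
      rw [norm_smul, norm_pow, Real.norm_of_nonneg ht.1.le]
      have h1 := hC _ (Metric.ball_subset_closedBall (seg_mem_ball hx ht.1.le ht.2))
      have h2 : t ^ (k + 1) ≤ 1 := pow_le_one₀ ht.1.le ht.2
      exact (mul_le_of_le_one_left (norm_nonneg _) h2).trans h1)
    intervalIntegrable_const
    (by
      refine Filter.Eventually.of_forall fun t ht x hx => ?_
      rw [Set.uIoc_of_le zero_le_one] at ht
      have hz := seg_mem_ball (hsub hx) ht.1.le ht.2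
      have h1 : HasFDerivAt f (fderiv ℝ f (y₀ + t • (x - y₀))) (y₀ + t • (x - y₀)) :=
        ((hf.contDiffAt (Metric.isOpen_ball.mem_nhds hz)).differentiableAt
          (by simp)).hasFDerivAt
      have h2 : HasFDerivAt (fun z : D => y₀ + t • (z - y₀)) (t • ContinuousLinearMap.id ℝ D) x :=
        (((hasFDerivAt_id x).sub_const y₀).const_smul t).const_add y₀
      have h3 := (h1.comp x h2).const_mul (t ^ k)
      refine h3.congr_fderiv ?_
      ext v
      simp [pow_succ, mul_assoc])
  refine ⟨_, main, fun v => ?_⟩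
  exact ContinuousLinearMap.intervalIntegral_apply
    (φ := fun t : ℝ => (t ^ (k + 1)) • fderiv ℝ f (y₀ + t • (y - y₀))) hF'.intervalIntegrable v

/-- The induction on the order runs over all weights and all functions at once, because
differentiating changes both. -/
theorem contDiffOn_segMean [FiniteDimensional ℝ D] {y₀ : D} {r : ℝ} (n : ℕ) :
    ∀ (k : ℕ) {f : D → ℝ}, ContDiffOn ℝ ∞ f (Metric.ball y₀ r) →
      ContDiffOn ℝ n (segMean y₀ k f) (Metric.ball y₀ r) := by
  induction n with
  | zero =>
    intro k f hf
    refine contDiffOn_zero.2 fun y hy => ?_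
    obtain ⟨L, hL, -⟩ := hasFDerivAt_segMean hf k hy
    exact hL.continuousAt.continuousWithinAt
  | succ n ih =>
    intro k f hf
    rw [Nat.cast_add, Nat.cast_one]
    refine contDiffOn_succ_of_fderiv_apply (fun y hy => ?_) (fun h => by simp at h) fun v => ?_
    · obtain ⟨L, hL, -⟩ := hasFDerivAt_segMean hf k hy
      exact hL.differentiableAt.differentiableWithinAt
    · refine (ih (k + 1) (f := fun z => fderiv ℝ f z v) ?_).congr fun y hy => ?_
      · exact (hf.fderiv_of_isOpen Metric.isOpen_ball (by simp)).clm_apply contDiffOn_const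
      · obtain ⟨L, hL, hLv⟩ := hasFDerivAt_segMean hf k hy
        rw [fderivWithin_of_isOpen Metric.isOpen_ball hy, hL.fderiv, hLv]

/-- **Hadamard's lemma** on a ball. -/
theorem hadamard [FiniteDimensional ℝ D] {κ : Type*} [Fintype κ] (b : Module.Basis κ ℝ D) {y₀ : D}
    {r : ℝ} {f : D → ℝ} (hf : ContDiffOn ℝ ∞ f (Metric.ball y₀ r)) :
    ∃ g : κ → D → ℝ, (∀ a, ContDiffOn ℝ ∞ (g a) (Metric.ball y₀ r)) ∧
      ∀ y ∈ Metric.ball y₀ r, f y = f y₀ + ∑ a, b.coord a (y - y₀) * g a y := by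
  have hd : ∀ v : D, ContDiffOn ℝ ∞ (fun z => fderiv ℝ f z v) (Metric.ball y₀ r) := fun v =>
    (hf.fderiv_of_isOpen Metric.isOpen_ball (by simp)).clm_apply contDiffOn_const
  -- The coefficient is the mean of the partial derivative ∂_a f over the segment from `y₀` to `y`.
  refine ⟨fun a => segMean y₀ 0 fun z => fderiv ℝ f z (b a), fun a => ?_, fun y hy => ?_⟩
  · rw [contDiffOn_infty]
    exact fun n => contDiffOn_segMean n 0 (hd (b a))
  · have hint : ∀ v, IntervalIntegrable (fun t : ℝ => fderiv ℝ f (y₀ + t • (y - y₀)) v)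
        MeasureTheory.volume 0 1 := fun v =>
      (continuousOn_seg (hd v).continuousOn hy).intervalIntegrable
    have h1 : ∫ t in (0 : ℝ)..1, fderiv ℝ f (y₀ + t • (y - y₀)) (y - y₀) = f y - f y₀ := by
      have := intervalIntegral.integral_eq_sub_of_hasDerivAt (a := 0) (b := 1)
        (f := fun t : ℝ => f (y₀ + t • (y - y₀)))
        (f' := fun t => fderiv ℝ f (y₀ + t • (y - y₀)) (y - y₀)) (fun t ht => by
          rw [Set.uIcc_of_le zero_le_one] at ht
          have hz := seg_mem_ball hy ht.1 ht.2
          have h1 : HasFDerivAt f (fderiv ℝ f (y₀ + t • (y - y₀))) (y₀ + t • (y - y₀)) :=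
            ((hf.contDiffAt (Metric.isOpen_ball.mem_nhds hz)).differentiableAt
              (by simp)).hasFDerivAt
          have h2 : HasDerivAt (fun t : ℝ => y₀ + t • (y - y₀)) (y - y₀) t := by
            simpa using ((hasDerivAt_id t).smul_const (y - y₀)).const_add y₀
          exact h1.comp_hasDerivAt t h2) (hint _)
      simpa using this
    have h2 : ∀ z, fderiv ℝ f z (y - y₀) = ∑ a, b.coord a (y - y₀) * fderiv ℝ f z (b a) := by
      intro z
      conv_lhs => rw [← b.sum_repr (y - y₀), map_sum]
      simp
    rw [← sub_eq_iff_eq_add', ← h1]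
    simp only [h2, segMean, pow_zero, one_mul]
    rw [intervalIntegral.integral_finsetSum fun a _ => (hint (b a)).const_mul _]
    simp only [intervalIntegral.integral_const_mul]

end Hadamard

/-! ## Sheaves of smooth functions -/

section Sheaves

theorem SuperPresheaf.IsSheaf.pushforward {X : Type u} {Y : Type u'} [TopologicalSpace X]
    [TopologicalSpace Y] (φ : C(X, Y)) {P : SuperPresheaf.{u, v} X}
    (hP : SuperPresheaf.IsSheaf.{u, v, t} P) :
    SuperPresheaf.IsSheaf.{u', v, t} (P.pushforward φ) where
  sep {_ U} V hV b b' H := hP.sep (U := Opens.comap φ U) (fun i => Opens.comap φ (V i))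
    (fun x hx => hV (φ x) hx) b b' H
  glue {_ U} V hV b H := hP.glue (U := Opens.comap φ U) (fun i => Opens.comap φ (V i))
    (fun x hx => hV (φ x) hx) b H

/-- The sheaf `V ↦ P(W ∩ V)`. -/
def SuperPresheaf.restr {X : Type u} [TopologicalSpace X] (P : SuperPresheaf.{u, v} X)
    (W : Opens X) : SuperPresheaf.{u, v} X where
  obj V := P.obj (W ⊓ V)
  ring V := P.ring (W ⊓ V)
  algebra V := P.algebra (W ⊓ V)
  res h := P.res (inf_le_inf_left W h)
  res_self _ f := P.res_self _ f
  res_res _ _ f := P.res_res _ _ f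
  par V := P.par (W ⊓ V)
  par_par _ f := P.par_par _ f
  par_res _ f := P.par_res _ f
  even_comm _ f g h := P.even_comm _ f g h
  odd_comm _ f g h := P.odd_comm _ f g h

theorem SuperPresheaf.IsSheaf.restr {X : Type u} [TopologicalSpace X] {P : SuperPresheaf.{u, v} X}
    (hP : SuperPresheaf.IsSheaf.{u, v, t} P) (W : Opens X) :
    SuperPresheaf.IsSheaf.{u, v, t} (P.restr W) where
  sep {_ U} V hV b b' H := by
    have hc : ∀ x ∈ W ⊓ U, ∃ i, x ∈ V i := fun x hx => hV x hx.2
    let c : P.obj (W ⊓ U) := b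
    let c' : P.obj (W ⊓ U) := b'
    have H' : ∀ i, P.res (inf_le_inf_left W inf_le_left : W ⊓ (U ⊓ V i) ≤ W ⊓ U) c =
      P.res (inf_le_inf_left W inf_le_left) c' := H
    refine hP.sep (U := W ⊓ U) V hc c c' fun i => ?_
    have := congrArg (P.res (show (W ⊓ U) ⊓ V i ≤ W ⊓ (U ⊓ V i) by rw [inf_assoc])) (H' i)
    rwa [P.res_res, P.res_res] at this
  glue {_ U} V hV b H := by
    have hc : ∀ x ∈ W ⊓ U, ∃ i, x ∈ V i := fun x hx => hV x hx.2
    let c : ∀ i, P.obj (W ⊓ (U ⊓ V i)) := b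
    have H' : ∀ i j, P.res (inf_le_inf_left W (inf_le_inf_left U inf_le_left) :
        W ⊓ (U ⊓ (V i ⊓ V j)) ≤ W ⊓ (U ⊓ V i)) (c i) =
      P.res (inf_le_inf_left W (inf_le_inf_left U inf_le_right)) (c j) := H
    obtain ⟨b₀, hb₀⟩ := hP.glue (U := W ⊓ U) V hc
      (fun i => P.res (show (W ⊓ U) ⊓ V i ≤ W ⊓ (U ⊓ V i) by rw [inf_assoc]) (c i)) fun i j => by
        have := congrArg (P.res (show (W ⊓ U) ⊓ (V i ⊓ V j) ≤ W ⊓ (U ⊓ (V i ⊓ V j)) by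
          rw [inf_assoc])) (H' i j)
        rw [P.res_res, P.res_res] at this ⊢
        exact this
    refine ⟨b₀, fun i => ?_⟩
    have := congrArg (P.res (show W ⊓ (U ⊓ V i) ≤ (W ⊓ U) ⊓ V i by rw [inf_assoc])) (hb₀ i)
    rw [P.res_res, P.res_res, P.res_self] at this
    exact this

variable {B : Type*} [NormedAddCommGroup B] [NormedSpace ℝ B] {H : Type*} [TopologicalSpace H]
  {I : ModelWithCorners ℝ B H} {N : Type u} [TopologicalSpace N] [ChartedSpace H N]

/-- The extension by zero of a function on an open set. -/
def extFun {U : Opens N} (f : U → ℝ) : N → ℝ := Function.extend Subtype.val f 0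

theorem extFun_apply {U : Opens N} (f : U → ℝ) (x : U) : extFun f x.1 = f x :=
  Subtype.val_injective.extend_apply f 0 x

theorem extFun_contMDiffAt {U : Opens N} (f : C^∞⟮I, U; 𝓘(ℝ, ℝ), ℝ⟯) {x : N} (hx : x ∈ U) :
    ContMDiffAt I 𝓘(ℝ, ℝ) ∞ (extFun f) x := by
  have h2 : ContMDiffAt I 𝓘(ℝ, ℝ) ∞ (fun y : U => extFun f y) ⟨x, hx⟩ := by
    rw [show (fun y : U => extFun f y) = f from funext (extFun_apply f)]
    exact f.contMDiff.contMDiffAt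
  exact contMDiffAt_subtype_iff.1 h2

theorem extFun_eventuallyEq {U : Opens N} {f : U → ℝ} {g : N → ℝ} (hg : ∀ y : U, f y = g y)
    {x : N} (hx : x ∈ U) : extFun f =ᶠ[𝓝 x] g := by
  filter_upwards [U.isOpen.mem_nhds hx] with y hy
  rw [extFun_apply f ⟨y, hy⟩, hg]

theorem smoothFun_isSheaf : SuperPresheaf.IsSheaf.{u, u, t} (smoothFun I N) where
  sep {_ U} V hV b b' H := by
    refine ContMDiffMap.ext fun x => ?_
    obtain ⟨i, hi⟩ := hV x.1 x.2
    exact congrArg (fun f : C^∞⟮I, (U ⊓ V i : Opens N); 𝓘(ℝ, ℝ), ℝ⟯ => f ⟨x.1, x.2, hi⟩) (H i)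
  glue {_ U} V hV b H := by
    choose i hi using fun x : U => hV x.1 x.2
    let c : ∀ k, C^∞⟮I, (U ⊓ V k : Opens N); 𝓘(ℝ, ℝ), ℝ⟯ := b
    let g : U → ℝ := fun x => c (i x) ⟨x.1, x.2, hi x⟩
    have hg : ∀ (x : U) k (hk : x.1 ∈ V k), g x = c k ⟨x.1, x.2, hk⟩ := fun x k hk =>
      congrArg (fun f : C^∞⟮I, (U ⊓ (V (i x) ⊓ V k) : Opens N); 𝓘(ℝ, ℝ), ℝ⟯ =>
        f ⟨x.1, x.2, hi x, hk⟩) (H (i x) k)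
    refine ⟨(⟨g, fun x => ?_⟩ : C^∞⟮I, U; 𝓘(ℝ, ℝ), ℝ⟯), fun k => ?_⟩
    · have h1 := extFun_contMDiffAt (c (i x)) (x := x.1) ⟨x.2, hi x⟩
      have h2 := (contMDiffAt_subtype_iff (U := U) (x := x)).2 h1
      refine h2.congr_of_eventuallyEq ?_
      filter_upwards [(V (i x)).isOpen.preimage continuous_subtype_val |>.mem_nhds (hi x)] with y hy
      rw [hg y (i x) hy]
      exact (extFun_apply (c (i x)) ⟨y.1, y.2, hy⟩).symm
    · exact ContMDiffMap.ext fun x => hg ⟨x.1, x.2.1⟩ k x.2.2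

theorem timesOdd_isSheaf : SuperPresheaf.IsSheaf.{u, u, t} (timesOdd I N) where
  sep V hV b b' H := TrivSqZeroExt.ext
    (smoothFun_isSheaf.sep V hV _ _ fun i => congrArg TrivSqZeroExt.fst (H i))
    (smoothFun_isSheaf.sep V hV _ _ fun i => congrArg TrivSqZeroExt.snd (H i))
  glue V hV b H := by
    obtain ⟨f, hf⟩ := (smoothFun_isSheaf (I := I) (N := N)).glue V hV
      (fun i => TrivSqZeroExt.fst (b i)) fun i j => congrArg TrivSqZeroExt.fst (H i j)
    obtain ⟨g, hg⟩ := (smoothFun_isSheaf (I := I) (N := N)).glue V hV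
      (fun i => TrivSqZeroExt.snd (b i)) fun i j => congrArg TrivSqZeroExt.snd (H i j)
    exact ⟨(f, g), fun i => TrivSqZeroExt.ext (hf i) (hg i)⟩

end Sheaves

/-! ## Coordinate vector fields on manifolds -/

section Coordinates

variable {B : Type*} [NormedAddCommGroup B] [NormedSpace ℝ B] {H : Type*} [TopologicalSpace H]
  {I : ModelWithCorners ℝ B H} [I.Boundaryless]
  {N : Type u} [TopologicalSpace N] [ChartedSpace H N] [IsManifold I ∞ N]

/-- The expression of a function in the chart at `p`. -/
def chartRep (I : ModelWithCorners ℝ B H) (p : N) {V : Opens N} (f : V → ℝ) : B → ℝ :=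
  extFun f ∘ (extChartAt I p).symm

theorem chartRep_contDiffAt (p : N) {V : Opens N} (f : C^∞⟮I, V; 𝓘(ℝ, ℝ), ℝ⟯) {x : N}
    (hx : x ∈ V) (hxp : x ∈ (extChartAt I p).source) :
    ContDiffAt ℝ ∞ (chartRep I p f) (extChartAt I p x) := by
  rw [← contMDiffAt_iff_contDiffAt]
  refine ContMDiffAt.comp (I' := I) _ ?_ ?_
  · rw [(extChartAt I p).left_inv hxp]
    exact extFun_contMDiffAt f hx
  · exact (contMDiffOn_extChartAt_symm p).contMDiffAt
      ((isOpen_extChartAt_target p).mem_nhds ((extChartAt I p).map_source hxp))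

theorem chartRep_eventuallyEq (p : N) {V W : Opens N} {f : V → ℝ} {g : W → ℝ} {x : N}
    (hx : x ∈ V) (hxW : x ∈ W) (hxp : x ∈ (extChartAt I p).source)
    (hfg : ∀ y (hV : y ∈ V) (hW : y ∈ W), f ⟨y, hV⟩ = g ⟨y, hW⟩) :
    chartRep I p f =ᶠ[𝓝 (extChartAt I p x)] chartRep I p g := by
  have hcont : ContinuousAt (extChartAt I p).symm (extChartAt I p x) :=
    continuousAt_extChartAt_symm' hxp
  have hVW := (V ⊓ W).isOpen.mem_nhds (x := x) ⟨hx, hxW⟩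
  rw [← (extChartAt I p).left_inv hxp] at hVW
  filter_upwards [hcont hVW] with z hz
  change extFun f _ = extFun g _
  rw [extFun_apply f ⟨_, hz.1⟩, extFun_apply g ⟨_, hz.2⟩]
  exact hfg _ hz.1 hz.2

/-- The derivative of smooth functions in the direction `v` of the chart at `p`. -/
def chartDeriv (p : N) (v : B) {V : Opens N} (hV : ∀ x ∈ V, x ∈ (extChartAt I p).source) :
    C^∞⟮I, V; 𝓘(ℝ, ℝ), ℝ⟯ →ₗ[ℝ] C^∞⟮I, V; 𝓘(ℝ, ℝ), ℝ⟯ where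
  toFun f := ⟨fun x => fderiv ℝ (chartRep I p f) (extChartAt I p x.1) v, fun x => by
    have hs : x.1 ∈ (chartAt H p).source := by simpa [extChartAt] using hV x.1 x.2
    refine (contMDiffAt_subtype_iff (U := V) (x := x)
      (f := fun y => fderiv ℝ (chartRep I p f) (extChartAt I p y) v)).2 ?_
    have h1 : ContDiffAt ℝ ∞ (fun z => fderiv ℝ (chartRep I p f) z v) (extChartAt I p x.1) :=
      ((chartRep_contDiffAt p f x.2 (hV x.1 x.2)).fderiv_right (by simp)).clm_apply
        contDiffAt_const
    exact h1.contMDiffAt.comp x.1 (contMDiffAt_extChartAt' hs)⟩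
  map_add' f g := by
    ext x
    have hf := (chartRep_contDiffAt p f x.2 (hV x.1 x.2)).differentiableAt (by simp)
    have hg := (chartRep_contDiffAt p g x.2 (hV x.1 x.2)).differentiableAt (by simp)
    have h1 : chartRep I p (f + g : C^∞⟮I, V; 𝓘(ℝ, ℝ), ℝ⟯) =ᶠ[𝓝 (extChartAt I p x.1)]
        chartRep I p f + chartRep I p g := by
      filter_upwards [(continuousAt_extChartAt_symm' (hV x.1 x.2)) (V.isOpen.mem_nhds
        (show (extChartAt I p).symm (extChartAt I p x.1) ∈ V by
          rw [(extChartAt I p).left_inv (hV x.1 x.2)]; exact x.2))] with z hz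
      change extFun (f + g : C^∞⟮I, V; 𝓘(ℝ, ℝ), ℝ⟯) _ = extFun f _ + extFun g _
      rw [extFun_apply _ ⟨_, hz⟩, extFun_apply _ ⟨_, hz⟩, extFun_apply _ ⟨_, hz⟩]
      rfl
    change fderiv ℝ (chartRep I p (f + g : C^∞⟮I, V; 𝓘(ℝ, ℝ), ℝ⟯)) _ v =
      fderiv ℝ (chartRep I p f) _ v + fderiv ℝ (chartRep I p g) _ v
    rw [h1.fderiv_eq, fderiv_add hf hg]
    rfl
  map_smul' c f := by
    ext x
    have hf := (chartRep_contDiffAt p f x.2 (hV x.1 x.2)).differentiableAt (by simp)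
    have h1 : chartRep I p (c • f : C^∞⟮I, V; 𝓘(ℝ, ℝ), ℝ⟯) =ᶠ[𝓝 (extChartAt I p x.1)]
        c • chartRep I p f := by
      filter_upwards [(continuousAt_extChartAt_symm' (hV x.1 x.2)) (V.isOpen.mem_nhds
        (show (extChartAt I p).symm (extChartAt I p x.1) ∈ V by
          rw [(extChartAt I p).left_inv (hV x.1 x.2)]; exact x.2))] with z hz
      change extFun (c • f : C^∞⟮I, V; 𝓘(ℝ, ℝ), ℝ⟯) _ = c • extFun f _
      rw [extFun_apply _ ⟨_, hz⟩, extFun_apply _ ⟨_, hz⟩]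
      rfl
    change fderiv ℝ (chartRep I p (c • f : C^∞⟮I, V; 𝓘(ℝ, ℝ), ℝ⟯)) _ v =
      c * fderiv ℝ (chartRep I p f) _ v
    rw [h1.fderiv_eq, fderiv_const_smul hf]
    rfl

theorem chartDeriv_apply (p : N) (v : B) {V : Opens N}
    (hV : ∀ x ∈ V, x ∈ (extChartAt I p).source) (f : C^∞⟮I, V; 𝓘(ℝ, ℝ), ℝ⟯) (x : V) :
    chartDeriv p v hV f x = fderiv ℝ (chartRep I p f) (extChartAt I p x.1) v := rfl

theorem chartDeriv_res (p : N) (v : B) {V W : Opens N}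
    (hV : ∀ x ∈ V, x ∈ (extChartAt I p).source) (hWV : W ≤ V) (f : C^∞⟮I, V; 𝓘(ℝ, ℝ), ℝ⟯) :
    resSmooth I N hWV (chartDeriv p v hV f) =
      chartDeriv p v (fun x hx => hV x (hWV hx)) (resSmooth I N hWV f) := by
  ext x
  change fderiv ℝ (chartRep I p f) (extChartAt I p x.1) v = fderiv ℝ (chartRep I p _) _ v
  rw [(chartRep_eventuallyEq (f := f) (g := resSmooth I N hWV f) p (hWV x.2) x.2 (hV x.1 (hWV x.2)) fun y _ _ => rfl).fderiv_eq]

theorem chartDeriv_mul (p : N) (v : B) {V : Opens N}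
    (hV : ∀ x ∈ V, x ∈ (extChartAt I p).source) (f g : C^∞⟮I, V; 𝓘(ℝ, ℝ), ℝ⟯) :
    chartDeriv p v hV (f * g) = chartDeriv p v hV f * g + f * chartDeriv p v hV g := by
  ext x
  have hf := (chartRep_contDiffAt p f x.2 (hV x.1 x.2)).differentiableAt (by simp)
  have hg := (chartRep_contDiffAt p g x.2 (hV x.1 x.2)).differentiableAt (by simp)
  have hxx : (extChartAt I p).symm (extChartAt I p x.1) = x.1 :=
    (extChartAt I p).left_inv (hV x.1 x.2)
  have h1 : chartRep I p (f * g : C^∞⟮I, V; 𝓘(ℝ, ℝ), ℝ⟯) =ᶠ[𝓝 (extChartAt I p x.1)]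
      chartRep I p f * chartRep I p g := by
    filter_upwards [(continuousAt_extChartAt_symm' (hV x.1 x.2)) (V.isOpen.mem_nhds
      (show (extChartAt I p).symm (extChartAt I p x.1) ∈ V by rw [hxx]; exact x.2))] with z hz
    change extFun (f * g : C^∞⟮I, V; 𝓘(ℝ, ℝ), ℝ⟯) _ = extFun f _ * extFun g _
    rw [extFun_apply _ ⟨_, hz⟩, extFun_apply _ ⟨_, hz⟩, extFun_apply _ ⟨_, hz⟩]
    rfl
  have hv : ∀ k : C^∞⟮I, V; 𝓘(ℝ, ℝ), ℝ⟯, chartRep I p k (extChartAt I p x.1) = k x := by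
    intro k
    change extFun k _ = _
    rw [hxx, extFun_apply]
  change fderiv ℝ (chartRep I p (f * g : C^∞⟮I, V; 𝓘(ℝ, ℝ), ℝ⟯)) _ v =
    fderiv ℝ (chartRep I p f) _ v * g x + f x * fderiv ℝ (chartRep I p g) _ v
  rw [h1.fderiv_eq, fderiv_mul hf hg, hv, hv]
  simp only [add_apply, smul_apply, ContinuousLinearMap.add_apply,
    ContinuousLinearMap.smul_apply, smul_eq_mul]
  ring

/-- The linear coordinate function `l ∘ φ`, `φ` the chart at `p`. -/
def chartCoord (I : ModelWithCorners ℝ B H) [IsManifold I ∞ N] (p : N) (l : B →L[ℝ] ℝ) {V : Opens N}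
    (hV : ∀ x ∈ V, x ∈ (extChartAt I p).source) : C^∞⟮I, V; 𝓘(ℝ, ℝ), ℝ⟯ :=
  ⟨fun x => l (extChartAt I p x.1), fun x => by
    have hs : x.1 ∈ (chartAt H p).source := by simpa [extChartAt] using hV x.1 x.2
    refine (contMDiffAt_subtype_iff (U := V) (x := x) (f := fun y => l (extChartAt I p y))).2 ?_
    exact (l.contDiff.contMDiff.contMDiffAt).comp x.1 (contMDiffAt_extChartAt' hs)⟩

theorem chartDeriv_chartCoord (p : N) (v : B) (l : B →L[ℝ] ℝ) {V : Opens N}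
    (hV : ∀ x ∈ V, x ∈ (extChartAt I p).source) (x : V) :
    chartDeriv p v hV (chartCoord I p l hV) x = l v := by
  have h1 : chartRep I p (chartCoord I p l hV) =ᶠ[𝓝 (extChartAt I p x.1)] l := by
    filter_upwards [(continuousAt_extChartAt_symm' (hV x.1 x.2)) (V.isOpen.mem_nhds
      (show (extChartAt I p).symm (extChartAt I p x.1) ∈ V by
        rw [(extChartAt I p).left_inv (hV x.1 x.2)]; exact x.2)),
      (isOpen_extChartAt_target p).mem_nhds ((extChartAt I p).map_source (hV x.1 x.2))]
      with z hz hzt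
    change extFun (chartCoord I p l hV) _ = _
    rw [extFun_apply _ ⟨_, hz⟩]
    change l (extChartAt I p ((extChartAt I p).symm z)) = l z
    rw [(extChartAt I p).right_inv hzt]
  rw [chartDeriv_apply, h1.fderiv_eq, l.fderiv]

/-- A point derivation which annihilates the coordinates of a chart is zero. -/
theorem pointDerivation_eq_zero [FiniteDimensional ℝ B] {κ : Type*} [Fintype κ]
    (b : Module.Basis κ ℝ B) (p : N) {U : Opens N}
    (hU : ∀ x ∈ U, x ∈ (extChartAt I p).source) {x : N}
    (Λ : ∀ V : Opens N, V ≤ U → x ∈ V → (C^∞⟮I, V; 𝓘(ℝ, ℝ), ℝ⟯ →ₗ[ℝ] ℝ))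
    (hres : ∀ V W (hV : V ≤ U) (hW : W ≤ V) (hx : x ∈ W) f,
      Λ W (hW.trans hV) hx (resSmooth I N hW f) = Λ V hV (hW hx) f)
    (hmul : ∀ V (hV : V ≤ U) (hx : x ∈ V) f g,
      Λ V hV hx (f * g) = Λ V hV hx f * g ⟨x, hx⟩ + f ⟨x, hx⟩ * Λ V hV hx g)
    (hcoord : ∀ (hx : x ∈ U) a,
      Λ U le_rfl hx (chartCoord I p (b.coord a).toContinuousLinearMap hU) = 0)
    (V : Opens N) (hV : V ≤ U) (hx : x ∈ V) (f : C^∞⟮I, V; 𝓘(ℝ, ℝ), ℝ⟯) : Λ V hV hx f = 0 := by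
  have hxs : x ∈ (extChartAt I p).source := hU x (hV hx)
  set y₀ := extChartAt I p x with hy₀
  have hnhds : (extChartAt I p).target ∩ (extChartAt I p).symm ⁻¹' V ∈ 𝓝 y₀ := by
    refine Filter.inter_mem ((isOpen_extChartAt_target p).mem_nhds
      ((extChartAt I p).map_source hxs)) ?_
    refine (continuousAt_extChartAt_symm' hxs) (V.isOpen.mem_nhds ?_)
    rw [(extChartAt I p).left_inv hxs]
    exact hx
  -- Hadamard's lemma needs a ball, so everything is moved to a coordinate ball around x inside V.
  obtain ⟨r, hr, hball⟩ := Metric.mem_nhds_iff.1 hnhds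
  have hf : ContDiffOn ℝ ∞ (chartRep I p f) (Metric.ball y₀ r) := by
    intro z hz
    have hzt := hball hz
    have := chartRep_contDiffAt p f hzt.2 ((extChartAt I p).map_target hzt.1)
    rw [(extChartAt I p).right_inv hzt.1] at this
    exact this.contDiffWithinAt
  obtain ⟨g, hg, hgf⟩ := hadamard b hf
  let W : Opens N := ⟨(extChartAt I p).source ∩ extChartAt I p ⁻¹' Metric.ball y₀ r ∩ V,
    ((continuousOn_extChartAt p).isOpen_inter_preimage (isOpen_extChartAt_source p)
      Metric.isOpen_ball).inter V.isOpen⟩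
  have hWV : W ≤ V := fun z hz => hz.2
  have hWU : W ≤ U := hWV.trans hV
  have hxW : x ∈ W := ⟨⟨hxs, Metric.mem_ball_self hr⟩, hx⟩
  let G : κ → C^∞⟮I, W; 𝓘(ℝ, ℝ), ℝ⟯ := fun a => ⟨fun z => g a (extChartAt I p z.1), fun z => by
    have hs : z.1 ∈ (chartAt H p).source := by simpa [extChartAt] using z.2.1.1
    refine (contMDiffAt_subtype_iff (U := W) (x := z)
      (f := fun y => g a (extChartAt I p y))).2 ?_
    exact (((hg a).contDiffAt (Metric.isOpen_ball.mem_nhds z.2.1.2)).contMDiffAt).comp z.1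
      (contMDiffAt_extChartAt' hs)⟩
  let X : κ → C^∞⟮I, W; 𝓘(ℝ, ℝ), ℝ⟯ := fun a =>
    resSmooth I N hWU (chartCoord I p (b.coord a).toContinuousLinearMap hU)
  have hX : ∀ a, Λ W hWU hxW (X a) = 0 := fun a =>
    (hres U W le_rfl hWU hxW _).trans (hcoord _ a)
  -- The product rule for 1 · 1 = 1 shows that constants are annihilated.
  have h1 : Λ W hWU hxW 1 = 0 := by
    have := hmul W hWU hxW 1 1
    rw [mul_one] at this
    have e : (1 : C^∞⟮I, W; 𝓘(ℝ, ℝ), ℝ⟯) ⟨x, hxW⟩ = 1 := rfl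
    rw [e, mul_one, one_mul] at this
    linarith
  -- Near x, f is a constant plus products of coordinate differences, which vanish at x, with smooth
  -- functions. The product rule kills every term.
  have hdec : resSmooth I N hWV f = (f ⟨x, hx⟩) • (1 : C^∞⟮I, W; 𝓘(ℝ, ℝ), ℝ⟯) +
      ∑ a, (X a - (b.coord a y₀) • (1 : C^∞⟮I, W; 𝓘(ℝ, ℝ), ℝ⟯)) * G a := by
    ext z
    have hz := hgf _ z.2.1.2
    have e1 : ∀ w : V, w.1 ∈ (extChartAt I p).source →
        chartRep I p f (extChartAt I p w.1) = f w := by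
      intro w hw
      change extFun f _ = _
      rw [(extChartAt I p).left_inv hw, extFun_apply]
    have e4 : chartRep I p f y₀ = f ⟨x, hx⟩ := e1 ⟨x, hx⟩ hxs
    rw [e1 ⟨z.1, z.2.2⟩ z.2.1.1, e4] at hz
    have e2 : ∀ s : κ → C^∞⟮I, W; 𝓘(ℝ, ℝ), ℝ⟯, (∑ a, s a) z = ∑ a, s a z := fun s =>
      map_sum (ContMDiffMap.evalRingHom (n := ∞) (I := I) z) s Finset.univ
    refine hz.trans ?_
    change _ = f ⟨x, hx⟩ * 1 + (∑ a, (X a - (b.coord a y₀) •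
      (1 : C^∞⟮I, W; 𝓘(ℝ, ℝ), ℝ⟯)) * G a) z
    rw [e2, mul_one]
    congr 1
    refine Finset.sum_congr rfl fun a _ => ?_
    change _ = (b.coord a (extChartAt I p z.1) - b.coord a y₀ * 1) * g a (extChartAt I p z.1)
    rw [map_sub, mul_one]
  rw [← hres V W hV hWV hxW f, hdec, map_add, map_smul, h1, smul_zero, zero_add, map_sum]
  refine Finset.sum_eq_zero fun a _ => ?_
  rw [hmul, map_sub, hX, map_smul, h1]
  have e3 : (X a - (b.coord a y₀) • (1 : C^∞⟮I, W; 𝓘(ℝ, ℝ), ℝ⟯)) ⟨x, hxW⟩ = 0 := by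
    change b.coord a (extChartAt I p x) - b.coord a y₀ * 1 = 0
    rw [mul_one, sub_self]
  rw [e3]
  simp

end Coordinates

/-! ## Frames from coordinates -/

section SpanningFrames

variable {B : Type*} [NormedAddCommGroup B] [NormedSpace ℝ B] {H : Type*} [TopologicalSpace H]
  {I : ModelWithCorners ℝ B H}
  {N : Type u} [TopologicalSpace N] [ChartedSpace H N]

/-- A vector field on a manifold from a derivation of the sheaf of smooth functions. -/
def smoothVF {U : Opens N}
    (D : ∀ V : Opens N, V ≤ U → (C^∞⟮I, V; 𝓘(ℝ, ℝ), ℝ⟯ →ₗ[ℝ] C^∞⟮I, V; 𝓘(ℝ, ℝ), ℝ⟯))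
    (hres : ∀ V W (hV : V ≤ U) (hW : W ≤ V) f,
      resSmooth I N hW (D V hV f) = D W (hW.trans hV) (resSmooth I N hW f))
    (hmul : ∀ V (hV : V ≤ U) f g, D V hV (f * g) = D V hV f * g + f * D V hV g) :
    VF (smoothFun I N) U :=
  Der.ofHom (p := 0) ⟨fun V => D V.1 V.2, fun V W hWV f => hres V.1 W.1 V.2 hWV f, fun V f => by
    simp only [psign, if_true, one_smul]
    rfl, fun V f g => by
    simp only [SuperPresheaf.twist, if_true]
    exact hmul V.1 V.2 f g⟩

/-- Vector fields on a manifold are even. -/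
theorem smoothVF_even {U : Opens N} {P : SuperPresheaf.{u, w} N}
    (hP : ∀ (V : Opens N) (a : P.obj V), P.par V a = a) {h : SheafHom (smoothFun I N) P}
    (Z : Der h U) : Der.HasParity Z 0 := by
  obtain ⟨D0, D1, h0, h1, rfl⟩ := Der.exists_parts Z
  have : D1 = 0 := by
    refine Der.ext_act fun V hV f => ?_
    have h2 := h1.par_act hV f
    rw [hP] at h2
    have h3 : Der.act D1 hV f = -Der.act D1 hV f := by
      refine h2.trans ?_
      simp only [psign, one_ne_zero, if_false, neg_smul, one_smul]
      rfl
    have h4 : (2 : ℝ) • Der.act D1 hV f = 0 := by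
      rw [two_smul]
      nth_rewrite 1 [h3]
      exact neg_add_cancel _
    simpa using h4
  rw [this, add_zero]
  exact h0

/-- A sheaf of superalgebras over the smooth functions of `N`. -/
structure FunctionInclusion (I : ModelWithCorners ℝ B H) (O : SuperPresheaf.{u, v} N) where
  app : ∀ V : Opens N, C^∞⟮I, V; 𝓘(ℝ, ℝ), ℝ⟯ →ₐ[ℝ] O.obj V
  app_res : ∀ {V W : Opens N} (hW : W ≤ V) (f : C^∞⟮I, V; 𝓘(ℝ, ℝ), ℝ⟯),
    O.res hW (app V f) = app W (resSmooth I N hW f)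
  par_app : ∀ (V : Opens N) (f : C^∞⟮I, V; 𝓘(ℝ, ℝ), ℝ⟯), O.par V (app V f) = app V f

/-- The smooth functions over themselves. -/
def FunctionInclusion.refl : FunctionInclusion I (smoothFun I N) where
  app V := AlgHom.id ℝ _
  app_res _ _ := rfl
  par_app _ _ := rfl

/-- A functional on germs at `x` of sections of `P` which is linear over functions along `h`. -/
structure PointFunctional {O : SuperPresheaf.{u, v} N} {P : SuperPresheaf.{u, w} N}
    (j : FunctionInclusion I O) (h : SheafHom O P) (x : N) where
  toFun : ∀ V : Opens N, x ∈ V → (P.obj V →ₗ[ℝ] ℝ)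
  toFun_res : ∀ {V W : Opens N} (hW : W ≤ V) (hx : x ∈ W) (b : P.obj V),
    toFun W hx (P.res hW b) = toFun V (hW hx) b
  toFun_mul : ∀ {V : Opens N} (hx : x ∈ V) (f : C^∞⟮I, V; 𝓘(ℝ, ℝ), ℝ⟯) (b : P.obj V),
    toFun V hx (h.app V (j.app V f) * b) = f ⟨x, hx⟩ * toFun V hx b

/-- Sections of `P` are determined by the values of point functionals. -/
def PointSeparated {O : SuperPresheaf.{u, v} N} {P : SuperPresheaf.{u, w} N}
    (j : FunctionInclusion I O) (h : SheafHom O P) : Prop :=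
  ∀ (V : Opens N) (b : P.obj V),
    (∀ (x : N) (hx : x ∈ V) (Λ : PointFunctional j h x), Λ.toFun V hx b = 0) → b = 0

variable [I.Boundaryless] [IsManifold I ∞ N] [FiniteDimensional ℝ B]

/-- A homogeneous derivation that kills the coordinates, followed by a point functional, is a point
derivation of smooth functions that kills the coordinates of a chart, so it vanishes on functions by
Hadamard's lemma. Functions and coordinates generate the algebra, so the derivation is zero.
Non-homogeneous derivations are split into parts. -/
theorem Frame.spans_of_generate {O : SuperPresheaf.{u, v} N} {P : SuperPresheaf.{u, w} N}
    (j : FunctionInclusion I O) {h : SheafHom O P} {U : Opens N} {ι : Type}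
    [DecidableEq ι] (fr : Frame O U ι) {κ : Type*} [Fintype κ]
    (b : Module.Basis κ ℝ B) (p : N) (hU : ∀ x ∈ U, x ∈ (extChartAt I p).source) (inc : κ → ι)
    (hinc : ∀ k, fr.x (inc k) =
      j.app U (chartCoord I p (b.coord k).toContinuousLinearMap hU))
    (hgen : ∀ (V : Opens N) (hV : V ≤ U) (s : O.obj V), s ∈ Algebra.adjoin ℝ
      (Set.range (j.app V) ∪ Set.range fun a => O.res hV (fr.x a)))
    (hsep : PointSeparated j h) : fr.Spans h := by
  intro V hV
  have hom : ∀ (q : ZMod 2) (Z : Der h V), Der.HasParity Z q →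
      (∀ a, Der.act Z le_rfl (O.res hV (fr.x a)) = 0) → Z = 0 := by
    intro q Z hZ hx
    have hj : ∀ (W : Opens N) (hW : W ≤ V) (f : C^∞⟮I, W; 𝓘(ℝ, ℝ), ℝ⟯),
        Der.act Z hW (j.app W f) = 0 := by
      intro W hW f
      refine hsep W _ fun x hxW Λ => ?_
      refine pointDerivation_eq_zero b p (U := V) (fun x hx => hU x (hV hx)) (x := x)
        (fun W' hW' hx' => Λ.toFun W' hx' ∘ₗ Der.act Z hW' ∘ₗ (j.app W').toLinearMap)
        (fun W₁ W₂ h₁ h₂ hx' k => ?_) (fun W₁ h₁ hx' k l => ?_) (fun hx' a => ?_) W hW hxW f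
      · simp only [LinearMap.comp_apply, AlgHom.toLinearMap_apply]
        rw [← Λ.toFun_res h₂ hx', Der.res_act, j.app_res]
      · simp only [LinearMap.comp_apply, AlgHom.toLinearMap_apply]
        -- Smooth functions are even, so neither the sign nor the order of the factors matters.
        have e2 : P.twist q W₁ (h.app W₁ (j.app W₁ k)) = h.app W₁ (j.app W₁ k) := by
          rw [← h.app_twist]
          rcases zmod2_cases q with rfl | rfl
          · simp [SuperPresheaf.twist]
          · simp [SuperPresheaf.twist, j.par_app]
        have e3 : Der.act Z h₁ (j.app W₁ k) * h.app W₁ (j.app W₁ l) =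
            h.app W₁ (j.app W₁ l) * Der.act Z h₁ (j.app W₁ k) :=
          (P.even_comm W₁ _ _ (by rw [← h.app_par, j.par_app])).symm
        rw [map_mul, hZ.act_mul, e2, e3, map_add, Λ.toFun_mul, Λ.toFun_mul]
        ring
      · simp only [LinearMap.comp_apply, AlgHom.toLinearMap_apply]
        have e1 := hx (inc a)
        rw [hinc, j.app_res] at e1
        exact (congrArg (Λ.toFun V hx') e1).trans (map_zero _)
    refine Der.ext_act fun W hW s => ?_
    rw [Der.act_zero]
    induction hgen W (hW.trans hV) s using Algebra.adjoin_induction with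
    | mem s hs =>
      rcases hs with ⟨f, rfl⟩ | ⟨a, rfl⟩
      · exact hj W hW f
      · have := Der.res_act Z le_rfl hW (O.res hV (fr.x a))
        rw [hx, map_zero, O.res_res] at this
        exact this.symm
    | algebraMap r =>
      have := hj W hW (algebraMap ℝ C^∞⟮I, W; 𝓘(ℝ, ℝ), ℝ⟯ r)
      rwa [AlgHom.commutes] at this
    | add s s' _ _ hs hs' => rw [map_add, hs, hs', add_zero]
    | mul s s' _ _ hs hs' => rw [hZ.act_mul, hs, hs', zero_mul, mul_zero, add_zero]
  intro Z hZ
  obtain ⟨Z0, Z1, h0, h1, rfl⟩ := Der.exists_parts Z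
  have hparts : ∀ a, Der.act Z0 le_rfl (O.res hV (fr.x a)) = 0 ∧
      Der.act Z1 le_rfl (O.res hV (fr.x a)) = 0 := by
    intro a
    have hp : O.par V (O.res hV (fr.x a)) = psign (fr.parity a) • O.res hV (fr.x a) := by
      rw [O.par_res, fr.x_par, map_smul]
    refine SuperPresheaf.parts_eq_zero (h0.par_act_of le_rfl hp) ?_ (hZ a)
    have := h1.par_act_of le_rfl hp
    rwa [show (1 : ZMod 2) + fr.parity a = 0 + fr.parity a + 1 by ring] at this
  rw [hom 0 Z0 h0 fun a => (hparts a).1, hom 1 Z1 h1 fun a => (hparts a).2, add_zero]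

/-- The frame of coordinate vector fields of a chart. -/
def chartFrame {κ : Type} [Fintype κ] [DecidableEq κ] (b : Module.Basis κ ℝ B) (p : N)
    {U : Opens N} (hU : ∀ x ∈ U, x ∈ (extChartAt I p).source) : Frame (smoothFun I N) U κ where
  parity _ := 0
  x k := chartCoord I p (b.coord k).toContinuousLinearMap hU
  d k := smoothVF (fun _ hV => chartDeriv p (b k) fun x hx => hU x (hV hx))
    (fun _ _ _ hW f => chartDeriv_res p (b k) _ hW f) (fun _ _ f g => chartDeriv_mul p (b k) _ f g)
  x_par k := by
    simp only [psign, if_true]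
    exact (one_smul ℝ _).symm
  d_par k := smoothVF_even (fun _ _ => rfl) _
  d_x k l := by
    refine ContMDiffMap.ext fun x => ?_
    refine (chartDeriv_chartCoord p (b k) _ hU x).trans ?_
    have h1 : (b.coord l).toContinuousLinearMap (b k) = if k = l then 1 else 0 := by
      simp [Module.Basis.coord_apply, Finsupp.single_apply]
    rw [h1]
    split_ifs <;> rfl

/-- Here the structure sheaf consists of smooth functions, so generation is immediate. -/
theorem chartFrame_spans {κ : Type} [Fintype κ] [DecidableEq κ] (b : Module.Basis κ ℝ B) (p : N)
    {U : Opens N} (hU : ∀ x ∈ U, x ∈ (extChartAt I p).source) {P : SuperPresheaf.{u, w} N}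
    (h : SheafHom (smoothFun I N) P) (hsep : PointSeparated FunctionInclusion.refl h) :
    (chartFrame b p hU).Spans h :=
  Frame.spans_of_generate FunctionInclusion.refl _ b p hU id (fun _ => rfl)
    (fun _ _ s => Algebra.subset_adjoin (Or.inl ⟨s, rfl⟩)) hsep

end SpanningFrames


open Bundle

/-! ## Local structure of Batchelor models -/

section ExteriorFacts

variable {V : Type*} [AddCommGroup V] [Module ℝ V]

theorem contractLeft_extPar (d : Module.Dual ℝ V) (a : ExteriorAlgebra ℝ V) :
    CliffordAlgebra.contractLeft d (extPar a) = -extPar (CliffordAlgebra.contractLeft d a) := by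
  induction a using CliffordAlgebra.left_induction with
  | algebraMap r =>
    rw [AlgHom.commutes, CliffordAlgebra.contractLeft_algebraMap, map_zero, neg_zero]
  | add x y hx hy => rw [map_add, map_add, hx, hy, map_add, map_add, neg_add]
  | ι_mul x m hx =>
    rw [map_mul, CliffordAlgebra.involute_ι, neg_mul, map_neg, CliffordAlgebra.contractLeft_ι_mul,
      CliffordAlgebra.contractLeft_ι_mul, hx, map_sub, map_smul, map_mul,
      CliffordAlgebra.involute_ι]
    noncomm_ring

/-- Contraction is an odd superderivation; it serves as the partial derivative in an odd direction.
-/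
theorem contractLeft_mul (d : Module.Dual ℝ V) (a b : ExteriorAlgebra ℝ V) :
    CliffordAlgebra.contractLeft d (a * b) =
      CliffordAlgebra.contractLeft d a * b + extPar a * CliffordAlgebra.contractLeft d b := by
  induction a using CliffordAlgebra.left_induction with
  | algebraMap r =>
    rw [CliffordAlgebra.contractLeft_algebraMap_mul, CliffordAlgebra.contractLeft_algebraMap,
      zero_mul, zero_add, AlgHom.commutes]
  | add x y hx hy => rw [add_mul, map_add, hx, hy, map_add, map_add, add_mul, add_mul]; abel
  | ι_mul x m hx =>
    rw [mul_assoc, CliffordAlgebra.contractLeft_ι_mul, hx, CliffordAlgebra.contractLeft_ι_mul,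
      map_mul, CliffordAlgebra.involute_ι, sub_mul, mul_add, smul_mul_assoc]
    noncomm_ring

end ExteriorFacts

/-! ### Smooth functions with values in a Grassmann algebra -/

section GrassmannFunctions

variable {B : Type*} [NormedAddCommGroup B] [NormedSpace ℝ B]
  {M : Type u} [TopologicalSpace M] [ChartedSpace B M]
  {F : Type*} [NormedAddCommGroup F] [NormedSpace ℝ F] [FiniteDimensional ℝ F]

variable (F) in
/-- A basis of the Grassmann algebra `Λ(F^*)`. -/
def gBasis := (Module.finBasis ℝ (Module.Dual ℝ F)).ExteriorAlgebra

theorem apply_eq_sum_gBasis (l : Module.Dual ℝ (ExteriorAlgebra ℝ (Module.Dual ℝ F)))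
    (a : ExteriorAlgebra ℝ (Module.Dual ℝ F)) :
    l a = ∑ i, (gBasis F).coord i a * l (gBasis F i) := by
  conv_lhs => rw [← (gBasis F).sum_repr a, map_sum]
  simp

theorem apply_mul_eq_sum_gBasis (l : Module.Dual ℝ (ExteriorAlgebra ℝ (Module.Dual ℝ F)))
    (a c : ExteriorAlgebra ℝ (Module.Dual ℝ F)) :
    l (a * c) = ∑ i, ∑ j, (gBasis F).coord i a * (gBasis F).coord j c *
      l (gBasis F i * gBasis F j) := by
  conv_lhs => rw [← (gBasis F).sum_repr a, ← (gBasis F).sum_repr c]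
  rw [Finset.sum_mul_sum, map_sum]
  refine Finset.sum_congr rfl fun i _ => ?_
  rw [map_sum]
  refine Finset.sum_congr rfl fun j _ => ?_
  rw [smul_mul_smul_comm, map_smul]
  rfl

variable (B F) in
/-- Functions on `V` with values in `Λ(F^*)` with smooth coefficients. -/
def gFun (V : Opens M) : Subalgebra ℝ (V → ExteriorAlgebra ℝ (Module.Dual ℝ F)) where
  carrier := {g | ∀ l : Module.Dual ℝ (ExteriorAlgebra ℝ (Module.Dual ℝ F)),
    ContMDiff 𝓘(ℝ, B) 𝓘(ℝ, ℝ) ∞ fun x => l (g x)}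
  mul_mem' := by
    intro g g' hg hg' l
    rw [show (fun x => l ((g * g') x)) = fun x => ∑ i, ∑ j, (gBasis F).coord i (g x) *
      (gBasis F).coord j (g' x) * l (gBasis F i * gBasis F j) from
        funext fun x => apply_mul_eq_sum_gBasis l (g x) (g' x)]
    exact contMDiff_finsetSum fun i _ => contMDiff_finsetSum fun j _ =>
      ((hg _).mul (hg' _)).mul contMDiff_const
  add_mem' := by
    intro g g' hg hg' l
    simp only [Pi.add_apply, map_add]
    exact (hg l).add (hg' l)
  algebraMap_mem' r l := by
    simp only [Pi.algebraMap_apply]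
    exact contMDiff_const

/-- The coefficient `l ∘ g`. -/
def gCoeff {V : Opens M} (l : Module.Dual ℝ (ExteriorAlgebra ℝ (Module.Dual ℝ F))) :
    gFun B F V →ₗ[ℝ] C^∞⟮𝓘(ℝ, B), V; 𝓘(ℝ, ℝ), ℝ⟯ where
  toFun g := ⟨fun x => l (g.1 x), g.2 l⟩
  map_add' g g' := ContMDiffMap.ext fun x => map_add l _ _
  map_smul' c g := ContMDiffMap.ext fun x => map_smul l c _

theorem gFun_ext {V : Opens M} {g g' : gFun B F V}
    (h : ∀ l, gCoeff l g = gCoeff l g') : g = g' := by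
  refine Subtype.ext (funext fun x => ?_)
  rw [← sub_eq_zero, ← Module.forall_dual_apply_eq_zero_iff ℝ]
  intro l
  rw [map_sub, sub_eq_zero]
  exact congrArg (fun f : C^∞⟮𝓘(ℝ, B), V; 𝓘(ℝ, ℝ), ℝ⟯ => f x) (h l)

/-- The element of `gFun` given by a family of coefficients. -/
def gOfCoeff {V : Opens M} (f : Finset (Fin (Module.finrank ℝ (Module.Dual ℝ F))) →
    C^∞⟮𝓘(ℝ, B), V; 𝓘(ℝ, ℝ), ℝ⟯) : gFun B F V :=
  ⟨fun x => ∑ i, f i x • gBasis F i, fun l => by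
    simp only [map_sum, map_smul, smul_eq_mul]
    exact contMDiff_finsetSum fun i _ => (f i).contMDiff.mul contMDiff_const⟩

theorem gCoeff_gOfCoeff {V : Opens M}
    (f : Finset (Fin (Module.finrank ℝ (Module.Dual ℝ F))) → C^∞⟮𝓘(ℝ, B), V; 𝓘(ℝ, ℝ), ℝ⟯)
    (l : Module.Dual ℝ (ExteriorAlgebra ℝ (Module.Dual ℝ F))) :
    gCoeff l (gOfCoeff f) = ∑ i, l (gBasis F i) • f i := by
  refine ContMDiffMap.ext fun x => ?_
  have e2 : ∀ s : Finset (Fin (Module.finrank ℝ (Module.Dual ℝ F))) →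
      C^∞⟮𝓘(ℝ, B), V; 𝓘(ℝ, ℝ), ℝ⟯, (∑ a, s a) x = ∑ a, s a x := fun s =>
    map_sum (ContMDiffMap.evalRingHom (n := ∞) (I := 𝓘(ℝ, B)) x) s Finset.univ
  change l (∑ i, f i x • gBasis F i) = _
  rw [e2, map_sum]
  refine Finset.sum_congr rfl fun i _ => ?_
  rw [map_smul, smul_eq_mul, mul_comm]
  rfl

theorem gCoeff_eq_sum {V : Opens M} (g : gFun B F V)
    (l : Module.Dual ℝ (ExteriorAlgebra ℝ (Module.Dual ℝ F))) :
    gCoeff l g = ∑ i, l (gBasis F i) • gCoeff ((gBasis F).coord i) g := by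
  rw [← gCoeff_gOfCoeff]
  refine ContMDiffMap.ext fun x => ?_
  change l (g.1 x) = l (∑ i, (gBasis F).coord i (g.1 x) • gBasis F i)
  congr 1
  exact ((gBasis F).sum_repr (g.1 x)).symm

theorem gCoeff_mul {V : Opens M} (g g' : gFun B F V)
    (l : Module.Dual ℝ (ExteriorAlgebra ℝ (Module.Dual ℝ F))) :
    gCoeff l (g * g') = ∑ i, ∑ j, l (gBasis F i * gBasis F j) •
      (gCoeff ((gBasis F).coord i) g * gCoeff ((gBasis F).coord j) g') := by
  refine ContMDiffMap.ext fun x => ?_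
  have e2 : ∀ s : Finset (Fin (Module.finrank ℝ (Module.Dual ℝ F))) →
      C^∞⟮𝓘(ℝ, B), V; 𝓘(ℝ, ℝ), ℝ⟯, (∑ a, s a) x = ∑ a, s a x := fun s =>
    map_sum (ContMDiffMap.evalRingHom (n := ∞) (I := 𝓘(ℝ, B)) x) s Finset.univ
  rw [e2]
  refine (apply_mul_eq_sum_gBasis l (g.1 x) (g'.1 x)).trans ?_
  refine Finset.sum_congr rfl fun i _ => ?_
  rw [e2]
  refine Finset.sum_congr rfl fun j _ => ?_
  exact mul_comm _ _

/-- Restriction of `Λ(F^*)`-valued functions. -/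
def gRes {V W : Opens M} (hW : W ≤ V) : gFun B F V →ₐ[ℝ] gFun B F W where
  toFun g := ⟨fun x => g.1 ⟨x.1, hW x.2⟩, fun l => (resSmooth _ _ hW (gCoeff l g)).contMDiff⟩
  map_one' := rfl
  map_mul' _ _ := rfl
  map_zero' := rfl
  map_add' _ _ := rfl
  commutes' _ := rfl

/-- The parity of `Λ(F^*)`-valued functions. -/
def gPar {V : Opens M} : gFun B F V →ₐ[ℝ] gFun B F V where
  toFun g := ⟨fun x => extPar (g.1 x), fun l => g.2 (l ∘ₗ extPar.toLinearMap)⟩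
  map_one' := Subtype.ext (funext fun _ => map_one _)
  map_mul' _ _ := Subtype.ext (funext fun _ => map_mul _ _ _)
  map_zero' := Subtype.ext (funext fun _ => map_zero _)
  map_add' _ _ := Subtype.ext (funext fun _ => map_add _ _ _)
  commutes' r := Subtype.ext (funext fun _ => AlgHom.commutes _ r)

/-- Constant functions. -/
def gConst (V : Opens M) : ExteriorAlgebra ℝ (Module.Dual ℝ F) →ₐ[ℝ] gFun B F V where
  toFun om := ⟨fun _ => om, fun _ => contMDiff_const⟩
  map_one' := rfl
  map_mul' _ _ := rfl
  map_zero' := rfl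
  map_add' _ _ := rfl
  commutes' _ := rfl

/-- Scalar functions. -/
def gScalar (V : Opens M) : C^∞⟮𝓘(ℝ, B), V; 𝓘(ℝ, ℝ), ℝ⟯ →ₐ[ℝ] gFun B F V where
  toFun f := ⟨fun x => algebraMap ℝ _ (f x), fun l => by
    simp only [Algebra.algebraMap_eq_smul_one, map_smul, smul_eq_mul]
    exact f.contMDiff.mul contMDiff_const⟩
  map_one' := Subtype.ext (funext fun _ => map_one _)
  map_mul' f g := Subtype.ext (funext fun x => map_mul (algebraMap ℝ _) (f x) (g x))
  map_zero' := Subtype.ext (funext fun _ => map_zero _)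
  map_add' f g := Subtype.ext (funext fun x => map_add (algebraMap ℝ _) (f x) (g x))
  commutes' _ := rfl

theorem gCoeff_gScalar {V : Opens M} (f : C^∞⟮𝓘(ℝ, B), V; 𝓘(ℝ, ℝ), ℝ⟯)
    (l : Module.Dual ℝ (ExteriorAlgebra ℝ (Module.Dual ℝ F))) :
    gCoeff l (gScalar V f) = l 1 • f := by
  refine ContMDiffMap.ext fun x => ?_
  change l (algebraMap ℝ _ (f x)) = l 1 * f x
  rw [Algebra.algebraMap_eq_smul_one, map_smul, smul_eq_mul, mul_comm]

theorem gFun_eq_sum {V : Opens M} (g : gFun B F V) :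
    g = ∑ i, gScalar V (gCoeff ((gBasis F).coord i) g) * gConst V (gBasis F i) := by
  refine Subtype.ext (funext fun x => ?_)
  rw [AddSubmonoidClass.coe_finset_sum, Finset.sum_apply]
  conv_lhs => rw [← (gBasis F).sum_repr (g.1 x)]
  refine Finset.sum_congr rfl fun i _ => ?_
  rw [Algebra.smul_def]
  rfl

/-- Contraction with `v ∈ F`, the derivative in an odd direction. -/
def gContract (v : F) (V : Opens M) : gFun B F V →ₗ[ℝ] gFun B F V where
  toFun g := ⟨fun x => CliffordAlgebra.contractLeft (Module.Dual.eval ℝ F v) (g.1 x),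
    fun l => g.2 (l ∘ₗ CliffordAlgebra.contractLeft (Module.Dual.eval ℝ F v))⟩
  map_add' _ _ := Subtype.ext (funext fun _ => map_add _ _ _)
  map_smul' c g := Subtype.ext (funext fun x =>
    map_smul (CliffordAlgebra.contractLeft (Module.Dual.eval ℝ F v)) c (g.1 x))

theorem gContract_mul (v : F) {V : Opens M} (g g' : gFun B F V) :
    gContract v V (g * g') = gContract v V g * g' + gPar g * gContract v V g' :=
  Subtype.ext (funext fun _ => contractLeft_mul _ _ _)

theorem gContract_par (v : F) {V : Opens M} (g : gFun B F V) :
    gContract v V (gPar g) = -gPar (gContract v V g) :=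
  Subtype.ext (funext fun _ => contractLeft_extPar _ _)

theorem gContract_gScalar (v : F) {V : Opens M} (f : C^∞⟮𝓘(ℝ, B), V; 𝓘(ℝ, ℝ), ℝ⟯) :
    gContract v V (gScalar V f) = 0 :=
  Subtype.ext (funext fun _ => CliffordAlgebra.contractLeft_algebraMap _ _ _)

theorem gContract_gConst_ι (v : F) (V : Opens M) (m : Module.Dual ℝ F) :
    gContract (B := B) v V (gConst V (ExteriorAlgebra.ι ℝ m)) = algebraMap ℝ _ (m v) :=
  Subtype.ext (funext fun _ => CliffordAlgebra.contractLeft_ι _ _ _)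

variable [IsManifold 𝓘(ℝ, B) ∞ M]

/-- The coefficientwise derivative in the direction `v` of the chart at `p`. -/
def gDeriv (p : M) (v : B) {V : Opens M} (hV : ∀ x ∈ V, x ∈ (extChartAt 𝓘(ℝ, B) p).source) :
    gFun B F V →ₗ[ℝ] gFun B F V where
  toFun g := gOfCoeff fun i => chartDeriv p v hV (gCoeff ((gBasis F).coord i) g)
  map_add' g g' := gFun_ext fun l => by
    simp only [map_add, gCoeff_gOfCoeff, smul_add, Finset.sum_add_distrib]
  map_smul' c g := gFun_ext fun l => by
    simp only [map_smul, gCoeff_gOfCoeff, Finset.smul_sum, RingHom.id_apply]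
    exact Finset.sum_congr rfl fun i _ => smul_comm _ _ _

theorem gCoeff_gDeriv (p : M) (v : B) {V : Opens M}
    (hV : ∀ x ∈ V, x ∈ (extChartAt 𝓘(ℝ, B) p).source) (g : gFun B F V)
    (l : Module.Dual ℝ (ExteriorAlgebra ℝ (Module.Dual ℝ F))) :
    gCoeff l (gDeriv p v hV g) = chartDeriv p v hV (gCoeff l g) := by
  rw [gCoeff_eq_sum g l, map_sum]
  refine (gCoeff_gOfCoeff _ l).trans ?_
  simp only [map_smul]

theorem gDeriv_mul (p : M) (v : B) {V : Opens M}
    (hV : ∀ x ∈ V, x ∈ (extChartAt 𝓘(ℝ, B) p).source) (g g' : gFun B F V) :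
    gDeriv p v hV (g * g') = gDeriv p v hV g * g' + g * gDeriv p v hV g' := by
  refine gFun_ext fun l => ?_
  rw [gCoeff_gDeriv, map_add, gCoeff_mul, gCoeff_mul, gCoeff_mul]
  simp only [map_sum, map_smul, chartDeriv_mul, gCoeff_gDeriv, smul_add, Finset.sum_add_distrib]

theorem gDeriv_par (p : M) (v : B) {V : Opens M}
    (hV : ∀ x ∈ V, x ∈ (extChartAt 𝓘(ℝ, B) p).source) (g : gFun B F V) :
    gDeriv p v hV (gPar g) = gPar (gDeriv p v hV g) := by
  refine gFun_ext fun l => ?_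
  rw [gCoeff_gDeriv]
  -- The parity involution is linear, so it can be absorbed into the functional.
  exact (gCoeff_gDeriv p v hV g (l ∘ₗ extPar.toLinearMap)).symm

theorem gDeriv_res (p : M) (v : B) {V W : Opens M}
    (hV : ∀ x ∈ V, x ∈ (extChartAt 𝓘(ℝ, B) p).source) (hW : W ≤ V) (g : gFun B F V) :
    gRes hW (gDeriv p v hV g) = gDeriv p v (fun x hx => hV x (hW hx)) (gRes hW g) := by
  refine gFun_ext fun l => ?_
  rw [gCoeff_gDeriv]
  refine Eq.trans ?_ (chartDeriv_res p v hV hW (gCoeff l g))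
  rw [← gCoeff_gDeriv]
  rfl

theorem gDeriv_gScalar (p : M) (v : B) {V : Opens M}
    (hV : ∀ x ∈ V, x ∈ (extChartAt 𝓘(ℝ, B) p).source) (f : C^∞⟮𝓘(ℝ, B), V; 𝓘(ℝ, ℝ), ℝ⟯) :
    gDeriv (F := F) p v hV (gScalar V f) = gScalar V (chartDeriv p v hV f) := by
  refine gFun_ext fun l => ?_
  rw [gCoeff_gDeriv, gCoeff_gScalar, gCoeff_gScalar, map_smul]

theorem chartDeriv_algebraMap (p : M) (v : B) {V : Opens M}
    (hV : ∀ x ∈ V, x ∈ (extChartAt 𝓘(ℝ, B) p).source) (r : ℝ) :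
    chartDeriv p v hV (algebraMap ℝ C^∞⟮𝓘(ℝ, B), V; 𝓘(ℝ, ℝ), ℝ⟯ r) = 0 := by
  have h1 : chartDeriv p v hV (1 : C^∞⟮𝓘(ℝ, B), V; 𝓘(ℝ, ℝ), ℝ⟯) = 0 := by
    have := chartDeriv_mul p v hV (1 : C^∞⟮𝓘(ℝ, B), V; 𝓘(ℝ, ℝ), ℝ⟯) 1
    rw [mul_one, one_mul, mul_one] at this
    exact left_eq_add.1 this
  rw [Algebra.algebraMap_eq_smul_one, map_smul, h1, smul_zero]

theorem gDeriv_gConst (p : M) (v : B) {V : Opens M}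
    (hV : ∀ x ∈ V, x ∈ (extChartAt 𝓘(ℝ, B) p).source)
    (om : ExteriorAlgebra ℝ (Module.Dual ℝ F)) : gDeriv p v hV (gConst V om) = 0 := by
  refine gFun_ext fun l => ?_
  rw [gCoeff_gDeriv, map_zero]
  exact chartDeriv_algebraMap p v hV (l om)

end GrassmannFunctions

/-! ### Trivializations of ΛE^* -/

section LocalModel

variable {B : Type*} [NormedAddCommGroup B] [NormedSpace ℝ B]
  {M : Type u} [TopologicalSpace M] [ChartedSpace B M]
  {F : Type*} [NormedAddCommGroup F] [NormedSpace ℝ F]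
  {E : M → Type*} [TopologicalSpace (TotalSpace F E)] [∀ x, AddCommGroup (E x)]
  [∀ x, Module ℝ (E x)] [∀ x, TopologicalSpace (E x)] [FiberBundle F E] [VectorBundle ℝ F E]

variable (F E) in
/-- The inverse of `localRep`. -/
def localInv (p x : M) :
    ExteriorAlgebra ℝ (Module.Dual ℝ F) →ₐ[ℝ] ExteriorAlgebra ℝ (Module.Dual ℝ (E x)) :=
  ExteriorAlgebra.map
    (((trivializationAt F E p).continuousLinearMapAt ℝ x).toLinearMap.dualMap)

theorem localRep_localInv {p x : M} (hx : x ∈ (trivializationAt F E p).baseSet)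
    (om : ExteriorAlgebra ℝ (Module.Dual ℝ F)) :
    localRep F E p x (localInv F E p x om) = om := by
  have h1 : (((trivializationAt F E p).symmL ℝ x).toLinearMap.dualMap) ∘ₗ
      (((trivializationAt F E p).continuousLinearMapAt ℝ x).toLinearMap.dualMap) =
        LinearMap.id := by
    ext m y
    exact congrArg m ((trivializationAt F E p).continuousLinearMapAt_symmL (R := ℝ) hx y)
  have h2 := DFunLike.congr_fun (ExteriorAlgebra.map_comp_map
    (((trivializationAt F E p).continuousLinearMapAt ℝ x).toLinearMap.dualMap)
    (((trivializationAt F E p).symmL ℝ x).toLinearMap.dualMap)) om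
  rw [h1, ExteriorAlgebra.map_id] at h2
  exact h2

theorem localInv_localRep {p x : M} (hx : x ∈ (trivializationAt F E p).baseSet)
    (om : ExteriorAlgebra ℝ (Module.Dual ℝ (E x))) :
    localInv F E p x (localRep F E p x om) = om := by
  have h1 : (((trivializationAt F E p).continuousLinearMapAt ℝ x).toLinearMap.dualMap) ∘ₗ
      (((trivializationAt F E p).symmL ℝ x).toLinearMap.dualMap) = LinearMap.id := by
    ext m y
    exact congrArg m ((trivializationAt F E p).symmL_continuousLinearMapAt (R := ℝ) hx y)
  have h2 := DFunLike.congr_fun (ExteriorAlgebra.map_comp_map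
    (((trivializationAt F E p).symmL ℝ x).toLinearMap.dualMap)
    (((trivializationAt F E p).continuousLinearMapAt ℝ x).toLinearMap.dualMap)) om
  rw [h1, ExteriorAlgebra.map_id] at h2
  exact h2

variable [FiniteDimensional ℝ F] [ContMDiffVectorBundle ∞ F E 𝓘(ℝ, B)]

variable (B F E) in
/-- The transition functions of `ΛE^*` are smooth. -/
theorem contMDiffAt_transition {p q x₀ : M} (hp : x₀ ∈ (trivializationAt F E p).baseSet)
    (hq : x₀ ∈ (trivializationAt F E q).baseSet) (om : ExteriorAlgebra ℝ (Module.Dual ℝ F)) :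
    ∀ l : Module.Dual ℝ (ExteriorAlgebra ℝ (Module.Dual ℝ F)), ContMDiffAt 𝓘(ℝ, B) 𝓘(ℝ, ℝ) ∞
      (fun x : M => l (localRep F E q x (localInv F E p x om))) x₀ := by
  induction om using ExteriorAlgebra.induction with
  | algebraMap r =>
    intro l
    simp only [AlgHom.commutes]
    exact contMDiffAt_const
  -- On generators the transition is composition with the coordinate change of E, whose matrix
  -- entries are smooth; the resulting form is expanded in the dual basis.
  | ι m =>
    intro l
    let c := Module.finBasis ℝ F
    have hA : ContMDiffAt 𝓘(ℝ, B) 𝓘(ℝ, F →L[ℝ] F) ∞ (fun x : M =>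
        ((trivializationAt F E q).coordChangeL ℝ (trivializationAt F E p) x : F →L[ℝ] F)) x₀ :=
      (contMDiffOn_coordChangeL (trivializationAt F E q) (trivializationAt F E p)).contMDiffAt
        (((trivializationAt F E q).open_baseSet.inter
          (trivializationAt F E p).open_baseSet).mem_nhds ⟨hq, hp⟩)
    have hj : ∀ j, ContMDiffAt 𝓘(ℝ, B) 𝓘(ℝ, ℝ) ∞ (fun x : M => m
        (((trivializationAt F E q).coordChangeL ℝ (trivializationAt F E p) x : F →L[ℝ] F)
          (c j))) x₀ := fun j =>
      (m.toContinuousLinearMap.contDiff.contMDiff.contMDiffAt).comp x₀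
        (hA.clm_apply contMDiffAt_const)
    have hsum : ContMDiffAt 𝓘(ℝ, B) 𝓘(ℝ, ℝ) ∞ (fun x : M => ∑ j, m
        (((trivializationAt F E q).coordChangeL ℝ (trivializationAt F E p) x : F →L[ℝ] F)
          (c j)) * l (ExteriorAlgebra.ι ℝ (c.coord j))) x₀ :=
      ContMDiffAt.sum fun j _ => (hj j).mul contMDiffAt_const
    refine hsum.congr_of_eventuallyEq ?_
    filter_upwards [((trivializationAt F E q).open_baseSet.inter
      (trivializationAt F E p).open_baseSet).mem_nhds ⟨hq, hp⟩] with x hx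
    have e1 : localRep F E q x (localInv F E p x (ExteriorAlgebra.ι ℝ m)) =
        ExteriorAlgebra.ι ℝ (m ∘ₗ
          ((trivializationAt F E q).coordChangeL ℝ (trivializationAt F E p) x :
            F →L[ℝ] F).toLinearMap) := by
      rw [localRep, localInv, ExteriorAlgebra.map_apply_ι, ExteriorAlgebra.map_apply_ι]
      congr 1
      ext y
      change m ((trivializationAt F E p).continuousLinearMapAt ℝ x
        ((trivializationAt F E q).symmL ℝ x y)) = _
      rw [Trivialization.continuousLinearMapAt_apply_of_mem ℝ _ hx.2,
        Trivialization.symmL_apply _ hx.1]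
      exact congrArg m (Trivialization.coordChangeL_apply _ _ hx y).symm
    have e2 : ∀ m' : Module.Dual ℝ F, m' = ∑ j, m' (c j) • c.coord j := by
      intro m'
      refine c.ext fun i => ?_
      simp [Finsupp.single_apply]
    rw [e1, e2 (m ∘ₗ _), map_sum, map_sum]
    refine Finset.sum_congr rfl fun j _ => ?_
    rw [map_smul, map_smul]
    rfl
  -- A functional of a product is a bilinear expression in the coefficients of the factors.
  | mul a b ha hb =>
    intro l
    simp only [map_mul]
    have h1 : ContMDiffAt 𝓘(ℝ, B) 𝓘(ℝ, ℝ) ∞ (fun x : M => ∑ i, ∑ j,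
        (gBasis F).coord i (localRep F E q x (localInv F E p x a)) *
          (gBasis F).coord j (localRep F E q x (localInv F E p x b)) *
            l (gBasis F i * gBasis F j)) x₀ :=
      ContMDiffAt.sum fun i _ => ContMDiffAt.sum fun j _ =>
        ((ha _).mul (hb _)).mul contMDiffAt_const
    exact h1.congr_of_eventuallyEq (Filter.Eventually.of_forall fun x =>
      apply_mul_eq_sum_gBasis l _ _)
  | add a b ha hb =>
    intro l
    simp only [map_add]
    exact (ha l).add (hb l)

variable (B) in
-- Smoothness of a section at a point is defined through the trivialization centred at that point.
-- Smoothness of the transition functions allows one fixed trivialization to be used on its whole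
-- domain.
theorem contMDiffAt_localRep_change {V : Opens M} {p q : M} {x₀ : V}
    (hp : x₀.1 ∈ (trivializationAt F E p).baseSet) (hq : x₀.1 ∈ (trivializationAt F E q).baseSet)
    {s : ∀ x : V, ExteriorAlgebra ℝ (Module.Dual ℝ (E x.1))}
    (hs : ∀ l : Module.Dual ℝ (ExteriorAlgebra ℝ (Module.Dual ℝ F)), ContMDiffAt 𝓘(ℝ, B) 𝓘(ℝ, ℝ) ∞
      (fun x : V => l (localRep F E p x.1 (s x))) x₀)
    (l : Module.Dual ℝ (ExteriorAlgebra ℝ (Module.Dual ℝ F))) :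
    ContMDiffAt 𝓘(ℝ, B) 𝓘(ℝ, ℝ) ∞ (fun x : V => l (localRep F E q x.1 (s x))) x₀ := by
  have h1 : ContMDiffAt 𝓘(ℝ, B) 𝓘(ℝ, ℝ) ∞ (fun x : V => ∑ i,
      (gBasis F).coord i (localRep F E p x.1 (s x)) *
        l (localRep F E q x.1 (localInv F E p x.1 (gBasis F i)))) x₀ :=
    ContMDiffAt.sum fun i _ => (hs _).mul
      (contMDiffAt_subtype_iff.2 (contMDiffAt_transition B F E hp hq (gBasis F i) l))
  refine h1.congr_of_eventuallyEq ?_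
  filter_upwards [((trivializationAt F E p).open_baseSet.preimage
    continuous_subtype_val).mem_nhds hp] with x hx
  have := apply_eq_sum_gBasis (l ∘ₗ (localRep F E q x.1).toLinearMap ∘ₗ
    (localInv F E p x.1).toLinearMap) (localRep F E p x.1 (s x))
  simp only [LinearMap.comp_apply, AlgHom.toLinearMap_apply, localInv_localRep hx] at this
  exact this

variable (B F E) in
/-- Sections of `ΛE^*` over a trivializing open set are `Λ(F^*)`-valued functions. -/
def sectionEquiv (p : M) {V : Opens M} (hV : ∀ x ∈ V, x ∈ (trivializationAt F E p).baseSet) :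
    smoothSections B F E V ≃ₐ[ℝ] gFun B F V where
  toFun s := ⟨fun x => localRep F E p x.1 (s.1 x), fun l x₀ =>
    contMDiffAt_localRep_change B (FiberBundle.mem_baseSet_trivializationAt' x₀.1) (hV x₀.1 x₀.2)
      (fun l => s.2 x₀ l) l⟩
  invFun g := ⟨fun x => localInv F E p x.1 (g.1 x), fun x₀ l =>
    contMDiffAt_localRep_change B (hV x₀.1 x₀.2) (FiberBundle.mem_baseSet_trivializationAt' x₀.1)
      (fun l => by
        refine (g.2 l x₀).congr_of_eventuallyEq (Filter.Eventually.of_forall fun x => ?_)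
        change l (localRep F E p x.1 (localInv F E p x.1 (g.1 x))) = _
        rw [localRep_localInv (hV x.1 x.2)]) l⟩
  left_inv s := Subtype.ext (funext fun x => localInv_localRep (hV x.1 x.2) _)
  right_inv g := Subtype.ext (funext fun x => localRep_localInv (hV x.1 x.2) _)
  map_mul' _ _ := Subtype.ext (funext fun _ => map_mul _ _ _)
  map_add' _ _ := Subtype.ext (funext fun _ => map_add _ _ _)
  commutes' r := Subtype.ext (funext fun _ => AlgHom.commutes _ r)

end LocalModel

/-! ## Frames of a supermanifold with a Batchelor model -/

section SplitFrame

variable {B : Type*} [NormedAddCommGroup B] [NormedSpace ℝ B]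
  {M : Type u} [TopologicalSpace M] [ChartedSpace B M]
  {F : Type*} [NormedAddCommGroup F] [NormedSpace ℝ F] [FiniteDimensional ℝ F]
  {E : M → Type*} [TopologicalSpace (TotalSpace F E)] [∀ x, AddCommGroup (E x)]
  [∀ x, Module ℝ (E x)] [∀ x, TopologicalSpace (E x)] [FiberBundle F E] [VectorBundle ℝ F E]
  {Ms : SuperPresheaf.{u, v} M}

/-- `β` as an isomorphism onto sections of `ΛE^*`. -/
def secEquiv (β : SheafIso Ms (batchelor B F E)) (V : Opens M) :
    Ms.obj V ≃ₐ[ℝ] smoothSections B F E V :=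
  AlgEquiv.ofBijective (β.app V) (β.bijective V)

theorem secEquiv_res (β : SheafIso Ms (batchelor B F E)) {V W : Opens M} (hW : W ≤ V)
    (s : Ms.obj V) (x : W) :
    (secEquiv β W (Ms.res hW s)).1 x = (secEquiv β V s).1 ⟨x.1, hW x.2⟩ :=
  congrFun (congrArg Subtype.val (β.app_res hW s)) x

theorem secEquiv_par (β : SheafIso Ms (batchelor B F E)) {V : Opens M} (s : Ms.obj V) (x : V) :
    (secEquiv β V (Ms.par V s)).1 x = extPar ((secEquiv β V s).1 x) :=
  congrFun (congrArg Subtype.val (β.app_par V s)) x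

variable (F E) in
/-- Functions as sections of `ΛE^*`. -/
def scalarSection (V : Opens M) : C^∞⟮𝓘(ℝ, B), V; 𝓘(ℝ, ℝ), ℝ⟯ →ₐ[ℝ] smoothSections B F E V where
  toFun f := ⟨fun x => algebraMap ℝ _ (f x), fun x₀ l => by
    simp only [AlgHom.commutes]
    simp only [Algebra.algebraMap_eq_smul_one, map_smul, smul_eq_mul]
    exact f.contMDiff.contMDiffAt.mul contMDiffAt_const⟩
  map_one' := Subtype.ext (funext fun _ => map_one _)
  map_mul' f g := Subtype.ext (funext fun x => map_mul (algebraMap ℝ _) (f x) (g x))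
  map_zero' := Subtype.ext (funext fun _ => map_zero _)
  map_add' f g := Subtype.ext (funext fun x => map_add (algebraMap ℝ _) (f x) (g x))
  commutes' _ := rfl

theorem secEquiv_symm_scalarSection (β : SheafIso Ms (batchelor B F E)) (V : Opens M)
    (f : C^∞⟮𝓘(ℝ, B), V; 𝓘(ℝ, ℝ), ℝ⟯) (x : V) :
    (secEquiv β V ((secEquiv β V).symm (scalarSection F E V f))).1 x = algebraMap ℝ _ (f x) :=
  congrFun (congrArg Subtype.val (AlgEquiv.apply_symm_apply _ _)) x

/-- Functions as superfunctions. -/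
def funIncl (β : SheafIso Ms (batchelor B F E)) : FunctionInclusion 𝓘(ℝ, B) Ms where
  app V := ((secEquiv β V).symm : smoothSections B F E V →ₐ[ℝ] Ms.obj V).comp
    (scalarSection F E V)
  app_res {V W} hW f := by
    refine (secEquiv β W).injective (Subtype.ext (funext fun x => ?_))
    refine (secEquiv_res β hW _ x).trans ((secEquiv_symm_scalarSection β V f _).trans ?_)
    exact (secEquiv_symm_scalarSection β W (resSmooth _ _ hW f) x).symm
  par_app V f := by
    refine (secEquiv β V).injective (Subtype.ext (funext fun x => ?_))
    refine (secEquiv_par β _ x).trans ?_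
    refine (congrArg extPar (secEquiv_symm_scalarSection β V f x)).trans ?_
    exact (AlgHom.commutes _ _).trans (secEquiv_symm_scalarSection β V f x).symm

theorem secEquiv_funIncl (β : SheafIso Ms (batchelor B F E)) (V : Opens M)
    (f : C^∞⟮𝓘(ℝ, B), V; 𝓘(ℝ, ℝ), ℝ⟯) (x : V) :
    (secEquiv β V ((funIncl β).app V f)).1 x = algebraMap ℝ _ (f x) :=
  secEquiv_symm_scalarSection β V f x

/-- The functionals are the linear forms on the exterior algebra of a single fibre, applied to the
value of a section there. -/
theorem funIncl_pointSeparated (β : SheafIso Ms (batchelor B F E)) :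
    PointSeparated (funIncl β) (SheafHom.id Ms) := by
  intro V b hb
  refine (secEquiv β V).injective (Subtype.ext (funext fun x => ?_))
  rw [map_zero]
  change _ = 0
  rw [← Module.forall_dual_apply_eq_zero_iff ℝ]
  intro l
  refine hb x.1 x.2 ⟨fun V hx => ⟨⟨fun s => l ((secEquiv β V s).1 ⟨x.1, hx⟩), fun s s' => ?_⟩,
    fun c s => ?_⟩, fun hW hx s => ?_, fun hx f s => ?_⟩
  · exact (congrArg (fun t : smoothSections B F E V => l (t.1 ⟨x.1, hx⟩))
      (map_add (secEquiv β V) s s')).trans (map_add l _ _)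
  · exact (congrArg (fun t : smoothSections B F E V => l (t.1 ⟨x.1, hx⟩))
      (map_smul (secEquiv β V) c s)).trans (map_smul l _ _)
  · exact congrArg l (secEquiv_res β hW s ⟨x.1, hx⟩)
  · refine (congrArg (fun t : smoothSections B F E _ => l (t.1 ⟨x.1, hx⟩))
      (map_mul (secEquiv β _) ((funIncl β).app _ f) s)).trans ?_
    refine (congrArg l (congrArg (· * _) (secEquiv_funIncl β _ f ⟨x.1, hx⟩))).trans ?_
    rw [← Algebra.smul_def, map_smul]
    rfl

variable [ContMDiffVectorBundle ∞ F E 𝓘(ℝ, B)]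

/-- Superfunctions over a trivializing open set are `Λ(F^*)`-valued functions. -/
def locEquiv (β : SheafIso Ms (batchelor B F E)) (p : M) {V : Opens M}
    (hV : ∀ x ∈ V, x ∈ (trivializationAt F E p).baseSet) : Ms.obj V ≃ₐ[ℝ] gFun B F V :=
  (secEquiv β V).trans (sectionEquiv B F E p hV)

section

variable (β : SheafIso Ms (batchelor B F E)) (p : M) {V W : Opens M}
  (hV : ∀ x ∈ V, x ∈ (trivializationAt F E p).baseSet)

theorem gRes_locEquiv (hW : W ≤ V) (s : Ms.obj V) :
    gRes hW (locEquiv β p hV s) = locEquiv β p (fun x hx => hV x (hW hx)) (Ms.res hW s) :=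
  Subtype.ext (funext fun x => (congrArg (localRep F E p x.1) (secEquiv_res β hW s x)).symm)

theorem gPar_locEquiv (s : Ms.obj V) :
    gPar (locEquiv β p hV s) = locEquiv β p hV (Ms.par V s) :=
  Subtype.ext (funext fun x => ((congrArg (localRep F E p x.1) (secEquiv_par β s x)).trans
    (extPar_map _ _)).symm)

theorem locEquiv_funIncl (f : C^∞⟮𝓘(ℝ, B), V; 𝓘(ℝ, ℝ), ℝ⟯) :
    locEquiv β p hV ((funIncl β).app V f) = gScalar V f :=
  Subtype.ext (funext fun x => (congrArg (localRep F E p x.1) (secEquiv_funIncl β V f x)).trans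
    (AlgHom.commutes _ _))

theorem res_locEquiv_symm (hW : W ≤ V) (g : gFun B F V) :
    Ms.res hW ((locEquiv β p hV).symm g) =
      (locEquiv β p (fun x hx => hV x (hW hx))).symm (gRes hW g) := by
  rw [AlgEquiv.eq_symm_apply, ← gRes_locEquiv β p hV hW, AlgEquiv.apply_symm_apply]

theorem par_locEquiv_symm (g : gFun B F V) :
    Ms.par V ((locEquiv β p hV).symm g) = (locEquiv β p hV).symm (gPar g) := by
  rw [AlgEquiv.eq_symm_apply, ← gPar_locEquiv β p hV, AlgEquiv.apply_symm_apply]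

end

/-- Superderivations over a trivializing open set, given by operators on `Λ(F^*)`-valued
functions. -/
def localVF (β : SheafIso Ms (batchelor B F E)) (p : M) {U : Opens M}
    (hU : ∀ x ∈ U, x ∈ (trivializationAt F E p).baseSet) (q : ZMod 2)
    (D : ∀ V : Opens M, V ≤ U → (gFun B F V →ₗ[ℝ] gFun B F V))
    (hres : ∀ V W (hV : V ≤ U) (hW : W ≤ V) g, gRes hW (D V hV g) = D W (hW.trans hV) (gRes hW g))
    (hpar : ∀ V (hV : V ≤ U) g, gPar (D V hV g) = psign q • D V hV (gPar g))
    (hmul : ∀ V (hV : V ≤ U) g g', D V hV (g * g') =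
      D V hV g * g' + (if q = 0 then g else gPar g) * D V hV g') : homDer (SheafHom.id Ms) q U :=
  ⟨fun V => (locEquiv β p fun x hx => hU x (V.2 hx)).symm.toLinearMap ∘ₗ D V.1 V.2 ∘ₗ
      (locEquiv β p fun x hx => hU x (V.2 hx)).toLinearMap, by
    refine ⟨fun V W hW s => ?_, fun V s => ?_, fun V s s' => ?_⟩
    · change Ms.res hW ((locEquiv β p _).symm _) = (locEquiv β p _).symm _
      rw [res_locEquiv_symm]
      refine congrArg _ ((hres V.1 W.1 V.2 hW _).trans ?_)
      exact congrArg _ (gRes_locEquiv β p _ hW s)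
    · change Ms.par V.1 ((locEquiv β p _).symm _) = psign q • (locEquiv β p _).symm _
      rw [par_locEquiv_symm, ← map_smul]
      refine congrArg _ ((hpar V.1 V.2 _).trans ?_)
      exact congrArg (fun t => psign q • D V.1 V.2 t) (gPar_locEquiv β p _ s)
    · change (locEquiv β p _).symm (D V.1 V.2 (locEquiv β p _ (s * s'))) =
        (locEquiv β p _).symm _ * s' + Ms.twist q V.1 s * (locEquiv β p _).symm _
      rw [map_mul, hmul V.1 V.2, map_add, map_mul, map_mul]
      refine congrArg₂ _ (congrArg _ (AlgEquiv.symm_apply_apply _ _)) (congrArg (· * _) ?_)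
      rw [AlgEquiv.symm_apply_eq]
      by_cases hq : q = 0
      · simp only [SuperPresheaf.twist, hq, if_true]
        rfl
      · simp only [SuperPresheaf.twist, hq, if_false]
        exact gPar_locEquiv β p _ s⟩

/-- The even and odd directions of a chart. -/
abbrev SplitIdx (B : Type*) [NormedAddCommGroup B] [NormedSpace ℝ B] (F : Type*)
    [NormedAddCommGroup F] [NormedSpace ℝ F] : Type :=
  Fin (Module.finrank ℝ B) ⊕ Fin (Module.finrank ℝ F)

/-- The parity of a direction. -/
def splitParity : SplitIdx B F → ZMod 2 := Sum.elim (fun _ => 0) (fun _ => 1)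

variable [IsManifold 𝓘(ℝ, B) ∞ M] [FiniteDimensional ℝ B]

variable (B F E) in
/-- The domain of the chart of the supermanifold at `p`. -/
def splitDom (p : M) : Opens M :=
  ⟨(chartAt B p).source ∩ (trivializationAt F E p).baseSet,
    (chartAt B p).open_source.inter (trivializationAt F E p).open_baseSet⟩

theorem mem_splitDom (p : M) : p ∈ splitDom B F E p :=
  ⟨mem_chart_source B p, FiberBundle.mem_baseSet_trivializationAt' p⟩

theorem splitDom_chart {p x : M} (hx : x ∈ splitDom B F E p) :
    x ∈ (extChartAt 𝓘(ℝ, B) p).source := by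
  rw [extChartAt_source]
  exact hx.1

theorem splitDom_triv {p x : M} (hx : x ∈ splitDom B F E p) :
    x ∈ (trivializationAt F E p).baseSet := hx.2

/-- The linear coordinates on `B`. -/
abbrev baseCoord (B : Type*) [NormedAddCommGroup B] [NormedSpace ℝ B] [FiniteDimensional ℝ B]
    (i : Fin (Module.finrank ℝ B)) : B →L[ℝ] ℝ :=
  ((Module.finBasis ℝ B).coord i).toContinuousLinearMap

/-- The coordinates of the chart of the supermanifold at `p`. -/
def splitCoord (β : SheafIso Ms (batchelor B F E)) (p : M) :
    SplitIdx B F → Ms.obj (splitDom B F E p) :=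
  Sum.elim
    (fun i => (funIncl β).app _ (chartCoord 𝓘(ℝ, B) p (baseCoord B i)
      fun _ hx => splitDom_chart hx))
    (fun a => (locEquiv β p fun _ hx => splitDom_triv hx).symm
      (gConst _ (ExteriorAlgebra.ι ℝ ((Module.finBasis ℝ F).coord a))))

/-- The coordinate vector fields of the chart of the supermanifold at `p`. -/
def splitPartial (β : SheafIso Ms (batchelor B F E)) (p : M) :
    SplitIdx B F → VF Ms (splitDom B F E p) :=
  Sum.elim
    (fun i => Der.ofHom (localVF β p (fun _ hx => splitDom_triv hx) 0
      (fun _ hV => gDeriv p (Module.finBasis ℝ B i) fun _ hx => splitDom_chart (hV hx))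
      (fun _ _ hV hW g => gDeriv_res p _ _ hW g)
      (fun V hV g => by rw [gDeriv_par]; simp [psign])
      (fun V hV g g' => by rw [gDeriv_mul]; simp)))
    (fun a => Der.ofHom (localVF β p (fun _ hx => splitDom_triv hx) 1
      (fun V _ => gContract (Module.finBasis ℝ F a) V)
      (fun _ _ _ _ _ => rfl)
      (fun V hV g => by rw [gContract_par]; simp [psign])
      (fun V hV g g' => by rw [gContract_mul]; simp)))

theorem splitCoord_par (β : SheafIso Ms (batchelor B F E)) (p : M) (a : SplitIdx B F) :
    Ms.par _ (splitCoord β p a) = psign (splitParity a) • splitCoord β p a := by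
  rcases a with i | a
  · simp only [splitCoord, splitParity, Sum.elim_inl, psign, if_true, one_smul]
    exact (funIncl β).par_app _ _
  · simp only [splitCoord, splitParity, Sum.elim_inr, psign, one_ne_zero, if_false, neg_smul,
      one_smul]
    rw [par_locEquiv_symm, ← map_neg]
    congr 1
    exact Subtype.ext (funext fun _ => CliffordAlgebra.involute_ι _)

/-- The chart of the supermanifold at `p`. -/
def splitFrame (β : SheafIso Ms (batchelor B F E)) (p : M) :
    Frame Ms (splitDom B F E p) (SplitIdx B F) where
  parity := splitParity
  x := splitCoord β p
  d := splitPartial β p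
  x_par := splitCoord_par β p
  d_par a := by
    rcases a with i | a
    · exact Der.ofHom_hasParity _
    · exact Der.ofHom_hasParity _
  d_x a b := by
    rcases a with i | a
    · change (locEquiv β p _).symm (gDeriv p _ _ (locEquiv β p _ (splitCoord β p b))) = _
      rw [AlgEquiv.symm_apply_eq]
      rcases b with j | b
      · simp only [splitCoord, Sum.elim_inl, locEquiv_funIncl, gDeriv_gScalar]
        refine Subtype.ext (funext fun x => ?_)
        refine (congrArg (algebraMap ℝ _) (chartDeriv_chartCoord p _ (baseCoord B j) _ x)).trans ?_
        have h1 : baseCoord B j (Module.finBasis ℝ B i) = if i = j then 1 else 0 := by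
          simp [baseCoord, Module.Basis.coord_apply, Finsupp.single_apply]
        rw [h1]
        by_cases hij : i = j
        · simp [hij]
        · simp [hij]
      · simp only [splitCoord, Sum.elim_inr, AlgEquiv.apply_symm_apply, gDeriv_gConst]
        simp
    · change (locEquiv β p _).symm (gContract _ _ (locEquiv β p _ (splitCoord β p b))) = _
      rw [AlgEquiv.symm_apply_eq]
      rcases b with j | b
      · simp only [splitCoord, Sum.elim_inl, locEquiv_funIncl, gContract_gScalar]
        simp
      · simp only [splitCoord, Sum.elim_inr, AlgEquiv.apply_symm_apply, gContract_gConst_ι]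
        by_cases hij : a = b
        · simp [hij]
        · simp [hij, Finsupp.single_apply]

/-- Constant sections are polynomials in the finitely many odd coordinates. -/
theorem gConst_mem_adjoin (V : Opens M) (a : ExteriorAlgebra ℝ (Module.Dual ℝ F)) :
    gConst (B := B) V a ∈ Algebra.adjoin ℝ (Set.range fun i : Fin (Module.finrank ℝ F) =>
      gConst (B := B) V (ExteriorAlgebra.ι ℝ ((Module.finBasis ℝ F).coord i))) := by
  induction a using ExteriorAlgebra.induction with
  | algebraMap r => rw [AlgHom.commutes]; exact Subalgebra.algebraMap_mem _ _
  | ι m =>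
    have e2 : m = ∑ j, m (Module.finBasis ℝ F j) • (Module.finBasis ℝ F).coord j := by
      refine (Module.finBasis ℝ F).ext fun i => ?_
      simp [Finsupp.single_apply]
    rw [e2, map_sum, map_sum]
    refine Subalgebra.sum_mem _ fun j _ => ?_
    rw [map_smul, map_smul]
    exact Subalgebra.smul_mem _ (Algebra.subset_adjoin (Set.mem_range_self j)) _
  | mul a b ha hb => rw [map_mul]; exact Subalgebra.mul_mem _ ha hb
  | add a b ha hb => rw [map_add]; exact Subalgebra.add_mem _ ha hb

/-- A superfunction is a finite sum of smooth coefficients times elements of a basis of Λ(F^*), and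
those elements are polynomials in the odd coordinates. -/
theorem mem_adjoin_splitCoord (β : SheafIso Ms (batchelor B F E)) (p : M) (V : Opens M)
    (hV : V ≤ splitDom B F E p) (s : Ms.obj V) : s ∈ Algebra.adjoin ℝ
      (Set.range ((funIncl β).app V) ∪ Set.range fun a => Ms.res hV (splitCoord β p a)) := by
  have hV' : ∀ x ∈ V, x ∈ (trivializationAt F E p).baseSet := fun x hx => splitDom_triv (hV hx)
  have h1 : s = ∑ i, (funIncl β).app V (gCoeff ((gBasis F).coord i) (locEquiv β p hV' s)) *
      (locEquiv β p hV').symm (gConst V (gBasis F i)) := by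
    refine (locEquiv β p hV').injective ?_
    rw [map_sum]
    simp only [map_mul, locEquiv_funIncl, AlgEquiv.apply_symm_apply]
    exact gFun_eq_sum _
  rw [h1]
  refine Subalgebra.sum_mem _ fun i _ => Subalgebra.mul_mem _
    (Algebra.subset_adjoin (Or.inl ⟨_, rfl⟩)) ?_
  have h2 : (Algebra.adjoin ℝ (Set.range fun i : Fin (Module.finrank ℝ F) =>
      gConst (B := B) V (ExteriorAlgebra.ι ℝ ((Module.finBasis ℝ F).coord i)))).map
        ((locEquiv β p hV').symm : gFun B F V →ₐ[ℝ] Ms.obj V) ≤ Algebra.adjoin ℝ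
      (Set.range ((funIncl β).app V) ∪ Set.range fun a => Ms.res hV (splitCoord β p a)) := by
    rw [AlgHom.map_adjoin]
    refine Algebra.adjoin_mono ?_
    rintro _ ⟨_, ⟨a, rfl⟩, rfl⟩
    exact Or.inr ⟨Sum.inr a, res_locEquiv_symm β p _ hV _⟩
  exact h2 ⟨_, gConst_mem_adjoin V (gBasis F i), rfl⟩

theorem splitFrame_spans (β : SheafIso Ms (batchelor B F E)) (p : M) {P : SuperPresheaf.{u, w} M}
    {h : SheafHom Ms P} (hsep : PointSeparated (funIncl β) h) : (splitFrame β p).Spans h :=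
  Frame.spans_of_generate (funIncl β) _ (Module.finBasis ℝ B) p (fun _ hx => splitDom_chart hx)
    Sum.inl (fun _ => rfl) (fun V hV s => mem_adjoin_splitCoord β p V hV s) hsep

end SplitFrame

/-! ## Odd points and the evaluation morphism `E × ℝ^{0|1} → 𝓜` -/

section DualPoints

/-- The parity of dual numbers. -/
def dualPar : DualNumber ℝ →ₐ[ℝ] DualNumber ℝ where
  toFun f := (f.fst, -f.snd)
  map_one' := TrivSqZeroExt.ext rfl neg_zero
  map_mul' f g := by
    refine TrivSqZeroExt.ext rfl ?_
    change -(f.fst • g.snd + MulOpposite.op g.fst • f.snd) =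
      f.fst • (-g.snd) + MulOpposite.op g.fst • (-f.snd)
    rw [smul_neg, smul_neg, neg_add]
  map_zero' := TrivSqZeroExt.ext rfl neg_zero
  map_add' f g := TrivSqZeroExt.ext rfl (neg_add _ _)
  commutes' _ := TrivSqZeroExt.ext rfl neg_zero

/-! ### Dual-number points of an exterior algebra -/

section Exterior

variable {V : Type*} [AddCommGroup V] [Module ℝ V]

/-- The algebra morphism `Λ(V^*) → ℝ[ε]`, `m ↦ m(v) ε`. -/
def toDual (v : V) : ExteriorAlgebra ℝ (Module.Dual ℝ V) →ₐ[ℝ] DualNumber ℝ :=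
  ExteriorAlgebra.lift ℝ ⟨(TrivSqZeroExt.inrHom ℝ ℝ) ∘ₗ Module.Dual.eval ℝ V v, fun _ =>
    TrivSqZeroExt.inr_mul_inr _ _ _⟩

theorem toDual_ι (v : V) (m : Module.Dual ℝ V) :
    toDual v (ExteriorAlgebra.ι ℝ m) = TrivSqZeroExt.inr (m v) :=
  ExteriorAlgebra.lift_ι_apply ℝ _ _ m

theorem toDual_extPar (v : V) (a : ExteriorAlgebra ℝ (Module.Dual ℝ V)) :
    toDual v (extPar a) = dualPar (toDual v a) := by
  have : (toDual v).comp extPar = dualPar.comp (toDual v) := by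
    refine ExteriorAlgebra.hom_ext (LinearMap.ext fun m => ?_)
    have h1 : extPar (ExteriorAlgebra.ι ℝ m) = -ExteriorAlgebra.ι ℝ m :=
      CliffordAlgebra.involute_ι m
    simp only [LinearMap.comp_apply, AlgHom.toLinearMap_apply, AlgHom.comp_apply, h1, map_neg,
      toDual_ι]
    exact TrivSqZeroExt.ext neg_zero rfl
  exact DFunLike.congr_fun this a

theorem toDual_fst (v : V) (a : ExteriorAlgebra ℝ (Module.Dual ℝ V)) :
    (toDual v a).fst = ExteriorAlgebra.algebraMapInv a := by
  have : (TrivSqZeroExt.fstHom ℝ ℝ ℝ).comp (toDual v) = ExteriorAlgebra.algebraMapInv := by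
    refine ExteriorAlgebra.hom_ext (LinearMap.ext fun m => ?_)
    simp only [LinearMap.comp_apply, AlgHom.toLinearMap_apply, AlgHom.comp_apply, toDual_ι]
    simp [ExteriorAlgebra.algebraMapInv]
  exact DFunLike.congr_fun this a

/-- Modulo degree two the exterior algebra is the square-zero extension of ℝ by V, and the formula
is its multiplication. -/
theorem ιInv_mul (a b : ExteriorAlgebra ℝ V) : ExteriorAlgebra.ιInv (a * b) =
    ExteriorAlgebra.algebraMapInv a • ExteriorAlgebra.ιInv b +
      ExteriorAlgebra.algebraMapInv b • (ExteriorAlgebra.ιInv a : V) := by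
  -- The same right action as in the definition of `ExteriorAlgebra.ιInv`, so that the `change`
  -- below holds by definition.
  letI : Module ℝᵐᵒᵖ V := Module.compHom _ ((RingHom.id ℝ).fromOpposite mul_comm)
  haveI : IsCentralScalar ℝ V := ⟨fun r m => rfl⟩
  have h1 : ∀ c : ExteriorAlgebra ℝ V,
      (ExteriorAlgebra.toTrivSqZeroExt c).fst = ExteriorAlgebra.algebraMapInv c := by
    have : (TrivSqZeroExt.fstHom ℝ ℝ V).comp ExteriorAlgebra.toTrivSqZeroExt =
        ExteriorAlgebra.algebraMapInv := by
      refine ExteriorAlgebra.hom_ext (LinearMap.ext fun m => ?_)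
      simp [ExteriorAlgebra.algebraMapInv]
    exact DFunLike.congr_fun this
  change (ExteriorAlgebra.toTrivSqZeroExt (a * b)).snd = _
  rw [map_mul, TrivSqZeroExt.snd_mul, h1, h1]
  rfl

/-- Together with `toDual_fst` this identifies the value in ℝ[τ] as a₀ + a₁(v) τ; higher degrees
disappear since τ² = 0. -/
theorem toDual_snd (v : V) (a : ExteriorAlgebra ℝ (Module.Dual ℝ V)) :
    (toDual v a).snd = (ExteriorAlgebra.ιInv a : Module.Dual ℝ V) v := by
  induction a using ExteriorAlgebra.induction with
  | algebraMap r =>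
    rw [AlgHom.commutes]
    have : (ExteriorAlgebra.ιInv (algebraMap ℝ (ExteriorAlgebra ℝ (Module.Dual ℝ V)) r)) = 0 := by
      simp [ExteriorAlgebra.ιInv, TrivSqZeroExt.algebraMap_eq_inl]
    rw [this]
    rfl
  | ι m => rw [toDual_ι, ExteriorAlgebra.ι_leftInverse m]; rfl
  | mul a b ha hb =>
    rw [map_mul, TrivSqZeroExt.snd_mul, ιInv_mul, toDual_fst, toDual_fst, ha, hb, op_smul_eq_smul]
    rfl
  | add a b ha hb =>
    rw [map_add, map_add, TrivSqZeroExt.snd_add, ha, hb]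
    rfl

end Exterior

/-- A point of `(X, O)` with values in the dual numbers. -/
structure OddPoint {X : Type u} [TopologicalSpace X] (O : SuperPresheaf.{u, v} X) (x : X) where
  toFun : ∀ V : Opens X, x ∈ V → (O.obj V →ₐ[ℝ] DualNumber ℝ)
  toFun_res : ∀ {V W : Opens X} (hW : W ≤ V) (hx : x ∈ W) (s : O.obj V),
    toFun W hx (O.res hW s) = toFun V (hW hx) s
  toFun_par : ∀ {V : Opens X} (hx : x ∈ V) (s : O.obj V),
    toFun V hx (O.par V s) = dualPar (toFun V hx s)

/-- The image of an odd point under a morphism. -/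
def OddPoint.comp {X : Type u} [TopologicalSpace X] {O : SuperPresheaf.{u, v} X}
    {P : SuperPresheaf.{u, w} X} {x : X} (χ : OddPoint P x) (h : SheafHom O P) : OddPoint O x where
  toFun V hx := (χ.toFun V hx).comp (h.app V)
  toFun_res hW hx s := (congrArg _ (h.app_res hW s)).trans (χ.toFun_res hW hx _)
  toFun_par hx s := (congrArg _ (h.app_par _ s)).trans (χ.toFun_par hx _)

/-- `P` has enough odd points. -/
def EnoughOddPoints {X : Type u} [TopologicalSpace X] (P : SuperPresheaf.{u, w} X) : Prop :=
  ∀ (V : Opens X) (b : P.obj V),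
    (∀ (x : X) (hx : x ∈ V) (χ : OddPoint P x), χ.toFun V hx b = 0) → b = 0

/-! ### Smooth functions at odd points -/

section FunctionsAtOddPoints

variable {B : Type*} [NormedAddCommGroup B] [NormedSpace ℝ B] {H : Type*} [TopologicalSpace H]
  {I : ModelWithCorners ℝ B H} {N : Type u} [TopologicalSpace N] [ChartedSpace H N]
  {O : SuperPresheaf.{u, v} N} (j : FunctionInclusion I O)

/-- Functions are even, so the τ-component vanishes. If the remaining number r differed from f(x),
then f − r would be invertible near x, yet it is sent to an element without body, which is not a
unit. -/
theorem OddPoint.apply_funIncl {x : N} (χ : OddPoint O x) {V : Opens N} (hx : x ∈ V)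
    (f : C^∞⟮I, V; 𝓘(ℝ, ℝ), ℝ⟯) :
    χ.toFun V hx (j.app V f) = TrivSqZeroExt.inl (f ⟨x, hx⟩) := by
  have hsnd : (χ.toFun V hx (j.app V f)).snd = 0 := by
    have h1 := congrArg TrivSqZeroExt.snd (χ.toFun_par hx (j.app V f))
    rw [j.par_app] at h1
    have h2 : (χ.toFun V hx (j.app V f)).snd = -(χ.toFun V hx (j.app V f)).snd := h1
    linarith
  refine TrivSqZeroExt.ext ?_ hsnd
  rw [TrivSqZeroExt.fst_inl]
  set r := (χ.toFun V hx (j.app V f)).fst with hr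
  by_contra hne
  let g : C^∞⟮I, V; 𝓘(ℝ, ℝ), ℝ⟯ := f - algebraMap ℝ _ r
  have hg : ∀ y, g y = f y - r := fun y => rfl
  -- The open set where f − r is invertible; it contains x under the assumption to be refuted.
  let W : Opens N := ⟨Subtype.val '' {y : V | g y ≠ 0},
    V.isOpen.isOpenMap_subtype_val _ (isOpen_ne_fun g.contMDiff.continuous continuous_const)⟩
  have hWV : W ≤ V := by
    rintro _ ⟨y, _, rfl⟩
    exact y.2
  have hxW : x ∈ W := ⟨⟨x, hx⟩, by
    change g _ ≠ 0
    rw [hg, sub_ne_zero]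
    exact fun h => hne h.symm, rfl⟩
  have hWne : ∀ y : W, resSmooth I N hWV g y ≠ 0 := by
    rintro ⟨_, y, hy, rfl⟩
    exact hy
  let k : C^∞⟮I, W; 𝓘(ℝ, ℝ), ℝ⟯ := ⟨fun y => (resSmooth I N hWV g y)⁻¹, fun y =>
    ((contDiffAt_inv ℝ (hWne y)).contMDiffAt).comp y (resSmooth I N hWV g).contMDiff.contMDiffAt⟩
  have hgk : resSmooth I N hWV g * k = 1 :=
    ContMDiffMap.ext fun y => mul_inv_cancel₀ (hWne y)
  have e1 : (χ.toFun V hx (j.app V g)).fst = 0 := by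
    have : j.app V g = j.app V f - algebraMap ℝ _ r := by
      rw [map_sub, AlgHom.commutes]
    rw [this, map_sub, AlgHom.commutes, TrivSqZeroExt.fst_sub, ← hr]
    exact sub_self r
  have e2 : (χ.toFun W hxW (j.app W (resSmooth I N hWV g))).fst = 0 := by
    rw [← j.app_res hWV, χ.toFun_res hWV hxW, e1]
  have e3 := congrArg TrivSqZeroExt.fst
    (congrArg (fun t => χ.toFun W hxW (j.app W t)) hgk)
  simp only [map_mul, map_one, TrivSqZeroExt.fst_mul, e2, zero_mul, TrivSqZeroExt.fst_one] at e3
  exact zero_ne_one e3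

/-- Both components of an odd point are linear over functions, because functions have no τ-component
at odd points. -/
theorem EnoughOddPoints.pointSeparated {P : SuperPresheaf.{u, w} N} (hP : EnoughOddPoints P)
    (h : SheafHom O P) : PointSeparated j h := by
  intro V b hb
  refine hP V b fun x hx χ => TrivSqZeroExt.ext ?_ ?_
  · refine hb x hx ⟨fun V hx => ((TrivSqZeroExt.fstHom ℝ ℝ ℝ).comp (χ.toFun V hx)).toLinearMap,
      fun hW hx b => congrArg TrivSqZeroExt.fst (χ.toFun_res hW hx b), fun hx f b => ?_⟩
    have e := (χ.comp h).apply_funIncl j hx f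
    change (χ.toFun _ hx (h.app _ (j.app _ f) * b)).fst = _ * (χ.toFun _ hx b).fst
    rw [map_mul]
    rw [show χ.toFun _ hx (h.app _ (j.app _ f)) = _ from e]
    simp
  · refine hb x hx ⟨fun V hx => (TrivSqZeroExt.sndHom ℝ ℝ) ∘ₗ (χ.toFun V hx).toLinearMap,
      fun hW hx b => congrArg TrivSqZeroExt.snd (χ.toFun_res hW hx b), fun hx f b => ?_⟩
    have e := (χ.comp h).apply_funIncl j hx f
    change (χ.toFun _ hx (h.app _ (j.app _ f) * b)).snd = _ * (χ.toFun _ hx b).snd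
    rw [map_mul]
    rw [show χ.toFun _ hx (h.app _ (j.app _ f)) = _ from e]
    simp

end FunctionsAtOddPoints

/-! ### Odd points of N × ℝ^{0|1} -/

section TimesOdd

variable {B : Type*} [NormedAddCommGroup B] [NormedSpace ℝ B] {H : Type*} [TopologicalSpace H]
  {I : ModelWithCorners ℝ B H} {N : Type u} [TopologicalSpace N] [ChartedSpace H N]
  {X : Type u'} [TopologicalSpace X]

/-- The value of a superfunction on `N × ℝ^{0|1}` at a point of `N`. -/
def evalDual {U : Opens N} (x : U) : (timesOdd I N).obj U →ₐ[ℝ] DualNumber ℝ where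
  toFun f := ((TrivSqZeroExt.fst f : C^∞⟮I, U; 𝓘(ℝ, ℝ), ℝ⟯) x,
    (TrivSqZeroExt.snd f : C^∞⟮I, U; 𝓘(ℝ, ℝ), ℝ⟯) x)
  map_one' := rfl
  map_mul' _ _ := rfl
  map_zero' := rfl
  map_add' _ _ := rfl
  commutes' _ := rfl

theorem evalDual_ext {U : Opens N} {f g : (timesOdd I N).obj U}
    (h : ∀ x, evalDual x f = evalDual x g) : f = g :=
  TrivSqZeroExt.ext (ContMDiffMap.ext fun x => congrArg TrivSqZeroExt.fst (h x))
    (ContMDiffMap.ext fun x => congrArg TrivSqZeroExt.snd (h x))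

/-- The odd point of `φ_*(N × ℝ^{0|1})` at a point of `N`. -/
def oddPoint (I : ModelWithCorners ℝ B H) (φ : C(N, X)) (n : N) :
    OddPoint ((timesOdd I N).pushforward φ) (φ n) where
  toFun V hx := evalDual (U := Opens.comap φ V) ⟨n, hx⟩
  toFun_res _ _ _ := rfl
  toFun_par _ _ := rfl

theorem enoughOddPoints_timesOdd (φ : C(N, X)) :
    EnoughOddPoints ((timesOdd I N).pushforward φ) := fun V b hb =>
  evalDual_ext (U := Opens.comap φ V) fun x =>
    (hb (φ x.1) x.2 (oddPoint I φ x.1)).trans (map_zero _).symm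

theorem enoughOddPoints_restr (φ : C(N, X)) (W : Opens N) :
    EnoughOddPoints (((timesOdd I N).restr W).pushforward φ) := fun V b hb => by
  refine evalDual_ext (U := W ⊓ Opens.comap φ V) fun x => ?_
  refine (hb (φ x.1) x.2.2 ⟨fun V hx => evalDual (U := W ⊓ Opens.comap φ V) ⟨x.1, x.2.1, hx⟩,
    fun _ _ _ => rfl, fun _ _ => rfl⟩).trans (map_zero _).symm

end TimesOdd

theorem SMap.ext_of_evalDual {B : Type*} [NormedAddCommGroup B] [NormedSpace ℝ B] {H : Type*}
    [TopologicalSpace H] {I : ModelWithCorners ℝ B H} {N : Type u} [TopologicalSpace N]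
    [ChartedSpace H N] {X : Type u'} [TopologicalSpace X] {O : SuperPresheaf.{u', v'} X}
    {Φ Φ' : SMap (timesOdd I N) O} (hbase : ∀ n, Φ.base n = Φ'.base n)
    (h : ∀ (U : Opens X) (s : O.obj U) (n : N) (hn : Φ.base n ∈ U) (hn' : Φ'.base n ∈ U),
      ((oddPoint I Φ.base n).comp Φ.pull).toFun U hn s =
        ((oddPoint I Φ'.base n).comp Φ'.pull).toFun U hn' s) : Φ = Φ' := by
  obtain ⟨b, q⟩ := Φ
  obtain ⟨b', q'⟩ := Φ'
  obtain rfl : b = b' := ContinuousMap.ext hbase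
  congr 1
  refine SheafHom.ext (funext fun U => AlgHom.ext fun s => ?_)
  exact evalDual_ext (U := Opens.comap b U) fun x => h U s x.1 x.2 x.2

end DualPoints

/-! ### The evaluation morphism and its universal property -/

section Evaluation

variable {B : Type*} [NormedAddCommGroup B] [NormedSpace ℝ B]
  {M : Type u} [TopologicalSpace M] [ChartedSpace B M]
  {F : Type*} [NormedAddCommGroup F] [NormedSpace ℝ F] [FiniteDimensional ℝ F]
  {E : M → Type*} [TopologicalSpace (TotalSpace F E)] [∀ x, AddCommGroup (E x)]
  [∀ x, Module ℝ (E x)] [∀ x, TopologicalSpace (E x)] [FiberBundle F E] [VectorBundle ℝ F E]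
  {Ms : SuperPresheaf.{u, v} M}

/-- The odd point of `Ms` given by a point of `E`. -/
def evPoint (β : SheafIso Ms (batchelor B F E)) (x : M) (e : E x) : OddPoint Ms x where
  toFun V hx := ((toDual e).comp (((Pi.evalAlgHom ℝ
    (fun x : V => ExteriorAlgebra ℝ (Module.Dual ℝ (E x.1))) ⟨x, hx⟩)).comp
      (smoothSections B F E V).val)).comp (secEquiv β V : Ms.obj V →ₐ[ℝ] smoothSections B F E V)
  toFun_res hW hx s := congrArg (toDual e) (secEquiv_res β hW s ⟨x, hx⟩)
  toFun_par hx s := (congrArg (toDual e) (secEquiv_par β s ⟨x, hx⟩)).trans (toDual_extPar _ _)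

theorem evPoint_apply (β : SheafIso Ms (batchelor B F E)) {x : M} (e : E x) {V : Opens M}
    (hx : x ∈ V) (s : Ms.obj V) :
    (evPoint β x e).toFun V hx s = toDual e ((secEquiv β V s).1 ⟨x, hx⟩) := rfl

variable [ContMDiffVectorBundle ∞ F E 𝓘(ℝ, B)]

/-- This is ψ ∘ pr = T ∘ q at a point of E, the bridge between affine functions on the fibres and
dual numbers. -/
theorem psi_eq_evPoint (β : SheafIso Ms (batchelor B F E)) {U : Opens M} (s : Ms.obj U)
    (e : TotalSpace F E) (he : e.proj ∈ U) :
    psi β s ⟨e, he⟩ = ((evPoint β e.proj e.2).toFun U he s).fst +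
      ((evPoint β e.proj e.2).toFun U he s).snd := by
  rw [evPoint_apply, toDual_fst, toDual_snd]
  rfl

/-- The superfunction `s₀ + s₁ τ` on `E × ℝ^{0|1}`, for a superfunction `s`. -/
def evFun (β : SheafIso Ms (batchelor B F E)) {U : Opens M} (s : Ms.obj U) :
    (timesOdd (𝓘(ℝ, B).prod 𝓘(ℝ, F)) (TotalSpace F E)).obj (Opens.comap (bundleProj F E) U) :=
  (⟨fun e => ((evPoint β e.1.proj e.1.2).toFun U e.2 s).fst, by
    -- Parity changes the sign of the τ-component only, so half the sum of ψ(s) and ψ(par s)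
    -- isolates the body; half the difference isolates the other component below. Smoothness is
    -- inherited from ψ.
    refine (((1 / 2 : ℝ) • (psi β s + psi β (Ms.par U s))).contMDiff).congr fun e => ?_
    have he : e.1.proj ∈ U := e.2
    change _ = (1 / 2 : ℝ) * (psi β s ⟨e.1, he⟩ + psi β (Ms.par U s) ⟨e.1, he⟩)
    rw [psi_eq_evPoint, psi_eq_evPoint, (evPoint β e.1.proj e.1.2).toFun_par]
    generalize hd : (evPoint β e.1.proj e.1.2).toFun U he s = d
    change d.fst =
      (1 / 2 : ℝ) * (d.fst + d.snd + (d.fst + -d.snd))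
    ring⟩,
   ⟨fun e => ((evPoint β e.1.proj e.1.2).toFun U e.2 s).snd, by
    refine (((1 / 2 : ℝ) • (psi β s - psi β (Ms.par U s))).contMDiff).congr fun e => ?_
    have he : e.1.proj ∈ U := e.2
    change _ = (1 / 2 : ℝ) * (psi β s ⟨e.1, he⟩ - psi β (Ms.par U s) ⟨e.1, he⟩)
    rw [psi_eq_evPoint, psi_eq_evPoint, (evPoint β e.1.proj e.1.2).toFun_par]
    generalize hd : (evPoint β e.1.proj e.1.2).toFun U he s = d
    change d.snd =
      (1 / 2 : ℝ) * (d.fst + d.snd - (d.fst + -d.snd))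
    ring⟩)

theorem evalDual_evFun (β : SheafIso Ms (batchelor B F E)) {U : Opens M} (s : Ms.obj U)
    (e : Opens.comap (bundleProj F E) U) :
    evalDual e (evFun β s) = (evPoint β e.1.proj e.1.2).toFun U e.2 s := rfl

/-- The morphism `q : 𝒪 → C^∞(E)[τ]`. -/
def evApp (β : SheafIso Ms (batchelor B F E)) (U : Opens M) :
    Ms.obj U →ₐ[ℝ] (timesOdd (𝓘(ℝ, B).prod 𝓘(ℝ, F)) (TotalSpace F E)).obj
      (Opens.comap (bundleProj F E) U) where
  toFun s := evFun β s
  map_one' := evalDual_ext fun e => (map_one ((evPoint β e.1.proj e.1.2).toFun U e.2)).trans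
    (map_one (evalDual e)).symm
  map_mul' s t := evalDual_ext fun e =>
    (map_mul ((evPoint β e.1.proj e.1.2).toFun U e.2) s t).trans (map_mul (evalDual e) (evFun β s) (evFun β t)).symm
  map_zero' := evalDual_ext fun e => (map_zero ((evPoint β e.1.proj e.1.2).toFun U e.2)).trans
    (map_zero (evalDual e)).symm
  map_add' s t := evalDual_ext fun e =>
    (map_add ((evPoint β e.1.proj e.1.2).toFun U e.2) s t).trans (map_add (evalDual e) (evFun β s) (evFun β t)).symm
  commutes' r := evalDual_ext fun e =>
    (AlgHom.commutes ((evPoint β e.1.proj e.1.2).toFun U e.2) r).trans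
      (AlgHom.commutes (evalDual e) r).symm

/-- The evaluation morphism `E × ℝ^{0|1} → 𝓜`. -/
def ev (β : SheafIso Ms (batchelor B F E)) :
    SMap (timesOdd (𝓘(ℝ, B).prod 𝓘(ℝ, F)) (TotalSpace F E)) Ms where
  base := bundleProj F E
  pull :=
    { app := evApp β
      app_res := fun hW s => evalDual_ext (U := Opens.comap (bundleProj F E) _) fun e =>
        (evPoint β e.1.proj e.1.2).toFun_res hW e.2 s
      app_par := fun U s => evalDual_ext (U := Opens.comap (bundleProj F E) _) fun e =>
        (evPoint β e.1.proj e.1.2).toFun_par e.2 s }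

variable [IsManifold 𝓘(ℝ, B) ∞ M] [FiniteDimensional ℝ B]

theorem evPoint_splitCoord_inr (β : SheafIso Ms (batchelor B F E)) {p x : M}
    (hx : x ∈ splitDom B F E p) (e : E x) (a : Fin (Module.finrank ℝ F)) :
    (evPoint β x e).toFun _ hx (splitCoord β p (Sum.inr a)) =
      TrivSqZeroExt.inr ((Module.finBasis ℝ F).coord a
        ((trivializationAt F E p).continuousLinearMapAt ℝ x e)) := by
  have h1 : (secEquiv β _ (splitCoord β p (Sum.inr a))).1 ⟨x, hx⟩ =
      localInv F E p x (ExteriorAlgebra.ι ℝ ((Module.finBasis ℝ F).coord a)) :=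
    congrFun (congrArg Subtype.val (AlgEquiv.apply_symm_apply (secEquiv β (splitDom B F E p)) _))
      ⟨x, hx⟩
  rw [evPoint_apply, h1, localInv, ExteriorAlgebra.map_apply_ι, toDual_ι]
  rfl

/-- All odd points over x agree on smooth functions, and near x the algebra is generated by
functions and odd coordinates. -/
theorem OddPoint.ext_splitCoord (β : SheafIso Ms (batchelor B F E)) {p x : M}
    (hx : x ∈ splitDom B F E p) {χ χ' : OddPoint Ms x}
    (h : ∀ a, (χ.toFun _ hx (splitCoord β p (Sum.inr a))) =
      (χ'.toFun _ hx (splitCoord β p (Sum.inr a)))) (V : Opens M) (hV : x ∈ V) (s : Ms.obj V) :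
    χ.toFun V hV s = χ'.toFun V hV s := by
  have hW : V ⊓ splitDom B F E p ≤ splitDom B F E p := inf_le_right
  have hxW : x ∈ V ⊓ splitDom B F E p := ⟨hV, hx⟩
  rw [← χ.toFun_res (inf_le_left : V ⊓ splitDom B F E p ≤ V) hxW,
    ← χ'.toFun_res (inf_le_left : V ⊓ splitDom B F E p ≤ V) hxW]
  have hmem := mem_adjoin_splitCoord β p _ hW (Ms.res inf_le_left s)
  have hEq : Set.EqOn (χ.toFun _ hxW) (χ'.toFun _ hxW) (Algebra.adjoin ℝ
      (Set.range ((funIncl β).app (V ⊓ splitDom B F E p)) ∪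
        Set.range fun a => Ms.res hW (splitCoord β p a))) := by
    refine fun t ht => AlgHom.mem_equalizer (χ.toFun _ hxW) (χ'.toFun _ hxW) t |>.1 ?_
    refine (Algebra.adjoin_le ?_ : _ ≤ AlgHom.equalizer (χ.toFun _ hxW) (χ'.toFun _ hxW)) ht
    rintro _ (⟨f, rfl⟩ | ⟨a, rfl⟩)
    · change χ.toFun _ hxW _ = χ'.toFun _ hxW _
      rw [χ.apply_funIncl, χ'.apply_funIncl]
    · change χ.toFun _ hxW (Ms.res hW _) = χ'.toFun _ hxW (Ms.res hW _)
      rw [χ.toFun_res hW, χ'.toFun_res hW]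
      rcases a with i | a
      · change χ.toFun _ _ ((funIncl β).app _ _) = χ'.toFun _ _ ((funIncl β).app _ _)
        rw [χ.apply_funIncl, χ'.apply_funIncl]
      · exact h a
  exact hEq hmem

/-- The τ-components of the odd coordinates are the coordinates of the fibre vector in the
trivialization. -/
theorem evPoint_injective (β : SheafIso Ms (batchelor B F E)) {x : M} {e e' : E x}
    (h : ∀ a, ((evPoint β x e).toFun _ (mem_splitDom x) (splitCoord β x (Sum.inr a))).snd =
      ((evPoint β x e').toFun _ (mem_splitDom x) (splitCoord β x (Sum.inr a))).snd) : e = e' := by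
  have h1 : (trivializationAt F E x).continuousLinearMapAt ℝ x e =
      (trivializationAt F E x).continuousLinearMapAt ℝ x e' := by
    refine (Module.finBasis ℝ F).ext_elem fun a => ?_
    have := h a
    rw [evPoint_splitCoord_inr, evPoint_splitCoord_inr] at this
    exact this
  have h2 := congrArg ((trivializationAt F E x).symmL ℝ x) h1
  rwa [(trivializationAt F E x).symmL_continuousLinearMapAt (R := ℝ)
    (FiberBundle.mem_baseSet_trivializationAt' x), (trivializationAt F E x).symmL_continuousLinearMapAt (R := ℝ)
    (FiberBundle.mem_baseSet_trivializationAt' x)] at h2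

/-- The point of `E` given by an odd point of `Ms`. -/
def OddPoint.fiber (β : SheafIso Ms (batchelor B F E)) {x : M} (χ : OddPoint Ms x) : E x :=
  (trivializationAt F E x).symmL ℝ x (∑ a,
    (χ.toFun _ (mem_splitDom x) (splitCoord β x (Sum.inr a))).snd • Module.finBasis ℝ F a)

theorem OddPoint.apply_splitCoord_inr (β : SheafIso Ms (batchelor B F E)) {p x : M}
    (χ : OddPoint Ms x) (hx : x ∈ splitDom B F E p) (a : Fin (Module.finrank ℝ F)) :
    (χ.toFun _ hx (splitCoord β p (Sum.inr a))).fst = 0 := by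
  have h1 := χ.toFun_par hx (splitCoord β p (Sum.inr a))
  rw [splitCoord_par, map_smul] at h1
  have h2 := congrArg TrivSqZeroExt.fst h1
  simp only [splitParity, Sum.elim_inr, psign, one_ne_zero, if_false, TrivSqZeroExt.fst_smul] at h2
  have h3 : (-1 : ℝ) • (χ.toFun _ hx (splitCoord β p (Sum.inr a))).fst =
    (χ.toFun _ hx (splitCoord β p (Sum.inr a))).fst := h2
  rw [smul_eq_mul] at h3
  linarith

/-- An odd coordinate is sent to a multiple of τ, and the multiples are the coordinates of a vector
in the fibre of E. Evaluation at this vector has the same values on generators. This is the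
pointwise form of the universal property. -/
theorem OddPoint.eq_evPoint (β : SheafIso Ms (batchelor B F E)) {x : M} (χ : OddPoint Ms x)
    (V : Opens M) (hV : x ∈ V) (s : Ms.obj V) :
    χ.toFun V hV s = (evPoint β x (χ.fiber β)).toFun V hV s := by
  refine OddPoint.ext_splitCoord β (mem_splitDom x) (fun a => ?_) V hV s
  rw [evPoint_splitCoord_inr, OddPoint.fiber, (trivializationAt F E x).continuousLinearMapAt_symmL
    (R := ℝ) (FiberBundle.mem_baseSet_trivializationAt' x)]
  refine TrivSqZeroExt.ext (χ.apply_splitCoord_inr β _ a) ?_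
  simp [Finsupp.single_apply]

end Evaluation

/-! ## Supercurves and curves in `E` -/

section Curves

theorem contMDiffAt_of_coord {B : Type*} [NormedAddCommGroup B] [NormedSpace ℝ B] {H : Type*}
    [TopologicalSpace H] {I : ModelWithCorners ℝ B H} {N : Type*} [TopologicalSpace N]
    [ChartedSpace H N] {D : Type*} [NormedAddCommGroup D] [NormedSpace ℝ D] {κ : Type*} [Fintype κ]
    (b : Module.Basis κ ℝ D) {g : N → D} {n : N}
    (h : ∀ i, ContMDiffAt I 𝓘(ℝ, ℝ) ∞ (fun m => b.coord i (g m)) n) :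
    ContMDiffAt I 𝓘(ℝ, D) ∞ g n := by
  have h1 : g = fun m => ∑ i, b.coord i (g m) • b i := funext fun m => (b.sum_repr (g m)).symm
  rw [h1]
  exact ContMDiffAt.sum fun i _ => (h i).smul contMDiffAt_const

variable {B : Type*} [NormedAddCommGroup B] [NormedSpace ℝ B] [FiniteDimensional ℝ B]
  {M : Type u} [TopologicalSpace M] [ChartedSpace B M] [IsManifold 𝓘(ℝ, B) ∞ M]
  {F : Type*} [NormedAddCommGroup F] [NormedSpace ℝ F] [FiniteDimensional ℝ F]
  {E : M → Type*} [TopologicalSpace (TotalSpace F E)] [∀ x, AddCommGroup (E x)]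
  [∀ x, Module ℝ (E x)] [∀ x, TopologicalSpace (E x)] [FiberBundle F E] [VectorBundle ℝ F E]
  [ContMDiffVectorBundle ∞ F E 𝓘(ℝ, B)]
  {Ms : SuperPresheaf.{u, v} M} (β : SheafIso Ms (batchelor B F E))

/-- Coordinates have degree at most one; hence conditions imposed on 𝓕 only can be tested on
coordinates. -/
theorem inF_splitCoord (p : M) (a : SplitIdx B F) : InF β (splitCoord β p a) := by
  intro x
  rcases a with i | a
  · refine ⟨baseCoord B i (extChartAt 𝓘(ℝ, B) p x.1), 0, ?_⟩
    rw [map_zero, add_zero]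
    exact secEquiv_funIncl β _ _ x
  · have h1 : (secEquiv β _ (splitCoord β p (Sum.inr a))).1 x =
        localInv F E p x.1 (ExteriorAlgebra.ι ℝ ((Module.finBasis ℝ F).coord a)) :=
      congrFun (congrArg Subtype.val
        (AlgEquiv.apply_symm_apply (secEquiv β (splitDom B F E p)) _)) x
    rw [localInv, ExteriorAlgebra.map_apply_ι] at h1
    exact ⟨0, _, h1.trans ((zero_add _).symm.trans (congrArg (· + _) (map_zero _).symm))⟩

/-- The odd coordinates lie in 𝓕 and become the linear coordinates on the fibre. -/
theorem totalSpace_ext_psi {e e' : TotalSpace F E} (hproj : e.proj = e'.proj)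
    (h : ∀ (U : Opens M) (s : Ms.obj U), InF β s → ∀ (he : e.proj ∈ U) (he' : e'.proj ∈ U),
      psi β s ⟨e, he⟩ = psi β s ⟨e', he'⟩) : e = e' := by
  obtain ⟨x, e⟩ := e
  obtain ⟨x', e'⟩ := e'
  obtain rfl : x = x' := hproj
  congr 1
  refine evPoint_injective β fun a => ?_
  have h1 := h _ _ (inF_splitCoord β x (Sum.inr a)) (mem_splitDom x) (mem_splitDom x)
  rw [psi_eq_evPoint, psi_eq_evPoint, OddPoint.apply_splitCoord_inr,
    OddPoint.apply_splitCoord_inr, zero_add, zero_add] at h1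
  exact h1

section LiftedMap

variable {D : Type*} [NormedAddCommGroup D] [NormedSpace ℝ D] {H : Type*} [TopologicalSpace H]
  {I : ModelWithCorners ℝ D H} {N : Type u'} [TopologicalSpace N] [ChartedSpace H N]

/-- The point of `E` over `Φ(n)` given by a morphism `Φ : N × ℝ^{0|1} → 𝓜`. -/
def liftPoint (Φ : SMap (timesOdd I N) Ms) (n : N) : TotalSpace F E :=
  ⟨Φ.base n, ((oddPoint I Φ.base n).comp Φ.pull).fiber β⟩

/-- In charts the coordinates of the lifted point are the bodies of the pullbacks of even
coordinates and the τ-components of the pullbacks of odd ones. Smoothness of the base map comes from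
here too, as it is only assumed continuous. -/
theorem contMDiff_liftPoint (Φ : SMap (timesOdd I N) Ms) :
    ContMDiff I (𝓘(ℝ, B).prod 𝓘(ℝ, F)) ∞ (liftPoint β Φ) := by
  intro n
  set p := Φ.base n with hp
  have hmem : ∀ᶠ m in 𝓝 n, Φ.base m ∈ splitDom B F E p :=
    Φ.base.continuous.continuousAt.eventually ((splitDom B F E p).isOpen.mem_nhds (mem_splitDom p))
  rw [contMDiffAt_totalSpace]
  constructor
  · refine contMDiffAt_iff_target.2 ⟨Φ.base.continuous.continuousAt, ?_⟩
    refine contMDiffAt_of_coord (Module.finBasis ℝ B) fun i => ?_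
    let f : C^∞⟮I, Opens.comap Φ.base (splitDom B F E p); 𝓘(ℝ, ℝ), ℝ⟯ :=
      TrivSqZeroExt.fst (Φ.pull.app _ (splitCoord β p (Sum.inl i)))
    refine (extFun_contMDiffAt f (mem_splitDom p)).congr_of_eventuallyEq ?_
    filter_upwards [hmem] with m hm
    refine Eq.trans ?_ (extFun_apply f ⟨m, hm⟩).symm
    exact (congrArg TrivSqZeroExt.fst (((oddPoint I Φ.base m).comp Φ.pull).apply_funIncl
      (funIncl β) hm (chartCoord 𝓘(ℝ, B) p (baseCoord B i) fun _ hx => splitDom_chart hx))).symm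
  · refine contMDiffAt_of_coord (Module.finBasis ℝ F) fun a => ?_
    let f : C^∞⟮I, Opens.comap Φ.base (splitDom B F E p); 𝓘(ℝ, ℝ), ℝ⟯ :=
      TrivSqZeroExt.snd (Φ.pull.app _ (splitCoord β p (Sum.inr a)))
    refine (extFun_contMDiffAt f (mem_splitDom p)).congr_of_eventuallyEq ?_
    filter_upwards [hmem] with m hm
    refine Eq.trans ?_ (extFun_apply f ⟨m, hm⟩).symm
    have h1 := ((oddPoint I Φ.base m).comp Φ.pull).eq_evPoint β _ hm (splitCoord β p (Sum.inr a))
    rw [evPoint_splitCoord_inr, (trivializationAt F E p).continuousLinearMapAt_apply_of_mem ℝ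
      (splitDom_triv hm)] at h1
    exact (congrArg TrivSqZeroExt.snd h1).symm

/-- The map `N → E` given by a morphism `Φ : N × ℝ^{0|1} → 𝓜`. -/
def liftMap (Φ : SMap (timesOdd I N) Ms) : C^∞⟮I, N; 𝓘(ℝ, B).prod 𝓘(ℝ, F), TotalSpace F E⟯ :=
  ⟨liftPoint β Φ, contMDiff_liftPoint β Φ⟩

/-- Morphisms out of N × ℝ^{0|1} are determined by their odd points, and at each of them
`OddPoint.eq_evPoint` applies. -/
theorem ev_comp_liftMap (Φ : SMap (timesOdd I N) Ms) :
    (ev β).comp (timesOddMap (liftMap β Φ)) = Φ :=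
  (SMap.ext_of_evalDual (Φ := Φ) (Φ' := (ev β).comp (timesOddMap (liftMap β Φ))) (fun _ => rfl)
    fun U s n hn _ => ((oddPoint I Φ.base n).comp Φ.pull).eq_evPoint β U hn s).symm

end LiftedMap

theorem curveCorr_ev (γ : CurveE B F E) : CurveCorr β ((ev β).comp (timesOddMap γ)) γ :=
  ⟨fun _ => rfl, fun U s _ t _ ht' => (psi_eq_evPoint β s (γ t) ht').symm⟩

/-- The functions ψ(s) with s in 𝓕 separate the points of each fibre. -/
theorem CurveCorr.eq {Φ : SMap R11 Ms} {γ γ' : CurveE B F E} (h : CurveCorr β Φ γ)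
    (h' : CurveCorr β Φ γ') : γ = γ' :=
  ContMDiffMap.ext fun t => totalSpace_ext_psi β ((h.1 t).trans (h'.1 t).symm)
    fun U s hs he he' => (h.2 U s hs t ((h.1 t) ▸ he) he).symm.trans (h'.2 U s hs t _ he')

/-- The bijection between supercurves and curves in `E`. -/
def curveEquiv : SMap R11 Ms ≃ CurveE B F E where
  toFun Φ := liftMap β Φ
  invFun γ := (ev β).comp (timesOddMap γ)
  left_inv Φ := ev_comp_liftMap β Φ
  right_inv γ := by
    have h := curveCorr_ev β (liftMap β ((ev β).comp (timesOddMap γ)))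
    rw [ev_comp_liftMap] at h
    exact h.eq β (curveCorr_ev β γ)

theorem curveEquiv_eq_iff (Φ : SMap R11 Ms) (γ : CurveE B F E) :
    curveEquiv β Φ = γ ↔ CurveCorr β Φ γ := by
  have h := curveCorr_ev β (liftMap β Φ)
  rw [ev_comp_liftMap] at h
  exact ⟨fun e => e ▸ h, fun h' => h.eq β h'⟩

end Curves

/-! ## Coordinates on `E` -/

section LiftedFrame

section SmoothPoints

variable {B : Type*} [NormedAddCommGroup B] [NormedSpace ℝ B] {H : Type*} [TopologicalSpace H]
  {I : ModelWithCorners ℝ B H} {N : Type u} [TopologicalSpace N] [ChartedSpace H N]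
  {B' : Type*} [NormedAddCommGroup B'] [NormedSpace ℝ B'] {H' : Type*} [TopologicalSpace H']
  {I' : ModelWithCorners ℝ B' H'} {N' : Type u'} [TopologicalSpace N'] [ChartedSpace H' N']

theorem pointSeparated_ofSmooth (γ : C^∞⟮I, N; I', N'⟯) :
    PointSeparated FunctionInclusion.refl (ofSmooth γ).pull := by
  intro V b hb
  let b' : C^∞⟮I, Opens.comap (contOf γ) V; 𝓘(ℝ, ℝ), ℝ⟯ := b
  change b' = 0
  refine ContMDiffMap.ext fun x => ?_
  exact hb (γ x.1) x.2 ⟨fun V hx =>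
    ⟨⟨fun f : C^∞⟮I, Opens.comap (contOf γ) V; 𝓘(ℝ, ℝ), ℝ⟯ => f ⟨x.1, hx⟩, fun _ _ => rfl⟩,
      fun _ _ => rfl⟩, fun _ _ _ => rfl, fun _ _ _ => rfl⟩

theorem pointSeparated_id : PointSeparated FunctionInclusion.refl (SheafHom.id (smoothFun I N)) := by
  intro V b hb
  let b' : C^∞⟮I, V; 𝓘(ℝ, ℝ), ℝ⟯ := b
  change b' = 0
  refine ContMDiffMap.ext fun x => ?_
  exact hb x.1 x.2 ⟨fun V hx =>
    ⟨⟨fun f : C^∞⟮I, V; 𝓘(ℝ, ℝ), ℝ⟯ => f ⟨x.1, hx⟩, fun _ _ => rfl⟩,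
      fun _ _ => rfl⟩, fun _ _ _ => rfl, fun _ _ _ => rfl⟩

/-- The superfunction `f` or `f τ`, depending on the parity. -/
def oddMul (p : ZMod 2) {U : Opens N} :
    C^∞⟮I, U; 𝓘(ℝ, ℝ), ℝ⟯ →ₗ[ℝ] DualNumber C^∞⟮I, U; 𝓘(ℝ, ℝ), ℝ⟯ where
  toFun f := if p = 0 then TrivSqZeroExt.inl f else TrivSqZeroExt.inr f
  map_add' f g := by
    split_ifs
    exacts [TrivSqZeroExt.inl_add _ _ _, TrivSqZeroExt.inr_add _ _ _]
  map_smul' c f := by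
    split_ifs
    exacts [TrivSqZeroExt.inl_smul _ _ _, TrivSqZeroExt.inr_smul _ _ _]

/-- The component `f` or `h` of `f + h τ`, depending on the parity. -/
def oddPart (p : ZMod 2) {U : Opens N} :
    DualNumber C^∞⟮I, U; 𝓘(ℝ, ℝ), ℝ⟯ →ₗ[ℝ] C^∞⟮I, U; 𝓘(ℝ, ℝ), ℝ⟯ where
  toFun f := if p = 0 then TrivSqZeroExt.fst f else TrivSqZeroExt.snd f
  map_add' f g := by split_ifs <;> simp
  map_smul' c f := by split_ifs <;> simp

theorem oddPart_oddMul (p : ZMod 2) {U : Opens N} (f : C^∞⟮I, U; 𝓘(ℝ, ℝ), ℝ⟯) :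
    oddPart p (oddMul p f) = f := by
  by_cases hp : p = 0 <;> simp [oddPart, oddMul, hp]

end SmoothPoints

variable (B : Type*) [NormedAddCommGroup B] [NormedSpace ℝ B] [FiniteDimensional ℝ B]
  {M : Type u} [TopologicalSpace M] [ChartedSpace B M] [IsManifold 𝓘(ℝ, B) ∞ M]
  (F : Type*) [NormedAddCommGroup F] [NormedSpace ℝ F] [FiniteDimensional ℝ F]
  (E : M → Type*) [TopologicalSpace (TotalSpace F E)] [∀ x, AddCommGroup (E x)]
  [∀ x, Module ℝ (E x)] [∀ x, TopologicalSpace (E x)] [FiberBundle F E] [VectorBundle ℝ F E]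
  [ContMDiffVectorBundle ∞ F E 𝓘(ℝ, B)]

/-- The domain of the chart of `E` over the chart at `p`. -/
abbrev liftDom (p : M) : Opens (TotalSpace F E) := Opens.comap (bundleProj F E) (splitDom B F E p)

variable {B F E}

theorem liftDom_chart {p : M} (e : TotalSpace F E) (he : e ∈ liftDom B F E p) :
    e ∈ (extChartAt (𝓘(ℝ, B).prod 𝓘(ℝ, F)) (⟨p, 0⟩ : TotalSpace F E)).source := by
  have h1 : e.proj ∈ splitDom B F E p := he
  rw [FiberBundle.extChartAt, PartialEquiv.trans_source]
  refine ⟨?_, ?_, trivial⟩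
  · change e ∈ (trivializationAt F E p).source
    rw [(trivializationAt F E p).mem_source]
    exact splitDom_triv h1
  · change ((trivializationAt F E p) e).1 ∈ _
    rw [(trivializationAt F E p).coe_fst' (splitDom_triv h1)]
    exact splitDom_chart h1

/-- The basis of `B × F`. -/
def totBasis (B : Type*) [NormedAddCommGroup B] [NormedSpace ℝ B] [FiniteDimensional ℝ B]
    (F : Type*) [NormedAddCommGroup F] [NormedSpace ℝ F] [FiniteDimensional ℝ F] :
    Module.Basis (SplitIdx B F) ℝ (B × F) :=
  (Module.finBasis ℝ B).prod (Module.finBasis ℝ F)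

variable (E) in
/-- The chart of `E` over the chart at `p`. -/
def liftFrame (p : M) : Frame (totE B F E) (liftDom B F E p) (SplitIdx B F) :=
  chartFrame (totBasis B F) (⟨p, 0⟩ : TotalSpace F E) liftDom_chart

variable (E) in
/-- The coordinates of the chart of `E` over the chart at `p`. -/
def liftCoord (p : M) (a : SplitIdx B F) :
    C^∞⟮𝓘(ℝ, B).prod 𝓘(ℝ, F), liftDom B F E p; 𝓘(ℝ, ℝ), ℝ⟯ := (liftFrame E p).x a

theorem liftCoord_inl (p : M) (i) (e : TotalSpace F E) (he : e ∈ liftDom B F E p) :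
    liftCoord (B := B) (F := F) E p (Sum.inl i) ⟨e, he⟩ =
      baseCoord B i (extChartAt 𝓘(ℝ, B) p e.proj) := by
  have h1 : e.proj ∈ splitDom B F E p := he
  change (totBasis B F).coord (Sum.inl i)
    (extChartAt (𝓘(ℝ, B).prod 𝓘(ℝ, F)) (⟨p, 0⟩ : TotalSpace F E) e) = _
  rw [FiberBundle.extChartAt]
  change (Module.finBasis ℝ B).coord i (extChartAt 𝓘(ℝ, B) p ((trivializationAt F E p) e).1) = _
  rw [(trivializationAt F E p).coe_fst' (splitDom_triv h1)]
  rfl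

theorem liftCoord_inr (p : M) (a) (e : TotalSpace F E) (he : e ∈ liftDom B F E p) :
    liftCoord (B := B) (F := F) E p (Sum.inr a) ⟨e, he⟩ =
      (Module.finBasis ℝ F).coord a ((trivializationAt F E p) e).2 := by
  change (totBasis B F).coord (Sum.inr a)
    (extChartAt (𝓘(ℝ, B).prod 𝓘(ℝ, F)) (⟨p, 0⟩ : TotalSpace F E) e) = _
  rw [FiberBundle.extChartAt]
  rfl

variable {Ms : SuperPresheaf.{u, v} M} (β : SheafIso Ms (batchelor B F E))

/-- In coordinates q sends x_i to y_i and ξ_a to y_a τ, where y are the bundle coordinates of E. All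
comparisons of components below start from this. -/
theorem evApp_splitCoord (p : M) (a : SplitIdx B F) :
    evApp β _ (splitCoord β p a) = oddMul (splitParity a) (liftCoord E p a) := by
  refine evalDual_ext (U := liftDom B F E p) fun e => ?_
  have he : e.1.proj ∈ splitDom B F E p := e.2
  refine (evalDual_evFun β (splitCoord β p a) e).trans ?_
  rcases a with i | a
  · refine ((evPoint β e.1.proj e.1.2).apply_funIncl (funIncl β) he _).trans ?_
    simp only [oddMul, splitParity, Sum.elim_inl]
    exact TrivSqZeroExt.ext (liftCoord_inl p i e.1 e.2).symm rfl
  · refine (evPoint_splitCoord_inr β he e.1.2 a).trans ?_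
    rw [(trivializationAt F E p).continuousLinearMapAt_apply_of_mem ℝ (splitDom_triv he)]
    simp only [oddMul, splitParity, Sum.elim_inr]
    exact TrivSqZeroExt.ext rfl (liftCoord_inr p a e.1 e.2).symm

theorem liftFrame_spans_id (p : M) : (liftFrame (B := B) (F := F) E p).Spans (SheafHom.id _) :=
  chartFrame_spans _ _ _ _ pointSeparated_id

end LiftedFrame

/-! ## Vector fields on manifolds and their extensions to `N × ℝ^{0|1}` -/

section VectorFields

variable {B : Type*} [NormedAddCommGroup B] [NormedSpace ℝ B] {H : Type*} [TopologicalSpace H]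
  {I : ModelWithCorners ℝ B H} {N : Type u} [TopologicalSpace N] [ChartedSpace H N]

/-- The action of a vector field on functions. -/
def vfAct {U V : Opens N} (A : VF (smoothFun I N) U) (hV : V ≤ U) :
    C^∞⟮I, V; 𝓘(ℝ, ℝ), ℝ⟯ →ₗ[ℝ] C^∞⟮I, V; 𝓘(ℝ, ℝ), ℝ⟯ := Der.act A hV

variable {U V W : Opens N}

theorem vfAct_add_left (A A' : VF (smoothFun I N) U) (hV : V ≤ U) (f : C^∞⟮I, V; 𝓘(ℝ, ℝ), ℝ⟯) :
    vfAct (A + A') hV f = vfAct A hV f + vfAct A' hV f := rfl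

theorem vfAct_smul_left (c : ℝ) (A : VF (smoothFun I N) U) (hV : V ≤ U)
    (f : C^∞⟮I, V; 𝓘(ℝ, ℝ), ℝ⟯) : vfAct (c • A) hV f = c • vfAct A hV f := rfl

theorem vfAct_mulLeft (g : C^∞⟮I, U; 𝓘(ℝ, ℝ), ℝ⟯) (A : VF (smoothFun I N) U) (hV : V ≤ U)
    (f : C^∞⟮I, V; 𝓘(ℝ, ℝ), ℝ⟯) :
    vfAct (Der.mulLeft (P := smoothFun I N) g A) hV f = resSmooth I N hV g * vfAct A hV f := rfl

theorem vfAct_sum_left {κ : Type*} (s : Finset κ) (A : κ → VF (smoothFun I N) U) (hV : V ≤ U)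
    (f : C^∞⟮I, V; 𝓘(ℝ, ℝ), ℝ⟯) : vfAct (∑ i ∈ s, A i) hV f = ∑ i ∈ s, vfAct (A i) hV f :=
  Der.act_sum s A hV f

theorem resSmooth_vfAct (A : VF (smoothFun I N) U) (hV : V ≤ U) (hW : W ≤ V)
    (f : C^∞⟮I, V; 𝓘(ℝ, ℝ), ℝ⟯) :
    resSmooth I N hW (vfAct A hV f) = vfAct A (hW.trans hV) (resSmooth I N hW f) :=
  Der.res_act A hV hW f

theorem vfAct_mul (A : VF (smoothFun I N) U) (hV : V ≤ U) (f g : C^∞⟮I, V; 𝓘(ℝ, ℝ), ℝ⟯) :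
    vfAct A hV (f * g) = vfAct A hV f * g + f * vfAct A hV g := by
  have h := (smoothVF_even (fun _ _ => rfl) A).act_mul hV f g
  simp only [SuperPresheaf.twist, if_true] at h
  exact h

theorem oddMul_res (p : ZMod 2) (hV : V ≤ U) (f : C^∞⟮I, U; 𝓘(ℝ, ℝ), ℝ⟯) :
    (timesOdd I N).res hV (oddMul p f) = oddMul p (resSmooth I N hV f) := by
  by_cases hp : p = 0
  · simp only [oddMul, hp, if_true]
    rfl
  · simp only [oddMul, hp, if_false]
    rfl

theorem oddPart_res (p : ZMod 2) (hV : V ≤ U) (f : DualNumber C^∞⟮I, U; 𝓘(ℝ, ℝ), ℝ⟯) :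
    resSmooth I N hV (oddPart p f) = oddPart p ((timesOdd I N).res hV f) := by
  by_cases hp : p = 0
  · simp only [oddPart, hp, if_true]
    rfl
  · simp only [oddPart, hp, if_false]
    rfl

theorem oddMul_eq_mul (p : ZMod 2) (f : C^∞⟮I, U; 𝓘(ℝ, ℝ), ℝ⟯) :
    oddMul p f = TrivSqZeroExt.inl f * oddMul p 1 := by
  by_cases hp : p = 0
  · simp only [oddMul, hp, if_true, LinearMap.coe_mk, AddHom.coe_mk]
    exact (mul_one _).symm
  · simp only [oddMul, hp, if_false, LinearMap.coe_mk, AddHom.coe_mk, TrivSqZeroExt.inl_mul_inr]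
    simp

theorem oddPart_inl_mul (p : ZMod 2) (f : C^∞⟮I, U; 𝓘(ℝ, ℝ), ℝ⟯)
    (z : DualNumber C^∞⟮I, U; 𝓘(ℝ, ℝ), ℝ⟯) :
    oddPart p (TrivSqZeroExt.inl f * z) = f * oddPart p z := by
  by_cases hp : p = 0 <;> simp [oddPart, hp]

/-- A homogeneous superfunction has only one nonzero component, so it carries exactly one smooth
function. -/
theorem oddMul_oddPart (p : ZMod 2) {z : (timesOdd I N).obj U}
    (hz : (timesOdd I N).par U z = psign p • z) : oddMul p (oddPart p z) = z := by
  have key : ∀ f : C^∞⟮I, U; 𝓘(ℝ, ℝ), ℝ⟯, f = -f → f = 0 := fun f hf =>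
    ContMDiffMap.ext fun x => by
      have h2 : f x = -f x := congrArg (fun k : C^∞⟮I, U; 𝓘(ℝ, ℝ), ℝ⟯ => k x) hf
      change f x = 0
      linarith
  by_cases hp : p = 0
  · simp only [oddMul, oddPart, hp, if_true, LinearMap.coe_mk, AddHom.coe_mk]
    simp only [psign, hp, if_true] at hz
    have h1 : -TrivSqZeroExt.snd z = TrivSqZeroExt.snd z :=
      congrArg TrivSqZeroExt.snd (hz.trans (one_smul ℝ z))
    exact TrivSqZeroExt.ext rfl (key _ h1.symm).symm
  · simp only [oddMul, oddPart, hp, if_false, LinearMap.coe_mk, AddHom.coe_mk]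
    simp only [psign, hp, if_false] at hz
    have h1 : TrivSqZeroExt.fst z = -TrivSqZeroExt.fst z :=
      congrArg TrivSqZeroExt.fst (hz.trans ((neg_smul (1 : ℝ) z).trans
        (congrArg Neg.neg (one_smul ℝ z))))
    exact TrivSqZeroExt.ext (key _ h1).symm rfl

/-- Splitting each component into a function times 1 or τ moves the functions out; the remaining
factors do not involve the vector fields and are the Christoffel symbols on E. The same identity
serves for the connection and for the geodesic equation. -/
theorem oddPart_christoffel {κ : Type*} [Fintype κ] (p : ZMod 2) (f : C^∞⟮I, U; 𝓘(ℝ, ℝ), ℝ⟯)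
    (q : κ → ZMod 2) (y z : κ → C^∞⟮I, U; 𝓘(ℝ, ℝ), ℝ⟯)
    (G : κ → κ → DualNumber C^∞⟮I, U; 𝓘(ℝ, ℝ), ℝ⟯) :
    oddPart p (oddMul p f + ∑ a, oddMul (q a) (y a) * ∑ b, oddMul (q b) (z b) * G a b) =
      f + ∑ a, ∑ b, y a * z b * oddPart p (oddMul (q a) 1 * (oddMul (q b) 1 * G a b)) := by
  rw [map_add, oddPart_oddMul, map_sum]
  congr 1
  refine Finset.sum_congr rfl fun a _ => ?_
  rw [Finset.mul_sum, map_sum]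
  refine Finset.sum_congr rfl fun b _ => ?_
  rw [oddMul_eq_mul (q a) (y a), oddMul_eq_mul (q b) (z b), ← oddPart_inl_mul]
  congr 1
  rw [TrivSqZeroExt.inl_mul]
  ring

variable {X : Type u'} [TopologicalSpace X]

/-- The extension of a vector field to `N × ℝ^{0|1}`. -/
def oddVF (φ : C(N, X)) (A : VF (smoothFun I N) W) :
    homDer (SheafHom.id (((timesOdd I N).restr W).pushforward φ)) 0 ⊤ :=
  ⟨fun V =>
    { toFun := fun f => (vfAct A (inf_le_left : W ⊓ Opens.comap φ V.1 ≤ W) (TrivSqZeroExt.fst f),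
        vfAct A (inf_le_left : W ⊓ Opens.comap φ V.1 ≤ W) (TrivSqZeroExt.snd f))
      map_add' := fun f g => TrivSqZeroExt.ext ((vfAct A _).map_add _ _) ((vfAct A _).map_add _ _)
      map_smul' := fun c f =>
        TrivSqZeroExt.ext ((vfAct A _).map_smul _ _) ((vfAct A _).map_smul _ _) },
    ⟨fun V V' hV f => TrivSqZeroExt.ext (resSmooth_vfAct A _ _ _) (resSmooth_vfAct A _ _ _),
      fun V f => by
        simp only [psign, if_true, one_smul]
        exact TrivSqZeroExt.ext rfl ((vfAct A _).map_neg _).symm,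
      fun V f g => by
        simp only [SuperPresheaf.twist, if_true]
        refine TrivSqZeroExt.ext (vfAct_mul A (inf_le_left : W ⊓ Opens.comap φ V.1 ≤ W)
          (TrivSqZeroExt.fst f) (TrivSqZeroExt.fst g)) ?_
        change vfAct A _ (TrivSqZeroExt.fst f * TrivSqZeroExt.snd g +
          TrivSqZeroExt.snd f * TrivSqZeroExt.fst g) =
          (vfAct A _ (TrivSqZeroExt.fst f) * TrivSqZeroExt.snd g +
            vfAct A _ (TrivSqZeroExt.snd f) * TrivSqZeroExt.fst g) +
          (TrivSqZeroExt.fst f * vfAct A _ (TrivSqZeroExt.snd g) +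
            TrivSqZeroExt.snd f * vfAct A _ (TrivSqZeroExt.fst g))
        rw [map_add, vfAct_mul, vfAct_mul]
        abel⟩⟩

theorem ap_oddVF_oddMul (φ : C(N, X)) (A : VF (smoothFun I N) W) (V : Opens X) (p : ZMod 2)
    (f : C^∞⟮I, (W ⊓ Opens.comap φ V : Opens N); 𝓘(ℝ, ℝ), ℝ⟯) :
    ap (oddVF φ A) V (oddMul p f) = oddMul p (vfAct A inf_le_left f) := by
  by_cases hp : p = 0
  · simp only [oddMul, hp, if_true]
    exact TrivSqZeroExt.ext rfl (map_zero (vfAct A _))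
  · simp only [oddMul, hp, if_false]
    exact TrivSqZeroExt.ext (map_zero (vfAct A _)) rfl

end VectorFields

/-! ## The reduced connection -/

section ReducedConnection

variable {B : Type*} [NormedAddCommGroup B] [NormedSpace ℝ B] [FiniteDimensional ℝ B]
  {M : Type u} [TopologicalSpace M] [ChartedSpace B M] [IsManifold 𝓘(ℝ, B) ∞ M]
  {F : Type*} [NormedAddCommGroup F] [NormedSpace ℝ F] [FiniteDimensional ℝ F]
  {E : M → Type*} [TopologicalSpace (TotalSpace F E)] [∀ x, AddCommGroup (E x)]
  [∀ x, Module ℝ (E x)] [∀ x, TopologicalSpace (E x)] [FiberBundle F E] [VectorBundle ℝ F E]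
  [ContMDiffVectorBundle ∞ F E 𝓘(ℝ, B)]
  {Ms : SuperPresheaf.{u, v} M}

/-- The direct image on `M` of the superfunctions on `W × ℝ^{0|1}`, for `W ⊆ E` open. -/
abbrev oddRestr (B : Type*) [NormedAddCommGroup B] [NormedSpace ℝ B] {M : Type u}
    [TopologicalSpace M] [ChartedSpace B M] (F : Type*) [NormedAddCommGroup F] [NormedSpace ℝ F]
    {E : M → Type*} [TopologicalSpace (TotalSpace F E)] [∀ x, AddCommGroup (E x)]
    [∀ x, Module ℝ (E x)] [∀ x, TopologicalSpace (E x)] [FiberBundle F E] [VectorBundle ℝ F E]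
    (W : Opens (TotalSpace F E)) : SuperPresheaf M :=
  ((timesOdd (𝓘(ℝ, B).prod 𝓘(ℝ, F)) (TotalSpace F E)).restr W).pushforward (bundleProj F E)

/-! ### Vector fields on E as even derivations along the evaluation morphism -/

section Lifts

variable (β : SheafIso Ms (batchelor B F E)) (W : Opens (TotalSpace F E))

/-- The restriction of `q : 𝒪 → C^∞(E)[τ]` to `W`. -/
def evRestr : SheafHom Ms (oddRestr B F W) where
  app V := ((timesOdd (𝓘(ℝ, B).prod 𝓘(ℝ, F)) (TotalSpace F E)).res
    (inf_le_right : W ⊓ Opens.comap (bundleProj F E) V ≤ _)).comp (evApp β V)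
  app_res {U V} h s := congrArg ((timesOdd (𝓘(ℝ, B).prod 𝓘(ℝ, F)) (TotalSpace F E)).res
    (inf_le_right : W ⊓ Opens.comap (bundleProj F E) V ≤ _)) ((ev β).pull.app_res h s)
  app_par V s := congrArg ((timesOdd (𝓘(ℝ, B).prod 𝓘(ℝ, F)) (TotalSpace F E)).res
    (inf_le_right : W ⊓ Opens.comap (bundleProj F E) V ≤ _)) ((ev β).pull.app_par V s)

theorem splitFrame_spans_evRestr (p : M) : (splitFrame β p).Spans (evRestr β W) :=
  splitFrame_spans β p ((enoughOddPoints_restr (bundleProj F E) W).pointSeparated _ _)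

theorem splitFrame_spans_id (p : M) : (splitFrame β p).Spans (SheafHom.id Ms) :=
  splitFrame_spans β p (funIncl_pointSeparated β)

theorem oddRestr_isSheaf : SuperPresheaf.IsSheaf.{u, _, t} (oddRestr B F W) :=
  (timesOdd_isSheaf.restr W).pushforward _

variable {W}

/-- The lift of a vector field on `W ⊆ E` to a derivation along `q`. -/
def liftVF (A : VF (totE B F E) W) : Der (evRestr β W) ⊤ :=
  Der.ofHom (velocityAlong (evRestr β W) (oddVF (bundleProj F E) A))

variable (E) in
/-- The coordinates of `E`, restricted. -/
def yOn (p : M) {V : Opens (TotalSpace F E)} (hV : V ≤ liftDom B F E p) (a : SplitIdx B F) :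
    C^∞⟮𝓘(ℝ, B).prod 𝓘(ℝ, F), V; 𝓘(ℝ, ℝ), ℝ⟯ := resSmooth _ _ hV (liftCoord E p a)

theorem evRestr_splitCoord (p : M) (a : SplitIdx B F) :
    (evRestr β W).app _ (splitCoord β p a) = oddMul (splitParity a)
      (yOn E p (inf_le_right : W ⊓ liftDom B F E p ≤ _) a) :=
  (congrArg _ (evApp_splitCoord β p a)).trans (oddMul_res _ _ _)

/-- The components of the lift are those of A times 1 or τ, so no information is lost in lifting. -/
theorem act_liftVF_splitCoord (A : VF (totE B F E) W) (p : M) (a : SplitIdx B F) :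
    Der.act (liftVF β A) le_top (splitCoord β p a) = oddMul (splitParity a)
      (vfAct A inf_le_left (yOn E p (inf_le_right : W ⊓ liftDom B F E p ≤ _) a)) := by
  refine (act_velocityAlong _ _).trans ?_
  rw [evRestr_splitCoord]
  exact ap_oddVF_oddMul _ A _ _ _

variable (nabla : Connection Ms)

/-- The Christoffel symbols of `∇`. -/
def superChristoffel (p : M) (a b c : SplitIdx B F) : Ms.obj (splitDom B F E p) :=
  Der.act (nabla.cov _ (splitPartial β p b) (splitPartial β p a)) le_rfl (splitCoord β p c)

/-- `q(s)` as a dual number. -/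
def evDual {U : Opens M} (s : Ms.obj U) :
    DualNumber C^∞⟮𝓘(ℝ, B).prod 𝓘(ℝ, F), Opens.comap (bundleProj F E) U; 𝓘(ℝ, ℝ), ℝ⟯ :=
  evApp β U s

/-- The Christoffel symbols of the reduced connection. -/
def christoffel (p : M) (a b c : SplitIdx B F) :
    C^∞⟮𝓘(ℝ, B).prod 𝓘(ℝ, F), liftDom B F E p; 𝓘(ℝ, ℝ), ℝ⟯ :=
  oddPart (splitParity c) (oddMul (splitParity a) 1 *
    (oddMul (splitParity b) 1 * evDual β (superChristoffel β nabla p a b c)))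

/-- The components of the reduced covariant derivative. -/
def covCoord (A B' : VF (totE B F E) W) (p : M) {V : Opens (TotalSpace F E)} (hVW : V ≤ W)
    (hV : V ≤ liftDom B F E p) (c : SplitIdx B F) :
    C^∞⟮𝓘(ℝ, B).prod 𝓘(ℝ, F), V; 𝓘(ℝ, ℝ), ℝ⟯ :=
  vfAct A hVW (vfAct B' hVW (yOn E p hV c)) + ∑ a, ∑ b,
    vfAct B' hVW (yOn E p hV a) * vfAct A hVW (yOn E p hV b) *
      resSmooth _ _ hV (christoffel β nabla p a b c)

theorem resSmooth_covCoord (A B' : VF (totE B F E) W) (p : M) {V V' : Opens (TotalSpace F E)}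
    (hVW : V ≤ W) (hV : V ≤ liftDom B F E p) (hV' : V' ≤ V) (c : SplitIdx B F) :
    resSmooth _ _ hV' (covCoord β nabla A B' p hVW hV c) =
      covCoord β nabla A B' p (hV'.trans hVW) (hV'.trans hV) c := by
  simp only [covCoord, map_add, map_sum, map_mul, resSmooth_vfAct]
  rfl

/-- The pullback derivative of an even derivation is even, so its components again have the shape of
those of a lifted vector field. The local formula then yields an expression of the classical form on
E. -/
theorem act_cov_liftVF (A B' : VF (totE B F E) W)
    {D : ∀ U : Opens M, Der (evRestr β W) U →ₗ[ℝ] Der (evRestr β W) U}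
    (hD : IsCovAlong nabla (evRestr β W) (oddVF (bundleProj F E) A) D) (p : M)
    (c : SplitIdx B F) :
    Der.act (D ⊤ (liftVF β B')) le_top (splitCoord β p c) = oddMul (splitParity c)
      (covCoord β nabla A B' p (inf_le_left : W ⊓ liftDom B F E p ≤ W) inf_le_right c) := by
  have hZ : Der.HasParity (D ⊤ (liftVF β B')) 0 := hD.even (Der.ofHom_hasParity _)
  have hpar := hZ.par_act_of le_top (splitCoord_par β p c)
  rw [zero_add] at hpar
  have h1 : Der.act (D ⊤ (liftVF β B')) le_top (splitCoord β p c) =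
      Der.act (covLocal nabla (evRestr β W) (oddVF (bundleProj F E) A) (splitFrame β p) le_rfl
        (Der.res le_top (liftVF β B'))) le_rfl (Ms.res le_rfl ((splitFrame β p).x c)) := by
    rw [Ms.res_self, ← hD.eq_covLocal (splitFrame_spans_evRestr β W p) le_rfl, ← hD.res]
    rfl
  rw [covLocal_act] at h1
  simp only [Ms.res_self, Der.act_res] at h1
  have h2 : ∀ a, Der.act (liftVF β B') le_top ((splitFrame β p).x a) = oddMul (splitParity a)
      (vfAct B' inf_le_left (yOn E p (inf_le_right : W ⊓ liftDom B F E p ≤ _) a)) :=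
    act_liftVF_splitCoord β B' p
  have h3 : ∀ a, ap (oddVF (bundleProj F E) A) _ ((evRestr β W).app _ ((splitFrame β p).x a)) =
      oddMul (splitParity a)
        (vfAct A inf_le_left (yOn E p (inf_le_right : W ⊓ liftDom B F E p ≤ _) a)) :=
    act_liftVF_splitCoord β A p
  simp only [h2, h3] at h1
  rw [ap_oddVF_oddMul] at h1
  -- The component is homogeneous of the parity of `c`, so it suffices to compute its part of that
  -- parity.
  have h4 := oddMul_oddPart (I := 𝓘(ℝ, B).prod 𝓘(ℝ, F)) (U := W ⊓ liftDom B F E p)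
    (splitParity c) hpar
  refine h4.symm.trans (congrArg (oddMul (splitParity c)) ?_)
  refine (congrArg (oddPart (splitParity c)) h1).trans ?_
  refine (oddPart_christoffel (splitParity c) _ splitParity _ _ (fun a b =>
    (timesOdd (𝓘(ℝ, B).prod 𝓘(ℝ, F)) (TotalSpace F E)).res
      (inf_le_right : W ⊓ liftDom B F E p ≤ _)
        (evDual β (superChristoffel β nabla p a b c)))).trans ?_
  refine congrArg _ (Finset.sum_congr rfl fun a _ => Finset.sum_congr rfl fun b _ =>
    congrArg _ ?_)
  rw [christoffel, oddPart_res]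
  congr 1
  refine Eq.trans ?_ (map_mul ((timesOdd (𝓘(ℝ, B).prod 𝓘(ℝ, F)) (TotalSpace F E)).res
      (inf_le_right : W ⊓ liftDom B F E p ≤ _)) _ _).symm
  refine congrArg₂ _ (oddMul_res _ _ 1).symm ?_
  refine Eq.trans ?_ (map_mul ((timesOdd (𝓘(ℝ, B).prod 𝓘(ℝ, F)) (TotalSpace F E)).res
      (inf_le_right : W ⊓ liftDom B F E p ≤ _)) _ _).symm
  exact congrArg₂ _ (oddMul_res _ _ 1).symm rfl

/-- `C` is the reduced covariant derivative of `B'` along `A`. -/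
def IsReducedCov (A B' C : VF (totE B F E) W) : Prop :=
  ∀ (p : M) (V : Opens (TotalSpace F E)) (hVW : V ≤ W) (hV : V ≤ liftDom B F E p)
    (c : SplitIdx B F), vfAct C hVW (yOn E p hV c) = covCoord β nabla A B' p hVW hV c

theorem exists_cov_evRestr (A : VF (totE B F E) W) :
    ∃ D, IsCovAlong nabla (evRestr β W) (oddVF (bundleProj F E) A) D :=
  exists_isCovAlong nabla _ _ (oddRestr_isSheaf W) (fun p : M => splitDom B F E p)
    (fun x => ⟨x, mem_splitDom x⟩) (splitFrame β) (fun p => splitFrame_spans_id β p)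
    (fun p => splitFrame_spans_evRestr β W p)

variable {β nabla} {A B' C C' : VF (totE B F E) W}

theorem IsReducedCov.unique (h : IsReducedCov β nabla A B' C) (h' : IsReducedCov β nabla A B' C') :
    C = C' := by
  refine Der.eq_of_cover (V := fun p => liftDom B F E p) smoothFun_isSheaf
    (fun x _ => ⟨x.proj, mem_splitDom _⟩) fun p => ?_
  refine (liftFrame_spans_id p).ext inf_le_right fun a => ?_
  exact (h p _ inf_le_left inf_le_right a).trans (h' p _ inf_le_left inf_le_right a).symm

theorem IsReducedCov.res {W' : Opens (TotalSpace F E)} (hW : W' ≤ W)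
    (h : IsReducedCov β nabla A B' C) :
    IsReducedCov β nabla (Der.res hW A) (Der.res hW B') (Der.res hW C) :=
  fun p V hVW hV c => h p V (hVW.trans hW) hV c

/-- The coordinates over a chart determine derivations along q there, so the formula in a single
chart already gives the lifted equation over that chart. -/
theorem res_liftVF_eq {D : ∀ U : Opens M, Der (evRestr β W) U →ₗ[ℝ] Der (evRestr β W) U}
    (hD : IsCovAlong nabla (evRestr β W) (oddVF (bundleProj F E) A) D) {p : M}
    (hC : ∀ c, vfAct C inf_le_left (yOn E p (inf_le_right : W ⊓ liftDom B F E p ≤ _) c) =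
      covCoord β nabla A B' p inf_le_left inf_le_right c) :
    Der.res (le_top : splitDom B F E p ≤ ⊤) (liftVF β C) = Der.res le_top (D ⊤ (liftVF β B')) := by
  refine (splitFrame_spans_evRestr β W p).ext le_rfl fun a => ?_
  rw [Ms.res_self]
  exact (act_liftVF_splitCoord β C p a).trans ((congrArg _ (hC a)).trans
    (act_cov_liftVF β nabla A B' hD p a).symm)

theorem IsReducedCov.liftVF_eq
    {D : ∀ U : Opens M, Der (evRestr β W) U →ₗ[ℝ] Der (evRestr β W) U}
    (hD : IsCovAlong nabla (evRestr β W) (oddVF (bundleProj F E) A) D)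
    (h : IsReducedCov β nabla A B' C) : liftVF β C = D ⊤ (liftVF β B') :=
  Der.eq_of_cover_of_le (oddRestr_isSheaf W) (V := fun p => splitDom B F E p)
    (fun x _ => ⟨x, mem_splitDom x⟩) (fun _ => le_top) fun p =>
      res_liftVF_eq hD fun c => h p _ inf_le_left inf_le_right c

/-- The lifted equation does not refer to a chart, so it implies the coordinate formula in all
charts at once. -/
theorem isReducedCov_of_liftVF_eq
    {D : ∀ U : Opens M, Der (evRestr β W) U →ₗ[ℝ] Der (evRestr β W) U}
    (hD : IsCovAlong nabla (evRestr β W) (oddVF (bundleProj F E) A) D)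
    (h : liftVF β C = D ⊤ (liftVF β B')) : IsReducedCov β nabla A B' C := by
  intro p V hVW hV c
  have h1 := (act_liftVF_splitCoord β C p c).symm.trans
    ((congrArg (fun Z => Der.act Z le_top (splitCoord β p c)) h).trans
      (act_cov_liftVF β nabla A B' hD p c))
  have h2 := congrArg (oddPart (splitParity c)) h1
  rw [oddPart_oddMul, oddPart_oddMul] at h2
  have h3 := congrArg (resSmooth _ _ (le_inf hVW hV)) h2
  rw [resSmooth_covCoord, resSmooth_vfAct] at h3
  exact h3

/-- All of W lies over the chart domain, so restricting to it discards no point of W. -/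
theorem oddRestr_res_injective {p : M} (hW : W ≤ liftDom B F E p) {V : Opens M}
    {b b' : (oddRestr B F W).obj V}
    (h : (oddRestr B F W).res (inf_le_left : V ⊓ splitDom B F E p ≤ V) b =
      (oddRestr B F W).res inf_le_left b') : b = b' := by
  refine evalDual_ext (U := W ⊓ Opens.comap (bundleProj F E) V) fun x => ?_
  exact congrArg (evalDual (I := 𝓘(ℝ, B).prod 𝓘(ℝ, F))
    (U := W ⊓ Opens.comap (bundleProj F E) (V ⊓ splitDom B F E p))
    ⟨x.1, x.2.1, x.2.2, hW x.2.1⟩) h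

variable (β nabla A B')

/-- The field is defined by its components in one chart. Passing through the lifted equation shows
that the formula holds in every other chart, with no computation of coordinate changes. -/
theorem exists_isReducedCov_of_le {p : M} (hW : W ≤ liftDom B F E p) :
    ∃ C, IsReducedCov β nabla A B' C := by
  obtain ⟨D, hD⟩ := exists_cov_evRestr β nabla A
  let C : VF (totE B F E) W := ∑ c, Der.mulLeft (P := totE B F E)
    (covCoord β nabla A B' p le_rfl hW c) (Der.res hW ((liftFrame E p).d c))
  have hC : ∀ (V : Opens (TotalSpace F E)) (hVW : V ≤ W) (hV : V ≤ liftDom B F E p) (c),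
      vfAct C hVW (yOn E p hV c) = covCoord β nabla A B' p hVW hV c := by
    intro V hVW hV c
    rw [← resSmooth_covCoord β nabla A B' p le_rfl hW hVW, vfAct_sum_left,
      Finset.sum_eq_single c]
    · rw [vfAct_mulLeft]
      have h1 : vfAct (Der.res hW ((liftFrame E p).d c)) hVW (yOn E p hV c) = 1 := by
        refine (resSmooth_vfAct ((liftFrame (B := B) E p).d c) le_rfl hV _).symm.trans ?_
        have := (liftFrame (B := B) (F := F) E p).d_x c c
        rw [if_pos rfl] at this
        exact (congrArg _ this).trans (map_one (resSmooth _ _ hV))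
      rw [h1, mul_one]
    · intro a _ hac
      rw [vfAct_mulLeft]
      have h1 : vfAct (Der.res hW ((liftFrame E p).d a)) hVW (yOn E p hV c) = 0 := by
        refine (resSmooth_vfAct ((liftFrame (B := B) E p).d a) le_rfl hV _).symm.trans ?_
        have := (liftFrame (B := B) (F := F) E p).d_x a c
        rw [if_neg hac] at this
        exact (congrArg _ this).trans (map_zero (resSmooth _ _ hV))
      rw [h1, mul_zero]
    · exact fun h => absurd (Finset.mem_univ c) h
  refine ⟨C, isReducedCov_of_liftVF_eq hD ?_⟩
  have h1 := res_liftVF_eq hD fun c => hC _ inf_le_left inf_le_right c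
  refine Der.ext_act fun V hV s => oddRestr_res_injective hW ?_
  rw [Der.res_act, Der.res_act]
  exact congrArg (fun Z => Der.act Z (inf_le_right : V ⊓ splitDom B F E p ≤ _)
    (Ms.res inf_le_left s)) h1

/-- The local solutions glue because the coordinate formula has at most one solution on each
overlap. -/
theorem exists_isReducedCov : ∃ C, IsReducedCov β nabla A B' C := by
  choose C hC using fun p : M => exists_isReducedCov_of_le β nabla
    (Der.res (inf_le_left : W ⊓ liftDom B F E p ≤ W) A) (Der.res inf_le_left B') inf_le_right
  obtain ⟨C₀, hC₀⟩ := Der.glue (U := W) (V := fun p => liftDom B F E p) smoothFun_isSheaf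
    (fun x _ => ⟨x.proj, mem_splitDom _⟩) C fun p q =>
      ((hC p).res (inf_le_inf_left W inf_le_left)).unique
        ((hC q).res (inf_le_inf_left W inf_le_right))
  refine ⟨C₀, fun p V hVW hV c => ?_⟩
  have h1 := hC p p V (le_inf hVW hV) hV c
  rw [← hC₀ p] at h1
  exact h1

/-- The reduced covariant derivative. -/
def reducedCov : VF (totE B F E) W := Classical.choose (exists_isReducedCov β nabla A B')

theorem isReducedCov_reducedCov : IsReducedCov β nabla A B' (reducedCov β nabla A B') :=
  Classical.choose_spec (exists_isReducedCov β nabla A B')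

end Lifts

theorem twist_smoothFun {D : Type*} [NormedAddCommGroup D] [NormedSpace ℝ D] {H : Type*}
    [TopologicalSpace H] {I : ModelWithCorners ℝ D H} {N : Type*} [TopologicalSpace N]
    [ChartedSpace H N] (p : ZMod 2) {U : Opens N} (f : (smoothFun I N).obj U) :
    (smoothFun I N).twist p U f = f := by
  rcases zmod2_cases p with rfl | rfl
  · simp [SuperPresheaf.twist]
  · simp only [SuperPresheaf.twist, one_ne_zero, if_false]
    rfl

theorem vf_eq_zero_of_odd {D : Type*} [NormedAddCommGroup D] [NormedSpace ℝ D] {H : Type*}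
    [TopologicalSpace H] {I : ModelWithCorners ℝ D H} {N : Type*} [TopologicalSpace N]
    [ChartedSpace H N] {U : Opens N} {A : VF (smoothFun I N) U} (hA : Der.HasParity A 1) :
    A = 0 :=
  (Der.parts_unique (smoothVF_even (fun _ _ => rfl) A)
    (show Der.HasParity (-A) 1 from Submodule.neg_mem _ hA) (add_neg_cancel A)).1

variable (β : SheafIso Ms (batchelor B F E)) (nabla : Connection Ms)

/-- The reduced covariant derivative as a bilinear map. -/
def reducedCovLin (W : Opens (TotalSpace F E)) :
    VF (totE B F E) W →ₗ[ℝ] VF (totE B F E) W →ₗ[ℝ] VF (totE B F E) W :=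
  LinearMap.mk₂ ℝ (reducedCov β nabla)
    (fun A A' B' => (isReducedCov_reducedCov β nabla _ _).unique fun p V hVW hV c => by
      rw [vfAct_add_left, isReducedCov_reducedCov β nabla A B' p V hVW hV,
        isReducedCov_reducedCov β nabla A' B' p V hVW hV]
      simp only [covCoord, vfAct_add_left, mul_add, add_mul, Finset.sum_add_distrib]
      abel)
    (fun r A B' => (isReducedCov_reducedCov β nabla _ _).unique fun p V hVW hV c => by
      rw [vfAct_smul_left, isReducedCov_reducedCov β nabla A B' p V hVW hV]
      simp only [covCoord, vfAct_smul_left, mul_smul_comm, smul_mul_assoc, smul_add,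
        Finset.smul_sum])
    (fun A B' B'' => (isReducedCov_reducedCov β nabla _ _).unique fun p V hVW hV c => by
      rw [vfAct_add_left, isReducedCov_reducedCov β nabla A B' p V hVW hV,
        isReducedCov_reducedCov β nabla A B'' p V hVW hV]
      simp only [covCoord, vfAct_add_left, map_add, add_mul, Finset.sum_add_distrib]
      abel)
    (fun r A B' => (isReducedCov_reducedCov β nabla _ _).unique fun p V hVW hV c => by
      rw [vfAct_smul_left, isReducedCov_reducedCov β nabla A B' p V hVW hV]
      simp only [covCoord, vfAct_smul_left, map_smul, smul_mul_assoc, smul_add,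
        Finset.smul_sum])

theorem isReducedCov_reducedCovLin {W : Opens (TotalSpace F E)} (A B' : VF (totE B F E) W) :
    IsReducedCov β nabla A B' (reducedCovLin β nabla W A B') := isReducedCov_reducedCov β nabla A B'

theorem reducedCovLin_mulLeft {W : Opens (TotalSpace F E)}
    (f : C^∞⟮𝓘(ℝ, B).prod 𝓘(ℝ, F), W; 𝓘(ℝ, ℝ), ℝ⟯) (A B' : VF (totE B F E) W) :
    reducedCovLin β nabla W (Der.mulLeft (P := totE B F E) f A) B' =
      Der.mulLeft (P := totE B F E) f (reducedCovLin β nabla W A B') := by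
  refine (isReducedCov_reducedCovLin β nabla _ _).unique fun p V hVW hV c => ?_
  rw [vfAct_mulLeft, isReducedCov_reducedCovLin β nabla A B' p V hVW hV c]
  simp only [covCoord, vfAct_mulLeft, mul_add, Finset.mul_sum]
  refine congrArg _ (Finset.sum_congr rfl fun a _ => Finset.sum_congr rfl fun b _ => ?_)
  ring

/-- In coordinates only the second-derivative term contributes the extra summand; the Christoffel
term is linear over functions in both arguments. -/
theorem reducedCovLin_leibniz {W : Opens (TotalSpace F E)}
    (f : C^∞⟮𝓘(ℝ, B).prod 𝓘(ℝ, F), W; 𝓘(ℝ, ℝ), ℝ⟯) (A B' : VF (totE B F E) W) :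
    reducedCovLin β nabla W A (Der.mulLeft (P := totE B F E) f B') =
      Der.mulLeft (P := totE B F E) (vfAct A le_rfl f) B' +
        Der.mulLeft (P := totE B F E) f (reducedCovLin β nabla W A B') := by
  refine (isReducedCov_reducedCovLin β nabla _ _).unique fun p V hVW hV c => ?_
  rw [vfAct_add_left, vfAct_mulLeft, vfAct_mulLeft,
    isReducedCov_reducedCovLin β nabla A B' p V hVW hV c, resSmooth_vfAct]
  simp only [covCoord, vfAct_mulLeft, vfAct_mul, mul_add, Finset.mul_sum, add_assoc]
  refine congrArg _ (congrArg _ (Finset.sum_congr rfl fun a _ =>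
    Finset.sum_congr rfl fun b _ => ?_))
  ring

/-- The connection `∇^{TE}`. -/
def reducedConnection : Connection (totE B F E) where
  cov W := reducedCovLin β nabla W
  cov_res hV A B' := ((isReducedCov_reducedCovLin β nabla A B').res hV).unique
    (isReducedCov_reducedCovLin β nabla _ _)
  cov_even {U A B' p q} hA hB := by
    rcases zmod2_cases p with rfl | rfl
    · rcases zmod2_cases q with rfl | rfl
      · rw [add_zero]
        exact smoothVF_even (fun _ _ => rfl) _
      · rw [vf_eq_zero_of_odd hB, map_zero]
        exact Der.HasParity.zero
    · rw [vf_eq_zero_of_odd hA, map_zero]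
      exact Der.HasParity.zero
  cov_mulLeft f A B' := reducedCovLin_mulLeft β nabla f A B'
  cov_leibniz {U q A} _ f B' := by
    rw [twist_smoothFun]
    exact reducedCovLin_leibniz β nabla f A B'

end ReducedConnection

/-! ## Reductions of superderivations and uniqueness of the reduced connection -/

section Reductions

variable {B : Type*} [NormedAddCommGroup B] [NormedSpace ℝ B] [FiniteDimensional ℝ B]
  {M : Type u} [TopologicalSpace M] [ChartedSpace B M] [IsManifold 𝓘(ℝ, B) ∞ M]
  {F : Type*} [NormedAddCommGroup F] [NormedSpace ℝ F] [FiniteDimensional ℝ F]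
  {E : M → Type*} [TopologicalSpace (TotalSpace F E)] [∀ x, AddCommGroup (E x)]
  [∀ x, Module ℝ (E x)] [∀ x, TopologicalSpace (E x)] [FiberBundle F E] [VectorBundle ℝ F E]
  [ContMDiffVectorBundle ∞ F E 𝓘(ℝ, B)]
  {Ms : SuperPresheaf.{u, v} M} (β : SheafIso Ms (batchelor B F E))

theorem psi_eq_evDual {U : Opens M} (s : Ms.obj U) :
    psi β s = TrivSqZeroExt.fst (evDual β s) + TrivSqZeroExt.snd (evDual β s) :=
  ContMDiffMap.ext fun e => psi_eq_evPoint β s e.1 e.2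

/-- For homogeneous s one component of q(s) vanishes, so T loses nothing and q(s) can be recovered
from ψ. -/
theorem evApp_of_par {U : Opens M} {p : ZMod 2} {s : Ms.obj U} (hs : Ms.par U s = psign p • s) :
    evApp β U s = oddMul p (psi β s) := by
  have h1 := oddMul_oddPart (I := 𝓘(ℝ, B).prod 𝓘(ℝ, F)) (U := Opens.comap (bundleProj F E) U) p
    (z := evApp β U s) (by
      refine ((ev β).pull.app_par U s).symm.trans ?_
      rw [hs]
      exact map_smul (evApp β U) _ _)
  have h2 : psi β s = oddPart p (evDual β s) := by
    rw [psi_eq_evDual]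
    have h3 : evDual β s = oddMul p (oddPart p (evDual β s)) := h1.symm
    rw [h3, oddPart_oddMul]
    by_cases hp : p = 0
    · simp [oddMul, hp]
    · simp [oddMul, hp]
  rw [h2]
  exact h1.symm

theorem psi_splitCoord (p : M) (a : SplitIdx B F) :
    psi β (splitCoord β p a) = liftCoord E p a := by
  have h := (evApp_of_par β (splitCoord_par β p a)).symm.trans (evApp_splitCoord β p a)
  have h2 := congrArg (oddPart (splitParity a)) h
  rwa [oddPart_oddMul, oddPart_oddMul] at h2

theorem InF.res {U V : Opens M} (hV : V ≤ U) {s : Ms.obj U} (hs : InF β s) :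
    InF β (Ms.res hV s) := fun x => by
  obtain ⟨r, m, h⟩ := hs ⟨x.1, hV x.2⟩
  exact ⟨r, m, (secEquiv_res β hV s x).trans h⟩

variable {β} {U : Opens M} {Z : VF Ms U}
  {Z' : VF (totE B F E) (Opens.comap (bundleProj F E) U)}

/-- Adding the two components of q on both sides turns relatedness by `ev` into the reduction
property. -/
theorem reducesTo_of_liftVF (h : Der.res (le_top : U ≤ ⊤) (liftVF β Z') =
    Der.post (evRestr β (Opens.comap (bundleProj F E) U)) Z) : ReducesTo β Z Z' := by
  intro V hV s _
  have hVU := Opens.comap_mono (bundleProj F E) hV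
  change vfAct Z' hVU (psi β s) = psi β (Der.act Z hV s)
  have h1 := congrArg (fun D => Der.act D hV s) h
  have hfst : vfAct Z' inf_le_left (resSmooth _ _ inf_le_right (TrivSqZeroExt.fst (evDual β s))) =
      resSmooth _ _ (inf_le_right : Opens.comap (bundleProj F E) U ⊓
        Opens.comap (bundleProj F E) V ≤ _) (TrivSqZeroExt.fst (evDual β (Der.act Z hV s))) :=
    congrArg TrivSqZeroExt.fst h1
  have hsnd : vfAct Z' inf_le_left (resSmooth _ _ inf_le_right (TrivSqZeroExt.snd (evDual β s))) =
      resSmooth _ _ (inf_le_right : Opens.comap (bundleProj F E) U ⊓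
        Opens.comap (bundleProj F E) V ≤ _) (TrivSqZeroExt.snd (evDual β (Der.act Z hV s))) :=
    congrArg TrivSqZeroExt.snd h1
  have h2 : resSmooth _ _ (inf_le_right : Opens.comap (bundleProj F E) U ⊓
        Opens.comap (bundleProj F E) V ≤ _) (vfAct Z' hVU (psi β s)) =
      resSmooth _ _ inf_le_right (psi β (Der.act Z hV s)) := by
    rw [resSmooth_vfAct, psi_eq_evDual, psi_eq_evDual, map_add, map_add, map_add, hfst, hsnd]
  refine ContMDiffMap.ext fun e => ?_
  exact congrArg (fun f : C^∞⟮𝓘(ℝ, B).prod 𝓘(ℝ, F), (Opens.comap (bundleProj F E) U ⊓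
    Opens.comap (bundleProj F E) V : Opens (TotalSpace F E)); 𝓘(ℝ, ℝ), ℝ⟯ =>
      f ⟨e.1, hVU e.2, e.2⟩) h2

/-- Both sides need only be compared on coordinates. These lie in 𝓕 and are homogeneous, and so are
their images under the even Z, so the identity for ψ lifts to one for q. -/
theorem liftVF_of_reducesTo (hZ : Der.HasParity Z 0) (h : ReducesTo β Z Z') :
    Der.res (le_top : U ≤ ⊤) (liftVF β Z') =
      Der.post (evRestr β (Opens.comap (bundleProj F E) U)) Z := by
  refine Der.eq_of_cover (V := fun p => splitDom B F E p)
    (oddRestr_isSheaf (Opens.comap (bundleProj F E) U)) (fun x _ => ⟨x, mem_splitDom x⟩)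
      fun p => ?_
  refine (splitFrame_spans_evRestr β _ p).ext inf_le_right fun a => ?_
  set V := U ⊓ splitDom B F E p
  set s : Ms.obj V := Ms.res inf_le_right ((splitFrame β p).x a)
  have hs : Ms.par V s = psign (splitParity a) • s := by
    change Ms.par V (Ms.res inf_le_right (splitCoord β p a)) = _
    rw [Ms.par_res, splitCoord_par, map_smul]
    rfl
  have hsF : InF β s := InF.res β inf_le_right (inF_splitCoord β p a)
  have hZs := hZ.par_act_of (inf_le_left : V ≤ U) hs
  rw [zero_add] at hZs
  have h1 : vfAct Z' (Opens.comap_mono (bundleProj F E) (inf_le_left : V ≤ U)) (psi β s) =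
    psi β (Der.act Z inf_le_left s) := h V inf_le_left s hsF
  change ap (oddVF (bundleProj F E) Z') V ((timesOdd _ _).res inf_le_right (evApp β V s)) =
    (timesOdd _ _).res inf_le_right (evApp β V (Der.act Z inf_le_left s))
  rw [evApp_of_par β hs, evApp_of_par β hZs]
  refine (congrArg (ap (oddVF (bundleProj F E) Z') V) (oddMul_res _ _ _)).trans ?_
  refine (ap_oddVF_oddMul _ Z' V _ _).trans ?_
  rw [← h1]
  refine Eq.trans ?_ (oddMul_res _ _ _).symm
  rw [resSmooth_vfAct]

/-- Reduction means relatedness by `ev`. When the direction X' is related to X, the pullback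
derivative along X' of q ∘ Y is q ∘ ∇_X Y by compatibility with a single summand of coefficient 1.
-/
theorem isReducedConnection_reducedConnection (nabla : Connection Ms) :
    IsReducedConnection β nabla (reducedConnection β nabla) := by
  intro U X Y X' Y' hX hY hXX hYY
  refine reducesTo_of_liftVF ?_
  obtain ⟨D, hD⟩ := exists_cov_evRestr β nabla X'
  have h1 : liftVF β ((reducedConnection β nabla).cov _ X' Y') = D ⊤ (liftVF β Y') :=
    (isReducedCov_reducedCovLin β nabla X' Y').liftVF_eq hD
  rw [h1, hD.res, liftVF_of_reducesTo hY.1 hYY]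
  have h2 := hD.compat (n := 1) (fun _ => 1) (fun _ => X) (by
    rw [Fin.sum_univ_one, Der.one_mulLeft]
    exact liftVF_of_reducesTo hX.1 hXX) Y
  rwa [Fin.sum_univ_one, Der.one_mulLeft] at h2

theorem ReducesTo.unique {p : M} {Z : VF Ms (splitDom B F E p)}
    {Z₁ Z₂ : VF (totE B F E) (liftDom B F E p)} (h₁ : ReducesTo β Z Z₁) (h₂ : ReducesTo β Z Z₂) :
    Z₁ = Z₂ := by
  refine (liftFrame_spans_id p).ext le_rfl fun a => ?_
  have e1 := h₁ _ le_rfl _ (inF_splitCoord β p a)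
  have e2 := h₂ _ le_rfl _ (inF_splitCoord β p a)
  rw [psi_splitCoord] at e1 e2
  exact e1.trans e2.symm

/-! ### Even multiples of the coordinate fields -/

section WeightedFrame

variable (β) (p : M)

/-- The weight `1` in even and `ξ` in odd directions. -/
def superWeight : SplitIdx B F → Ms.obj (splitDom B F E p) :=
  Sum.elim (fun _ => 1) fun a => splitCoord β p (Sum.inr a)

variable (E) in
/-- The weight `1` in horizontal and `y` in vertical directions. -/
def weight : SplitIdx B F → C^∞⟮𝓘(ℝ, B).prod 𝓘(ℝ, F), liftDom B F E p; 𝓘(ℝ, ℝ), ℝ⟯ :=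
  Sum.elim (fun _ => 1) fun a => liftCoord E p (Sum.inr a)

theorem superWeight_par (a : SplitIdx B F) :
    Ms.par _ (superWeight β p a) = psign (splitParity a) • superWeight β p a := by
  rcases a with i | a
  · simp [superWeight, splitParity, psign]
  · exact splitCoord_par β p (Sum.inr a)

theorem evApp_superWeight (a : SplitIdx B F) :
    evApp β _ (superWeight β p a) = oddMul (splitParity a) (weight E p a) := by
  rcases a with i | a
  · refine (map_one (evApp β (splitDom B F E p))).trans ?_
    simp only [splitParity, weight, Sum.elim_inl, oddMul, if_true]
    rfl
  · exact evApp_splitCoord β p (Sum.inr a)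

/-- The vector fields `∂_i` and `ξ_α ∂_α`. -/
def weightedPartial (a : SplitIdx B F) : VF Ms (splitDom B F E p) :=
  Der.mulLeft (superWeight β p a) (splitPartial β p a)

variable (E) in
/-- The vector fields `∂_i` and `y_α ∂_α`. -/
def weightedLift (a : SplitIdx B F) : VF (totE B F E) (liftDom B F E p) :=
  Der.mulLeft (P := totE B F E) (weight E p a) ((liftFrame E p).d a)

theorem weightedPartial_even (a : SplitIdx B F) : Der.HasParity (weightedPartial β p a) 0 := by
  have h := ((splitFrame β p).d_par a).mulLeft (superWeight_par β p a)
  have h2 : splitParity a + (splitFrame β p).parity a = 0 := zmod2_add_self _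
  rwa [h2] at h

/-- On each coordinate both sides give the weight or zero, and q sends ξ_a to y_a τ, matching the
two weights. -/
theorem reducesTo_weighted (a : SplitIdx B F) :
    ReducesTo β (weightedPartial β p a) (weightedLift E p a) := by
  refine reducesTo_of_liftVF ?_
  refine (splitFrame_spans_evRestr β _ p).ext le_rfl fun c => ?_
  rw [Ms.res_self]
  refine (act_liftVF_splitCoord β (weightedLift E p a) p c).trans ?_
  change _ = (evRestr β _).app _ (Ms.res le_rfl (superWeight β p a) *
    Der.act ((splitFrame β p).d a) le_rfl ((splitFrame β p).x c))
  rw [Ms.res_self, (splitFrame β p).d_x]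
  have h1 : vfAct ((liftFrame (B := B) (F := F) E p).d a) inf_le_left
      (yOn E p (inf_le_right : liftDom B F E p ⊓ liftDom B F E p ≤ _) c) =
        if a = c then 1 else 0 := by
    refine (resSmooth_vfAct ((liftFrame (B := B) E p).d a) le_rfl inf_le_right _).symm.trans ?_
    refine (congrArg _ ((liftFrame (B := B) (F := F) E p).d_x a c)).trans ?_
    split_ifs
    exacts [map_one (resSmooth _ _ _), map_zero (resSmooth _ _ _)]
  rw [weightedLift]
  refine (congrArg (oddMul (splitParity c)) (vfAct_mulLeft _ _ _ _)).trans ?_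
  rw [h1]
  by_cases hac : a = c
  · subst hac
    rw [if_pos rfl, if_pos rfl, mul_one, mul_one]
    exact ((congrArg _ (evApp_superWeight β p a)).trans (oddMul_res _ _ _)).symm
  · rw [if_neg hac, if_neg hac, mul_zero, mul_zero, map_zero, map_zero]
    rfl

end WeightedFrame

end Reductions

/-! ## Uniqueness of the reduced connection -/

section ConnectionFrame

variable {X : Type u} [TopologicalSpace X] {O : SuperPresheaf.{u, v} X}

theorem Connection.ext_cov {n₁ n₂ : Connection O} (h : ∀ U A B, n₁.cov U A B = n₂.cov U A B) :
    n₁ = n₂ := by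
  have hcov : n₁.cov = n₂.cov := funext fun U => LinearMap.ext fun A => LinearMap.ext (h U A)
  cases n₁
  cases n₂
  simp only at hcov
  subst hcov
  rfl

theorem Connection.cov_mulLeft_mulLeft (n : Connection O) {U : Opens X} {q : ZMod 2} {A : VF O U}
    (hA : Der.HasParity A q) (f g : O.obj U) (Y : VF O U) :
    n.cov U (Der.mulLeft f A) (Der.mulLeft g Y) = Der.mulLeft f
      (Der.mulLeft (Der.act A le_rfl g) Y + Der.mulLeft (O.twist q U g) (n.cov U A Y)) := by
  rw [n.cov_mulLeft, n.cov_leibniz hA]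

/-- Linearity in the first argument and the Leibniz rule in the second reduce a connection to its
values on a frame. -/
theorem Connection.cov_eq_of_frame {n₁ n₂ : Connection O} {U V : Opens X} {κ : Type}
    [Fintype κ] [DecidableEq κ] {fr : Frame O U κ} (hfr : fr.Spans (SheafHom.id O))
    (h : ∀ a b, n₁.cov U (fr.d b) (fr.d a) = n₂.cov U (fr.d b) (fr.d a)) (hV : V ≤ U)
    (A Y : VF O V) : n₁.cov V A Y = n₂.cov V A Y := by
  rw [cov_expand hfr hV A, cov_expand hfr hV A]
  refine Finset.sum_congr rfl fun b _ => congrArg _ ?_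
  rw [hfr.expand_id hV Y, map_sum, map_sum]
  refine Finset.sum_congr rfl fun a _ => ?_
  rw [n₁.cov_leibniz ((fr.d_par b).res hV), n₂.cov_leibniz ((fr.d_par b).res hV), ← n₁.cov_res,
    ← n₂.cov_res, h a b]

end ConnectionFrame

/-! ### Test fields preserving 𝓕 and cancellation of weights -/

section Uniqueness

variable {B : Type*} [NormedAddCommGroup B] [NormedSpace ℝ B] [FiniteDimensional ℝ B]
  {M : Type u} [TopologicalSpace M] [ChartedSpace B M] [IsManifold 𝓘(ℝ, B) ∞ M]
  {F : Type*} [NormedAddCommGroup F] [NormedSpace ℝ F] [FiniteDimensional ℝ F]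
  {E : M → Type*} [TopologicalSpace (TotalSpace F E)] [∀ x, AddCommGroup (E x)]
  [∀ x, Module ℝ (E x)] [∀ x, TopologicalSpace (E x)] [FiberBundle F E] [VectorBundle ℝ F E]
  [ContMDiffVectorBundle ∞ F E 𝓘(ℝ, B)]
  {Ms : SuperPresheaf.{u, v} M}

/-- The elements of degree at most one of the exterior algebra. -/
def degLEOne (V : Type*) [AddCommGroup V] [Module ℝ V] : Submodule ℝ (ExteriorAlgebra ℝ V) where
  carrier := {a | ∃ (r : ℝ) (m : V), a = algebraMap ℝ _ r + ExteriorAlgebra.ι ℝ m}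
  zero_mem' := ⟨0, 0, by simp⟩
  add_mem' := by
    rintro _ _ ⟨r, m, rfl⟩ ⟨r', m', rfl⟩
    exact ⟨r + r', m + m', by simp only [map_add]; abel⟩
  smul_mem' := by
    rintro c _ ⟨r, m, rfl⟩
    exact ⟨c * r, c • m, by rw [smul_add, map_smul, Algebra.smul_def, map_mul]⟩

theorem map_mem_degLEOne {V V' : Type*} [AddCommGroup V] [Module ℝ V] [AddCommGroup V']
    [Module ℝ V'] (f : V →ₗ[ℝ] V') {a : ExteriorAlgebra ℝ V} (ha : a ∈ degLEOne V) :
    ExteriorAlgebra.map f a ∈ degLEOne V' := by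
  obtain ⟨r, m, rfl⟩ := ha
  exact ⟨r, f m, by rw [map_add, AlgHom.commutes, ExteriorAlgebra.map_apply_ι]⟩

variable (β : SheafIso Ms (batchelor B F E))

theorem inF_iff_locEquiv (p : M) {V : Opens M}
    (hV : ∀ x ∈ V, x ∈ (trivializationAt F E p).baseSet) (s : Ms.obj V) :
    InF β s ↔ ∀ x : V, (locEquiv β p hV s).1 x ∈ degLEOne (Module.Dual ℝ F) := by
  refine ⟨fun h x => map_mem_degLEOne _ (h x), fun h x => ?_⟩
  have h1 := map_mem_degLEOne (((trivializationAt F E p).continuousLinearMapAt ℝ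
    x.1).toLinearMap.dualMap) (h x)
  have h2 : localInv F E p x.1 (localRep F E p x.1 ((secEquiv β V s).1 x)) =
    (secEquiv β V s).1 x := localInv_localRep (hV x.1 x.2) _
  change localInv F E p x.1 (localRep F E p x.1 ((secEquiv β V s).1 x)) ∈ _ at h1
  rw [h2] at h1
  exact h1

/-- The subspace of degree at most one is cut out by linear functionals, and these commute with the
coefficientwise derivative. -/
theorem gDeriv_mem_degLEOne (p : M) (v : B) {V : Opens M}
    (hV : ∀ x ∈ V, x ∈ (extChartAt 𝓘(ℝ, B) p).source) {g : gFun B F V}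
    (hg : ∀ x, g.1 x ∈ degLEOne (Module.Dual ℝ F)) (x : V) :
    (gDeriv p v hV g).1 x ∈ degLEOne (Module.Dual ℝ F) := by
  rw [← Subspace.forall_mem_dualAnnihilator_apply_eq_zero_iff]
  intro l hl
  have h1 : gCoeff l g = 0 := ContMDiffMap.ext fun y =>
    (Submodule.mem_dualAnnihilator l).1 hl _ (hg y)
  have h2 := gCoeff_gDeriv p v hV g l
  rw [h1, map_zero] at h2
  exact congrArg (fun f : C^∞⟮𝓘(ℝ, B), V; 𝓘(ℝ, ℝ), ℝ⟯ => f x) h2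

/-- Even coordinate derivatives act on coefficients only. An odd one contracts a form of degree one
to a scalar, and the factor ξ_a restores degree one and makes the field even. -/
theorem inL0_weightedPartial (p : M) (a : SplitIdx B F) : InL0 β (weightedPartial β p a) := by
  refine ⟨weightedPartial_even β p a, fun V hV s hs => ?_⟩
  have htriv : ∀ x ∈ V, x ∈ (trivializationAt F E p).baseSet := fun x hx => splitDom_triv (hV hx)
  have hs' := (inF_iff_locEquiv β p htriv s).1 hs
  rw [inF_iff_locEquiv β p htriv]
  change ∀ x : V, (locEquiv β p htriv (Ms.res hV (superWeight β p a) *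
    Der.act (splitPartial β p a) hV s)).1 x ∈ _
  intro x
  rcases a with i | a
  · have h1 : locEquiv β p htriv (Ms.res hV (superWeight β p (Sum.inl i)) *
        Der.act (splitPartial β p (Sum.inl i)) hV s) =
        gDeriv p (Module.finBasis ℝ B i) (fun _ hx => splitDom_chart (hV hx))
          (locEquiv β p htriv s) := by
      rw [superWeight, Sum.elim_inl, map_one, one_mul]
      exact AlgEquiv.apply_symm_apply _ _
    rw [h1]
    exact gDeriv_mem_degLEOne p _ _ hs' x
  · have h1 : locEquiv β p htriv (Ms.res hV (superWeight β p (Sum.inr a)) *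
        Der.act (splitPartial β p (Sum.inr a)) hV s) =
        gConst V (ExteriorAlgebra.ι ℝ ((Module.finBasis ℝ F).coord a)) *
          gContract (Module.finBasis ℝ F a) V (locEquiv β p htriv s) := by
      rw [map_mul]
      refine congrArg₂ _ ?_ (AlgEquiv.apply_symm_apply _ _)
      rw [superWeight, Sum.elim_inr, ← gRes_locEquiv β p (fun _ hx => splitDom_triv hx) hV]
      exact congrArg (gRes hV) (AlgEquiv.apply_symm_apply _ _)
    rw [h1]
    obtain ⟨r, m, hrm⟩ := hs' x
    change ExteriorAlgebra.ι ℝ ((Module.finBasis ℝ F).coord a) *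
      CliffordAlgebra.contractLeft (Module.Dual.eval ℝ F (Module.finBasis ℝ F a))
        ((locEquiv β p htriv s).1 x) ∈ _
    rw [hrm, map_add, CliffordAlgebra.contractLeft_algebraMap, zero_add]
    refine ⟨0, (m (Module.finBasis ℝ F a)) • (Module.finBasis ℝ F).coord a, ?_⟩
    have h2 := CliffordAlgebra.contractLeft_ι (Q := (0 : QuadraticForm ℝ (Module.Dual ℝ F)))
      (Module.Dual.eval ℝ F (Module.finBasis ℝ F a)) m
    refine (congrArg (_ * ·) h2).trans ?_
    rw [map_zero, zero_add, map_smul, ← Algebra.commutes, ← Algebra.smul_def]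
    rfl

/-- Where y_a ≠ 0 the equation y_a g = 0 gives g = 0. Differentiating it along y_a gives g + y_a ∂_a
g = 0, which settles the points with y_a = 0. -/
theorem eq_zero_of_weight_mul_eq_zero (p : M) (a : SplitIdx B F)
    {g : C^∞⟮𝓘(ℝ, B).prod 𝓘(ℝ, F), liftDom B F E p; 𝓘(ℝ, ℝ), ℝ⟯} (h : weight E p a * g = 0) :
    g = 0 := by
  rcases a with i | a
  · rwa [weight, Sum.elim_inl, one_mul] at h
  · have h1 := congrArg (vfAct ((liftFrame (B := B) E p).d (Sum.inr a)) le_rfl) h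
    rw [vfAct_mul, map_zero] at h1
    have h2 : vfAct ((liftFrame (B := B) E p).d (Sum.inr a)) le_rfl (weight E p (Sum.inr a)) =
      1 := ((liftFrame (B := B) (F := F) E p).d_x (Sum.inr a) (Sum.inr a)).trans (if_pos rfl)
    rw [h2, one_mul] at h1
    refine ContMDiffMap.ext fun e => ?_
    have h3 : (weight E p (Sum.inr a) : C^∞⟮𝓘(ℝ, B).prod 𝓘(ℝ, F), liftDom B F E p; 𝓘(ℝ, ℝ), ℝ⟯) e *
      g e = 0 := congrArg (fun f : C^∞⟮𝓘(ℝ, B).prod 𝓘(ℝ, F), liftDom B F E p; 𝓘(ℝ, ℝ), ℝ⟯ => f e) h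
    have h4 : g e + (weight E p (Sum.inr a) :
        C^∞⟮𝓘(ℝ, B).prod 𝓘(ℝ, F), liftDom B F E p; 𝓘(ℝ, ℝ), ℝ⟯) e *
        vfAct ((liftFrame (B := B) E p).d (Sum.inr a)) le_rfl g e = 0 :=
      congrArg (fun f : C^∞⟮𝓘(ℝ, B).prod 𝓘(ℝ, F), liftDom B F E p; 𝓘(ℝ, ℝ), ℝ⟯ => f e) h1
    rcases mul_eq_zero.1 h3 with h5 | h5
    · rw [h5, zero_mul, add_zero] at h4
      exact h4
    · exact h5

variable {β} {nabla : Connection Ms} {n₁ n₂ : Connection (totE B F E)}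

/-- Both connections agree on the weighted fields, as reductions over a chart are unique. Expanding
by the Leibniz rule leaves the difference of Christoffel symbols times two weights, which cancel. -/
theorem IsReducedConnection.cov_frame_eq (h₁ : IsReducedConnection β nabla n₁)
    (h₂ : IsReducedConnection β nabla n₂) (p : M) (a b : SplitIdx B F) :
    n₁.cov _ ((liftFrame E p).d b) ((liftFrame E p).d a) =
      n₂.cov _ ((liftFrame E p).d b) ((liftFrame E p).d a) := by
  have h := (h₁ _ _ _ _ _ (inL0_weightedPartial β p b) (inL0_weightedPartial β p a)
    (reducesTo_weighted β p b) (reducesTo_weighted β p a)).unique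
    (h₂ _ _ _ _ _ (inL0_weightedPartial β p b) (inL0_weightedPartial β p a)
    (reducesTo_weighted β p b) (reducesTo_weighted β p a))
  have key : ∀ n : Connection (totE B F E), n.cov _ (weightedLift E p b) (weightedLift E p a) =
      Der.mulLeft (P := totE B F E) (weight E p b) (
        Der.mulLeft (P := totE B F E)
          (vfAct ((liftFrame (B := B) E p).d b) le_rfl (weight E p a)) ((liftFrame E p).d a) +
        Der.mulLeft (P := totE B F E) (weight E p a)
          (n.cov _ ((liftFrame E p).d b) ((liftFrame E p).d a))) := by
    intro n
    have h1 := n.cov_mulLeft_mulLeft ((liftFrame E p).d_par b) (weight E p b) (weight E p a)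
      ((liftFrame E p).d a)
    exact h1
  rw [key n₁, key n₂] at h
  refine (liftFrame_spans_id p).ext le_rfl fun c => ?_
  have h1 := congrArg (fun Z : VF (totE B F E) (liftDom B F E p) =>
    vfAct Z le_rfl (liftCoord E p c)) h
  simp only [vfAct_mulLeft, vfAct_add_left] at h1
  have h2 := sub_eq_zero.2 h1
  have h3 : weight E p b * (weight E p a *
      (vfAct (n₁.cov _ ((liftFrame E p).d b) ((liftFrame E p).d a)) le_rfl (liftCoord E p c) -
        vfAct (n₂.cov _ ((liftFrame E p).d b) ((liftFrame E p).d a)) le_rfl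
          (liftCoord E p c))) = 0 := by
    refine Eq.trans ?_ h2
    change weight E p b * _ = weight E p b * _ - weight E p b * _
    rw [← mul_sub, add_sub_add_left_eq_sub, mul_sub (weight E p a)]
    rfl
  exact sub_eq_zero.1 (eq_zero_of_weight_mul_eq_zero p a (eq_zero_of_weight_mul_eq_zero p b h3))

theorem IsReducedConnection.unique (h₁ : IsReducedConnection β nabla n₁)
    (h₂ : IsReducedConnection β nabla n₂) : n₁ = n₂ := by
  refine Connection.ext_cov fun W A B' => ?_
  refine Der.eq_of_cover (V := fun p => liftDom B F E p) smoothFun_isSheaf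
    (fun x _ => ⟨x.proj, mem_splitDom _⟩) fun p => ?_
  rw [n₁.cov_res, n₂.cov_res]
  exact Connection.cov_eq_of_frame (liftFrame_spans_id p) (h₁.cov_frame_eq h₂ p) inf_le_right _ _

end Uniqueness

/-! ## The geodesic equation in coordinates -/

section GeodesicEquation

variable {N : Type u} {M : Type u'} [TopologicalSpace N] [TopologicalSpace M]
  {ON : SuperPresheaf.{u, v} N} {OM : SuperPresheaf.{u', v'} M}

/-- A vector field on the source, acting on the direct image. -/
def pushVF (φ : C(N, M)) (δ : homDer (SheafHom.id ON) 0 ⊤) :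
    homDer (SheafHom.id (ON.pushforward φ)) 0 ⊤ :=
  ⟨fun V => δ.1 ⟨Opens.comap φ V.1, le_top⟩,
    fun _ _ hW f => δ.2.1 ⟨_, le_top⟩ ⟨_, le_top⟩ (Opens.comap_mono φ hW) f,
    fun _ f => δ.2.2.1 ⟨_, le_top⟩ f, fun _ f g => δ.2.2.2 ⟨_, le_top⟩ f g⟩

/-- The two notions differ only in regarding the target as a sheaf on N or as its direct image on M.
-/
theorem isPullbackCov_iff (nabla : Connection OM) (Φ : SMap ON OM)
    (δ : homDer (SheafHom.id ON) 0 ⊤) (D : ∀ U : Opens M, Der Φ.pull U →ₗ[ℝ] Der Φ.pull U) :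
    IsPullbackCov nabla Φ δ D ↔ IsCovAlong nabla Φ.pull (pushVF Φ.base δ) D :=
  ⟨fun h => ⟨h.res, h.even, h.leibniz, h.compat⟩, fun h => ⟨h.res, h.even, h.leibniz, h.compat⟩⟩

/-- The components of `∇/dδ (δ ∘ h)` in a frame. -/
def geodesicDefect {P : SuperPresheaf.{u', w} M} {κ : Type} [Fintype κ] [DecidableEq κ]
    (nabla : Connection OM) (h : SheafHom OM P) (δ : homDer (SheafHom.id P) 0 ⊤) {U : Opens M}
    (fr : Frame OM U κ) (c : κ) : P.obj U :=
  ap δ U (ap δ U (h.app U (fr.x c))) + ∑ a, ap δ U (h.app U (fr.x a)) *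
    ∑ b, ap δ U (h.app U (fr.x b)) *
      h.app U (Der.act (nabla.cov U (fr.d b) (fr.d a)) le_rfl (fr.x c))

/-- The defect is a component of an even derivation along `h`, so it has the parity of its
coordinate. -/
theorem geodesicDefect_par {P : SuperPresheaf.{u', w} M} {κ : Type} [Fintype κ] [DecidableEq κ]
    (nabla : Connection OM) (h : SheafHom OM P) (δ : homDer (SheafHom.id P) 0 ⊤) {U : Opens M}
    (fr : Frame OM U κ) (c : κ) : P.par U (geodesicDefect nabla h δ fr c) =
      psign (fr.parity c) • geodesicDefect nabla h δ fr c := by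
  have h1 := (hasParity_covLocal (nabla := nabla) (δ := δ) (fr := fr) le_rfl
    ((Der.ofHom_hasParity (velocityAlong h δ)).res (le_top : U ≤ ⊤))).par_act_of le_rfl (fr.x_par c)
  rw [zero_add, act_covLocal_velocity] at h1
  exact h1

/-- A pullback derivative exists and is forced in each frame, so the existential in the definition
of a geodesic turns into equations for components. -/
theorem isGeodesicFor_iff {κ : Type} [Fintype κ] [DecidableEq κ] {J : Type t}
    (nabla : Connection OM) (Φ : SMap ON OM) (δ : homDer (SheafHom.id ON) 0 ⊤)
    (hON : SuperPresheaf.IsSheaf.{u, v, t} ON) (U : J → Opens M) (hU : ∀ x, ∃ i, x ∈ U i)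
    (fr : ∀ i, Frame OM (U i) κ) (hid : ∀ i, (fr i).Spans (SheafHom.id OM))
    (hfr : ∀ i, (fr i).Spans Φ.pull) : IsGeodesicFor nabla Φ δ ↔
      ∀ i c, geodesicDefect nabla Φ.pull (pushVF Φ.base δ) (fr i) c = 0 := by
  have key : ∀ D, IsCovAlong nabla Φ.pull (pushVF Φ.base δ) D → ∀ i,
      Der.res le_top (D ⊤ (velocityDer Φ δ)) = covLocal nabla Φ.pull (pushVF Φ.base δ) (fr i) le_rfl
        (Der.res le_top (Der.ofHom (velocityAlong Φ.pull (pushVF Φ.base δ)))) := by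
    intro D hD i
    rw [hD.res, hD.eq_covLocal (hfr i) le_rfl]
    rfl
  constructor
  · rintro ⟨D, hD, h0⟩ i c
    have h1 := key D ((isPullbackCov_iff _ _ _ _).1 hD) i
    rw [h0, map_zero] at h1
    have h2 := act_covLocal_velocity (nabla := nabla) (h := Φ.pull) (δ := pushVF Φ.base δ)
      (fr := fr i) c
    rw [← h1] at h2
    exact h2.symm
  · intro h
    obtain ⟨D, hD⟩ := exists_isCovAlong nabla Φ.pull (pushVF Φ.base δ) (hON.pushforward Φ.base)
      U hU fr hid hfr
    refine ⟨D, (isPullbackCov_iff _ _ _ _).2 hD, ?_⟩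
    refine Der.eq_of_cover_of_le (hON.pushforward Φ.base) (V := U) (fun x _ => hU x)
      (fun _ => le_top) fun i => ?_
    rw [key D hD i, map_zero]
    refine (hfr i).ext le_rfl fun c => ?_
    rw [OM.res_self]
    exact (act_covLocal_velocity c).trans (h i c)

end GeodesicEquation

/-! ### Comparison of the two geodesic equations -/

section GeodesicCorrespondence

variable {B : Type*} [NormedAddCommGroup B] [NormedSpace ℝ B] [FiniteDimensional ℝ B]
  {M : Type u} [TopologicalSpace M] [ChartedSpace B M] [IsManifold 𝓘(ℝ, B) ∞ M]
  {F : Type*} [NormedAddCommGroup F] [NormedSpace ℝ F] [FiniteDimensional ℝ F]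
  {E : M → Type*} [TopologicalSpace (TotalSpace F E)] [∀ x, AddCommGroup (E x)]
  [∀ x, Module ℝ (E x)] [∀ x, TopologicalSpace (E x)] [FiberBundle F E] [VectorBundle ℝ F E]
  [ContMDiffVectorBundle ∞ F E 𝓘(ℝ, B)]
  {Ms : SuperPresheaf.{u, v} M} (β : SheafIso Ms (batchelor B F E)) (nabla : Connection Ms)

variable {β nabla}

/-- A coordinate of a curve in `E`. -/
def curveCoord (γ : CurveE B F E) (p : M) (a : SplitIdx B F) :
    C^∞⟮𝓘(ℝ, ℝ), Opens.comap (contOf γ) (liftDom B F E p); 𝓘(ℝ, ℝ), ℝ⟯ :=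
  pullSmooth γ _ (liftCoord E p a)

theorem dt_dualNumber_oddMul {U : Opens ℝ} (q : ZMod 2) (f : C^∞⟮𝓘(ℝ, ℝ), U; 𝓘(ℝ, ℝ), ℝ⟯) :
    ap partialTSuper U (oddMul q f) = oddMul q (dt U f) := by
  by_cases hq : q = 0
  · simp only [oddMul, hq, if_true]
    exact TrivSqZeroExt.ext rfl (map_zero (dt U))
  · simp only [oddMul, hq, if_false]
    exact TrivSqZeroExt.ext (map_zero (dt U)) rfl

theorem pull_superCurve_splitCoord (γ : CurveE B F E) (p : M) (a : SplitIdx B F) :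
    ((ev β).comp (timesOddMap γ)).pull.app _ (splitCoord β p a) =
      oddMul (splitParity a) (curveCoord γ p a) := by
  have h := congrArg ((timesOddMap γ).pull.app (liftDom B F E p)) (evApp_splitCoord β p a)
  refine h.trans ?_
  by_cases hq : splitParity a = 0
  · simp only [oddMul, hq, if_true]
    rfl
  · simp only [oddMul, hq, if_false]
    rfl

theorem oddPart_pull (γ : CurveE B F E) (q : ZMod 2) {W : Opens (TotalSpace F E)}
    (z : DualNumber C^∞⟮𝓘(ℝ, B).prod 𝓘(ℝ, F), W; 𝓘(ℝ, ℝ), ℝ⟯) :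
    oddPart q ((timesOddMap γ).pull.app W z) = pullSmooth γ W (oddPart q z) := by
  by_cases hq : q = 0
  · simp only [oddPart, hq, if_true]
    rfl
  · simp only [oddPart, hq, if_false]
    rfl

theorem oddMul_pull (γ : CurveE B F E) (q : ZMod 2) {W : Opens (TotalSpace F E)}
    (f : C^∞⟮𝓘(ℝ, B).prod 𝓘(ℝ, F), W; 𝓘(ℝ, ℝ), ℝ⟯) :
    (timesOddMap γ).pull.app W (oddMul q f) = oddMul q (pullSmooth γ W f) := by
  by_cases hq : q = 0
  · simp only [oddMul, hq, if_true]
    rfl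
  · simp only [oddMul, hq, if_false]
    rfl

/-- Pulled back to the supercurve, each coordinate is a coordinate of γ times 1 or τ, and ∂_t acts
on the function only. Separating the factors 1 and τ leaves the pullbacks along γ of the Christoffel
symbols on E. -/
theorem oddPart_geodesicDefect_superCurve (γ : CurveE B F E) (p : M) (c : SplitIdx B F) :
    oddPart (splitParity c) (geodesicDefect nabla ((ev β).comp (timesOddMap γ)).pull
      (pushVF ((ev β).comp (timesOddMap γ)).base partialTSuper) (splitFrame β p) c) =
      dt _ (dt _ (curveCoord γ p c)) + ∑ a, ∑ b,
        dt _ (curveCoord γ p a) * dt _ (curveCoord γ p b) *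
          pullSmooth γ _ (christoffel β nabla p a b c) := by
  have h1 : ∀ a, ap (pushVF ((ev β).comp (timesOddMap γ)).base partialTSuper) _
      (((ev β).comp (timesOddMap γ)).pull.app _ ((splitFrame β p).x a)) =
      oddMul (splitParity a) (dt _ (curveCoord γ p a)) := fun a =>
    (congrArg (ap partialTSuper _) (pull_superCurve_splitCoord γ p a)).trans
      (dt_dualNumber_oddMul _ _)
  have h2 : ap (pushVF ((ev β).comp (timesOddMap γ)).base partialTSuper) _
      (ap (pushVF ((ev β).comp (timesOddMap γ)).base partialTSuper) _
      (((ev β).comp (timesOddMap γ)).pull.app _ ((splitFrame β p).x c))) =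
      oddMul (splitParity c) (dt _ (dt _ (curveCoord γ p c))) :=
    (congrArg (ap partialTSuper _) (h1 c)).trans (dt_dualNumber_oddMul _ _)
  rw [geodesicDefect, h2]
  simp only [h1]
  refine (oddPart_christoffel (splitParity c) _ splitParity _ _ (fun a b =>
    (timesOddMap γ).pull.app (liftDom B F E p)
      (evDual β (superChristoffel β nabla p a b c)))).trans ?_
  refine congrArg _ (Finset.sum_congr rfl fun a _ => Finset.sum_congr rfl fun b _ =>
    congrArg _ ?_)
  rw [christoffel, ← oddPart_pull]
  congr 1
  refine Eq.trans ?_ (map_mul ((timesOddMap γ).pull.app (liftDom B F E p)) _ _).symm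
  refine congrArg₂ _ (oddMul_pull _ _ 1).symm ?_
  refine Eq.trans ?_ (map_mul ((timesOddMap γ).pull.app (liftDom B F E p)) _ _).symm
  exact congrArg₂ _ (oddMul_pull _ _ 1).symm rfl

/-- For coordinate fields the components are constant, so the second-derivative term vanishes and a
single Christoffel symbol survives. -/
theorem christoffel_reducedConnection (p : M) (a b c : SplitIdx B F) :
    vfAct ((reducedConnection β nabla).cov _ ((liftFrame E p).d b) ((liftFrame E p).d a)) le_rfl
      (liftCoord E p c) = christoffel β nabla p a b c := by
  have h1 := isReducedCov_reducedCovLin β nabla ((liftFrame E p).d b) ((liftFrame E p).d a)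
    p _ le_rfl le_rfl c
  have hy : ∀ a b : SplitIdx B F, vfAct ((liftFrame (B := B) (F := F) E p).d a) le_rfl
      (yOn E p le_rfl b) = if a = b then 1 else 0 := fun a b =>
    (liftFrame (B := B) (F := F) E p).d_x a b
  refine h1.trans ?_
  simp only [covCoord, hy]
  rw [Finset.sum_eq_single a, Finset.sum_eq_single b]
  · have h0 : vfAct ((liftFrame (B := B) (F := F) E p).d b) le_rfl (if a = c then 1 else 0) = 0 := by
      split_ifs
      · have h2 := vfAct_mul ((liftFrame (B := B) (F := F) E p).d b) le_rfl 1 1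
        rw [mul_one, mul_one, one_mul] at h2
        exact add_eq_left.1 h2.symm
      · exact map_zero _
    rw [h0, if_pos rfl, if_pos rfl, one_mul, one_mul, zero_add]
    rfl
  · intro b' _ hb'
    rw [if_neg (Ne.symm hb'), mul_zero, zero_mul]
  · exact fun h => absurd (Finset.mem_univ _) h
  · intro a' _ ha'
    refine Finset.sum_eq_zero fun b' _ => ?_
    rw [if_neg (Ne.symm ha'), zero_mul, zero_mul]
  · exact fun h => absurd (Finset.mem_univ _) h

theorem isGeodesic_iff (n : Connection (totE B F E)) (γ : CurveE B F E) : IsGeodesic n γ ↔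
    ∀ (p : M) (c : SplitIdx B F),
      dt _ (dt _ (curveCoord γ p c)) + ∑ a, dt _ (curveCoord γ p a) * ∑ b,
        dt _ (curveCoord γ p b) * pullSmooth γ _ (vfAct (n.cov _ ((liftFrame E p).d b)
          ((liftFrame E p).d a)) le_rfl (liftCoord E p c)) = 0 :=
  isGeodesicFor_iff n (ofSmooth γ) partialT smoothFun_isSheaf (fun p => liftDom B F E p)
    (fun e => ⟨e.proj, mem_splitDom _⟩) (liftFrame E) liftFrame_spans_id
    fun _ => chartFrame_spans _ _ _ _ (pointSeparated_ofSmooth γ)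

theorem isSuperGeodesic_iff_isGeodesic (γ : CurveE B F E) :
    IsSuperGeodesic nabla ((ev β).comp (timesOddMap γ)) ↔
      IsGeodesic (reducedConnection β nabla) γ := by
  rw [isGeodesic_iff]
  refine (isGeodesicFor_iff nabla ((ev β).comp (timesOddMap γ)) partialTSuper timesOdd_isSheaf
    (fun p => splitDom B F E p) (fun p => ⟨p, mem_splitDom p⟩) (splitFrame β)
    (fun p => splitFrame_spans_id β p) fun p => splitFrame_spans β p
      ((enoughOddPoints_timesOdd _).pointSeparated _ _)).trans ?_
  refine forall_congr' fun p => forall_congr' fun c => ?_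
  have h1 := oddPart_geodesicDefect_superCurve (β := β) (nabla := nabla) γ p c
  have h2 : ∀ a, dt _ (curveCoord γ p a) * ∑ b, dt _ (curveCoord γ p b) *
      pullSmooth γ _ (vfAct ((reducedConnection β nabla).cov _ ((liftFrame E p).d b)
        ((liftFrame E p).d a)) le_rfl (liftCoord E p c)) =
      ∑ b, dt _ (curveCoord γ p a) * dt _ (curveCoord γ p b) *
        pullSmooth γ _ (christoffel β nabla p a b c) := by
    intro a
    rw [Finset.mul_sum]
    refine Finset.sum_congr rfl fun b _ => ?_
    rw [christoffel_reducedConnection, mul_assoc]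
  simp only [h2, ← h1]
  -- The defect is homogeneous, so it vanishes exactly when its one possible nonzero component does.
  have h3 := oddMul_oddPart (splitParity c) (geodesicDefect_par nabla
    ((ev β).comp (timesOddMap γ)).pull
    (pushVF ((ev β).comp (timesOddMap γ)).base partialTSuper) (splitFrame β p) c)
  constructor
  · intro h
    rw [h]
    exact map_zero _
  · intro h
    rw [← h3]
    exact (congrArg _ h).trans (map_zero _)

end GeodesicCorrespondence

/-! ## Geodesics are determined by their initial conditions -/

section GeodesicUniqueness

variable {B : Type*} [NormedAddCommGroup B] [NormedSpace ℝ B] [FiniteDimensional ℝ B]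
  {M : Type u} [TopologicalSpace M] [ChartedSpace B M] [IsManifold 𝓘(ℝ, B) ∞ M]
  {F : Type*} [NormedAddCommGroup F] [NormedSpace ℝ F] [FiniteDimensional ℝ F]
  {E : M → Type*} [TopologicalSpace (TotalSpace F E)] [∀ x, AddCommGroup (E x)]
  [∀ x, Module ℝ (E x)] [∀ x, TopologicalSpace (E x)] [FiberBundle F E] [VectorBundle ℝ F E]
  [ContMDiffVectorBundle ∞ F E 𝓘(ℝ, B)]

theorem curveCoord_apply (γ : CurveE B F E) (p : M) (a : SplitIdx B F) {t : ℝ}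
    (ht : t ∈ Opens.comap (contOf γ) (liftDom B F E p)) : curveCoord γ p a ⟨t, ht⟩ =
      (totBasis B F).equivFun
        (extChartAt (𝓘(ℝ, B).prod 𝓘(ℝ, F)) (⟨p, 0⟩ : TotalSpace F E) (γ t)) a := rfl

/-- Coordinates and velocity of a curve. -/
def curveJet (γ : CurveE B F E) (p : M) (t : ℝ) : (SplitIdx B F → ℝ) × (SplitIdx B F → ℝ) :=
  (fun a => extZero _ (curveCoord γ p a) t, fun a => extZero _ (dt _ (curveCoord γ p a)) t)

theorem hasDerivAt_curveJet (γ : CurveE B F E) (p : M) {t : ℝ}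
    (ht : t ∈ Opens.comap (contOf γ) (liftDom B F E p)) :
    HasDerivAt (curveJet γ p) (fun a => dt _ (curveCoord γ p a) ⟨t, ht⟩,
      fun a => dt _ (dt _ (curveCoord γ p a)) ⟨t, ht⟩) t :=
  (hasDerivAt_pi.2 fun a => (extZero_differentiableAt (curveCoord γ p a) ⟨t, ht⟩).hasDerivAt).prodMk
    (hasDerivAt_pi.2 fun a =>
      (extZero_differentiableAt (dt _ (curveCoord γ p a)) ⟨t, ht⟩).hasDerivAt)

/-- The Christoffel symbols of a connection on `E`. -/
def liftChristoffel (n : Connection (totE B F E)) (p : M) (a b c : SplitIdx B F) :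
    C^∞⟮𝓘(ℝ, B).prod 𝓘(ℝ, F), liftDom B F E p; 𝓘(ℝ, ℝ), ℝ⟯ :=
  vfAct (n.cov _ ((liftFrame E p).d b) ((liftFrame E p).d a)) le_rfl (liftCoord E p c)

/-- The geodesic equation as a system of first order. -/
def geodesicSpray (n : Connection (totE B F E)) (p : M)
    (y : (SplitIdx B F → ℝ) × (SplitIdx B F → ℝ)) : (SplitIdx B F → ℝ) × (SplitIdx B F → ℝ) :=
  (y.2, fun c => -∑ a, y.2 a * ∑ b, y.2 b * chartRep (𝓘(ℝ, B).prod 𝓘(ℝ, F))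
    (⟨p, 0⟩ : TotalSpace F E) (liftChristoffel n p a b c) ((totBasis B F).equivFun.symm y.1))

theorem curveJet_fst (γ : CurveE B F E) (p : M) {t : ℝ}
    (ht : t ∈ Opens.comap (contOf γ) (liftDom B F E p)) :
    (totBasis B F).equivFun.symm (curveJet γ p t).1 =
      extChartAt (𝓘(ℝ, B).prod 𝓘(ℝ, F)) (⟨p, 0⟩ : TotalSpace F E) (γ t) := by
  rw [LinearEquiv.symm_apply_eq]
  exact funext fun a => extZero_apply _ ⟨t, ht⟩

/-- The coefficients are smooth only over the chart domain, hence the restriction to jets of a curve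
inside it. -/
theorem contDiffAt_geodesicSpray (n : Connection (totE B F E)) (γ : CurveE B F E) (p : M) {t : ℝ}
    (ht : t ∈ Opens.comap (contOf γ) (liftDom B F E p)) :
    ContDiffAt ℝ 1 (geodesicSpray n p) (curveJet γ p t) := by
  have hsnd : ∀ a, ContDiffAt ℝ 1 (fun y : (SplitIdx B F → ℝ) × (SplitIdx B F → ℝ) => y.2 a)
      (curveJet γ p t) := fun a => (contDiff_apply ℝ ℝ a).contDiffAt.comp _ contDiffAt_snd
  refine contDiffAt_snd.prodMk (contDiffAt_pi.2 fun c => ContDiffAt.neg (ContDiffAt.sum fun a _ =>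
    (hsnd a).mul (ContDiffAt.sum fun b _ => (hsnd b).mul ?_)))
  have h1 := (chartRep_contDiffAt (I := 𝓘(ℝ, B).prod 𝓘(ℝ, F)) (⟨p, 0⟩ : TotalSpace F E)
    (liftChristoffel n p a b c) (x := γ t) ht (liftDom_chart _ ht)).of_le
    (show (1 : WithTop ℕ∞) ≤ ∞ by exact_mod_cast le_top)
  rw [← curveJet_fst γ p ht] at h1
  exact h1.comp (curveJet γ p t) (f := fun y : (SplitIdx B F → ℝ) × (SplitIdx B F → ℝ) =>
    (totBasis B F).equivFun.symm y.1)
    ((totBasis B F).equivFun.symm.toLinearMap.toContinuousLinearMap.contDiff.contDiffAt.comp _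
      contDiffAt_fst)

theorem IsGeodesic.hasDerivAt_curveJet {n : Connection (totE B F E)} {γ : CurveE B F E}
    (h : IsGeodesic n γ) (p : M) {t : ℝ}
    (ht : t ∈ Opens.comap (contOf γ) (liftDom B F E p)) :
    HasDerivAt (curveJet γ p) (geodesicSpray n p (curveJet γ p t)) t := by
  have h1 := SuperGeo.hasDerivAt_curveJet γ p ht
  have h2 : ∀ a, (curveJet γ p t).2 a = dt _ (curveCoord γ p a) ⟨t, ht⟩ := fun a =>
    extZero_apply _ ⟨t, ht⟩
  have hγ : γ t ∈ liftDom B F E p := ht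
  have h3 : ∀ a b c, chartRep (𝓘(ℝ, B).prod 𝓘(ℝ, F)) (⟨p, 0⟩ : TotalSpace F E)
      (liftChristoffel n p a b c) ((totBasis B F).equivFun.symm (curveJet γ p t).1) =
      liftChristoffel n p a b c ⟨γ t, hγ⟩ := by
    intro a b c
    rw [curveJet_fst γ p ht, chartRep, Function.comp_apply,
      (extChartAt (𝓘(ℝ, B).prod 𝓘(ℝ, F)) (⟨p, 0⟩ : TotalSpace F E)).left_inv (liftDom_chart _ hγ)]
    exact extFun_apply _ (⟨γ t, hγ⟩ : liftDom B F E p)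
  convert h1 using 1
  refine Prod.ext (funext h2) (funext fun c => ?_)
  have h4 := congrArg (ContMDiffMap.evalRingHom (n := ∞) (I := 𝓘(ℝ, ℝ))
    (⟨t, ht⟩ : Opens.comap (contOf γ) (liftDom B F E p))) ((isGeodesic_iff n γ).1 h p c)
  simp only [map_add, map_sum, map_mul, map_zero] at h4
  change -∑ a, (curveJet γ p t).2 a * ∑ b, (curveJet γ p t).2 b * _ = _
  simp only [h2, h3]
  exact (eq_neg_of_add_eq_zero_left h4).symm

theorem eventually_eq_of_curveJet_eq {γ₁ γ₂ : CurveE B F E} {p : M} {t : ℝ}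
    (ht₁ : t ∈ Opens.comap (contOf γ₁) (liftDom B F E p))
    (ht₂ : t ∈ Opens.comap (contOf γ₂) (liftDom B F E p))
    (h : curveJet γ₁ p =ᶠ[𝓝 t] curveJet γ₂ p) : ∀ᶠ s in 𝓝 t, γ₁ s = γ₂ s := by
  filter_upwards [h, (Opens.comap (contOf γ₁) (liftDom B F E p)).isOpen.mem_nhds ht₁,
    (Opens.comap (contOf γ₂) (liftDom B F E p)).isOpen.mem_nhds ht₂] with s hs h₁ h₂
  have e := congrArg (fun y => (totBasis B F).equivFun.symm y.1) hs
  simp only [curveJet_fst γ₁ p h₁, curveJet_fst γ₂ p h₂] at e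
  exact (extChartAt (𝓘(ℝ, B).prod 𝓘(ℝ, F)) (⟨p, 0⟩ : TotalSpace F E)).injOn
    (liftDom_chart (γ₁ s) h₁) (liftDom_chart (γ₂ s) h₂) e

/-- Local uniqueness for the first-order system: the spray is C¹ at the common jet, hence Lipschitz
nearby, and both jets stay in that neighbourhood for a short time. -/
theorem IsGeodesic.eventually_eq {n : Connection (totE B F E)} {γ₁ γ₂ : CurveE B F E}
    (h₁ : IsGeodesic n γ₁) (h₂ : IsGeodesic n γ₂) {p : M} {t : ℝ}
    (ht₁ : t ∈ Opens.comap (contOf γ₁) (liftDom B F E p))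
    (ht₂ : t ∈ Opens.comap (contOf γ₂) (liftDom B F E p))
    (h : curveJet γ₁ p t = curveJet γ₂ p t) : ∀ᶠ s in 𝓝 t, γ₁ s = γ₂ s := by
  obtain ⟨K, S, hS, hK⟩ := (contDiffAt_geodesicSpray n γ₁ p ht₁).exists_lipschitzOnWith
  have key : ∀ {γ : CurveE B F E}, IsGeodesic n γ →
      t ∈ Opens.comap (contOf γ) (liftDom B F E p) → S ∈ 𝓝 (curveJet γ p t) →
      ∀ᶠ s in 𝓝 t, HasDerivAt (curveJet γ p) (geodesicSpray n p (curveJet γ p s)) s ∧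
        curveJet γ p s ∈ S := by
    intro γ hγ ht hS
    filter_upwards [(Opens.comap (contOf γ) (liftDom B F E p)).isOpen.mem_nhds ht,
      (SuperGeo.hasDerivAt_curveJet γ p ht).continuousAt.eventually hS] with s hs hs'
    exact ⟨hγ.hasDerivAt_curveJet p hs, hs'⟩
  exact eventually_eq_of_curveJet_eq ht₁ ht₂ (ODE_solution_unique_of_eventually
    (v := fun _ => geodesicSpray n p) (s := fun _ => S) (Filter.Eventually.of_forall fun _ => hK)
    (key h₁ ht₁ hS) (key h₂ ht₂ (h ▸ hS)) h)

/-- The feet agree because M is Hausdorff. Then both points lie in the domain of one chart of E, and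
the claim follows in its normed model space. -/
theorem apply_eq_of_frequently_eq [T2Space M] {γ₁ γ₂ : CurveE B F E} {t : ℝ}
    (h : ∃ᶠ s in 𝓝 t, γ₁ s = γ₂ s) : γ₁ t = γ₂ t := by
  have hc : ∀ γ : CurveE B F E, Continuous fun s => (γ s).proj := fun γ =>
    (FiberBundle.continuous_proj F E).comp γ.contMDiff.continuous
  have hproj : (γ₁ t).proj = (γ₂ t).proj := by
    have h1 : IsClosed {s | (γ₁ s).proj = (γ₂ s).proj} := isClosed_eq (hc γ₁) (hc γ₂)
    exact h1.mem_of_frequently_of_tendsto (h.mono fun s hs => congrArg _ hs) Filter.tendsto_id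
  set p := (γ₁ t).proj with hp
  have ht₁ : t ∈ Opens.comap (contOf γ₁) (liftDom B F E p) := mem_splitDom p
  have ht₂ : t ∈ Opens.comap (contOf γ₂) (liftDom B F E p) := by
    change (γ₂ t).proj ∈ splitDom B F E p
    rw [← hproj]
    exact mem_splitDom p
  let φ := extChartAt (𝓘(ℝ, B).prod 𝓘(ℝ, F)) (⟨p, 0⟩ : TotalSpace F E)
  have hφ : ∀ γ : CurveE B F E, t ∈ Opens.comap (contOf γ) (liftDom B F E p) →
      ContinuousAt (fun s => φ (γ s)) t := fun γ hγ =>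
    (continuousAt_extChartAt' (liftDom_chart (γ t) hγ)).comp γ.contMDiff.continuous.continuousAt
  refine φ.injOn (liftDom_chart (γ₁ t) ht₁) (liftDom_chart (γ₂ t) ht₂) ?_
  by_contra hne
  exact h (((hφ γ₁ ht₁).ne_iff_eventually_ne (hφ γ₂ ht₂)).1 hne |>.mono fun s hs he =>
    hs (congrArg φ he))

theorem IsGeodesic.eq_of_curveJet_eq [T2Space M] {n : Connection (totE B F E)}
    {γ₁ γ₂ : CurveE B F E} (h₁ : IsGeodesic n γ₁) (h₂ : IsGeodesic n γ₂) {p : M} {t₀ : ℝ}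
    (ht₁ : t₀ ∈ Opens.comap (contOf γ₁) (liftDom B F E p))
    (ht₂ : t₀ ∈ Opens.comap (contOf γ₂) (liftDom B F E p))
    (h : curveJet γ₁ p t₀ = curveJet γ₂ p t₀) : γ₁ = γ₂ := by
  -- The set where the germs agree is open by construction, and closed by local uniqueness in a
  -- chart at a limit point; ℝ is connected.
  let S : Set ℝ := {t | ∀ᶠ s in 𝓝 t, γ₁ s = γ₂ s}
  have hopen : IsOpen S := isOpen_iff_mem_nhds.2 fun t ht => eventually_eventually_nhds.2 ht
  have hclosed : IsClosed S := by
    refine isClosed_iff_frequently.2 fun t ht => ?_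
    have he : γ₁ t = γ₂ t := apply_eq_of_frequently_eq (ht.mono fun s hs => hs.self_of_nhds)
    have m₁ : t ∈ Opens.comap (contOf γ₁) (liftDom B F E (γ₁ t).proj) := mem_splitDom _
    have m₂ : t ∈ Opens.comap (contOf γ₂) (liftDom B F E (γ₁ t).proj) := by
      change (γ₂ t).proj ∈ splitDom B F E (γ₁ t).proj
      rw [← he]
      exact m₁
    refine h₁.eventually_eq h₂ m₁ m₂ ?_
    -- If the jets differed at t, by continuity they would differ nearby, also at points of `S`,
    -- where they agree.
    by_contra hne
    have hne' := ((SuperGeo.hasDerivAt_curveJet γ₁ _ m₁).continuousAt.ne_iff_eventually_ne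
      (SuperGeo.hasDerivAt_curveJet γ₂ _ m₂).continuousAt).1 hne
    refine ht ?_
    filter_upwards [hne', (Opens.comap (contOf γ₁) (liftDom B F E (γ₁ t).proj)).isOpen.mem_nhds m₁,
      (Opens.comap (contOf γ₂) (liftDom B F E (γ₁ t).proj)).isOpen.mem_nhds m₂] with s hs k₁ k₂ hsS
    refine hs (Prod.ext (funext fun a => ?_) (funext fun a => ?_))
    · refine (extZero_apply (curveCoord γ₁ _ a) ⟨s, k₁⟩).trans
        (Eq.trans ?_ (extZero_apply (curveCoord γ₂ _ a) ⟨s, k₂⟩).symm)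
      rw [curveCoord_apply, curveCoord_apply, hsS.self_of_nhds]
    · refine (extZero_apply (dt _ (curveCoord γ₁ _ a)) ⟨s, k₁⟩).trans
        (Eq.trans ?_ (extZero_apply (dt _ (curveCoord γ₂ _ a)) ⟨s, k₂⟩).symm)
      refine Filter.EventuallyEq.deriv_eq ?_
      filter_upwards [hsS, (Opens.comap (contOf γ₁) _).isOpen.mem_nhds k₁,
        (Opens.comap (contOf γ₂) _).isOpen.mem_nhds k₂] with r hr k₁ k₂
      refine (extZero_apply (curveCoord γ₁ _ a) ⟨r, k₁⟩).trans
        (Eq.trans ?_ (extZero_apply (curveCoord γ₂ _ a) ⟨r, k₂⟩).symm)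
      rw [curveCoord_apply, curveCoord_apply, hr]
  have huniv := IsClopen.eq_univ ⟨hclosed, hopen⟩ ⟨t₀, h₁.eventually_eq h₂ ht₁ ht₂ h⟩
  refine ContMDiffMap.ext fun t => ?_
  have : t ∈ S := huniv ▸ Set.mem_univ t
  exact this.self_of_nhds

end GeodesicUniqueness

/-! ## Initial conditions -/

section InitialConditions

variable {B : Type*} [NormedAddCommGroup B] [NormedSpace ℝ B] [FiniteDimensional ℝ B]
  {M : Type u} [TopologicalSpace M] [ChartedSpace B M] [IsManifold 𝓘(ℝ, B) ∞ M]
  {F : Type*} [NormedAddCommGroup F] [NormedSpace ℝ F] [FiniteDimensional ℝ F]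
  {E : M → Type*} [TopologicalSpace (TotalSpace F E)] [∀ x, AddCommGroup (E x)]
  [∀ x, Module ℝ (E x)] [∀ x, TopologicalSpace (E x)] [FiberBundle F E] [VectorBundle ℝ F E]
  [ContMDiffVectorBundle ∞ F E 𝓘(ℝ, B)]

/-- The chain rule; an arbitrary extension G is allowed because only its germ on W enters. -/
theorem dt_pullSmooth (γ : CurveE B F E) {W : Opens (TotalSpace F E)}
    (f : C^∞⟮𝓘(ℝ, B).prod 𝓘(ℝ, F), W; 𝓘(ℝ, ℝ), ℝ⟯) {G : TotalSpace F E → ℝ}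
    (hG : ∀ e : W, G e.1 = f e) {t : ℝ} (ht : t ∈ Opens.comap (contOf γ) W) :
    dt _ (pullSmooth γ W f) ⟨t, ht⟩ = mfderiv (𝓘(ℝ, B).prod 𝓘(ℝ, F)) 𝓘(ℝ, ℝ) G (γ t)
      (mfderiv 𝓘(ℝ, ℝ) (𝓘(ℝ, B).prod 𝓘(ℝ, F)) γ t (1 : ℝ)) := by
  have hγ : γ t ∈ W := ht
  have hGd : MDifferentiableAt (𝓘(ℝ, B).prod 𝓘(ℝ, F)) 𝓘(ℝ, ℝ) G (γ t) := by
    refine ((extFun_contMDiffAt f hγ).congr_of_eventuallyEq ?_).mdifferentiableAt (by simp)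
    exact (extFun_eventuallyEq (fun y => (hG y).symm) hγ).symm
  have hγd : MDifferentiableAt 𝓘(ℝ, ℝ) (𝓘(ℝ, B).prod 𝓘(ℝ, F)) γ t :=
    γ.contMDiff.contMDiffAt.mdifferentiableAt (by simp)
  have h1 : extZero _ (pullSmooth γ W f) =ᶠ[𝓝 t] G ∘ γ := by
    filter_upwards [(Opens.comap (contOf γ) W).isOpen.mem_nhds ht] with s hs
    exact (extZero_apply (pullSmooth γ W f) ⟨s, hs⟩).trans (hG ⟨γ s, hs⟩).symm
  refine h1.deriv_eq.trans ?_
  have h2 := mfderiv_comp t hGd hγd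
  rw [mfderiv_eq_fderiv] at h2
  rw [← fderiv_apply_one_eq_deriv]
  exact DFunLike.congr_fun h2 (1 : ℝ)

/-- A coordinate of a tangent vector of `E`. -/
def tangentCoord (p : M) (a : SplitIdx B F)
    (α : TangentBundle (𝓘(ℝ, B).prod 𝓘(ℝ, F)) (TotalSpace F E)) : ℝ :=
  mfderiv (𝓘(ℝ, B).prod 𝓘(ℝ, F)) 𝓘(ℝ, ℝ) (extFun (liftCoord (B := B) (F := F) E p a)) α.proj α.2

theorem dt_curveCoord_zero (γ : CurveE B F E) (p : M) (a : SplitIdx B F)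
    (h : (0 : ℝ) ∈ Opens.comap (contOf γ) (liftDom B F E p)) :
    dt _ (curveCoord γ p a) ⟨0, h⟩ = tangentCoord p a (initVelocity γ) :=
  dt_pullSmooth γ (liftCoord E p a) (extFun_apply _) h

theorem tangentCoord_eq (p : M) (a : SplitIdx B F) {e : TotalSpace F E}
    (he : e ∈ liftDom B F E p) (v : TangentSpace (𝓘(ℝ, B).prod 𝓘(ℝ, F)) e) :
    tangentCoord p a ⟨e, v⟩ = (totBasis B F).equivFun (mfderiv (𝓘(ℝ, B).prod 𝓘(ℝ, F))
      𝓘(ℝ, B × F) (extChartAt (𝓘(ℝ, B).prod 𝓘(ℝ, F)) (⟨p, 0⟩ : TotalSpace F E)) e v) a := by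
  let l : B × F →L[ℝ] ℝ := ((totBasis B F).coord a).toContinuousLinearMap
  have h1 : extFun (liftCoord (B := B) (F := F) E p a) =ᶠ[𝓝 e]
      l ∘ extChartAt (𝓘(ℝ, B).prod 𝓘(ℝ, F)) (⟨p, 0⟩ : TotalSpace F E) :=
    extFun_eventuallyEq (g := l ∘ extChartAt (𝓘(ℝ, B).prod 𝓘(ℝ, F)) (⟨p, 0⟩ : TotalSpace F E))
      (fun y => rfl) he
  have hφ : MDifferentiableAt (𝓘(ℝ, B).prod 𝓘(ℝ, F)) 𝓘(ℝ, B × F)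
      (extChartAt (𝓘(ℝ, B).prod 𝓘(ℝ, F)) (⟨p, 0⟩ : TotalSpace F E)) e :=
    mdifferentiableAt_extChartAt (by
      rw [← extChartAt_source (𝓘(ℝ, B).prod 𝓘(ℝ, F))]
      exact liftDom_chart e he)
  have h2 := mfderiv_comp e (l.differentiableAt.mdifferentiableAt) hφ
  rw [tangentCoord, h1.mfderiv_eq, h2, mfderiv_eq_fderiv, l.fderiv]
  rfl

/-- The derivative of the chart is invertible, and its components are the tangent coordinates. -/
theorem tangent_ext {α α' : TangentBundle (𝓘(ℝ, B).prod 𝓘(ℝ, F)) (TotalSpace F E)} {p : M}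
    (hp : α.proj ∈ liftDom B F E p) (h : α.proj = α'.proj)
    (hc : ∀ a, tangentCoord p a α = tangentCoord p a α') : α = α' := by
  obtain ⟨e, v⟩ := α
  obtain ⟨e', v'⟩ := α'
  obtain rfl : e = e' := h
  congr 1
  have hinv := isInvertible_mfderiv_extChartAt (I := 𝓘(ℝ, B).prod 𝓘(ℝ, F)) (liftDom_chart e hp)
  refine hinv.injective ((totBasis B F).equivFun.injective (funext fun a => ?_))
  exact (tangentCoord_eq p a hp v).symm.trans ((hc a).trans (tangentCoord_eq p a hp v'))

/-- A straight line would leave the chart. The oscillating path φ(e) + (sin(Kt)/K) v has the same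
velocity v at 0 and stays in a small ball for all times. -/
theorem exists_curve (e : TotalSpace F E) (z : SplitIdx B F → ℝ) : ∃ γ : CurveE B F E, γ 0 = e ∧
    ∀ a (h : (0 : ℝ) ∈ Opens.comap (contOf γ) (liftDom B F E e.proj)),
      dt _ (curveCoord γ e.proj a) ⟨0, h⟩ = z a := by
  set φ := extChartAt (𝓘(ℝ, B).prod 𝓘(ℝ, F)) (⟨e.proj, 0⟩ : TotalSpace F E) with hφ
  have he : e ∈ φ.source := liftDom_chart e (mem_splitDom e.proj)
  obtain ⟨r, hr, hball⟩ := Metric.isOpen_iff.1 (isOpen_extChartAt_target (I := 𝓘(ℝ, B).prod 𝓘(ℝ, F))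
    (⟨e.proj, 0⟩ : TotalSpace F E)) (φ e) (φ.map_source he)
  let v : B × F := (totBasis B F).equivFun.symm z
  -- Chosen so that ‖v‖ / K < r; the summand 1 keeps K positive when v = 0.
  set K : ℝ := ‖v‖ / r + 1 with hK
  have hK0 : 0 < K := by positivity
  let c : ℝ → B × F := fun t => φ e + (Real.sin (K * t) / K) • v
  have hc : ContDiff ℝ ∞ c := by
    have h1 : ContDiff ℝ ∞ fun t : ℝ => Real.sin (K * t) / K :=
      (Real.contDiff_sin.comp (contDiff_const.mul contDiff_id)).div_const K
    exact contDiff_const.add (h1.smul contDiff_const)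
  have hct : ∀ t, c t ∈ φ.target := fun t => hball (by
    rw [Metric.mem_ball, dist_eq_norm, add_sub_cancel_left, norm_smul, norm_div, Real.norm_eq_abs,
      Real.norm_eq_abs, abs_of_pos hK0]
    have h1 : |Real.sin (K * t)| / K * ‖v‖ ≤ 1 / K * ‖v‖ := by
      gcongr
      exact Real.abs_sin_le_one _
    refine h1.trans_lt ?_
    rw [one_div, inv_mul_lt_iff₀ hK0, hK, add_mul, div_mul_cancel₀ _ hr.ne']
    linarith)
  let γ : CurveE B F E := ⟨fun t => φ.symm (c t), fun t =>
    ((contMDiffOn_extChartAt_symm (I := 𝓘(ℝ, B).prod 𝓘(ℝ, F)) (n := ∞)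
      (⟨e.proj, 0⟩ : TotalSpace F E)).contMDiffAt (extChartAt_target_mem_nhds' (hct t))).comp t
        hc.contMDiff.contMDiffAt⟩
  have hc0 : c 0 = φ e := by simp [c]
  have hγ0 : γ 0 = e := by
    change φ.symm (c 0) = e
    rw [hc0, φ.left_inv he]
  refine ⟨γ, hγ0, fun a h => ?_⟩
  have h1 : extZero _ (curveCoord γ e.proj a) =ᶠ[𝓝 0]
      fun t => (totBasis B F).equivFun (φ e) a + Real.sin (K * t) / K * z a := by
    filter_upwards [(Opens.comap (contOf γ) (liftDom B F E e.proj)).isOpen.mem_nhds h] with s hs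
    refine (extZero_apply (curveCoord γ e.proj a) ⟨s, hs⟩).trans ?_
    rw [curveCoord_apply]
    have h2 : φ (γ s) = c s := φ.right_inv (hct s)
    refine (congrArg (fun y => (totBasis B F).equivFun y a) h2).trans ?_
    change (totBasis B F).equivFun (φ e + (Real.sin (K * s) / K) • v) a = _
    rw [map_add, map_smul, LinearEquiv.apply_symm_apply]
    rfl
  refine h1.deriv_eq.trans ?_
  have h3 : HasDerivAt (fun t : ℝ => Real.sin (K * t)) (Real.cos (K * 0) * (K * 1)) 0 :=
    (Real.hasDerivAt_sin (K * 0)).comp 0 ((hasDerivAt_id (0 : ℝ)).const_mul K)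
  have h4 := ((h3.div_const K).mul_const (z a)).const_add ((totBasis B F).equivFun (φ e) a)
  rw [h4.deriv]
  simp [hK0.ne']

theorem exists_initVelocity_eq (α : TangentBundle (𝓘(ℝ, B).prod 𝓘(ℝ, F)) (TotalSpace F E)) :
    ∃ γ : CurveE B F E, initVelocity γ = α := by
  obtain ⟨γ, h0, hγ⟩ := exists_curve α.proj fun a => tangentCoord α.proj.proj a α
  have hmem : γ 0 ∈ liftDom B F E α.proj.proj := by
    rw [h0]
    exact mem_splitDom _
  exact ⟨γ, tangent_ext hmem h0 fun a => (dt_curveCoord_zero γ _ a hmem).symm.trans (hγ a hmem)⟩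

theorem IsGeodesic.eq_of_initVelocity_eq [T2Space M] {n : Connection (totE B F E)}
    {γ₁ γ₂ : CurveE B F E} (h₁ : IsGeodesic n γ₁) (h₂ : IsGeodesic n γ₂)
    (h : initVelocity γ₁ = initVelocity γ₂) : γ₁ = γ₂ := by
  have h0 : γ₁ 0 = γ₂ 0 := congrArg Bundle.TotalSpace.proj h
  have m₁ : (0 : ℝ) ∈ Opens.comap (contOf γ₁) (liftDom B F E (γ₁ 0).proj) := mem_splitDom _
  have m₂ : (0 : ℝ) ∈ Opens.comap (contOf γ₂) (liftDom B F E (γ₁ 0).proj) := by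
    change (γ₂ 0).proj ∈ splitDom B F E (γ₁ 0).proj
    rw [← h0]
    exact m₁
  refine h₁.eq_of_curveJet_eq h₂ m₁ m₂ (Prod.ext (funext fun a => ?_) (funext fun a => ?_))
  · refine (extZero_apply (curveCoord γ₁ _ a) ⟨0, m₁⟩).trans
      (Eq.trans ?_ (extZero_apply (curveCoord γ₂ _ a) ⟨0, m₂⟩).symm)
    rw [curveCoord_apply, curveCoord_apply, h0]
  · refine (extZero_apply (dt _ (curveCoord γ₁ _ a)) ⟨0, m₁⟩).trans
      (Eq.trans ?_ (extZero_apply (dt _ (curveCoord γ₂ _ a)) ⟨0, m₂⟩).symm)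
    rw [dt_curveCoord_zero, dt_curveCoord_zero, h]

variable {Ms : SuperPresheaf.{u, v} M} (β : SheafIso Ms (batchelor B F E))

/-- Both conditions are the relation T ∘ q = ψ ∘ pr at time 0, the second one after differentiation
in t. -/
theorem initCorr_initCond (γ : CurveE B F E) :
    InitCorr β (initCond ((ev β).comp (timesOddMap γ))) (initVelocity γ) := by
  refine ⟨rfl, fun U s hs h h' => ⟨(psi_eq_evPoint β s (γ 0) h').symm, fun G hG => ?_⟩⟩
  have hU : (0 : ℝ) ∈ Opens.comap (contOf γ) (Opens.comap (bundleProj F E) U) := h'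
  refine Eq.trans ?_ (dt_pullSmooth γ (psi β s) hG hU)
  rw [psi_eq_evDual, map_add, map_add]
  rfl

variable {β}

theorem InitCorr.liftMap_zero {A : InitCond Ms}
    {α : TangentBundle (𝓘(ℝ, B).prod 𝓘(ℝ, F)) (TotalSpace F E)} (h : InitCorr β A α) :
    liftMap β A.point 0 = α.proj := by
  refine totalSpace_ext_psi β h.1.symm fun U s hs he he' => ?_
  refine Eq.trans ?_ (h.2 U s hs he he').1
  rw [psi_eq_evPoint]
  have h1 := ((oddPoint 𝓘(ℝ, R0) A.point.base 0).comp A.point.pull).eq_evPoint β U he s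
  exact (congrArg (fun z : DualNumber ℝ => z.fst + z.snd) h1).symm

theorem InitCorr.coord {A : InitCond Ms}
    {α : TangentBundle (𝓘(ℝ, B).prod 𝓘(ℝ, F)) (TotalSpace F E)} (h : InitCorr β A α) {p : M}
    (hp : A.point.base 0 ∈ splitDom B F E p) (a : SplitIdx B F) :
    bodyAddSoul (D := R0) (U := Opens.comap A.point.base (splitDom B F E p))
      (A.vec.1 ⟨splitDom B F E p, le_top⟩ (splitCoord β p a)) ⟨0, hp⟩ = tangentCoord p a α :=
  (h.2 _ _ (inF_splitCoord β p a) hp (h.1 ▸ hp)).2 _ fun e => by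
    rw [psi_splitCoord]
    exact extFun_apply (liftCoord (B := B) (F := F) E p a) e

theorem bodyAddSoul_oddMul {D : Type*} [NormedAddCommGroup D] [NormedSpace ℝ D] {U : Opens D}
    (q : ZMod 2) (f : C^∞⟮𝓘(ℝ, D), U; 𝓘(ℝ, ℝ), ℝ⟯) (x : U) :
    bodyAddSoul (oddMul q f : DualNumber C^∞⟮𝓘(ℝ, D), U; 𝓘(ℝ, ℝ), ℝ⟯) x = f x := by
  by_cases hq : q = 0
  · simp only [oddMul, hq, if_true]
    exact add_zero (f x)
  · simp only [oddMul, hq, if_false]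
    exact zero_add (f x)

/-- The base of ℝ^{0|1} is one point, so a homogeneous component is a single number and T recovers
it. Coordinates determine the derivation over the chart domain, and that domain contains the image
of the point, so nothing is lost by restricting to it. -/
theorem InitCond.ext_coord {A A' : InitCond Ms} {p : M} (hpt : A.point = A'.point)
    (h0 : A.point.base 0 ∈ splitDom B F E p) (h0' : A'.point.base 0 ∈ splitDom B F E p)
    (hvec : ∀ a, bodyAddSoul (D := R0) (U := Opens.comap A.point.base (splitDom B F E p))
        (A.vec.1 ⟨splitDom B F E p, le_top⟩ (splitCoord β p a)) ⟨0, h0⟩ =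
      bodyAddSoul (D := R0) (U := Opens.comap A'.point.base (splitDom B F E p))
        (A'.vec.1 ⟨splitDom B F E p, le_top⟩ (splitCoord β p a)) ⟨0, h0'⟩) : A = A' := by
  obtain ⟨f, v⟩ := A
  obtain ⟨f', v'⟩ := A'
  obtain rfl : f = f' := hpt
  congr 1
  have hres : Der.res (le_top : splitDom B F E p ≤ ⊤) (Der.ofHom v) =
      Der.res le_top (Der.ofHom v') := by
    refine (splitFrame_spans β p ((enoughOddPoints_timesOdd f.base).pointSeparated _ _)).ext
      le_rfl fun a => ?_
    rw [Ms.res_self]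
    have hz : ∀ w : homDer f.pull 0 ⊤, oddMul (splitParity a) (oddPart (splitParity a)
        (w.1 ⟨splitDom B F E p, le_top⟩ (splitCoord β p a))) =
        w.1 ⟨splitDom B F E p, le_top⟩ (splitCoord β p a) := fun w => by
      have := (Der.ofHom_hasParity w).par_act_of (le_top : splitDom B F E p ≤ ⊤)
        (splitCoord_par β p a)
      rw [zero_add] at this
      exact oddMul_oddPart (U := Opens.comap f.base (splitDom B F E p)) _ this
    refine (hz v).symm.trans (Eq.trans ?_ (hz v'))
    refine congrArg _ (ContMDiffMap.ext fun x => ?_)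
    have hx : x = ⟨0, h0⟩ := Subtype.ext (Subsingleton.elim _ _)
    have h1 := hvec a
    simp only at h1
    rw [← hz v, ← hz v', bodyAddSoul_oddMul, bodyAddSoul_oddMul] at h1
    rw [hx]
    exact h1
  refine Subtype.ext (funext fun V => LinearMap.ext fun s => ?_)
  refine evalDual_ext (I := 𝓘(ℝ, R0)) (U := Opens.comap f.base V.1) fun x => ?_
  have hx : f.base x.1 ∈ V.1 ⊓ splitDom B F E p := ⟨x.2, by
    rw [Subsingleton.elim x.1 0]
    exact h0⟩
  have h1 := congrArg (fun Z => evalDual (I := 𝓘(ℝ, R0))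
    (U := Opens.comap f.base (V.1 ⊓ splitDom B F E p)) ⟨x.1, hx⟩
      (Der.act Z inf_le_right (Ms.res inf_le_left s))) hres
  have h2 : ∀ w : homDer f.pull 0 ⊤, evalDual (I := 𝓘(ℝ, R0))
      (U := Opens.comap f.base (V.1 ⊓ splitDom B F E p)) ⟨x.1, hx⟩
      (w.1 ⟨V.1 ⊓ splitDom B F E p, le_top⟩ (Ms.res inf_le_left s)) =
      evalDual (I := 𝓘(ℝ, R0)) (U := Opens.comap f.base V.1) x (w.1 V s) := fun w =>
    (congrArg (evalDual (I := 𝓘(ℝ, R0))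
      (U := Opens.comap f.base (V.1 ⊓ splitDom B F E p)) ⟨x.1, hx⟩)
      (w.2.1 V ⟨V.1 ⊓ splitDom B F E p, le_top⟩ inf_le_left s)).symm
  exact (h2 v).symm.trans (h1.trans (h2 v'))

theorem InitCorr.right_unique {A : InitCond Ms}
    {α α' : TangentBundle (𝓘(ℝ, B).prod 𝓘(ℝ, F)) (TotalSpace F E)} (h : InitCorr β A α)
    (h' : InitCorr β A α') : α = α' := by
  have hp : α.proj ∈ liftDom B F E (A.point.base 0) := by
    change α.proj.proj ∈ splitDom B F E (A.point.base 0)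
    rw [h.1]
    exact mem_splitDom _
  exact tangent_ext hp (h.liftMap_zero.symm.trans h'.liftMap_zero) fun a =>
    (h.coord (mem_splitDom _) a).symm.trans (h'.coord (mem_splitDom _) a)

/-- A morphism from ℝ^{0|1} factors through a map from one point to E, so its value at 0 determines
it. -/
theorem InitCond.point_eq {A A' : InitCond Ms}
    (h : liftMap β A.point 0 = liftMap β A'.point 0) : A.point = A'.point := by
  have h1 : liftMap β A.point = liftMap β A'.point := ContMDiffMap.ext fun x => by
    rw [Subsingleton.elim x 0, h]
  rw [← ev_comp_liftMap β A.point, h1, ev_comp_liftMap]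

theorem InitCorr.left_unique {A A' : InitCond Ms}
    {α : TangentBundle (𝓘(ℝ, B).prod 𝓘(ℝ, F)) (TotalSpace F E)} (h : InitCorr β A α)
    (h' : InitCorr β A' α) : A = A' := by
  have h0 : A.point.base 0 ∈ splitDom B F E α.proj.proj := by
    rw [← h.1]
    exact mem_splitDom _
  have h0' : A'.point.base 0 ∈ splitDom B F E α.proj.proj := by
    rw [← h'.1]
    exact mem_splitDom _
  exact InitCond.ext_coord (InitCond.point_eq (h.liftMap_zero.trans h'.liftMap_zero.symm)) h0 h0'
    fun a => (h.coord h0 a).trans (h'.coord h0' a).symm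

variable (β)

/-- A curve in E is taken through the point of E given by the morphism, with the coordinate
velocities given by the derivation; the corresponding supercurve has the wanted initial condition.
-/
theorem exists_initCond_eq (A : InitCond Ms) :
    ∃ γ : CurveE B F E, initCond ((ev β).comp (timesOddMap γ)) = A := by
  have h0 : A.point.base 0 ∈ splitDom B F E (A.point.base 0) := mem_splitDom _
  obtain ⟨γ, hγ0, hγ⟩ := exists_curve (liftMap β A.point 0) fun a =>
    bodyAddSoul (D := R0) (U := Opens.comap A.point.base (splitDom B F E (A.point.base 0)))
      (A.vec.1 ⟨splitDom B F E (A.point.base 0), le_top⟩ (splitCoord β (A.point.base 0) a)) ⟨0, h0⟩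
  have h := initCorr_initCond β γ
  have hp : (γ 0).proj ∈ splitDom B F E (A.point.base 0) := by
    rw [hγ0]
    exact h0
  refine ⟨γ, InitCond.ext_coord (β := β) (InitCond.point_eq (h.liftMap_zero.trans hγ0)) hp h0 fun a => ?_⟩
  rw [h.coord hp a, ← dt_curveCoord_zero γ _ a hp]
  exact hγ a hp

/-- The bijection between initial conditions on `𝓜` and tangent vectors of `E`. -/
def initEquiv :
    InitCond Ms ≃ TangentBundle (𝓘(ℝ, B).prod 𝓘(ℝ, F)) (TotalSpace F E) :=
  -- The result does not depend on the chosen curve, since the correspondence is unique on either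
  -- side; surjectivity holds because every tangent vector is the velocity of a curve.
  Equiv.ofBijective (fun A => initVelocity (Classical.choose (exists_initCond_eq β A))) <| by
    have key : ∀ A, InitCorr β A (initVelocity (Classical.choose (exists_initCond_eq β A))) :=
      fun A => by
        have := initCorr_initCond β (Classical.choose (exists_initCond_eq β A))
        rwa [Classical.choose_spec (exists_initCond_eq β A)] at this
    refine ⟨fun A A' h => (key A).left_unique ?_, fun α => ?_⟩
    · exact (congrArg (InitCorr β A') h).mpr (key A')
    · obtain ⟨γ, rfl⟩ := exists_initVelocity_eq α
      exact ⟨_, (key _).right_unique (initCorr_initCond β γ)⟩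

theorem initEquiv_eq_iff (A : InitCond Ms)
    (α : TangentBundle (𝓘(ℝ, B).prod 𝓘(ℝ, F)) (TotalSpace F E)) :
    initEquiv β A = α ↔ InitCorr β A α := by
  have key : InitCorr β A (initEquiv β A) := by
    have := initCorr_initCond β (Classical.choose (exists_initCond_eq β A))
    rwa [Classical.choose_spec (exists_initCond_eq β A)] at this
  exact ⟨fun h => h ▸ key, fun h => key.right_unique h⟩

theorem initEquiv_initCond (Φ : SMap R11 Ms) :
    initEquiv β (initCond Φ) = initVelocity (curveEquiv β Φ) := by
  rw [initEquiv_eq_iff]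
  have h := initCorr_initCond β (curveEquiv β Φ)
  have h2 : (ev β).comp (timesOddMap (curveEquiv β Φ)) = Φ := (curveEquiv β).symm_apply_apply Φ
  rwa [h2] at h

end InitialConditions

end

end SuperGeo

theorem mainTheorem2
    {B : Type*} [NormedAddCommGroup B] [NormedSpace ℝ B] [FiniteDimensional ℝ B]
    {M : Type*} [TopologicalSpace M] [ChartedSpace B M] [IsManifold 𝓘(ℝ, B) ∞ M]
    [T2Space M] [SecondCountableTopology M]
    {F : Type*} [NormedAddCommGroup F] [NormedSpace ℝ F] [FiniteDimensional ℝ F]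
    {E : M → Type*} [TopologicalSpace (Bundle.TotalSpace F E)] [∀ x, AddCommGroup (E x)]
    [∀ x, Module ℝ (E x)] [∀ x, TopologicalSpace (E x)] [FiberBundle F E] [VectorBundle ℝ F E]
    [ContMDiffVectorBundle ∞ F E 𝓘(ℝ, B)]
    (Ms : SuperGeo.SuperPresheaf M)
    (β : SuperGeo.SheafIso Ms (SuperGeo.batchelor B F E))
    (nabla : SuperGeo.Connection Ms) :
    ∃ nablaE : SuperGeo.Connection (SuperGeo.totE B F E),
      SuperGeo.IsReducedConnection β nabla nablaE ∧
      (∀ nabla' : SuperGeo.Connection (SuperGeo.totE B F E),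
        SuperGeo.IsReducedConnection β nabla nabla' → nabla' = nablaE) ∧
      ∃ (κ : SuperGeo.SMap SuperGeo.R11 Ms ≃ SuperGeo.CurveE B F E)
        (ι : SuperGeo.InitCond Ms ≃
          TangentBundle (𝓘(ℝ, B).prod 𝓘(ℝ, F)) (Bundle.TotalSpace F E)),
        (∀ Φ γ, κ Φ = γ ↔ SuperGeo.CurveCorr β Φ γ) ∧
        (∀ A α, ι A = α ↔ SuperGeo.InitCorr β A α) ∧
        (∀ Φ, ι (SuperGeo.initCond Φ) = SuperGeo.initVelocity (κ Φ)) ∧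
        ∃ Γ : {Φ : SuperGeo.SMap SuperGeo.R11 Ms // SuperGeo.IsSuperGeodesic nabla Φ} ≃
            {γ : SuperGeo.CurveE B F E // SuperGeo.IsGeodesic nablaE γ},
          (∀ Φ γ, Γ Φ = γ ↔
            ι (SuperGeo.initCond Φ.1) = SuperGeo.initVelocity γ.1) ∧
          (∀ Φ, (Γ Φ).1 = κ Φ.1) := by
  refine ⟨SuperGeo.reducedConnection β nabla,
    SuperGeo.isReducedConnection_reducedConnection nabla,
    fun nabla' h => h.unique (SuperGeo.isReducedConnection_reducedConnection nabla),
    SuperGeo.curveEquiv β, SuperGeo.initEquiv β, SuperGeo.curveEquiv_eq_iff β,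
    SuperGeo.initEquiv_eq_iff β, SuperGeo.initEquiv_initCond β, ?_⟩
  -- Every supercurve is `ev` ∘ (γ × id) for γ = κ(Φ), so the comparison of geodesic equations
  -- applies to all of them.
  have key : ∀ Φ, SuperGeo.IsSuperGeodesic nabla Φ ↔
      SuperGeo.IsGeodesic (SuperGeo.reducedConnection β nabla) (SuperGeo.curveEquiv β Φ) := by
    intro Φ
    obtain ⟨γ, rfl⟩ := (SuperGeo.curveEquiv β).symm.surjective Φ
    rw [Equiv.apply_symm_apply]
    exact SuperGeo.isSuperGeodesic_iff_isGeodesic γ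
  refine ⟨(SuperGeo.curveEquiv β).subtypeEquiv key, fun Φ γ => ?_, fun Φ => rfl⟩
  rw [SuperGeo.initEquiv_initCond]
  -- The condition now compares the initial velocities of the geodesics κ(Φ) and γ of E, and equal
  -- velocities force equal geodesics.
  refine ⟨fun h => congrArg (fun γ => SuperGeo.initVelocity γ.1) h, fun h => Subtype.ext ?_⟩
  exact ((key Φ.1).1 Φ.2).eq_of_initVelocity_eq γ.2 h
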